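/- **Setting.** Let $N\ge 1$, $\mathcal N=\{1,\dots,N\}$, $T>0$, $0<\eta<\infty$. For $k\in\mathcal N$ let $g^k:\mathbb R\to\mathbb R$ be Lipschitz and non-increasing with $g^k(1)=0$, and $f^k(u)=u\,g^k(u)$. Let $\nu^k:\mathbb R\times\mathbb R\to\mathbb R$ be $C^2$ in each variable separately, with mixed second derivatives; assume that $\nu^k$ and its derivatives $D_1\nu^k,D_2\nu^k,D_{11}\nu^k,D_{12}\nu^k,D_{21}\nu^k,D_{22}\nu^k$ are bounded on $\mathbb R\times[0,1]$, that $\nu^k\ge 0$ on $\mathbb R\times[0,1]$, and that $|\nu^k(x,u)-\nu^k(y,u)|\le C_0|a_0(x)-a_0(y)|$ for all $x,y,u\in\mathbb R$, for some constant $C_0$ and some $a_0:\mathbb R\to\mathbb R$ of bounded variation. Let $\omega\in C^2([0,\eta])$ be non-negative and non-increasing with $\int_0^\eta\omega=1$, extended by zero, and $(v*\omega)(x)=\int_x^{x+\eta}\omega(y-x)v(y)\,dy$. Put $S^0=S^N=0$ and, for $1\le k<N$, with $a^+=\max(a,0)$, $a^-=-\min(a,0)$, $$S^k(x,a,b,A,B)=\big(g^{k+1}(b)\nu^{k+1}(x,B)-g^k(a)\nu^k(x,A)\big)^+a-\big(g^{k+1}(b)\nu^{k+1}(x,B)-g^k(a)\nu^k(x,A)\big)^-b,$$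 $$R^k(x,\boldsymbol u,\boldsymbol U)=S^{k-1}(x,u^{k-1},u^k,U^{k-1},U^k)-S^k(x,u^k,u^{k+1},U^k,U^{k+1}).$$ Consider $\partial_tu^k+\partial_x\big(f^k(u^k)\nu^k(x,u^k*\omega)\big)=R^k\big(x,\boldsymbol u,(u^j*\omega)_j\big)$ on $Q_T=(0,T)\times\mathbb R$ with initial data $\boldsymbol u_0\in((L^1\cap BV)(\mathbb R;[0,1]))^N$. An *entropy solution* is a function $\boldsymbol u\in(\mathrm{Lip}([0,T];L^1(\mathbb R;[0,1]))\cap L^\infty([0,T];BV(\mathbb R)))^N$ with $\boldsymbol u(0)=\boldsymbol u_0$ such that for all $k\in\mathcal N$, $\alpha\in\mathbb R$ and $0\le\phi\in C_c^\infty([0,T)\times\mathbb R)$, with $\mathcal U^k=\nu^k(x,u^k*\omega)$ and $\mathcal R^k_{\boldsymbol u}=R^k(x,\boldsymbol u,(u^j*\omega)_j)$, $$\int_{Q_T}|u^k-\alpha|\phi_t+\int_{Q_T}\mathrm{sgn}(u^k-\alpha)(f^k(u^k)-f^k(\alpha))\,\mathcal U^k\phi_x-\int_{Q_T}\mathrm{sgn}(u^k-\alpha)f^k(\alpha)\,\mathcal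 U^k_x\phi+\int_{\mathbb R}|u^k(0,x)-\alpha|\phi(0,x)\,dx\ \ge\ -\int_{Q_T}\mathrm{sgn}(u^k-\alpha)\,\mathcal R^k_{\boldsymbol u}\,\phi .$$ **Scheme.** Let $0<\beta<2/3$, let $\Delta x,\Delta t>0$ with $\eta=N_\eta\Delta x$, $T=N_T\Delta t$ for integers $N_\eta,N_T$, and $\lambda=\Delta t/\Delta x$, $x_i=i\Delta x$, $x_{i+1/2}=(i+\frac12)\Delta x$, $C_i=[x_{i-1/2},x_{i+1/2})$, $t^n=n\Delta t$. Put $u_i^{k,0}=\frac1{\Delta x}\int_{C_i}u_0^k$ and $$u_i^{k,n+1}=u_i^{k,n}-\lambda\big[\mathcal F^{k,n}_{i+1/2}(u_i^{k,n},u_{i+1}^{k,n})-\mathcal F^{k,n}_{i-1/2}(u_{i-1}^{k,n},u_i^{k,n})\big]+\Delta t\,\mathcal R_i^{k,n},\qquad\text{(MF)}$$ where $\mathcal F^{k,n}_{i+1/2}(a,b)=\frac12\nu^k(x_{i+1/2},c^{k,n}_{i+1/2})(f^k(a)+f^k(b))-\frac{\beta}{2\lambda}(b-a)$, $c^{k,n}_{i+1/2}=\sum_{p=0}^{N_\eta-1}\big(\int_{p\Delta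 x}^{(p+1)\Delta x}\omega\big)u^{k,n}_{i+p+1}$, $c^{k,n}_i=\frac12(c^{k,n}_{i+1/2}+c^{k,n}_{i+3/2})$ and $\mathcal R^{k,n}_i=R^k(x_i,(u_i^{j,n})_j,(c_i^{j,n})_j)$. Let $u^k_\Delta(t,x)=u_i^{k,n}$ for $x\in C_i$, $t\in[t^n,t^{n+1})$. Write $\mathrm{TV}(u^{k,n})=\sum_i|u^{k,n}_{i+1}-u^{k,n}_i|$. Let $|f^k|_{Lip}$ be the Lipschitz constant of $f^k$ on $[0,1]$, $\|\cdot\|_\infty$ the supremum norm on $\mathbb R\times[0,1]$, and $|\boldsymbol S|$ the maximum over $k$ of the Lipschitz constants of $S^k(x,\cdot)$ on $[0,1]^4$ (with the $\ell^1$ distance), uniform in $x\in\mathbb R$. The *CFL condition* is, for all $k\in\mathcal N$, $$\lambda\le\frac{\min(1,\,4-6\beta,\,6\beta,\,1-2\Delta t|\boldsymbol S|)}{1+6|f^k|_{Lip}\|\nu^k\|_\infty}.\qquad\text{(CFL)}$$ For (a)–(e) assume moreover, for all $k\in\mathcal N$, $$\beta+\lambda|f^k|_{Lip}\|\nu^k\|_\infty+2\Delta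 t|\boldsymbol S|\le1,\qquad\text{(D)}$$ which follows from (CFL) whenever $6\Delta t|\boldsymbol S|\le1$. **Lemma.** Under these conditions the following hold. (a) $0\le u^k_\Delta(t,x)\le1$ for all $(t,x)\in[0,T]\times\mathbb R$ and $k\in\mathcal N$. (b) For $0\le n\le N_T$ the sums $\sum_iu_i^{k,n}$ converge and $\sum_k\sum_iu_i^{k,n}=\sum_k\sum_iu_i^{k,0}$. (c) For $0\le n\le N_T+1$ the variations $\mathrm{TV}(u^{k,n})$ are finite and $$\sum_k\mathrm{TV}(u^{k,n})\le e^{C_{TV}t^n}\sum_k\mathrm{TV}(u^{k,0})+e^{C_{TV}t^n}-1,$$ where $C_{TV}$ depends only on $N$, $|\boldsymbol S|$, $|\omega|_{BV(\mathbb R)}$, $\|\boldsymbol u_0\|_{(L^1)^N}$ and the maxima over $k$ of $|f^k|_{Lip}$, $\|D_1\nu^k\|_\infty$, $\|D_2\nu^k\|_\infty$, $\|D_{11}\nu^k\|_\infty$, $\|D_{12}\nu^k\|_\infty$, $\|D_{21}\nu^k\|_\infty$, $\|D_{22}\nu^k\|_\infty$. (d) For $k\in\mathcal N$ and $0\le n<m\le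 N_T$, $\ \Delta x\sum_i|u_i^{k,m}-u_i^{k,n}|\le C_L\,\Delta t\,(m-n)$, where $C_L$ depends only on $|\boldsymbol S|$, $|\omega|_{BV(\mathbb R)}$, $\|\boldsymbol u_0\|_{(L^1)^N}$, the maxima over $k$ of $|f^k|_{Lip}$, $\|\nu^k\|_\infty$, $\|D_1\nu^k\|_\infty$, $\|D_2\nu^k\|_\infty$, on $\lambda$, $\beta$, and on $\max_{k,\,r\le N_T}\mathrm{TV}(u^{k,r})$. (e) For all $\alpha\in\mathbb R$, $i\in\mathbb Z$, $k\in\mathcal N$, $0\le n\le N_T$, with $\mathcal G^{k,n}_{i+1/2}(a,b,\alpha)=\mathcal F^{k,n}_{i+1/2}(a\vee\alpha,b\vee\alpha)-\mathcal F^{k,n}_{i+1/2}(a\wedge\alpha,b\wedge\alpha)$, $$|u_i^{k,n+1}-\alpha|-|u_i^{k,n}-\alpha|+\lambda\big(\mathcal G^{k,n}_{i+1/2}(u_i^{k,n},u_{i+1}^{k,n},\alpha)-\mathcal G^{k,n}_{i-1/2}(u_{i-1}^{k,n},u_i^{k,n},\alpha)\big)$$ $$+\lambda\,\mathrm{sgn}(u_i^{k,n+1}-\alpha)f^k(\alpha)\big(\nu^k(x_{i+1/2},c^{k,n}_{i+1/2})-\nu^k(x_{i-1/2},c^{k,n}_{i-1/2})\big)\le\Delta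 t\,\mathrm{sgn}(u_i^{k,n+1}-\alpha)\mathcal R_i^{k,n}.$$ (f) An entropy solution exists, and the approximations converge to the entropy solution $\boldsymbol u$: for every $\lambda_0>0$, along all meshes that satisfy (CFL) and $\lambda\ge\lambda_0$, $$\max_k\ \sup_{t\in[0,T]}\|u^k_\Delta(t,\cdot)-u^k(t,\cdot)\|_{L^1(\mathbb R)}\to0\quad\text{as }\Delta x,\Delta t\to0 .$$ -/

import Mathlib

open MeasureTheory Set

noncomputable section

namespace MultiLane

/-- Partial derivative in the first (space) variable. -/
def D1 (q : ℝ → ℝ → ℝ) : ℝ → ℝ → ℝ := fun x u => deriv (fun y => q y u) x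

/-- Partial derivative in the second (state) variable. -/
def D2 (q : ℝ → ℝ → ℝ) : ℝ → ℝ → ℝ := fun x u => deriv (fun v => q x v) u

/-- `q` is bounded on `ℝ × [0,1]`. -/
def BoundedOnStrip (q : ℝ → ℝ → ℝ) : Prop :=
  ∃ C : ℝ, ∀ x : ℝ, ∀ u ∈ Icc (0 : ℝ) 1, |q x u| ≤ C

/-- The norm of `L^∞(ℝ × [0,1])`, for everywhere defined functions, as a supremum. -/
def stripNorm (q : ℝ → ℝ → ℝ) : ℝ :=
  sSup {r | ∃ x : ℝ, ∃ u ∈ Icc (0 : ℝ) 1, r = |q x u|}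

/-- Total variation of the almost-everywhere class of `v : ℝ → ℝ`: the infimum of the pointwise
variations of its representatives. -/
def essVariation (v : ℝ → ℝ) : ENNReal :=
  ⨅ w : {w : ℝ → ℝ // w =ᵐ[volume] v}, eVariationOn w.1 univ

/-- The data of the system.  The lanes are `1, …, N`; values of `g`, `ν` at other indices are never
used.  Lane `k` has the flux factor `g k` and the velocity `ν k x u`; `ω` is the kernel on
`[0, η]`. -/
structure Model where
  N : ℕ
  g : ℕ → ℝ → ℝ
  ν : ℕ → ℝ → ℝ → ℝ
  η : ℝ
  ω : ℝ → ℝ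

namespace Model

variable (M : Model)

/-- The set of lanes. -/
def lanes : Finset ℕ := Finset.Icc 1 M.N

/-- `f^k(u) = u g^k(u)`. -/
def f (k : ℕ) (u : ℝ) : ℝ := u * M.g k u

/-- Standing assumptions on the flux, the velocity and the kernel. -/
structure Standing : Prop where
  g_lip : ∀ k ∈ M.lanes, ∃ K : NNReal, LipschitzWith K (M.g k)
  g_one : ∀ k ∈ M.lanes, M.g k 1 = 0
  g_anti : ∀ k ∈ M.lanes, Antitone (M.g k)
  nu_C2_space : ∀ k ∈ M.lanes, ∀ u : ℝ, ContDiff ℝ 2 (fun x => M.ν k x u)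
  nu_C2_state : ∀ k ∈ M.lanes, ∀ x : ℝ, ContDiff ℝ 2 (fun u => M.ν k x u)
  nu_mixed : ∀ k ∈ M.lanes, ∀ x u : ℝ,
    DifferentiableAt ℝ (fun v => D1 (M.ν k) x v) u ∧ DifferentiableAt ℝ (fun y => D2 (M.ν k) y u) x
  nu_bdd : ∀ k ∈ M.lanes, BoundedOnStrip (M.ν k)
  nu_D1_bdd : ∀ k ∈ M.lanes, BoundedOnStrip (D1 (M.ν k))
  nu_D2_bdd : ∀ k ∈ M.lanes, BoundedOnStrip (D2 (M.ν k))
  nu_D11_bdd : ∀ k ∈ M.lanes, BoundedOnStrip (D1 (D1 (M.ν k)))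
  nu_D12_bdd : ∀ k ∈ M.lanes, BoundedOnStrip (D1 (D2 (M.ν k)))
  nu_D21_bdd : ∀ k ∈ M.lanes, BoundedOnStrip (D2 (D1 (M.ν k)))
  nu_D22_bdd : ∀ k ∈ M.lanes, BoundedOnStrip (D2 (D2 (M.ν k)))
  nu_nonneg : ∀ k ∈ M.lanes, ∀ x : ℝ, ∀ u ∈ Icc (0 : ℝ) 1, 0 ≤ M.ν k x u
  nu_BV : ∀ k ∈ M.lanes, ∃ C₀ : ℝ, ∃ a₀ : ℝ → ℝ, BoundedVariationOn a₀ univ ∧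
    ∀ x y u : ℝ, |M.ν k x u - M.ν k y u| ≤ C₀ * |a₀ x - a₀ y|
  eta_pos : 0 < M.η
  omega_C2 : ContDiffOn ℝ 2 M.ω (Icc 0 M.η)
  omega_nonneg : ∀ y ∈ Icc 0 M.η, 0 ≤ M.ω y
  omega_anti : AntitoneOn M.ω (Icc 0 M.η)
  omega_mass : ∫ y in (0 : ℝ)..M.η, M.ω y = 1

/-- Flow from lane `k` to lane `k + 1`; it vanishes for `k = 0` and `k = N`.
Here `a⁺ = max a 0` and `a⁻ = - min a 0`. -/
def S (k : ℕ) (x a b A B : ℝ) : ℝ :=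
  if 1 ≤ k ∧ k < M.N then
    max (M.g (k + 1) b * M.ν (k + 1) x B - M.g k a * M.ν k x A) 0 * a
      - (-min (M.g (k + 1) b * M.ν (k + 1) x B - M.g k a * M.ν k x A) 0) * b
  else 0

/-- The source term `R^k(x, w, W)` with densities `w` and averaged densities `W` (for `k ≥ 1`). -/
def R (k : ℕ) (x : ℝ) (w W : ℕ → ℝ) : ℝ :=
  M.S (k - 1) x (w (k - 1)) (w k) (W (k - 1)) (W k) - M.S k x (w k) (w (k + 1)) (W k) (W (k + 1))

/-- The downstream average `(v * ω)(x) = ∫_x^{x+η} ω(y - x) v(y) dy`. -/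
def avg (v : ℝ → ℝ) (x : ℝ) : ℝ := ∫ y in x..(x + M.η), M.ω (y - x) * v y

/-! ### Norms of the data -/

/-- Maximum of a quantity over the lanes. -/
def maxLane (q : ℕ → ℝ) : ℝ := sSup {r | ∃ k ∈ M.lanes, r = q k}

/-- Lipschitz constant of `f^k` on the range `[0,1]` of the densities. -/
def fLip (k : ℕ) : ℝ :=
  sSup {r | ∃ a ∈ Icc (0 : ℝ) 1, ∃ b ∈ Icc (0 : ℝ) 1, r = |M.f k a - M.f k b| / |a - b|}

/-- The norm of `S` in `L^∞(ℝ; Lip([0,1]^4))`, with the `ℓ¹` distance on `[0,1]^4` and the maximum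
over the components. -/
def SLip : ℝ :=
  sSup {r | ∃ k ∈ M.lanes, ∃ x : ℝ,
    ∃ a ∈ Icc (0 : ℝ) 1, ∃ b ∈ Icc (0 : ℝ) 1, ∃ A ∈ Icc (0 : ℝ) 1, ∃ B ∈ Icc (0 : ℝ) 1,
    ∃ a' ∈ Icc (0 : ℝ) 1, ∃ b' ∈ Icc (0 : ℝ) 1, ∃ A' ∈ Icc (0 : ℝ) 1, ∃ B' ∈ Icc (0 : ℝ) 1,
    r = |M.S k x a b A B - M.S k x a' b' A' B'|
          / (|a - a'| + |b - b'| + |A - A'| + |B - B'|)}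

/-- Total variation on `ℝ` of the kernel extended by zero outside `[0, η]`. -/
def kernelTV : ℝ := (eVariationOn (indicator (Icc 0 M.η) M.ω) univ).toReal

/-- `‖u₀‖_{(L¹)^N}`, the sum of the `L¹` norms of the components. -/
def dataL1 (u₀ : ℕ → ℝ → ℝ) : ℝ := ∑ k ∈ M.lanes, ∫ x, |u₀ k x|

/-! ### Initial data and entropy solutions -/

/-- `u₀ ∈ ((L¹ ∩ BV)(ℝ; [0,1]))^N`. -/
def InitialData (u₀ : ℕ → ℝ → ℝ) : Prop :=
  ∀ k ∈ M.lanes, Integrable (u₀ k) ∧ essVariation (u₀ k) < ⊤ ∧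
    ∀ᵐ x, u₀ k x ∈ Icc (0 : ℝ) 1

/-- Test functions `φ ∈ C_c^∞([0,T) × ℝ)`, non-negative on `[0,T) × ℝ`; they are represented by
smooth compactly supported functions on `(-∞,T) × ℝ`. -/
structure IsTest (T : ℝ) (φ : ℝ → ℝ → ℝ) : Prop where
  smooth : ContDiff ℝ (⊤ : ℕ∞) (fun p : ℝ × ℝ => φ p.1 p.2)
  compact : HasCompactSupport (fun p : ℝ × ℝ => φ p.1 p.2)
  support : tsupport (fun p : ℝ × ℝ => φ p.1 p.2) ⊆ Iio T ×ˢ univ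
  nonneg : ∀ t, 0 ≤ t → ∀ x, 0 ≤ φ t x

/-- `𝒢^k(a,b) = sgn(a - b)(f^k(a) - f^k(b))`. -/
def kruzkovFlux (k : ℕ) (a b : ℝ) : ℝ := Real.sign (a - b) * (M.f k a - M.f k b)

/-- `𝒰^k(t,x) = ν^k(x, (u^k * ω)(t,x))`. -/
def velocity (u : ℕ → ℝ → ℝ → ℝ) (k : ℕ) (t x : ℝ) : ℝ := M.ν k x (M.avg (u k t) x)

/-- `R^k(x, u(t,x), (u ⊛ ω)(t,x))`. -/
def sourceOf (u : ℕ → ℝ → ℝ → ℝ) (k : ℕ) (t x : ℝ) : ℝ :=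
  M.R k x (fun j => u j t x) (fun j => M.avg (u j t) x)

/-- Kružkov entropy inequality for lane `k`, the constant `α` and the test function `φ`, on
`Q_T = (0,T) × ℝ`. -/
def EntropyIneq (T : ℝ) (u : ℕ → ℝ → ℝ → ℝ) (k : ℕ) (α : ℝ) (φ : ℝ → ℝ → ℝ) : Prop :=
  -(∫ p in Ioo 0 T ×ˢ (univ : Set ℝ),
      Real.sign (u k p.1 p.2 - α) * M.sourceOf u k p.1 p.2 * φ p.1 p.2) ≤
    (∫ p in Ioo 0 T ×ˢ (univ : Set ℝ), |u k p.1 p.2 - α| * deriv (fun s => φ s p.2) p.1)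
    + (∫ p in Ioo 0 T ×ˢ (univ : Set ℝ),
        M.kruzkovFlux k (u k p.1 p.2) α * M.velocity u k p.1 p.2 * deriv (fun y => φ p.1 y) p.2)
    - (∫ p in Ioo 0 T ×ˢ (univ : Set ℝ),
        Real.sign (u k p.1 p.2 - α) * M.f k α
          * deriv (fun y => M.velocity u k p.1 y) p.2 * φ p.1 p.2)
    + ∫ x, |u k 0 x - α| * φ 0 x

/-- Entropy solutions on `[0,T]` with initial data `u₀`: functions in
`(Lip([0,T]; L¹(ℝ; [0,1])) ∩ L^∞([0,T]; BV(ℝ)))^N`, represented by jointly measurable functions,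
which satisfy the entropy inequalities. -/
structure IsEntropySolution (T : ℝ) (u₀ : ℕ → ℝ → ℝ) (u : ℕ → ℝ → ℝ → ℝ) : Prop where
  meas : ∀ k ∈ M.lanes, AEStronglyMeasurable (fun p : ℝ × ℝ => u k p.1 p.2)
    (volume.restrict (Ioo 0 T ×ˢ univ))
  integrable : ∀ k ∈ M.lanes, ∀ t ∈ Icc 0 T, Integrable (u k t)
  range : ∀ k ∈ M.lanes, ∀ t ∈ Icc 0 T, ∀ᵐ x, u k t x ∈ Icc (0 : ℝ) 1
  lip : ∀ k ∈ M.lanes, ∃ K : ℝ, ∀ s ∈ Icc 0 T, ∀ t ∈ Icc 0 T,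
    ∫ x, |u k s x - u k t x| ≤ K * |s - t|
  bv : ∀ k ∈ M.lanes, ∃ K : NNReal, ∀ t ∈ Icc 0 T, essVariation (u k t) ≤ K
  initial : ∀ k ∈ M.lanes, u k 0 =ᵐ[volume] u₀ k
  entropy : ∀ k ∈ M.lanes, ∀ α : ℝ, ∀ φ : ℝ → ℝ → ℝ, IsTest T φ → M.EntropyIneq T u k α φ

end Model

/-! ### The scheme -/

/-- A space-time mesh: space step, time step, number of cells in `[0,η]` and number of time
steps in `[0,T]`. -/
structure Mesh where
  Δx : ℝ
  Δt : ℝ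
  Nη : ℕ
  NT : ℕ

namespace Mesh

variable (m : Mesh)

/-- The mesh resolves the kernel support `[0,η]` and the time interval `[0,T]` exactly. -/
structure Fits (M : Model) (T : ℝ) : Prop where
  dx_pos : 0 < m.Δx
  dt_pos : 0 < m.Δt
  eta_eq : M.η = m.Nη * m.Δx
  T_eq : T = m.NT * m.Δt

/-- `λ = Δt/Δx`. -/
def lam : ℝ := m.Δt / m.Δx

/-- `x_i = i Δx`. -/
def node (i : ℤ) : ℝ := i * m.Δx

/-- `x_{i+1/2}`. -/
def half (i : ℤ) : ℝ := (m.node i + m.node (i + 1)) / 2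

/-- `C_i = [x_{i-1/2}, x_{i+1/2})`. -/
def cell (i : ℤ) : Set ℝ := Ico (m.half (i - 1)) (m.half i)

/-- `t^n = n Δt`. -/
def time (n : ℕ) : ℝ := n * m.Δt

/-- The index of the cell that contains `x`. -/
def cellIndex (x : ℝ) : ℤ := ⌊x / m.Δx + 1 / 2⌋

/-- The index `n` with `t ∈ [t^n, t^{n+1})`, for `t ≥ 0`. -/
def timeIndex (t : ℝ) : ℕ := ⌊t / m.Δt⌋₊

end Mesh

namespace Model

variable (M : Model) (m : Mesh) (β : ℝ)

/-- `ζ_{p+1/2} = ∫_{pΔx}^{(p+1)Δx} ω`. -/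
def zeta (p : ℕ) : ℝ := ∫ y in (p * m.Δx)..((p + 1) * m.Δx), M.ω y

/-- `c_{i+1/2}`, for the cell values `v` of one lane at one time level. -/
def cHalf (v : ℤ → ℝ) (i : ℤ) : ℝ := ∑ p ∈ Finset.range m.Nη, M.zeta m p * v (i + p + 1)

/-- `c_i = (c_{i+1/2} + c_{i+3/2}) / 2`. -/
def cMid (v : ℤ → ℝ) (i : ℤ) : ℝ := (M.cHalf m v i + M.cHalf m v (i + 1)) / 2

/-- The numerical flux `ℱ_{i+1/2}(a,b)` of lane `k`, whose cell values are `v`. -/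
def flux (k : ℕ) (v : ℤ → ℝ) (i : ℤ) (a b : ℝ) : ℝ :=
  1 / 2 * M.ν k (m.half i) (M.cHalf m v i) * (M.f k a + M.f k b) - β / (2 * m.lam) * (b - a)

/-- The discrete source `ℛ_i^k`, for the cell values `w` of all lanes. -/
def discreteSource (w : ℕ → ℤ → ℝ) (k : ℕ) (i : ℤ) : ℝ :=
  M.R k (m.node i) (fun j => w j i) (fun j => M.cMid m (w j) i)

/-- One step of the marching formula. -/
def step (w : ℕ → ℤ → ℝ) (k : ℕ) (i : ℤ) : ℝ :=
  w k i
    - m.lam * (M.flux m β k (w k) i (w k i) (w k (i + 1))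
        - M.flux m β k (w k) (i - 1) (w k (i - 1)) (w k i))
    + m.Δt * M.discreteSource m w k i

/-- The cell values `u_i^{k,n}`: cell averages of the initial data, then the marching formula. -/
def approx (u₀ : ℕ → ℝ → ℝ) : ℕ → ℕ → ℤ → ℝ
  | 0 => fun k i => (1 / m.Δx) * ∫ x in m.cell i, u₀ k x
  | n + 1 => M.step m β (approx u₀ n)

/-- The piecewise constant approximate solution `u_Δ^k(t,x)`. -/
def approxSol (u₀ : ℕ → ℝ → ℝ) (k : ℕ) (t x : ℝ) : ℝ :=
  M.approx m β u₀ (m.timeIndex t) k (m.cellIndex x)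

/-- The CFL condition. -/
def CFL : Prop :=
  ∀ k ∈ M.lanes,
    m.lam ≤ min 1 (min (4 - 6 * β) (min (6 * β) (1 - 2 * m.Δt * M.SLip)))
      / (1 + 6 * M.fLip k * stripNorm (M.ν k))

/-- The diagonal part of the CFL restriction: the value in a cell enters its own update with a
non-negative weight.  Together with the CFL condition it excludes only coarse time steps: it
follows from the CFL condition as soon as `6 Δt |S| ≤ 1`. -/
def DiagonalCFL : Prop :=
  ∀ k ∈ M.lanes, β + m.lam * M.fLip k * stripNorm (M.ν k) + 2 * m.Δt * M.SLip ≤ 1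

/-- Numerical entropy flux `𝒢_{i+1/2}(a,b,α)`. -/
def entropyFlux (k : ℕ) (v : ℤ → ℝ) (i : ℤ) (a b α : ℝ) : ℝ :=
  M.flux m β k v i (max a α) (max b α) - M.flux m β k v i (min a α) (min b α)

/-- Total variation of a step function with cell values `v`. -/
def discreteTV (v : ℤ → ℝ) : ℝ := ∑' i : ℤ, |v (i + 1) - v i|

/-- Largest total variation of a component of `u_Δ(t^n, ·)`, `n = 0, …, N_T`. -/
def maxTV (u₀ : ℕ → ℝ → ℝ) : ℝ :=
  sSup {r | ∃ n ≤ m.NT, ∃ k ∈ M.lanes, r = discreteTV (M.approx m β u₀ n k)}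

/-- Maximum over the lanes of `‖D ν^k‖_{L^∞(ℝ × [0,1])}` for a differential operator `D`. -/
def nuNorm (D : (ℝ → ℝ → ℝ) → ℝ → ℝ → ℝ) : ℝ := M.maxLane (fun k => stripNorm (D (M.ν k)))

end Model

end MultiLane

end

open MultiLane

namespace MultiLane

open Filter Topology

local notation "𝕀" => Icc (0 : ℝ) 1

theorem mul_mono_l {a b c : ℝ} (h : a ≤ b) (hc : 0 ≤ c) : c * a ≤ c * b :=
  mul_le_mul_of_nonneg_left h hc

theorem mul_mono_r {a b c : ℝ} (h : a ≤ b) (hc : 0 ≤ c) : a * c ≤ b * c :=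
  mul_le_mul_of_nonneg_right h hc

theorem abs_le_stripNorm {q : ℝ → ℝ → ℝ} (h : BoundedOnStrip q) (x : ℝ)
    (hu : u ∈ 𝕀) : |q x u| ≤ stripNorm q := by
  obtain ⟨C,hC⟩ := h
  refine le_csSup ⟨C,?_⟩ ⟨x,u,hu,rfl⟩
  rintro r ⟨y,v,hv,rfl⟩
  exact hC y v hv

theorem stripNorm_nonneg (q : ℝ → ℝ → ℝ) : 0 ≤ stripNorm q := by
  refine Real.sSup_nonneg ?_
  rintro r ⟨y,v,hv,rfl⟩
  exact abs_nonneg _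

/-- A function on an interval whose derivative is bounded there is Lipschitz. -/
theorem abs_sub_le_of_deriv_Icc {φ : ℝ → ℝ} (hφ : Differentiable ℝ φ)
    (hC : ∀ u ∈ 𝕀,|deriv φ u| ≤ C) (hu : u ∈ 𝕀)
    (hv : v ∈ 𝕀) : |φ u-φ v| ≤ C*|u-v| :=
  (convex_Icc 0 1).norm_image_sub_le_of_norm_deriv_le (fun x _ => hφ x) hC hv hu

theorem abs_sub_le_of_deriv {φ : ℝ → ℝ} (hφ : Differentiable ℝ φ)
    (hC : ∀ u,|deriv φ u| ≤ C) (u v : ℝ) : |φ u-φ v| ≤ C*|u-v| :=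
  convex_univ.norm_image_sub_le_of_norm_deriv_le (fun x _ => hφ x) (fun x _ => hC x)
    (mem_univ v) (mem_univ u)

/-- First order Taylor bound on `[0,1]`. -/
theorem abs_taylor_Icc {φ : ℝ → ℝ} (hφ : ContDiff ℝ 2 φ) (hC0 : 0 ≤ C)
    (hC : ∀ u ∈ 𝕀,|deriv (deriv φ) u| ≤ C) (hu : u ∈ 𝕀)
    (hv : v ∈ 𝕀) : |φ u-φ v-deriv φ v*(u-v)| ≤ C*|u-v| * |u-v| := by
  have h1 := hφ.differentiable (by norm_num)
  have h2 := hφ.differentiable_deriv_two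
  have hsub : uIcc v u ⊆ Icc 0 1 := by
    rw [uIcc_eq_union]; rintro x (⟨h,h'⟩ | ⟨h,h'⟩) <;>
    grind
  have hd : Differentiable ℝ (fun x => φ x-deriv φ v*x) := h1.sub (by fun_prop)
  have key := (convex_uIcc v u).norm_image_sub_le_of_norm_deriv_le
    (C := C*|u-v|) (fun x _ => hd x) (fun x hx => by
      have : deriv (fun x => φ x-deriv φ v*x) x = deriv φ x-deriv φ v := by
        rw [deriv_fun_sub (h1 x) (by fun_prop)]
        simp
      rw [this]
      refine (abs_sub_le_of_deriv_Icc h2 hC (hsub hx) hv).trans ?_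
      exact mul_mono_l (abs_sub_left_of_mem_uIcc hx) hC0) left_mem_uIcc right_mem_uIcc
  simp [Real.norm_eq_abs] at key
  convert key using 2
  ring

namespace Model

variable {M : Model}
variable {u v a b a' b' A A' B B' C : ℝ} {k : ℕ}

theorem le_maxLane (q : ℕ → ℝ) (hk : k ∈ M.lanes) : q k ≤ M.maxLane q := by
  refine le_csSup ?_ ⟨k,hk,rfl⟩
  refine ((M.lanes.finite_toSet.image q).subset ?_).bddAbove
  rintro r ⟨j,hj,rfl⟩
  exact ⟨j,hj,rfl⟩

theorem maxLane_nonneg {q : ℕ → ℝ} (hq : ∀ k,0 ≤ q k) : 0 ≤ M.maxLane q := by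
  refine Real.sSup_nonneg ?_
  rintro r ⟨j,hj,rfl⟩
  exact hq j

theorem nuNorm_nonneg (D : (ℝ → ℝ → ℝ) → ℝ → ℝ → ℝ) : 0 ≤ M.nuNorm D :=
  maxLane_nonneg fun _ => stripNorm_nonneg _

theorem fLip_nonneg (k : ℕ) : 0 ≤ M.fLip k := by
  refine Real.sSup_nonneg ?_
  rintro r ⟨a,ha,b,hb,rfl⟩
  positivity

namespace Standing

variable (H : M.Standing) {k : ℕ} (hk : k ∈ M.lanes)
include H hk

theorem g_continuous : Continuous (M.g k) := by
  obtain ⟨K,hK⟩ := H.g_lip k hk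
  exact hK.continuous

theorem f_continuous : Continuous (M.f k) := continuous_id.mul (H.g_continuous hk)

theorem g_nonneg (ha : a≤1) : 0 ≤ M.g k a := by rw [← H.g_one k hk]; exact H.g_anti k hk ha

theorem f_one : M.f k 1=0 := by simp [Model.f,H.g_one k hk]

theorem exists_f_lip (r : ℝ) : ∃ C,0 ≤ C ∧ ∀ a ∈ Icc (-r) r,∀ b ∈ Icc (-r) r,
    |M.f k a-M.f k b| ≤ C*|a-b| := by
  obtain ⟨K,hK⟩ := H.g_lip k hk
  have hl := fun a b => by simpa [Real.dist_eq] using hK.dist_le_mul a b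
  refine ⟨|r| * K+K*(|r| + 1),by positivity,fun a ha b hb => ?_⟩
  have hab : ∀ c ∈ Icc (-r) r,|c| ≤ |r| := fun c hc => (abs_le.2 hc).trans (le_abs_self r)
  have h1 : M.f k a-M.f k b = a*(M.g k a-M.g k b)+(a-b)*M.g k b := by
    simp only [Model.f]; ring
  have h2 : |M.g k b| ≤ K*(|r| + 1) := by
    have := hl b 1
    rw [H.g_one k hk,sub_zero] at this
    refine this.trans ?_
    gcongr
    grind
  rw [h1]
  refine (abs_add_le _ _).trans ?_
  rw [abs_mul,abs_mul]
  have h3 := hab a ha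
  have h4 := hl a b
  calc |a| * |M.g k a-M.g k b| + |a-b| * |M.g k b|
      ≤ |r| * (K*|a-b|)+|a-b| * (K*(|r| + 1)) := by gcongr
    _ = _ := by ring

theorem f_lip (ha : a ∈ 𝕀) (hb : b ∈ 𝕀) :
    |M.f k a-M.f k b| ≤ M.fLip k*|a-b| := by
  rcases eq_or_ne a b with rfl | hab
  · simp
  have hpos := abs_pos.2 (sub_ne_zero.2 hab)
  rw [← div_le_iff₀ hpos]
  obtain ⟨C,hC0,hC⟩ := H.exists_f_lip hk 1
  refine le_csSup ⟨C,?_⟩ ⟨a,ha,b,hb,rfl⟩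
  rintro r ⟨a',ha',b',hb',rfl⟩
  exact div_le_of_le_mul₀ (abs_nonneg _) hC0
    (hC a' ⟨by linarith [ha'.1],ha'.2⟩ b' ⟨by linarith [hb'.1],hb'.2⟩)

theorem g_le (ha : a ∈ 𝕀) : M.g k a ≤ M.fLip k := by
  have h1 : ∀ c ∈ Ioc 0 1,M.g k c ≤ M.fLip k := fun c hc => by
    have := H.f_lip hk (b := 0) ⟨hc.1.le,hc.2⟩ (by simp)
    simp only [Model.f,zero_mul,sub_zero] at this
    rw [abs_mul,mul_comm] at this
    exact (le_abs_self _).trans (le_of_mul_le_mul_right this (abs_pos.2 hc.1.ne'))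
  have h0 : M.g k 0 ≤ M.fLip k := by
    have ht : Tendsto (M.g k) (nhdsWithin 0 (Ioi 0)) (𝓝 (M.g k 0)) :=
      (H.g_continuous hk).continuousWithinAt
    refine le_of_tendsto ht ?_
    filter_upwards [Ioc_mem_nhdsGT (show 0<1 by norm_num)] with c hc using h1 c hc
  exact (H.g_anti k hk ha.1).trans h0

theorem f_nonneg (ha : a ∈ 𝕀) : 0 ≤ M.f k a :=
  mul_nonneg ha.1 (H.g_nonneg hk ha.2)

theorem f_le (ha : a ∈ 𝕀) : M.f k a ≤ M.fLip k*a := by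
  rw [mul_comm]; exact mul_mono_l (H.g_le hk ha) ha.1

theorem f_le_fLip (ha : a ∈ 𝕀) : M.f k a ≤ M.fLip k :=
  (H.f_le hk ha).trans (mul_le_of_le_one_right (fLip_nonneg k) ha.2)

theorem nu_diff_space (u : ℝ) : Differentiable ℝ (fun x => M.ν k x u) :=
  (H.nu_C2_space k hk u).differentiable (by norm_num)

theorem nu_diff_state (x : ℝ) : Differentiable ℝ (fun u => M.ν k x u) :=
  (H.nu_C2_state k hk x).differentiable (by norm_num)

theorem nu_le (x : ℝ) (hu : u ∈ 𝕀) : M.ν k x u ≤ stripNorm (M.ν k) :=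
  (le_abs_self _).trans (abs_le_stripNorm (H.nu_bdd k hk) x hu)

theorem nu_lip_space (x y : ℝ) (hu : u ∈ 𝕀) :
    |M.ν k x u-M.ν k y u| ≤ stripNorm (D1 (M.ν k))*|x-y| :=
  abs_sub_le_of_deriv (H.nu_diff_space hk u)
    (fun z => abs_le_stripNorm (H.nu_D1_bdd k hk) z hu) x y

theorem nu_lip_state (x : ℝ) (hu : u ∈ 𝕀) (hv : v ∈ 𝕀) :
    |M.ν k x u-M.ν k x v| ≤ stripNorm (D2 (M.ν k))*|u-v| :=
  abs_sub_le_of_deriv_Icc (H.nu_diff_state hk x)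
    (fun z hz => abs_le_stripNorm (H.nu_D2_bdd k hk) x hz) hu hv

theorem D1_lip_space (x y : ℝ) (hu : u ∈ 𝕀) :
    |D1 (M.ν k) x u-D1 (M.ν k) y u| ≤ stripNorm (D1 (D1 (M.ν k)))*|x-y| := by
  refine abs_sub_le_of_deriv ?_
    (fun z => abs_le_stripNorm (H.nu_D11_bdd k hk) z hu) x y
  exact (H.nu_C2_space k hk u).differentiable_deriv_two

theorem D1_lip_state (x : ℝ) (hu : u ∈ 𝕀) (hv : v ∈ 𝕀) :
    |D1 (M.ν k) x u-D1 (M.ν k) x v| ≤ stripNorm (D2 (D1 (M.ν k)))*|u-v| :=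
  abs_sub_le_of_deriv_Icc (fun z => (H.nu_mixed k hk x z).1)
    (fun z hz => abs_le_stripNorm (H.nu_D21_bdd k hk) x hz) hu hv

theorem D2_lip_space (x y : ℝ) (hu : u ∈ 𝕀) :
    |D2 (M.ν k) x u-D2 (M.ν k) y u| ≤ stripNorm (D1 (D2 (M.ν k)))*|x-y| :=
  abs_sub_le_of_deriv (fun z => (H.nu_mixed k hk z u).2)
    (fun z => abs_le_stripNorm (H.nu_D12_bdd k hk) z hu) x y

theorem D2_lip_state (x : ℝ) (hu : u ∈ 𝕀) (hv : v ∈ 𝕀) :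
    |D2 (M.ν k) x u-D2 (M.ν k) x v| ≤ stripNorm (D2 (D2 (M.ν k)))*|u-v| := by
  refine abs_sub_le_of_deriv_Icc ?_
    (fun z hz => abs_le_stripNorm (H.nu_D22_bdd k hk) x hz) hu hv
  exact (H.nu_C2_state k hk x).differentiable_deriv_two

theorem nu_taylor_state (x : ℝ) (hu : u ∈ 𝕀) (hv : v ∈ 𝕀) :
    |M.ν k x u-M.ν k x v-D2 (M.ν k) x v*(u-v)|
      ≤ stripNorm (D2 (D2 (M.ν k)))*|u-v| * |u-v| :=
  abs_taylor_Icc (H.nu_C2_state k hk x) (stripNorm_nonneg _)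
    (fun z hz => abs_le_stripNorm (H.nu_D22_bdd k hk) x hz) hu hv

end Standing

/-! ### The exchange term -/

/-- `X⁺ a - X⁻ b`. -/
def exchange (X a b : ℝ) : ℝ := max X 0*a-(-min X 0)*b

theorem abs_exchange_sub_le (X Y : ℝ) (ha : 0 ≤ a) (hb : 0 ≤ b) :
    |exchange X a b-exchange Y a b| ≤ |X-Y| * (a+b) := by
  have h1 : exchange X a b-exchange Y a b
      = (max X 0-max Y 0)*a+(min X 0-min Y 0)*b := by
    simp [exchange]; ring
  rw [h1]
  refine (abs_add_le _ _).trans ?_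
  rw [abs_mul,abs_mul,abs_of_nonneg ha,abs_of_nonneg hb,mul_add]
  exact add_le_add (mul_mono_r (abs_max_sub_max_le_abs X Y 0) ha)
    (mul_mono_r (by grind) hb)

theorem abs_exchange_sub_le' (X : ℝ) (a b a' b' : ℝ) :
    |exchange X a b-exchange X a' b'| ≤ |X| * (|a-a'| + |b-b'|) := by
  have h1 : exchange X a b-exchange X a' b' = max X 0*(a-a')+min X 0*(b-b') := by
    simp only [exchange]; ring
  rw [h1]
  refine (abs_add_le _ _).trans ?_
  rw [abs_mul,abs_mul,mul_add]
  have h2 : |max X 0| ≤ |X| := by grind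
  have h3 : |min X 0| ≤ |X| := by grind
  gcongr

theorem exchange_mono {X Y : ℝ} (hXY : X ≤ Y) (ha : 0 ≤ a) (haa : a ≤ a')
    (hbb : b' ≤ b) (hb' : 0 ≤ b') : exchange X a b ≤ exchange Y a' b' := by
  have h1 : max X 0*a ≤ max Y 0*a' := by gcongr
  have h2 : (-min Y 0)*b'≤(-min X 0)*b := by
    have : 0 ≤ -min X 0 := by simp
    gcongr
  simp only [exchange]; linarith

theorem S_eq (k : ℕ) (x a b A B : ℝ) : M.S k x a b A B = if 1 ≤ k ∧ k < M.N then
    exchange (M.g (k+1) b*M.ν (k+1) x B-M.g k a*M.ν k x A) a b else 0 := rfl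

theorem S_zero (x a b A B : ℝ) : M.S 0 x a b A B=0 := by simp [S_eq]

theorem S_last (x a b A B : ℝ) : M.S M.N x a b A B=0 := by simp [S_eq]

theorem mem_lanes : k ∈ M.lanes ↔ 1 ≤ k ∧ k ≤ M.N := Finset.mem_Icc

theorem pair_mem_lanes (h : 1 ≤ k ∧ k < M.N) : k ∈ M.lanes ∧ k+1 ∈ M.lanes :=
  ⟨mem_lanes.2 ⟨h.1,h.2.le⟩,mem_lanes.2 ⟨by omega,h.2⟩⟩

/-- `[0,1]`-valued arguments of `S`. -/
structure UnitBox (a b A B : ℝ) : Prop where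
  a_mem : a ∈ 𝕀
  b_mem : b ∈ 𝕀
  A_mem : A ∈ 𝕀
  B_mem : B ∈ 𝕀

theorem abs_S_state_zero (k : ℕ) (x A B : ℝ) : M.S k x 0 0 A B=0 := by simp [S_eq,exchange]

theorem SLip_nonneg : 0 ≤ M.SLip := by
  refine Real.sSup_nonneg ?_
  rintro r ⟨k,hk,x,a,ha,b,hb,A,hA,B,hB,a',ha',b',hb',A',hA',B',hB',rfl⟩
  positivity

namespace Standing

variable (H : M.Standing)
include H

theorem abs_gnu_sub_le (hk : k ∈ M.lanes) (x x' : ℝ)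
    {K : NNReal} (hK : LipschitzWith K (M.g k))
    (ha : a ∈ 𝕀) (ha' : a' ∈ 𝕀) (hA : A ∈ 𝕀)
    (hA' : A' ∈ 𝕀) :
    |M.g k a*M.ν k x A-M.g k a'*M.ν k x' A'| ≤
      K*stripNorm (M.ν k)*|a-a'| + M.fLip k*(stripNorm (D1 (M.ν k))*|x-x'|
        + stripNorm (D2 (M.ν k))*|A-A'|) := by
  have h1 : M.g k a*M.ν k x A-M.g k a'*M.ν k x' A'
      = (M.g k a-M.g k a')*M.ν k x A+M.g k a'*((M.ν k x A-M.ν k x' A)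
        + (M.ν k x' A-M.ν k x' A')) := by ring
  rw [h1]
  have h2 : |M.g k a-M.g k a'| ≤ K*|a-a'| := by simpa [Real.dist_eq] using hK.dist_le_mul a a'
  have h3 := abs_le_stripNorm (H.nu_bdd k hk) x hA
  have h4 : |M.g k a'| ≤ M.fLip k := by
    rw [abs_of_nonneg (H.g_nonneg hk ha'.2)]; exact H.g_le hk ha'
  have h5 := H.nu_lip_space hk x x' hA
  have h6 := H.nu_lip_state hk x' hA hA'
  calc _ ≤ |M.g k a-M.g k a'| * |M.ν k x A| + |M.g k a'| * (|M.ν k x A-M.ν k x' A|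
        + |M.ν k x' A-M.ν k x' A'|) := by
        refine (abs_add_le _ _).trans ?_
        rw [abs_mul,abs_mul]
        gcongr
        exact abs_add_le _ _
    _≤(K*|a-a'|)*stripNorm (M.ν k)+M.fLip k*(stripNorm (D1 (M.ν k))*|x-x'|
        + stripNorm (D2 (M.ν k))*|A-A'|) := by
        have := fLip_nonneg (M := M) k
        gcongr
    _ = _ := by ring

/-- Dependence of `S` on the position and the averages, with a weight that vanishes with the
densities. -/
theorem S_lip_coeff {L P Q : ℝ} (hL : ∀ k ∈ M.lanes,M.fLip k ≤ L)
    (hP : ∀ k ∈ M.lanes,stripNorm (D1 (M.ν k)) ≤ P)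
    (hQ : ∀ k ∈ M.lanes,stripNorm (D2 (M.ν k)) ≤ Q) (hL0 : 0 ≤ L) (hP0 : 0 ≤ P) (hQ0 : 0 ≤ Q)
    (k : ℕ) (x x' : ℝ)
    (h : 1 ≤ k ∧ k < M.N → UnitBox a b A B ∧ UnitBox a b A' B') :
    |M.S k x a b A B-M.S k x' a b A' B'| ≤
      if 1 ≤ k ∧ k < M.N then L*(2*P*|x-x'| + Q*(|A-A'| + |B-B'|))*(a+b)
      else 0 := by
  by_cases hkN : 1 ≤ k ∧ k < M.N
  swap
  · simp [S_eq,hkN]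
  obtain ⟨h,h'⟩ := h hkN
  obtain ⟨hk1,hk2⟩ := pair_mem_lanes hkN
  simp [S_eq,hkN]
  refine (abs_exchange_sub_le _ _ h.a_mem.1 h.b_mem.1).trans ?_
  refine mul_mono_r ?_ (add_nonneg h.a_mem.1 h.b_mem.1)
  obtain ⟨K,hK⟩ := H.g_lip k hk1
  obtain ⟨K',hK'⟩ := H.g_lip (k+1) hk2
  have e1 := H.abs_gnu_sub_le hk1 x x' hK h.a_mem h.a_mem h.A_mem h'.A_mem
  have e2 := H.abs_gnu_sub_le hk2 x x' hK' h.b_mem h.b_mem h.B_mem h'.B_mem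
  rw [sub_self,abs_zero,mul_zero,zero_add] at e1 e2
  have e3 : ∀ j ∈ M.lanes,∀ s t : ℝ,0 ≤ s → 0 ≤ t →
      M.fLip j*(stripNorm (D1 (M.ν j))*s+stripNorm (D2 (M.ν j))*t)
        ≤ L*(P*s+Q*t) := fun j hj s t hs ht => by
    have := hL j hj
    have := hP j hj
    have := hQ j hj
    have := stripNorm_nonneg (D1 (M.ν j))
    have := stripNorm_nonneg (D2 (M.ν j))
    gcongr
  have e4 := e1.trans (e3 k hk1 _ _ (abs_nonneg _) (abs_nonneg _))
  have e5 := e2.trans (e3 (k+1) hk2 _ _ (abs_nonneg _) (abs_nonneg _))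
  grind

theorem S_lip (hk : k ≤ M.N) (x : ℝ)
    (h : 1 ≤ k ∧ k < M.N → UnitBox a b A B ∧ UnitBox a' b' A' B') :
    |M.S k x a b A B-M.S k x a' b' A' B'| ≤
      if 1 ≤ k ∧ k < M.N then M.SLip*(|a-a'| + |b-b'| + |A-A'| + |B-B'|) else 0 := by
  by_cases hkN : 1 ≤ k ∧ k < M.N
  swap
  · simp [S_eq,hkN]
  obtain ⟨h,h'⟩ := h hkN
  rw [if_pos hkN]
  set d := |a-a'| + |b-b'| + |A-A'| + |B-B'| with hd
  have hd0 : 0 ≤ d := by positivity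
  rcases hd0.eq_or_lt with h0 | hpos
  · have h1 : |a-a'|=0 ∧ |b-b'|=0 ∧ |A-A'|=0 ∧ |B-B'|=0 := by grind
    simp [sub_eq_zero] at h1
    obtain ⟨rfl,rfl,rfl,rfl⟩ := h1
    simp [← h0]
  rw [← div_le_iff₀ hpos]
  refine le_csSup ?_ ⟨k,mem_lanes.2 ⟨hkN.1,hk⟩,x,a,h.a_mem,b,h.b_mem,A,h.A_mem,B,
    h.B_mem,a',h'.a_mem,b',h'.b_mem,A',h'.A_mem,B',h'.B_mem,rfl⟩
  choose! K hK using H.g_lip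
  have hbd : ∀ q : ℕ → ℝ,∃ C,0 ≤ C ∧ ∀ j ∈ M.lanes,q j ≤ C := fun q =>
    ⟨|M.maxLane q|,abs_nonneg _,fun j hj => (le_maxLane q hj).trans (le_abs_self _)⟩
  obtain ⟨CK,hCK0,hCK⟩ := hbd (fun j => (K j : ℝ))
  obtain ⟨Cν,hCν0,hCν⟩ := hbd (fun j => stripNorm (M.ν j))
  obtain ⟨Cf,hCf0,hCf⟩ := hbd M.fLip
  obtain ⟨C2,hC20,hC2⟩ := hbd (fun j => stripNorm (D2 (M.ν j)))
  refine ⟨2*(CK*Cν+Cf*C2)+2*(Cf*Cν),?_⟩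
  rintro r ⟨j,hj,x,a,ha,b,hb,A,hA,B,hB,a',ha',b',hb',A',hA',B',hB',rfl⟩
  refine div_le_of_le_mul₀ (by positivity) (by positivity) ?_
  by_cases hjN : 1 ≤ j ∧ j < M.N
  swap
  · simp [S_eq,hjN]; positivity
  have hk2 := (pair_mem_lanes hjN).2
  simp [S_eq,hjN]
  have e1 := H.abs_gnu_sub_le hj x x (hK j hj) ha ha' hA hA'
  have e2 := H.abs_gnu_sub_le hk2 x x (hK _ hk2) hb hb' hB hB'
  rw [sub_self,abs_zero,mul_zero,zero_add] at e1 e2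
  have e3 : ∀ j ∈ M.lanes,∀ s t : ℝ,0 ≤ s → 0 ≤ t →
      K j*stripNorm (M.ν j)*s+M.fLip j*(stripNorm (D2 (M.ν j))*t)
        ≤ (CK*Cν+Cf*C2)*(s+t) := fun j hj s t hs ht => by
    have h1 := hCK j hj
    have h2 := hCν j hj
    have h3 := hCf j hj
    have h4 := hC2 j hj
    have := stripNorm_nonneg (D2 (M.ν j))
    have := stripNorm_nonneg (M.ν j)
    calc _ ≤ CK*Cν*s+Cf*(C2*t) := by gcongr
      _≤(CK*Cν*s+Cf*(C2*t))+(CK*Cν*t+Cf*C2*s) := by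
          have : 0 ≤ CK*Cν*t+Cf*C2*s := by positivity
          linarith
      _ = _ := by ring
  have e4 := e1.trans (e3 j hj _ _ (abs_nonneg _) (abs_nonneg _))
  have e5 := e2.trans (e3 (j+1) hk2 _ _ (abs_nonneg _) (abs_nonneg _))
  have e7 : ∀ j ∈ M.lanes,∀ c ∈ Icc 0 1,∀ C ∈ Icc 0 1,
      0 ≤ M.g j c*M.ν j x C ∧ M.g j c*M.ν j x C ≤ Cf*Cν := fun j hj c hc C hC =>
    ⟨mul_nonneg (H.g_nonneg hj hc.2) (H.nu_nonneg j hj x C hC),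
      mul_le_mul ((H.g_le hj hc).trans (hCf j hj)) ((H.nu_le hj x hC).trans (hCν j hj))
        (H.nu_nonneg j hj x C hC) hCf0⟩
  set X := M.g (j+1) b*M.ν (j+1) x B-M.g j a*M.ν j x A
  set X' := M.g (j+1) b'*M.ν (j+1) x B'-M.g j a'*M.ν j x A' with hX'
  have e6 : |X-X'|≤(CK*Cν+Cf*C2)*(|a-a'| + |b-b'| + |A-A'| + |B-B'|) := by
    have e6 : ∀ p q r s : ℝ,|p-q-(r-s)| ≤ |p-r| + |q-s| := fun p q r s => by
      have := abs_sub (p-r) (q-s)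
      grind
    grind
  have e8 : |X'|≤2*(Cf*Cν) := by
    have h1 := e7 j hj a' ha' A' hA'
    have h2 := e7 (j+1) hk2 b' hb' B' hB'
    rw [abs_le]; constructor <;> linarith
  calc |exchange X a b-exchange X' a' b'|
      ≤ |exchange X a b-exchange X' a b| + |exchange X' a b-exchange X' a' b'| :=
        abs_sub_le _ _ _
    _ ≤ |X-X'| * (a+b)+|X'| * (|a-a'| + |b-b'|) :=
        add_le_add (abs_exchange_sub_le _ _ ha.1 hb.1) (abs_exchange_sub_le' _ _ _ _ _)
    _≤((CK*Cν+Cf*C2)*(|a-a'| + |b-b'| + |A-A'| + |B-B'|))*2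
        + 2*(Cf*Cν)*(|a-a'| + |b-b'| + |A-A'| + |B-B'|) := by
        refine add_le_add (mul_le_mul e6 (by linarith [ha.2,hb.2]) (add_nonneg ha.1 hb.1)
          (by positivity)) (mul_le_mul e8 ?_ (by positivity) (by positivity))
        linarith [abs_nonneg (A-A'),abs_nonneg (B-B')]
    _ = _ := by ring

theorem abs_S_le (hk : k ≤ M.N) (x : ℝ)
    (h : 1 ≤ k ∧ k < M.N → UnitBox a b A B) :
    |M.S k x a b A B| ≤ if 1 ≤ k ∧ k < M.N then M.SLip*(a+b) else 0 := by
  have h0 : (0 : ℝ) ∈ Icc 0 1 := by simp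
  have := H.S_lip hk x (a' := 0) (b' := 0) (A' := A) (B' := B)
    (fun hh => ⟨h hh,⟨h0,h0,(h hh).A_mem,(h hh).B_mem⟩⟩)
  rw [abs_S_state_zero,sub_zero] at this
  refine this.trans ?_
  split_ifs with hh
  · simp [abs_of_nonneg (h hh).a_mem.1,abs_of_nonneg (h hh).b_mem.1]
  · exact le_rfl

/-- `S` is non-decreasing in its first density and non-increasing in its second one. -/
theorem S_mono (k : ℕ) (x : ℝ)
    (h : 1 ≤ k ∧ k < M.N → UnitBox a b A B ∧ UnitBox a' b' A B ∧ a ≤ a' ∧ b' ≤ b) :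
    M.S k x a b A B ≤ M.S k x a' b' A B := by
  by_cases hkN : 1 ≤ k ∧ k < M.N
  swap
  · simp [S_eq,hkN]
  obtain ⟨h,h',haa,hbb⟩ := h hkN
  obtain ⟨hk1,hk2⟩ := pair_mem_lanes hkN
  simp [S_eq,hkN]
  refine exchange_mono ?_ h.a_mem.1 haa hbb h'.b_mem.1
  exact sub_le_sub (mul_mono_r (H.g_anti _ hk2 hbb)
    (H.nu_nonneg _ hk2 x B h.B_mem)) (mul_mono_r (H.g_anti _ hk1 haa)
    (H.nu_nonneg _ hk1 x A h.A_mem))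

theorem S_one (k : ℕ) (x A B : ℝ) : M.S k x 1 1 A B=0 := by
  by_cases hkN : 1 ≤ k ∧ k < M.N
  · simp [S_eq,exchange,H.g_one k (pair_mem_lanes hkN).1,H.g_one (k+1) (pair_mem_lanes hkN).2]
  · simp [S_eq,hkN]

/-! ### The kernel -/

theorem omega_continuousOn : ContinuousOn M.ω (Icc 0 M.η) := H.omega_C2.continuousOn

theorem omega_le {y : ℝ} (hy : y ∈ Icc 0 M.η) : M.ω y ≤ M.ω 0 :=
  H.omega_anti (left_mem_Icc.2 H.eta_pos.le) hy hy.1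

theorem omega_zero_nonneg : 0 ≤ M.ω 0 := H.omega_nonneg 0 (left_mem_Icc.2 H.eta_pos.le)

theorem kernel_variation_ne_top : eVariationOn (indicator (Icc 0 M.η) M.ω) univ ≠ ⊤ := by
  set w := indicator (Icc 0 M.η) M.ω with hw
  have hw0 : ∀ y<0,w y=0 := fun y hy => indicator_of_notMem (fun h => by linarith [h.1]) _
  have h1 : AntitoneOn w (Ici 0) := by
    intro p hp q hq hpq
    by_cases hq' : q ≤ M.η
    · rw [hw,indicator_of_mem (show q ∈ Icc 0 M.η from ⟨hq,hq'⟩),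
        indicator_of_mem (show p ∈ Icc 0 M.η from ⟨hp,hpq.trans hq'⟩)]
      exact H.omega_anti ⟨hp,hpq.trans hq'⟩ ⟨hq,hq'⟩ hpq
    · rw [hw,indicator_of_notMem (show q ∉ Icc 0 M.η from fun h => hq' h.2)]
      exact indicator_nonneg (fun z hz => H.omega_nonneg z hz) p
  have h2 : MonotoneOn w (Iic 0) := by
    intro p hp q hq hpq
    rcases (show p≤0 from hp).eq_or_lt with rfl | hp
    · rw [show q=0 from le_antisymm hq hpq]
    · rw [hw0 p hp]; exact indicator_nonneg (fun z hz => H.omega_nonneg z hz) q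
  have hle : ∀ y,|w y| ≤ M.ω 0 := fun y => by
    rw [abs_of_nonneg (indicator_nonneg (fun z hz => H.omega_nonneg z hz) y)]
    by_cases hy : y ∈ Icc 0 M.η
    · rw [indicator_of_mem hy]; exact H.omega_le hy
    · rw [indicator_of_notMem hy]; exact H.omega_zero_nonneg
  have key : ∀ (s : Set ℝ) (φ : ℝ → ℝ),(MonotoneOn φ s) → (∀ y,|φ y| ≤ M.ω 0) →
      eVariationOn φ s ≤ ENNReal.ofReal (M.ω 0+M.ω 0) := by
    intro s φ hφ hb
    rw [eVariationOn.eq_biSup_inter_Icc]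
    refine iSup₂_le ?_
    rintro ⟨a,b⟩ ⟨ha,hb',-⟩
    refine (hφ.eVariationOn_eq ha hb').le.trans (ENNReal.ofReal_le_ofReal ?_)
    have := abs_le.1 (hb a); have := abs_le.1 (hb b); linarith
  have e1 := key _ _ h2 hle
  have e2 : eVariationOn w (Ici 0) ≤ ENNReal.ofReal (M.ω 0+M.ω 0) := by
    have := key (Ici 0) (fun y => -w y) h1.neg (fun y => by rw [abs_neg]; exact hle y)
    refine le_trans (le_of_eq ?_) this
    simp only [eVariationOn,edist_neg_neg]
  have := eVariationOn.union w (x := (0 : ℝ)) isGreatest_Iic isLeast_Ici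
  rw [Iic_union_Ici] at this
  rw [this]
  exact ne_top_of_le_ne_top (by simp) (add_le_add e1 e2)

theorem omega_zero_le_kernelTV : M.ω 0 ≤ M.kernelTV := by
  have h := eVariationOn.edist_le (indicator (Icc 0 M.η) M.ω) (x := -1) (y := 0)
    (mem_univ _) (mem_univ _)
  rw [indicator_of_notMem (by simp),indicator_of_mem (left_mem_Icc.2 H.eta_pos.le)] at h
  have := ENNReal.toReal_mono H.kernel_variation_ne_top h
  rw [edist_dist,ENNReal.toReal_ofReal dist_nonneg,Real.dist_eq,zero_sub,abs_neg] at this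
  exact (le_abs_self _).trans this

end Standing
end Model

variable {v : ℤ → ℝ} {TV : ℝ} {k : ℕ}

/-! ### Sums over the cells -/

/-- `∑ a ≤ C`, including summability. -/
def SumLe (a : ℤ → ℝ) (C : ℝ) : Prop := Summable a ∧ ∑' i,a i ≤ C

namespace SumLe

variable {a b : ℤ → ℝ} {A B : ℝ}

theorem weaken (h : SumLe a A) (hAB : A ≤ B) : SumLe a B := ⟨h.1,h.2.trans hAB⟩

theorem mono (h : SumLe b B) (h0 : ∀ i,0 ≤ a i) (hab : ∀ i,a i ≤ b i) : SumLe a B :=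
  have hs := Summable.of_nonneg_of_le h0 hab h.1
  ⟨hs,(hs.tsum_le_tsum hab h.1).trans h.2⟩

theorem add (ha : SumLe a A) (hb : SumLe b B) : SumLe (fun i => a i+b i) (A+B) :=
  ⟨ha.1.add hb.1,by rw [ha.1.tsum_add hb.1]; exact add_le_add ha.2 hb.2⟩

theorem const_mul (ha : SumLe a A) {c : ℝ} (hc : 0 ≤ c) : SumLe (fun i => c*a i) (c*A) :=
  ⟨ha.1.mul_left c,by rw [tsum_mul_left]; exact mul_mono_l ha.2 hc⟩

theorem shift (ha : SumLe a A) (j : ℤ) : SumLe (fun i => a (i+j)) A :=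
  ⟨(Equiv.addRight j).summable_iff.2 ha.1,((Equiv.addRight j).tsum_eq a).le.trans ha.2⟩

theorem zero : SumLe (fun _ => 0) 0 := ⟨summable_zero,by simp⟩

theorem sum {ι : Type*} (s : Finset ι) {f : ι → ℤ → ℝ} {F : ι → ℝ}
    (h : ∀ j ∈ s,SumLe (f j) (F j)) : SumLe (fun i => ∑ j ∈ s,f j i) (∑ j ∈ s,F j) := by
  refine ⟨summable_sum fun j hj => (h j hj).1,?_⟩
  rw [Summable.tsum_finsetSum fun j hj => (h j hj).1]
  exact Finset.sum_le_sum fun j hj => (h j hj).2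

theorem abs_le (h : SumLe (fun i => |a i|) A) : Summable a ∧ |∑' i,a i| ≤ A := by
  have hs := h.1.of_abs
  refine ⟨hs,le_trans ?_ h.2⟩
  simpa using norm_tsum_le_tsum_norm (f := a) (by simpa using h.1)

end SumLe

theorem tsum_shift (a : ℤ → ℝ) (j : ℤ) : ∑' i,a (i+j)=∑' i,a i :=
  (Equiv.addRight j).tsum_eq a

theorem summable_shift {a : ℤ → ℝ} (h : Summable a) (j : ℤ) : Summable fun i => a (i+j) :=
  (Equiv.addRight j).summable_iff.2 h

/-- Summation by parts against a non-increasing weight. -/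
theorem abs_sum_mul_sub_le (ζ δ : ℕ → ℝ) (n : ℕ) (h0 : ∀ p ≤ n,0 ≤ ζ p)
    (hanti : ∀ p < n,ζ (p+1) ≤ ζ p) :
    |∑ p ∈ Finset.range (n+1),ζ p*(δ (p+1)-δ p)| ≤
      ζ 0*|δ 0| + ∑ p ∈ Finset.range n,(ζ p-ζ (p+1))*|δ (p+1)|
        + ζ n*|δ (n+1)| := by
  have key : ∀ n,∑ p ∈ Finset.range (n+1),ζ p*(δ (p+1)-δ p)
      = -(ζ 0*δ 0)+∑ p ∈ Finset.range n,(ζ p-ζ (p+1))*δ (p+1)+ζ n*δ (n+1) := by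
    intro n
    induction n with
    | zero => simp; ring
    | succ n ih => rw [Finset.sum_range_succ,ih,Finset.sum_range_succ]; ring
  rw [key]
  refine (abs_add_le _ _).trans (add_le_add ((abs_add_le _ _).trans (add_le_add ?_ ?_)) ?_)
  · rw [abs_neg,abs_mul,abs_of_nonneg (h0 0 (by omega))]
  · refine (Finset.abs_sum_le_sum_abs _ _).trans (Finset.sum_le_sum fun p hp => ?_)
    rw [abs_mul,abs_of_nonneg (sub_nonneg.2 (hanti p (Finset.mem_range.1 hp)))]
  · rw [abs_mul,abs_of_nonneg (h0 n le_rfl)]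

/-- Harten's estimate for schemes in incremental form. -/
theorem SumLe.incremental {e C D : ℤ → ℝ} {E : ℝ} (hC : ∀ i,0 ≤ C i) (hD : ∀ i,0 ≤ D i)
    (hCD : ∀ i,C i+D i≤1) (hv : SumLe (fun i => |v (i+1)-v i|) TV)
    (he : SumLe (fun i => |e (i+1)-e i|) E) {new : ℤ → ℝ}
    (hnew : ∀ i,new i = v i+C i*(v (i+1)-v i)-D (i-1)*(v i-v (i-1))+e i) :
    SumLe (fun i => |new (i+1)-new i|) (TV+E) := by
  set δ : ℤ → ℝ := fun i => |v (i+1)-v i| with hδ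
  have hbd : ∀ i,C i≤1 ∧ D i≤1 := fun i =>
    ⟨by linarith [hD i,hCD i],by linarith [hC i,hCD i]⟩
  have s1 := Summable.of_nonneg_of_le
    (fun i => mul_nonneg (hC i) (abs_nonneg _))
    (fun i => mul_le_of_le_one_left (abs_nonneg _) (hbd i).1) hv.1
  have s2 := Summable.of_nonneg_of_le
    (fun i => mul_nonneg (hD i) (abs_nonneg _))
    (fun i => mul_le_of_le_one_left (abs_nonneg _) (hbd i).2) hv.1
  have s3 : SumLe (fun i => (δ i-C i*δ i-D i*δ i)+C (i+1)*δ (i+1)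
      + D (i+-1)*δ (i+-1)) TV := by
    have s4 := (hv.1.sub s1).sub s2
    refine ⟨(s4.add (summable_shift s1 1)).add (summable_shift s2 (-1)),?_⟩
    rw [(s4.add (summable_shift s1 1)).tsum_add (summable_shift s2 (-1)),
      s4.tsum_add (summable_shift s1 1),tsum_shift (fun i => C i*δ i),
      tsum_shift (fun i => D i*δ i),(hv.1.sub s1).tsum_sub s2,hv.1.tsum_sub s1]
    linarith [hv.2]
  refine (s3.add he).mono (fun i => abs_nonneg _) fun i => ?_
  have e1 : new (i+1)-new i=(1-C i-D i)*(v (i+1)-v i)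
      + C (i+1)*(v (i+1+1)-v (i+1))+D (i-1)*(v i-v (i-1))
      + (e (i+1)-e i) := by rw [hnew,hnew,show i+1-1 = i by ring]; ring
  rw [e1]
  refine (abs_add_le _ _).trans (add_le_add_left ?_ _)
  refine (abs_add_three _ _ _).trans (le_of_eq ?_)
  rw [abs_mul,abs_mul,abs_mul,abs_of_nonneg (hC _),abs_of_nonneg (hD _),
    abs_of_nonneg (by linarith [hCD i] : 0≤1-C i-D i)]
  grind

namespace Model

variable {M : Model} {m : Mesh} {β : ℝ}

/-- All conditions on the parameters of one step of the scheme. -/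
structure Admissible (M : Model) (m : Mesh) (β : ℝ) : Prop where
  std : M.Standing
  dx_pos : 0 < m.Δx
  dt_pos : 0 < m.Δt
  eta_eq : M.η = m.Nη*m.Δx
  beta_pos : 0 < β
  beta_lt : β<2/3
  cfl : M.CFL m β
  diag : M.DiagonalCFL m β

/-- All cell values lie in `[0,1]`. -/
def UnitValued (M : Model) (w : ℕ → ℤ → ℝ) : Prop := ∀ k ∈ M.lanes,∀ i,w k i ∈ 𝕀

namespace Admissible

variable (h : Admissible M m β)
include h

theorem lam_pos : 0 < m.lam := div_pos h.dt_pos h.dx_pos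

theorem lam_mul_dx : m.lam*m.Δx = m.Δt := div_mul_cancel₀ _ h.dx_pos.ne'

theorem lam_flux_le (hk : k ∈ M.lanes) :
    m.lam*M.fLip k*stripNorm (M.ν k) ≤ β := by
  have h1 := h.cfl k hk
  have h2 : 0 ≤ M.fLip k*stripNorm (M.ν k) := mul_nonneg (fLip_nonneg k) (stripNorm_nonneg _)
  rw [le_div_iff₀ (by linarith)] at h1
  have h3 := h1.trans ((min_le_right _ _).trans ((min_le_right _ _).trans (min_le_left _ _)))
  nlinarith [h.lam_pos]

theorem Neta_pos : 0 < m.Nη := by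
  rcases Nat.eq_zero_or_pos m.Nη with h0 | h0
  · have := h.eta_eq; rw [h0] at this; simp at this
    exact absurd h.std.eta_pos (by linarith)
  · exact h0

theorem sub_eta {p : ℕ} (hp : p < m.Nη) {y : ℝ}
    (hy : y ∈ Icc ((p : ℝ)*m.Δx) ((p+1)*m.Δx)) : y ∈ Icc 0 M.η := by
  have := h.dx_pos
  refine ⟨le_trans (by positivity) hy.1,hy.2.trans ?_⟩
  rw [h.eta_eq]
  have : ((p : ℝ)+1) ≤ m.Nη := by exact_mod_cast hp
  gcongr

theorem le_next (p : ℕ) : (p : ℝ)*m.Δx≤(p+1)*m.Δx := by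
  have := h.dx_pos
  gcongr; linarith

theorem omega_intervalIntegrable {p : ℕ} (hp : p < m.Nη) :
    IntervalIntegrable M.ω volume ((p : ℝ)*m.Δx) ((p+1)*m.Δx) := by
  refine ContinuousOn.intervalIntegrable_of_Icc (h.le_next p) ?_
  exact h.std.omega_continuousOn.mono fun y hy => h.sub_eta hp hy

theorem zeta_nonneg {p : ℕ} (hp : p < m.Nη) : 0 ≤ M.zeta m p :=
  intervalIntegral.integral_nonneg (h.le_next p)
    fun y hy => h.std.omega_nonneg y (h.sub_eta hp hy)

theorem zeta_le {p : ℕ} (hp : p < m.Nη) : M.zeta m p ≤ M.ω 0*m.Δx := by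
  have h1 := intervalIntegral.integral_mono_on (h.le_next p) (h.omega_intervalIntegrable hp)
    (intervalIntegrable_const) fun y hy => h.std.omega_le (h.sub_eta hp hy)
  rw [intervalIntegral.integral_const,smul_eq_mul] at h1
  calc M.zeta m p ≤ _ := h1
    _ = _ := by ring

theorem zeta_anti {p : ℕ} (hp : p+1 < m.Nη) : M.zeta m (p+1) ≤ M.zeta m p := by
  have h1 : M.zeta m (p+1)=∫ y in (p*m.Δx)..((p+1)*m.Δx),M.ω (y+m.Δx) := by
    rw [intervalIntegral.integral_comp_add_right]
    simp [zeta]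
    push_cast
    congr 1 <;> ring
  rw [h1]
  have hi := h.omega_intervalIntegrable hp
  refine intervalIntegral.integral_mono_on (h.le_next p) ?_
    (h.omega_intervalIntegrable (by omega)) fun y hy => ?_
  · have := (hi.comp_add_right m.Δx)
    push_cast at this
    convert this using 1 <;> ring
  · have e1 : y+m.Δx ∈ Icc 0 M.η := by
      refine h.sub_eta hp ?_
      grind
    exact h.std.omega_anti (h.sub_eta (by omega) hy) e1 (by linarith [h.dx_pos])

theorem zeta_sum : ∑ p ∈ Finset.range m.Nη,M.zeta m p=1 := by
  have h1 := intervalIntegral.sum_integral_adjacent_intervals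
    (a := fun p => p*m.Δx) (fun p hp => by push_cast; exact h.omega_intervalIntegrable hp)
  rw [← h.eta_eq] at h1
  simp [h.std.omega_mass] at h1
  exact h1

theorem cHalf_mem (hv : ∀ i,v i ∈ 𝕀) (i : ℤ) :
    M.cHalf m v i ∈ 𝕀 := by
  constructor
  · exact Finset.sum_nonneg fun p hp =>
      mul_nonneg (h.zeta_nonneg (Finset.mem_range.1 hp)) (hv _).1
  · rw [← h.zeta_sum]
    exact Finset.sum_le_sum fun p hp =>
      mul_le_of_le_one_right (h.zeta_nonneg (Finset.mem_range.1 hp)) (hv _).2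

theorem cMid_mem (hv : ∀ i,v i ∈ 𝕀) (i : ℤ) :
    M.cMid m v i ∈ 𝕀 := by
  have h1 := h.cHalf_mem hv i
  have h2 := h.cHalf_mem hv (i+1)
  exact ⟨by unfold cMid; linarith [h1.1,h2.1],by unfold cMid; linarith [h1.2,h2.2]⟩

theorem cHalf_sub_eq (v : ℤ → ℝ) (i : ℤ) : M.cHalf m v (i+1)-M.cHalf m v i
    = ∑ p ∈ Finset.range m.Nη,M.zeta m p*(v (i+p+2)-v (i+p+1)) := by
  simp [cHalf,← Finset.sum_sub_distrib,← mul_sub]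
  grind

theorem exists_weights : ∃ e : ℕ → ℝ,(∀ p ∈ Finset.range (m.Nη+1),0 ≤ e p) ∧
    ∑ p ∈ Finset.range (m.Nη+1),e p≤2*M.ω 0*m.Δx ∧ ∀ δ : ℕ → ℝ,
    |∑ p ∈ Finset.range m.Nη,M.zeta m p*(δ (p+1)-δ p)|
      ≤ ∑ p ∈ Finset.range (m.Nη+1),e p*|δ p| := by
  obtain ⟨n,hn⟩ : ∃ n,m.Nη = n+1 := ⟨m.Nη-1,by have := h.Neta_pos; omega⟩
  set ζ := M.zeta m
  let e : ℕ → ℝ := fun p => if p=0 then ζ 0 else if p = n+1 then ζ n else ζ (p-1)-ζ p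
  have hsum : ∀ q : ℕ → ℝ,∑ p ∈ Finset.range (n+1+1),e p*q p
      = ζ 0*q 0+∑ p ∈ Finset.range n,(ζ p-ζ (p+1))*q (p+1)+ζ n*q (n+1) := by
    intro q
    rw [Finset.sum_range_succ,Finset.sum_range_succ']
    have e1 : ∑ p ∈ Finset.range n,e (p+1)*q (p+1)
        = ∑ p ∈ Finset.range n,(ζ p-ζ (p+1))*q (p+1) :=
      Finset.sum_congr rfl fun p hp => by measurability
    rw [e1]
    simp [e]
    ring
  have hanti : ∀ p < n,ζ (p+1) ≤ ζ p := fun p hp => h.zeta_anti (by omega)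
  refine ⟨e,fun p hp => ?_,?_,fun δ => ?_⟩
  · by_cases h1 : p=0
    · simpa [e,h1] using h.zeta_nonneg h.Neta_pos
    by_cases h2 : p = n+1
    · simpa [e,h2] using h.zeta_nonneg (by omega)
    grind
  · have := hsum (fun _ => 1)
    simp only [mul_one] at this
    rw [hn,this,Finset.sum_range_sub']
    linarith [h.zeta_le h.Neta_pos]
  · rw [hn,hsum (fun p => |δ p|)]
    exact abs_sum_mul_sub_le ζ δ n (fun p hp => h.zeta_nonneg (by omega)) hanti

theorem abs_cHalf_sub_le (hv : ∀ i,v i ∈ 𝕀) (i : ℤ) :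
    |M.cHalf m v (i+1)-M.cHalf m v i|≤2*M.ω 0*m.Δx := by
  obtain ⟨e,he0,hes,he⟩ := h.exists_weights
  have h1 := he fun p => v (i+p+1)
  rw [h.cHalf_sub_eq]
  have h2 : ∀ p : ℕ,v (i+((p+1 : ℕ) : ℤ)+1) = v (i+p+2) := fun p => by
    congr 1; push_cast; ring
  simp only [h2] at h1
  refine h1.trans (le_trans (Finset.sum_le_sum fun p hp => ?_) hes)
  refine mul_le_of_le_one_right (he0 p hp) ?_
  rw [abs_of_nonneg (hv _).1]
  exact (hv _).2

theorem cHalf_tv (hv : SumLe (fun i => |v (i+1)-v i|) TV) :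
    SumLe (fun i => |M.cHalf m v (i+1)-M.cHalf m v i|) TV := by
  have h1 : SumLe (fun i => ∑ p ∈ Finset.range m.Nη,
      M.zeta m p*|v (i+(p+1)+1)-v (i+(p+1))|)
      (∑ p ∈ Finset.range m.Nη,M.zeta m p*TV) :=
    SumLe.sum _ fun p hp => (hv.shift (p+1)).const_mul (h.zeta_nonneg (Finset.mem_range.1 hp))
  rw [← Finset.sum_mul,h.zeta_sum,one_mul] at h1
  refine h1.mono (fun i => abs_nonneg _) fun i => ?_
  rw [h.cHalf_sub_eq]
  refine (Finset.abs_sum_le_sum_abs _ _).trans (Finset.sum_le_sum fun p hp => le_of_eq ?_)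
  rw [abs_mul,abs_of_nonneg (h.zeta_nonneg (Finset.mem_range.1 hp)),
    show i+(p+1)+1 = i+p+2 by ring,show i+(p+1) = i+p+1 by ring]

theorem cHalf_second (hv : SumLe (fun i => |v (i+1)-v i|) TV)
    (hTV : 0 ≤ TV) :
    SumLe (fun i => |M.cHalf m v (i+2)-2*M.cHalf m v (i+1)+M.cHalf m v i|)
      (2*M.ω 0*m.Δx*TV) := by
  obtain ⟨e,he0,hes,he⟩ := h.exists_weights
  have h1 : SumLe (fun i => ∑ p ∈ Finset.range (m.Nη+1),
      e p*|v (i+(p+1)+1)-v (i+(p+1))|)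
      (∑ p ∈ Finset.range (m.Nη+1),e p*TV) :=
    SumLe.sum _ fun p hp => (hv.shift (p+1)).const_mul (he0 p hp)
  rw [← Finset.sum_mul] at h1
  refine (h1.weaken (by gcongr)).mono (fun i => abs_nonneg _)
    fun i => ?_
  have h2 := he fun p => v (i+(p+1)+1)-v (i+(p+1))
  have h3 : M.cHalf m v (i+2)-2*M.cHalf m v (i+1)+M.cHalf m v i
      = (M.cHalf m v (i+1+1)-M.cHalf m v (i+1))
        - (M.cHalf m v (i+1)-M.cHalf m v i) := by rw [show i+1+1 = i+2 by ring]; ring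
  rw [h3,h.cHalf_sub_eq,h.cHalf_sub_eq,← Finset.sum_sub_distrib]
  grind

omit h in
theorem half_succ_sub (m : Mesh) (i : ℤ) : m.half (i+1)-m.half i = m.Δx := by
  simp [Mesh.half,Mesh.node]; ring

theorem abs_half_sub (i : ℤ) : |m.half (i+1)-m.half i| = m.Δx := by
  rw [half_succ_sub,abs_of_pos h.dx_pos]

/-- The velocities at the cell interfaces. -/
theorem abs_nu_sub_le (hk : k ∈ M.lanes) (hv : ∀ i,v i ∈ 𝕀)
    (i : ℤ) : |M.ν k (m.half (i+1)) (M.cHalf m v (i+1))-M.ν k (m.half i) (M.cHalf m v i)|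
      ≤ (stripNorm (D1 (M.ν k))+stripNorm (D2 (M.ν k))*(2*M.ω 0))*m.Δx := by
  have h1 := h.std.nu_lip_space hk (m.half (i+1)) (m.half i) (h.cHalf_mem hv (i+1))
  have h2 := h.std.nu_lip_state hk (m.half i) (h.cHalf_mem hv (i+1)) (h.cHalf_mem hv i)
  rw [h.abs_half_sub] at h1
  refine (abs_sub_le _ _ _).trans ((add_le_add h1 (h2.trans (mul_mono_l
    (h.abs_cHalf_sub_le hv i) (stripNorm_nonneg _)))).trans (le_of_eq ?_))
  ring

end Admissible

theorem Standing.nu_second (H : M.Standing) (hk : k ∈ M.lanes) {x₀ d W c₀ c₁ c₂ : ℝ}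
    (hd : 0 ≤ d) (h₀ : c₀ ∈ 𝕀) (h₁ : c₁ ∈ 𝕀) (h₂ : c₂ ∈ 𝕀)
    (hW : 0 ≤ W) (h12 : |c₂-c₁| ≤ W*d) (h01 : |c₁-c₀| ≤ W*d) :
    |M.ν k (x₀+2*d) c₂-2*M.ν k (x₀+d) c₁+M.ν k x₀ c₀| ≤
      stripNorm (D2 (M.ν k))*|c₂-2*c₁+c₀| + (stripNorm (D1 (D1 (M.ν k)))
        + 2*stripNorm (D2 (D1 (M.ν k)))*W+2*stripNorm (D2 (D2 (M.ν k)))*W^2)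
        * d*d := by
  have mixed : ∀ a ∈ Icc 0 1,∀ b ∈ Icc 0 1,|a-b| ≤ W*d →
      |(M.ν k (x₀+d) a-M.ν k (x₀+d) b)-(M.ν k x₀ a-M.ν k x₀ b)|
        ≤ stripNorm (D2 (D1 (M.ν k)))*(W*d)*d := by
    intro a ha b hb hab
    have := abs_sub_le_of_deriv (φ := fun x => M.ν k x a-M.ν k x b)
      ((H.nu_diff_space hk a).sub (H.nu_diff_space hk b))
      (C := stripNorm (D2 (D1 (M.ν k)))*(W*d)) (fun x => by
        rw [deriv_fun_sub (H.nu_diff_space hk a x) (H.nu_diff_space hk b x)]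
        exact (H.D1_lip_state hk x ha hb).trans
          (mul_mono_l hab (stripNorm_nonneg _))) (x₀+d) x₀
    simpa [abs_of_nonneg hd] using this
  have m1 := mixed c₂ h₂ c₁ h₁ h12
  have m2 := mixed c₁ h₁ c₀ h₀ h01
  have sp : |(M.ν k (x₀+d+d) c₂-M.ν k (x₀+d) c₂)-(M.ν k (x₀+d) c₂-M.ν k x₀ c₂)|
      ≤ stripNorm (D1 (D1 (M.ν k)))*d*d := by
    have hdiff : Differentiable ℝ fun x => M.ν k (x+d) c₂ :=
      (H.nu_diff_space hk c₂).comp (differentiable_id.add_const d)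
    have := abs_sub_le_of_deriv (φ := fun x => M.ν k (x+d) c₂-M.ν k x c₂)
      (hdiff.sub (H.nu_diff_space hk c₂))
      (C := stripNorm (D1 (D1 (M.ν k)))*d) (fun x => by
        rw [deriv_fun_sub (hdiff x) (H.nu_diff_space hk c₂ x),
          deriv_comp_add_const (fun x => M.ν k x c₂)]
        have := H.D1_lip_space hk (x+d) x h₂
        rw [add_sub_cancel_left,abs_of_nonneg hd] at this
        exact this) (x₀+d) x₀
    simpa [abs_of_nonneg hd] using this
  have t1 := H.nu_taylor_state hk (x₀+d) h₂ h₁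
  have t2 := H.nu_taylor_state hk (x₀+d) h₀ h₁
  rw [abs_sub_comm c₀ c₁] at t2
  have hB := stripNorm_nonneg (D2 (D2 (M.ν k)))
  have sq : ∀ r : ℝ,0 ≤ r → r ≤ W*d → stripNorm (D2 (D2 (M.ν k)))*r*r
      ≤ stripNorm (D2 (D2 (M.ν k)))*W^2*d*d := fun r h0 h1 => by
    calc _ ≤ stripNorm (D2 (D2 (M.ν k)))*(W*d)*(W*d) := by gcongr
      _ = _ := by ring
  have t1' := t1.trans (sq _ (abs_nonneg _) h12)
  have t2' := t2.trans (sq _ (abs_nonneg _) h01)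
  have t3 : |D2 (M.ν k) (x₀+d) c₁*(c₂-2*c₁+c₀)|
      ≤ stripNorm (D2 (M.ν k))*|c₂-2*c₁+c₀| := by
    rw [abs_mul]
    exact mul_mono_r (abs_le_stripNorm (H.nu_D2_bdd k hk) _ h₁) (abs_nonneg _)
  have e : x₀+d+d = x₀+2*d := by ring
  rw [e] at sp
  rw [abs_le] at *
  constructor <;> nlinarith

variable {M : Model} {m : Mesh} {β : ℝ}
variable {k : ℕ} {w : ℕ → ℤ → ℝ} {v : ℤ → ℝ} {L P Q K : ℝ} {TV mass : ℕ → ℝ}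

/-- The flow from lane `k` to lane `k + 1` at the node `i`. -/
noncomputable def nodeFlow (M : Model) (m : Mesh) (w : ℕ → ℤ → ℝ) (k : ℕ) (i : ℤ) : ℝ :=
  M.S k (m.node i) (w k i) (w (k+1) i) (M.cMid m (w k) i) (M.cMid m (w (k+1)) i)

/-- Bounds on all lanes: total variation and mass of each lane. -/
structure Budget (M : Model) (w : ℕ → ℤ → ℝ) (TV mass : ℕ → ℝ) : Prop where
  tv : ∀ k ∈ M.lanes,SumLe (fun i => |w k (i+1)-w k i|) (TV k)
  tv_nonneg : ∀ k ∈ M.lanes,0 ≤ TV k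
  mass_le : ∀ k ∈ M.lanes,SumLe (w k) (mass k)
  mass_nonneg : ∀ k ∈ M.lanes,0 ≤ mass k

theorem le_sum_lanes {q : ℕ → ℝ} (hq : ∀ k ∈ M.lanes,0 ≤ q k)
    (hk : k ∈ M.lanes) : q k≤∑ j ∈ M.lanes,q j := Finset.single_le_sum hq hk

namespace Admissible

variable (h : Admissible M m β)
include h

/-- The velocity at `x_{i+1/2}`. -/
theorem nu_half_mem (hk : k ∈ M.lanes) (hv : ∀ i,v i ∈ 𝕀)
    (i : ℤ) : M.ν k (m.half i) (M.cHalf m v i) ∈ Icc 0 (stripNorm (M.ν k)) :=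
  ⟨h.std.nu_nonneg k hk _ _ (h.cHalf_mem hv i),h.std.nu_le hk _ (h.cHalf_mem hv i)⟩

omit h in
theorem step_eq (hl : m.lam ≠ 0) (w : ℕ → ℤ → ℝ) (k : ℕ) (i : ℤ) {a a' : ℝ}
    (ha : M.ν k (m.half i) (M.cHalf m (w k) i) = a)
    (ha' : M.ν k (m.half (i-1)) (M.cHalf m (w k) (i-1)) = a') :
    M.step m β w k i = w k i-m.lam/2*(a*(M.f k (w k i)+M.f k (w k (i+1)))
      - a'*(M.f k (w k (i-1))+M.f k (w k i)))
      + β/2*(w k (i+1)-w k i)-β/2*(w k i-w k (i-1))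
      + m.Δt*M.discreteSource m w k i := by
  simp [step,flux,ha,ha']
  field_simp
  ring

theorem unitBox (hw : UnitValued M w) (i j : ℤ) (k : ℕ)
    (hk : 1 ≤ k ∧ k < M.N) : UnitBox (w k i) (w (k+1) i) (M.cMid m (w k) j)
      (M.cMid m (w (k+1)) j) := by
  obtain ⟨hk1,hk2⟩ := pair_mem_lanes hk
  exact ⟨hw k hk1 i,hw _ hk2 i,h.cMid_mem (hw k hk1) j,h.cMid_mem (hw _ hk2) j⟩

omit h in
theorem discreteSource_eq (w : ℕ → ℤ → ℝ) (hk : k ∈ M.lanes) (i : ℤ) :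
    M.discreteSource m w k i = nodeFlow M m w (k-1) i-nodeFlow M m w k i := by
  have := Nat.sub_add_cancel (mem_lanes.1 hk).1
  simp [discreteSource,R,nodeFlow,this]

theorem discreteSource_bounds (hw : UnitValued M w) (hk : k ∈ M.lanes)
    (i : ℤ) : -(2*M.SLip*w k i) ≤ M.discreteSource m w k i ∧
      M.discreteSource m w k i≤2*M.SLip*(1-w k i) := by
  have h0 : (0 : ℝ) ∈ Icc 0 1 := by simp
  have h1 : (1 : ℝ) ∈ Icc 0 1 := by simp
  have hS := SLip_nonneg (M := M)
  have hwk := hw k hk i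
  have hk' := mem_lanes.1 hk
  rw [discreteSource_eq w hk]
  have A1 : nodeFlow M m w (k-1) i ≤ M.SLip*(1-w k i) ∧
      -(M.SLip*w k i) ≤ nodeFlow M m w (k-1) i := by
    obtain ⟨j,rfl⟩ : ∃ j,k = j+1 := ⟨k-1,by omega⟩
    simp only [Nat.add_sub_cancel,nodeFlow]
    have hB := h.unitBox hw i i j
    set A := M.cMid m (w j) i
    set B := M.cMid m (w (j+1)) i
    constructor
    · have e1 := h.std.S_mono j (m.node i) (b := w (j+1) i) (A := A) (B := B)
        (a' := 1) (b' := w (j+1) i) fun hj => ⟨hB hj,⟨h1,(hB hj).b_mem,(hB hj).A_mem,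
          (hB hj).B_mem⟩,(hB hj).a_mem.2,le_rfl⟩
      have e2 := h.std.S_lip (k := j) (by omega) (m.node i) (a := 1) (b := w (j+1) i)
        (A := A) (B := B) (a' := 1) (b' := 1) (A' := A) (B' := B) fun hj =>
          ⟨⟨h1,(hB hj).b_mem,(hB hj).A_mem,(hB hj).B_mem⟩,
            ⟨h1,h1,(hB hj).A_mem,(hB hj).B_mem⟩⟩
      rw [h.std.S_one,sub_zero] at e2
      refine e1.trans ((le_abs_self _).trans (e2.trans ?_))
      have : 0 ≤ M.SLip*(1-w (j+1) i) := mul_nonneg hS (by linarith [hwk.2])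
      split_ifs
      · rw [abs_sub_comm (w (j+1) i),abs_of_nonneg (by linarith [hwk.2] :
          0≤1-w (j+1) i)]; simp
      · exact this
    · have e1 := h.std.S_mono j (m.node i) (a := 0) (b := w (j+1) i) (A := A) (B := B)
        (a' := w j i) (b' := w (j+1) i) fun hj => ⟨⟨h0,(hB hj).b_mem,(hB hj).A_mem,
          (hB hj).B_mem⟩,hB hj,(hB hj).a_mem.1,le_rfl⟩
      have e2 := h.std.abs_S_le (k := j) (by omega) (m.node i) (a := 0) (b := w (j+1) i)
        (A := A) (B := B) fun hj => ⟨h0,(hB hj).b_mem,(hB hj).A_mem,(hB hj).B_mem⟩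
      have : 0 ≤ M.SLip*w (j+1) i := mul_nonneg hS hwk.1
      grind
  have A2 : nodeFlow M m w k i ≤ M.SLip*w k i ∧
      -(M.SLip*(1-w k i)) ≤ nodeFlow M m w k i := by
    simp only [nodeFlow]
    have hB := h.unitBox hw i i k
    set A := M.cMid m (w k) i
    set B := M.cMid m (w (k+1)) i
    constructor
    · have e1 := h.std.S_mono k (m.node i) (a := w k i) (b := w (k+1) i) (A := A) (B := B)
        (a' := w k i) (b' := 0) fun hj => ⟨hB hj,⟨(hB hj).a_mem,h0,(hB hj).A_mem,
          (hB hj).B_mem⟩,le_rfl,(hB hj).b_mem.1⟩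
      have e2 := h.std.abs_S_le (k := k) hk'.2 (m.node i) (a := w k i) (b := 0)
        (A := A) (B := B) fun hj => ⟨(hB hj).a_mem,h0,(hB hj).A_mem,(hB hj).B_mem⟩
      refine e1.trans ((le_abs_self _).trans (e2.trans ?_))
      have : 0 ≤ M.SLip*w k i := mul_nonneg hS hwk.1
      split_ifs
      · simp
      · exact this
    · have e1 := h.std.S_mono k (m.node i) (a := w k i) (b := 1) (A := A) (B := B)
        (a' := w k i) (b' := w (k+1) i) fun hj => ⟨⟨(hB hj).a_mem,h1,(hB hj).A_mem,
          (hB hj).B_mem⟩,hB hj,le_rfl,(hB hj).b_mem.2⟩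
      have e2 := h.std.S_lip (k := k) hk'.2 (m.node i) (a := w k i) (b := 1)
        (A := A) (B := B) (a' := 1) (b' := 1) (A' := A) (B' := B) fun hj =>
          ⟨⟨(hB hj).a_mem,h1,(hB hj).A_mem,(hB hj).B_mem⟩,
            ⟨h1,h1,(hB hj).A_mem,(hB hj).B_mem⟩⟩
      rw [h.std.S_one,sub_zero] at e2
      have : 0 ≤ M.SLip*(1-w k i) := mul_nonneg hS (by linarith [hwk.2])
      have e3 : |M.S k (m.node i) (w k i) 1 A B| ≤ M.SLip*(1-w k i) := by
        refine e2.trans ?_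
        split_ifs
        · rw [abs_sub_comm (w k i),abs_of_nonneg (by linarith [hwk.2] : 0≤1-w k i)]; simp
        · exact this
      linarith [neg_abs_le (M.S k (m.node i) (w k i) 1 A B)]
  constructor <;> linarith [A1.1,A1.2,A2.1,A2.2]

/-- The invariant region. -/
theorem step_mem (hw : UnitValued M w) : UnitValued M (M.step m β w) := by
  intro k hk i
  have hl := h.lam_pos
  obtain ⟨R1,R2⟩ := h.discreteSource_bounds hw hk i
  obtain ⟨a0,a1⟩ := h.nu_half_mem hk (hw k hk) i
  obtain ⟨b0,b1⟩ := h.nu_half_mem hk (hw k hk) (i-1)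
  rw [step_eq hl.ne' w k i rfl rfl]
  set a := M.ν k (m.half i) (M.cHalf m (w k) i)
  set b := M.ν k (m.half (i-1)) (M.cHalf m (w k) (i-1))
  set V := stripNorm (M.ν k)
  set L := M.fLip k
  have hLV := h.lam_flux_le hk
  have hd := h.diag k hk
  have f0 := fun j => h.std.f_nonneg hk (hw k hk j)
  have f1 := fun j => h.std.f_le hk (hw k hk j)
  have f2 : ∀ j,M.f k (w k j) ≤ L*(1-w k j) := fun j => by
    have := h.std.f_lip hk (hw k hk j) (b := 1) (by simp)
    rw [h.std.f_one hk,sub_zero,abs_sub_comm,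
      abs_of_nonneg (by linarith [(hw k hk j).2] : 0≤1-w k j)] at this
    exact (le_abs_self _).trans this
  have key : ∀ (p q r : ℝ),0 ≤ p → p ≤ V → 0 ≤ q → 0 ≤ r → q ≤ L*r →
      0 ≤ m.lam*(p*q) ∧ m.lam*(p*q) ≤ β*r ∧
      m.lam*(p*q) ≤ m.lam*L*V*r := by
    intro p q r hp hpV hq hr hqr
    have hV : 0 ≤ V := hp.trans hpV
    have e : m.lam*(p*q) ≤ m.lam*L*V*r := by
      calc m.lam*(p*q) ≤ m.lam*(V*(L*r)) := by gcongr
        _ = _ := by ring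
    exact ⟨by positivity,e.trans (mul_mono_r hLV hr),e⟩
  have ht : m.Δt*-(2*M.SLip*w k i) ≤ m.Δt*M.discreteSource m w k i :=
    mul_mono_l R1 h.dt_pos.le
  have ht' : m.Δt*M.discreteSource m w k i ≤ m.Δt*(2*M.SLip*(1-w k i)) :=
    mul_mono_l R2 h.dt_pos.le
  have u0 := fun j => (hw k hk j).1
  have u1 : ∀ j,0≤1-w k j := fun j => by linarith [(hw k hk j).2]
  constructor
  · have k1 := key a _ _ a0 a1 (f0 (i+1)) (u0 (i+1)) (f1 (i+1))
    have k2 := key b _ _ b0 b1 (f0 (i-1)) (u0 (i-1)) (f1 (i-1))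
    have k3 := key a _ _ a0 a1 (f0 i) (u0 i) (f1 i)
    have k4 := key b _ _ b0 b1 (f0 i) (u0 i) (f1 i)
    have k5 := mul_nonneg (u0 i) (sub_nonneg.2 hd)
    linarith
  · have k1 := key a _ _ a0 a1 (f0 (i+1)) (u1 (i+1)) (f2 (i+1))
    have k2 := key b _ _ b0 b1 (f0 (i-1)) (u1 (i-1)) (f2 (i-1))
    have k3 := key a _ _ a0 a1 (f0 i) (u1 i) (f2 i)
    have k4 := key b _ _ b0 b1 (f0 i) (u1 i) (f2 i)
    have k5 := mul_nonneg (u1 i) (sub_nonneg.2 hd)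
    linarith

/-! ### Cell entropy inequality -/

/-- Monotonicity of the convective part of the scheme. -/
theorem convective_mono (hk : k ∈ M.lanes) (hv : ∀ i,v i ∈ 𝕀)
    (i : ℤ) {p q r p' q' r' : ℝ} (hp : p ∈ 𝕀) (hq : q ∈ 𝕀)
    (hr : r ∈ 𝕀) (hp' : p' ∈ 𝕀) (hq' : q' ∈ 𝕀)
    (hr' : r' ∈ 𝕀) (hpp : p ≤ p') (hqq : q ≤ q') (hrr : r ≤ r') :
    q-m.lam*(M.flux m β k v i q r-M.flux m β k v (i-1) p q) ≤
      q'-m.lam*(M.flux m β k v i q' r'-M.flux m β k v (i-1) p' q') := by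
  have hl := h.lam_pos
  obtain ⟨a0,a1⟩ := h.nu_half_mem hk hv i
  obtain ⟨b0,b1⟩ := h.nu_half_mem hk hv (i-1)
  have e : ∀ p q r : ℝ,q-m.lam*(M.flux m β k v i q r-M.flux m β k v (i-1) p q)
      = q-m.lam/2*(M.ν k (m.half i) (M.cHalf m v i)*(M.f k q+M.f k r)
        - M.ν k (m.half (i-1)) (M.cHalf m v (i-1))*(M.f k p+M.f k q))
        + β/2*(r-q)-β/2*(q-p) := fun p q r => by simp [flux]; field_simp; ring
  rw [e,e]
  set a := M.ν k (m.half i) (M.cHalf m v i)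
  set b := M.ν k (m.half (i-1)) (M.cHalf m v (i-1))
  have hLV := h.lam_flux_le hk
  have hd := h.diag k hk
  have hS : 0≤2*m.Δt*M.SLip := mul_nonneg (by linarith [h.dt_pos]) SLip_nonneg
  have key : ∀ c ∈ Icc 0 (stripNorm (M.ν k)),∀ s ∈ Icc 0 1,∀ t ∈ Icc 0 1,s ≤ t →
      |m.lam*(c*(M.f k t-M.f k s))|
        ≤ m.lam*M.fLip k*stripNorm (M.ν k)*(t-s) := by
    intro c hc s hs t ht hst
    have h1 := h.std.f_lip hk ht hs
    rw [abs_of_nonneg (by linarith : 0 ≤ t-s)] at h1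
    rw [abs_mul,abs_mul,abs_of_pos hl,abs_of_nonneg hc.1]
    calc _ ≤ m.lam*(stripNorm (M.ν k)*(M.fLip k*(t-s))) := by
          refine mul_mono_l (mul_le_mul hc.2 h1 (abs_nonneg _) (by linarith)) hl.le
      _ = _ := by ring
  have k1 := abs_le.1 (key a ⟨a0,a1⟩ r hr r' hr' hrr)
  have k2 := abs_le.1 (key b ⟨b0,b1⟩ p hp p' hp' hpp)
  have k3 := abs_le.1 (key a ⟨a0,a1⟩ q hq q' hq' hqq)
  have k4 := abs_le.1 (key b ⟨b0,b1⟩ q hq q' hq' hqq)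
  nlinarith

omit h in
theorem sign_mul_le_abs (r x : ℝ) : Real.sign r*x ≤ |x| := by
  rcases Real.sign_apply_eq r with h | h | h <;> rw [h]
  · simpa using neg_le_abs x
  · simp
  · simpa using le_abs_self x

omit h in
theorem sign_mul_self (r : ℝ) : Real.sign r*r = |r| := by
  rcases lt_trichotomy r 0 with h | h | h
  · rw [Real.sign_of_neg h,abs_of_neg h]; ring
  · simp [h]
  · rw [Real.sign_of_pos h,abs_of_pos h]; ring

omit h in
theorem max_sub_min_eq (x y : ℝ) : max x y-min x y = |x-y| := max_sub_min_eq_abs' x y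

theorem cell_entropy (hw : UnitValued M w) (α : ℝ) (i : ℤ)
    (hk : k ∈ M.lanes) :
    |M.step m β w k i-α| - |w k i-α|
      + m.lam*(M.entropyFlux m β k (w k) i (w k i) (w k (i+1)) α
          - M.entropyFlux m β k (w k) (i-1) (w k (i-1)) (w k i) α)
      + m.lam*Real.sign (M.step m β w k i-α)*M.f k α
          * (M.ν k (m.half i) (M.cHalf m (w k) i)
            - M.ν k (m.half (i-1)) (M.cHalf m (w k) (i-1)))
      ≤ m.Δt*Real.sign (M.step m β w k i-α)*M.discreteSource m w k i := by
  have hnew := h.step_mem hw k hk i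
  have hα : m.lam*(M.flux m β k (w k) i α α-M.flux m β k (w k) (i-1) α α)
      = m.lam*M.f k α*(M.ν k (m.half i) (M.cHalf m (w k) i)
            - M.ν k (m.half (i-1)) (M.cHalf m (w k) (i-1))) := by
    simp only [flux]; ring
  set D := M.ν k (m.half i) (M.cHalf m (w k) i)
            - M.ν k (m.half (i-1)) (M.cHalf m (w k) (i-1)) with hD
  have hst : M.step m β w k i = w k i
    - m.lam*(M.flux m β k (w k) i (w k i) (w k (i+1))
        - M.flux m β k (w k) (i-1) (w k (i-1)) (w k i))
    + m.Δt*M.discreteSource m w k i := rfl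
  set u := M.step m β w k i with hu
  set R := M.discreteSource m w k i
  have hx := hw k hk (i-1)
  have hy := hw k hk i
  have hz := hw k hk (i+1)
  set x := w k (i-1)
  set y := w k i
  set z := w k (i+1)
  simp only [entropyFlux]
  rcases lt_or_ge α 0 with hneg | hα0
  · rw [max_eq_left (by linarith [hy.1]),max_eq_left (by linarith [hz.1]),
      max_eq_left (by linarith [hx.1]),min_eq_right (by linarith [hy.1]),
      min_eq_right (by linarith [hz.1]),min_eq_right (by linarith [hx.1]),
      Real.sign_of_pos (by linarith [hnew.1]),abs_of_pos (by linarith [hnew.1] : 0 < u-α),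
      abs_of_pos (by linarith [hy.1] : 0 < y-α)]
    linarith
  rcases lt_or_ge 1 α with hgt | hα1
  · rw [max_eq_right (by linarith [hy.2]),max_eq_right (by linarith [hz.2]),
      max_eq_right (by linarith [hx.2]),min_eq_left (by linarith [hy.2]),
      min_eq_left (by linarith [hz.2]),min_eq_left (by linarith [hx.2]),
      Real.sign_of_neg (by linarith [hnew.2]),abs_of_neg (by linarith [hnew.2] : u-α<0),
      abs_of_neg (by linarith [hy.2] : y-α<0)]
    linarith
  have hαm : α ∈ Icc 0 1 := ⟨hα0,hα1⟩
  have hmax : ∀ s ∈ 𝕀,max s α ∈ 𝕀 := fun s hs =>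
    ⟨le_max_of_le_left hs.1,max_le hs.2 hα1⟩
  have hmin : ∀ s ∈ 𝕀,min s α ∈ Icc 0 1 := fun s hs =>
    ⟨le_min hs.1 hα0,(min_le_left _ _).trans hs.2⟩
  have hm := fun {p q r p' q' r' : ℝ} => h.convective_mono hk (hw k hk) i (p := p) (q := q)
    (r := r) (p' := p') (q' := q') (r' := r')
  have u1 := hm hx hy hz (hmax x hx) (hmax y hy) (hmax z hz) (le_max_left _ _) (le_max_left _ _)
    (le_max_left _ _)
  have u2 := hm hαm hαm hαm (hmax x hx) (hmax y hy) (hmax z hz) (le_max_right _ _)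
    (le_max_right _ _) (le_max_right _ _)
  have l1 := hm (hmin x hx) (hmin y hy) (hmin z hz) hx hy hz (min_le_left _ _) (min_le_left _ _)
    (min_le_left _ _)
  have l2 := hm (hmin x hx) (hmin y hy) (hmin z hz) hαm hαm hαm (min_le_right _ _)
    (min_le_right _ _) (min_le_right _ _)
  have hyα := max_sub_min_eq y α
  have habs : |u-α-m.Δt*R+m.lam*M.f k α*D| ≤ |y-α|
      - m.lam*((M.flux m β k (w k) i (max y α) (max z α)
        - M.flux m β k (w k) i (min y α) (min z α))
        - (M.flux m β k (w k) (i-1) (max x α) (max y α)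
        - M.flux m β k (w k) (i-1) (min x α) (min y α))) := by
    rw [abs_le]
    constructor <;> linarith
  have hs := sign_mul_le_abs (u-α) (u-α-m.Δt*R+m.lam*M.f k α*D)
  have e : Real.sign (u-α)*(u-α-m.Δt*R+m.lam*M.f k α*D)
      = |u-α| - m.Δt*Real.sign (u-α)*R+m.lam*Real.sign (u-α)*M.f k α*D := by
    rw [← sign_mul_self (u-α)]; ring
  linarith

/-! ### One-step estimates -/

theorem abs_f_nu_second (hk : k ∈ M.lanes)
    (hv : ∀ i,v i ∈ 𝕀) {TV mass : ℝ} (hTV0 : 0 ≤ TV)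
    (hTV : SumLe (fun i => |v (i+1)-v i|) TV) (hmass : SumLe v mass)
    (hL : M.fLip k ≤ L) (hP : stripNorm (D1 (M.ν k)) ≤ P) (hQ : stripNorm (D2 (M.ν k)) ≤ Q)
    (hK : stripNorm (D1 (D1 (M.ν k)))+2*stripNorm (D2 (D1 (M.ν k)))*(2*M.ω 0)
      + 2*stripNorm (D2 (D2 (M.ν k)))*(2*M.ω 0)^2 ≤ K) {a : ℤ → ℝ}
    (ha : ∀ i,a i = M.ν k (m.half i) (M.cHalf m v i)) :
    SumLe (fun i => |m.lam*(a (i+1)-a i)*M.f k (v (i+1))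
        - m.lam*(a i-a (i-1))*M.f k (v i)|)
      (m.Δt*(L*(P+2*Q*(2*M.ω 0))*TV+K*L*(m.Δx*mass))) := by
  have hω := h.std.omega_zero_nonneg
  set W := 2*M.ω 0 with hWd
  have hW : 0 ≤ W := by positivity
  have hL0 := (fLip_nonneg k).trans hL
  have hP0 := (stripNorm_nonneg _).trans hP
  have hQ0 := (stripNorm_nonneg _).trans hQ
  have hK0 : 0 ≤ K := by
    refine le_trans ?_ hK
    have := stripNorm_nonneg (D1 (D1 (M.ν k))); have := stripNorm_nonneg (D2 (D1 (M.ν k)))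
    have := stripNorm_nonneg (D2 (D2 (M.ν k)))
    positivity
  have hl := h.lam_pos
  have hx := h.dx_pos
  have s1 := hTV.const_mul (c := m.lam*((P+Q*W)*m.Δx)*L) (by positivity)
  have s2 := ((h.cHalf_second hTV hTV0).shift (-1)).const_mul (c := m.lam*Q*L) (by positivity)
  have s3 := hmass.const_mul (c := m.lam*(K*m.Δx*m.Δx)*L) (by positivity)
  refine (((s1.add s2).add s3).weaken (le_of_eq ?_)).mono (fun i => abs_nonneg _) fun i => ?_
  · rw [← h.lam_mul_dx]; ring
  have e1 : |a (i+1)-a i|≤(P+Q*W)*m.Δx := by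
    rw [ha,ha]
    refine (h.abs_nu_sub_le hk hv i).trans ?_
    gcongr
  have e2 : |a (i+1)-2*a i+a (i-1)| ≤ Q*|M.cHalf m v (i+-1+2)
      - 2*M.cHalf m v (i+-1+1)+M.cHalf m v (i+-1)| + K*m.Δx*m.Δx := by
    have i1 : i+-1+2 = i+1 := by ring
    have i2 : i+-1+1 = i := by ring
    have i3 : i+-1 = i-1 := by ring
    rw [i1,i2,i3,ha,ha,ha]
    have n1 : m.half (i+1) = m.half (i-1)+2*m.Δx := by
      have := half_succ_sub m i; have := half_succ_sub m (i-1)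
      rw [sub_add_cancel] at this; linarith
    have n2 : m.half i = m.half (i-1)+m.Δx := by
      have := half_succ_sub m (i-1); rw [sub_add_cancel] at this; linarith
    have c01 := h.abs_cHalf_sub_le hv (i-1)
    rw [sub_add_cancel] at c01
    have := h.std.nu_second hk (x₀ := m.half (i-1)) hx.le (h.cHalf_mem hv (i-1))
      (h.cHalf_mem hv i) (h.cHalf_mem hv (i+1)) hW (h.abs_cHalf_sub_le hv i) c01
    rw [n1,n2]
    refine this.trans ?_
    gcongr
  have e3 := h.std.f_lip hk (hv (i+1)) (hv i)
  have e4 := h.std.f_le hk (hv i)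
  have e5 := h.std.f_nonneg hk (hv i)
  have e6 := (h.std.f_le_fLip hk (hv i)).trans hL
  have e4' := e4.trans (mul_mono_r hL (hv i).1)
  have e3' := e3.trans (mul_mono_r hL (abs_nonneg _))
  have e7 : m.lam*(a (i+1)-a i)*M.f k (v (i+1))-m.lam*(a i-a (i-1))*M.f k (v i)
      = m.lam*((a (i+1)-a i)*(M.f k (v (i+1))-M.f k (v i)))
        + m.lam*((a (i+1)-2*a i+a (i-1))*M.f k (v i)) := by ring
  rw [e7]
  refine (abs_add_le _ _).trans ?_
  rw [abs_mul,abs_mul,abs_mul,abs_mul,abs_of_pos hl,abs_of_nonneg e5]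
  set c2 := |M.cHalf m v (i+-1+2)-2*M.cHalf m v (i+-1+1)+M.cHalf m v (i+-1)|
  have p1 := mul_le_mul e1 e3' (abs_nonneg _) (by positivity)
  have p2 := mul_mono_r e2 e5
  have p3 : Q*c2*M.f k (v i) ≤ Q*c2*L := mul_mono_l e6 (by positivity)
  have p4 : K*m.Δx*m.Δx*M.f k (v i) ≤ K*m.Δx*m.Δx*(L*v i) :=
    mul_mono_l e4' (by positivity)
  have p5 := mul_mono_l (add_le_add p1 p2) hl.le
  have p6 := mul_mono_l (add_le_add p3 p4) hl.le
  linarith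

theorem cMid_tv {TV : ℝ} (hv : SumLe (fun i => |v (i+1)-v i|) TV) :
    SumLe (fun i => |M.cMid m v (i+1)-M.cMid m v i|) TV := by
  have h1 := h.cHalf_tv hv
  have h2 := (h1.add (h1.shift 1)).const_mul (c := 1/2) (by norm_num)
  refine (h2.weaken (by linarith)).mono (fun i => abs_nonneg _) fun i => ?_
  have e : M.cMid m v (i+1)-M.cMid m v i
      = 1/2*((M.cHalf m v (i+1)-M.cHalf m v i)
        + (M.cHalf m v (i+1+1)-M.cHalf m v (i+1))) := by
    simp [cMid]; ring
  grind

theorem nodeFlow_tv (hw : UnitValued M w)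
    (hb : Budget M w TV mass) (hL : ∀ k ∈ M.lanes,M.fLip k ≤ L)
    (hP : ∀ k ∈ M.lanes,stripNorm (D1 (M.ν k)) ≤ P)
    (hQ : ∀ k ∈ M.lanes,stripNorm (D2 (M.ν k)) ≤ Q) (hL0 : 0 ≤ L) (hP0 : 0 ≤ P) (hQ0 : 0 ≤ Q)
    (hk : k ≤ M.N) :
    SumLe (fun i => |nodeFlow M m w k (i+1)-nodeFlow M m w k i|)
      (4*M.SLip*∑ j ∈ M.lanes,TV j+4*L*P*(m.Δx*∑ j ∈ M.lanes,mass j)) := by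
  have hS := SLip_nonneg (M := M)
  have hx := h.dx_pos
  have hsT := Finset.sum_nonneg hb.tv_nonneg
  have hsM := Finset.sum_nonneg hb.mass_nonneg
  by_cases hkN : 1 ≤ k ∧ k < M.N
  swap
  · simp [nodeFlow,S_eq,hkN]
    exact SumLe.zero.weaken (by positivity)
  obtain ⟨hk1,hk2⟩ := pair_mem_lanes hkN
  have t1 := hb.tv k hk1
  have t2 := hb.tv _ hk2
  have s1 := (((t1.add t2).add (h.cMid_tv t1)).add (h.cMid_tv t2)).const_mul hS
  have s2 := ((hb.mass_le k hk1).add (hb.mass_le _ hk2)).const_mul (c := L*(2*P*m.Δx))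
    (by positivity)
  have l1 := le_sum_lanes hb.tv_nonneg hk1
  have l2 := le_sum_lanes hb.tv_nonneg hk2
  have l3 := le_sum_lanes hb.mass_nonneg hk1
  have l4 := le_sum_lanes hb.mass_nonneg hk2
  refine ((s1.add s2).weaken ?_).mono (fun i => abs_nonneg _) fun i => ?_
  · calc M.SLip*(TV k+TV (k+1)+TV k+TV (k+1))
        + L*(2*P*m.Δx)*(mass k+mass (k+1))
        ≤ M.SLip*(4*∑ j ∈ M.lanes,TV j)
        + L*(2*P*m.Δx)*(2*∑ j ∈ M.lanes,mass j) := by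
          gcongr
          · linarith
          · linarith
      _ = _ := by ring
  · have b1 := h.unitBox hw (i+1) (i+1) k hkN
    have b2 := h.unitBox hw i i k hkN
    have e1 := h.std.S_lip hk (m.node (i+1)) fun _ => ⟨b1,b2⟩
    have e2 := h.std.S_lip_coeff hL hP hQ hL0 hP0 hQ0 k (m.node (i+1)) (m.node i)
      fun _ => ⟨b2,b2⟩
    rw [if_pos hkN] at e1 e2
    have e3 : |m.node (i+1)-m.node i| = m.Δx := by
      rw [show m.node (i+1)-m.node i = m.Δx by simp [Mesh.node]; ring,
        abs_of_pos hx]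
    rw [e3,sub_self,abs_zero,sub_self,abs_zero,add_zero,mul_zero,add_zero] at e2
    exact (abs_sub_le _ _ _).trans (add_le_add e1 e2)

/-- Total variation after one step. -/
theorem step_tv (hw : UnitValued M w)
    (hb : Budget M w TV mass) (hL : ∀ k ∈ M.lanes,M.fLip k ≤ L)
    (hP : ∀ k ∈ M.lanes,stripNorm (D1 (M.ν k)) ≤ P)
    (hQ : ∀ k ∈ M.lanes,stripNorm (D2 (M.ν k)) ≤ Q)
    (hK : ∀ k ∈ M.lanes,stripNorm (D1 (D1 (M.ν k)))
      + 2*stripNorm (D2 (D1 (M.ν k)))*(2*M.ω 0)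
      + 2*stripNorm (D2 (D2 (M.ν k)))*(2*M.ω 0)^2 ≤ K)
    (hL0 : 0 ≤ L) (hP0 : 0 ≤ P) (hQ0 : 0 ≤ Q) (hk : k ∈ M.lanes) :
    SumLe (fun i => |M.step m β w k (i+1)-M.step m β w k i|)
      (TV k+m.Δt*(L*(P+2*Q*(2*M.ω 0))*TV k+K*L*(m.Δx*mass k)
        + 2*(4*M.SLip*∑ j ∈ M.lanes,TV j
          + 4*L*P*(m.Δx*∑ j ∈ M.lanes,mass j)))) := by
  have hl := h.lam_pos
  have hwk := hw k hk
  have hk' := mem_lanes.1 hk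
  set a : ℤ → ℝ := fun i => M.ν k (m.half i) (M.cHalf m (w k) i) with ha
  set q : ℤ → ℝ := fun i => (M.f k (w k (i+1))-M.f k (w k i))/(w k (i+1)-w k i) with hq
  have hqd : ∀ i,q i*(w k (i+1)-w k i) = M.f k (w k (i+1))-M.f k (w k i) := fun i => by
    grind
  have hqL : ∀ i,|q i| ≤ M.fLip k := fun i => by
    rw [hq,abs_div]
    exact div_le_of_le_mul₀ (abs_nonneg _) (fLip_nonneg k) (h.std.f_lip hk (hwk _) (hwk _))
  have hlq : ∀ i,|m.lam*(a i*q i)| ≤ β := fun i => by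
    have h1 := h.nu_half_mem hk hwk i
    rw [abs_mul,abs_mul,abs_of_pos hl,abs_of_nonneg h1.1]
    refine le_trans ?_ (h.lam_flux_le hk)
    calc m.lam*(a i*|q i|) ≤ m.lam*(stripNorm (M.ν k)*M.fLip k) := by
          refine mul_mono_l (mul_le_mul h1.2 (hqL i) (abs_nonneg _)
            (stripNorm_nonneg _)) hl.le
      _ = _ := by ring
  set e : ℤ → ℝ := fun i => -(m.lam*(a i-a (i-1))*M.f k (w k i))
    + m.Δt*(nodeFlow M m w (k-1) i-nodeFlow M m w k i) with he
  have hE : SumLe (fun i => |e (i+1)-e i|) (m.Δt*(L*(P+2*Q*(2*M.ω 0))*TV k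
      + K*L*(m.Δx*mass k)+2*(4*M.SLip*∑ j ∈ M.lanes,TV j
          + 4*L*P*(m.Δx*∑ j ∈ M.lanes,mass j)))) := by
    have s1 := h.abs_f_nu_second hk hwk (hb.tv_nonneg k hk) (hb.tv k hk) (hb.mass_le k hk)
      (hL k hk) (hP k hk) (hQ k hk) (hK k hk) (a := a) fun i => rfl
    have s2 := (h.nodeFlow_tv hw hb hL hP hQ hL0 hP0 hQ0 (k := k-1) (by omega)).const_mul
      h.dt_pos.le
    have s3 := (h.nodeFlow_tv hw hb hL hP hQ hL0 hP0 hQ0 (k := k) hk'.2).const_mul h.dt_pos.le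
    refine (((s1.add s2).add s3).weaken (le_of_eq (by ring))).mono (fun i => abs_nonneg _)
      fun i => ?_
    have e1 : e (i+1)-e i = -(m.lam*(a (i+1)-a i)*M.f k (w k (i+1))
        - m.lam*(a i-a (i-1))*M.f k (w k i))
        + m.Δt*(nodeFlow M m w (k-1) (i+1)-nodeFlow M m w (k-1) i)
        + -(m.Δt*(nodeFlow M m w k (i+1)-nodeFlow M m w k i)) := by
      simp only [he,show i+1-1 = i by ring]; ring
    rw [e1]
    refine (abs_add_three _ _ _).trans (le_of_eq ?_)
    rw [abs_neg,abs_neg,abs_mul m.Δt,abs_mul m.Δt,abs_of_pos h.dt_pos]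
  refine SumLe.incremental (C := fun i => β/2-m.lam/2*(a i*q i))
    (D := fun i => β/2+m.lam/2*(a i*q i)) (fun i => ?_) (fun i => ?_) (fun i => ?_)
    (hb.tv k hk) hE fun i => ?_
  · linarith [(abs_le.1 (hlq i)).2]
  · linarith [(abs_le.1 (hlq i)).1]
  · linarith [h.beta_lt]
  · rw [step_eq hl.ne' w k i (a := a i) (a' := a (i-1)) rfl rfl,discreteSource_eq w hk]
    grind

theorem nodeFlow_sum (hw : UnitValued M w)
    (hb : Budget M w TV mass) (hk : k ≤ M.N) :
    SumLe (fun i => |nodeFlow M m w k i|) (2*M.SLip*∑ j ∈ M.lanes,mass j) := by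
  have hS := SLip_nonneg (M := M)
  have hsM := Finset.sum_nonneg hb.mass_nonneg
  by_cases hkN : 1 ≤ k ∧ k < M.N
  swap
  · simp [nodeFlow,S_eq,hkN]
    exact SumLe.zero.weaken (by positivity)
  obtain ⟨hk1,hk2⟩ := pair_mem_lanes hkN
  have s := ((hb.mass_le k hk1).add (hb.mass_le _ hk2)).const_mul hS
  have l3 := le_sum_lanes hb.mass_nonneg hk1
  have l4 := le_sum_lanes hb.mass_nonneg hk2
  refine (s.weaken ?_).mono (fun i => abs_nonneg _) fun i => ?_
  · nlinarith
  · have := h.std.abs_S_le hk (m.node i) fun _ => h.unitBox hw i i k hkN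
    rwa [if_pos hkN] at this

/-- Displacement in `L¹` during one step. -/
theorem step_displacement (hw : UnitValued M w)
    (hb : Budget M w TV mass) (hk : k ∈ M.lanes) :
    SumLe (fun i => |M.step m β w k i-w k i|) (2*β*TV k
      + m.Δt*((stripNorm (D1 (M.ν k))+stripNorm (D2 (M.ν k))*(2*M.ω 0))*M.fLip k*mass k
        + 4*M.SLip*∑ j ∈ M.lanes,mass j)) := by
  have hl := h.lam_pos
  have hwk := hw k hk
  have hk' := mem_lanes.1 hk
  set a : ℤ → ℝ := fun i => M.ν k (m.half i) (M.cHalf m (w k) i) with ha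
  set Z := (stripNorm (D1 (M.ν k))+stripNorm (D2 (M.ν k))*(2*M.ω 0)) with hZ
  have hZ0 : 0 ≤ Z := by
    have := stripNorm_nonneg (D1 (M.ν k)); have := stripNorm_nonneg (D2 (M.ν k))
    have := h.std.omega_zero_nonneg
    positivity
  have hL0 := fLip_nonneg (M := M) k
  have t := (hb.tv k hk).const_mul h.beta_pos.le
  have n1 := (h.nodeFlow_sum hw hb (k := k-1) (by omega)).const_mul h.dt_pos.le
  have n2 := (h.nodeFlow_sum hw hb hk'.2).const_mul h.dt_pos.le
  have ms := (hb.mass_le k hk).const_mul (c := m.lam*(Z*m.Δx*M.fLip k)) (by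
    have := h.dx_pos; positivity)
  refine (((((t.add (t.shift (-1))).add ms).add n1).add n2).weaken (le_of_eq ?_)).mono
    (fun i => abs_nonneg _) fun i => ?_
  · rw [← h.lam_mul_dx]; ring
  have i1 : i+-1+1 = i := by ring
  have key : ∀ j,|m.lam*(a j*(M.f k (w k (j+1))-M.f k (w k j)))|
      ≤ β*|w k (j+1)-w k j| := fun j => by
    have h1 := h.nu_half_mem hk hwk j
    rw [abs_mul,abs_mul,abs_of_pos hl,abs_of_nonneg h1.1]
    refine le_trans ?_ (mul_mono_r (h.lam_flux_le hk) (abs_nonneg _))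
    calc _ ≤ m.lam*(stripNorm (M.ν k)*(M.fLip k*|w k (j+1)-w k j|)) :=
          mul_mono_l (mul_le_mul h1.2 (h.std.f_lip hk (hwk _) (hwk _))
            (abs_nonneg _) (stripNorm_nonneg _)) hl.le
      _ = _ := by ring
  have k1 := key i
  have k2 := key (i-1)
  have k3 : |m.lam*((a i-a (i-1))*M.f k (w k i))|
      ≤ m.lam*(Z*m.Δx*M.fLip k)*w k i := by
    have h1 := h.abs_nu_sub_le hk hwk (i-1)
    rw [sub_add_cancel] at h1
    rw [abs_mul,abs_mul,abs_of_pos hl,abs_of_nonneg (h.std.f_nonneg hk (hwk i)),mul_assoc]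
    refine mul_mono_l ?_ hl.le
    rw [mul_assoc]
    exact mul_le_mul h1 (h.std.f_le hk (hwk i)) (h.std.f_nonneg hk (hwk i))
      (mul_nonneg hZ0 h.dx_pos.le)
  rw [step_eq hl.ne' w k i (a' := a (i-1)) rfl rfl,discreteSource_eq w hk]
  have hb0 := h.beta_pos
  have a1 : |β/2*(w k (i+1)-w k i)| = β/2*|w k (i+1)-w k i| := by
    rw [abs_mul,abs_of_pos (by linarith)]
  have a2 : |β/2*(w k i-w k (i-1))| = β/2*|w k i-w k (i-1)| := by
    rw [abs_mul,abs_of_pos (by linarith)]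
  have a3 : |m.Δt*nodeFlow M m w (k-1) i| = m.Δt*|nodeFlow M m w (k-1) i| := by
    rw [abs_mul,abs_of_pos h.dt_pos]
  have a4 : |m.Δt*nodeFlow M m w k i| = m.Δt*|nodeFlow M m w k i| := by
    rw [abs_mul,abs_of_pos h.dt_pos]
  have b1 := abs_le.1 a1.le
  have b2 := abs_le.1 a2.le
  have b3 := abs_le.1 a3.le
  have c1 := abs_le.1 k1
  have c2 := abs_le.1 k2
  have c3 := abs_le.1 k3
  grind

/-! ### Conservation -/

theorem flux_summable (hw : UnitValued M w) (hk : k ∈ M.lanes)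
    (hs : Summable (w k)) : Summable fun i => M.flux m β k (w k) i (w k i) (w k (i+1)) := by
  have hwk := hw k hk
  have h1 : Summable fun i => M.ν k (m.half i) (M.cHalf m (w k) i)
      * (M.f k (w k i)+M.f k (w k (i+1))) := by
    refine Summable.of_nonneg_of_le (fun i => mul_nonneg (h.nu_half_mem hk hwk i).1
      (add_nonneg (h.std.f_nonneg hk (hwk _)) (h.std.f_nonneg hk (hwk _)))) (fun i =>
      mul_le_mul (h.nu_half_mem hk hwk i).2 (add_le_add (h.std.f_le hk (hwk i))
        (h.std.f_le hk (hwk (i+1)))) (add_nonneg (h.std.f_nonneg hk (hwk _))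
          (h.std.f_nonneg hk (hwk _))) (stripNorm_nonneg _)) ?_
    exact ((hs.mul_left _).add ((summable_shift hs 1).mul_left _)).mul_left _
  have h2 := (h1.mul_left (1/2)).sub (((summable_shift hs 1).sub hs).mul_left (β/(2*m.lam)))
  refine h2.congr fun i => ?_
  simp only [flux]; ring

theorem step_summable (hw : UnitValued M w)
    (hb : Budget M w TV mass) (hk : k ∈ M.lanes) :
    Summable (M.step m β w k) ∧ ∑' i,M.step m β w k i=∑' i,w k i
      + m.Δt*(∑' i,nodeFlow M m w (k-1) i-∑' i,nodeFlow M m w k i) := by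
  have hk' := mem_lanes.1 hk
  have hs := (hb.mass_le k hk).1
  have s1 := h.flux_summable hw hk hs
  have s2 := (h.nodeFlow_sum hw hb (k := k-1) (by omega)).abs_le.1
  have s3 := (h.nodeFlow_sum hw hb hk'.2).abs_le.1
  have s1' : Summable fun i => M.flux m β k (w k) (i-1) (w k (i-1)) (w k i) := by
    refine (summable_shift s1 (-1)).congr fun i => ?_
    measurability
  have t1 : ∑' i,M.flux m β k (w k) (i-1) (w k (i-1)) (w k i)
      = ∑' i,M.flux m β k (w k) i (w k i) (w k (i+1)) := by
    rw [← tsum_shift _ 1]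
    simp [add_sub_cancel_right]
  have s4 := (hs.sub ((s1.sub s1').mul_left m.lam)).add ((s2.sub s3).mul_left m.Δt)
  have e : M.step m β w k = fun i => w k i-m.lam*(M.flux m β k (w k) i (w k i) (w k (i+1))
      - M.flux m β k (w k) (i-1) (w k (i-1)) (w k i))
      + m.Δt*(nodeFlow M m w (k-1) i-nodeFlow M m w k i) := by
    funext i
    rw [← discreteSource_eq w hk]; rfl
  rw [e]
  refine ⟨s4,?_⟩
  rw [(hs.sub ((s1.sub s1').mul_left m.lam)).tsum_add ((s2.sub s3).mul_left m.Δt),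
    hs.tsum_sub ((s1.sub s1').mul_left m.lam),tsum_mul_left,tsum_mul_left,
    s1.tsum_sub s1',s2.tsum_sub s3,t1,sub_self,mul_zero,sub_zero]

omit h in
theorem sum_lanes_telescope (q : ℕ → ℝ) (h0 : q 0=0) (hN : q M.N=0) :
    ∑ k ∈ M.lanes,(q (k-1)-q k)=0 := by
  have : ∀ n,∑ k ∈ Finset.Icc 1 n,(q (k-1)-q k) = q 0-q n := by
    intro n
    induction n with
    | zero => simp
    | succ n ih => rw [Finset.sum_Icc_succ_top (by omega),ih]; simp
  rw [lanes,this,h0,hN,sub_zero]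

theorem step_mass (hw : UnitValued M w)
    (hb : Budget M w TV mass) :
    ∑ k ∈ M.lanes,∑' i,M.step m β w k i=∑ k ∈ M.lanes,∑' i,w k i := by
  rw [Finset.sum_congr rfl fun k hk => (h.step_summable hw hb hk).2,Finset.sum_add_distrib,
    ← Finset.mul_sum,sum_lanes_telescope (fun k => ∑' i,nodeFlow M m w k i),mul_zero,
    add_zero]
  · simp [nodeFlow,S_zero]
  · simp [nodeFlow,S_last]

end Admissible
end Model

/-! ### Functions of bounded variation and translations -/

theorem tsum_edist_le_eVariationOn (w : ℝ → ℝ) {x : ℤ → ℝ} (hx : Monotone x) :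
    ∑' i : ℤ,edist (w (x (i+1))) (w (x i)) ≤ eVariationOn w univ := by
  rw [ENNReal.tsum_eq_iSup_sum]
  refine iSup_le fun s => ?_
  obtain ⟨n,hn⟩ : ∃ n : ℕ,s ⊆ Finset.Ico (-n) n := by
    refine ⟨∑ i ∈ s,(i.natAbs+1),fun i hi => ?_⟩
    have := Finset.single_le_sum (f := fun i => i.natAbs+1) (fun _ _ => Nat.zero_le _) hi
    rw [Finset.mem_Ico]
    omega
  refine (Finset.sum_le_sum_of_subset hn).trans ?_
  have h1 : ∑ i ∈ Finset.Ico (-(n : ℤ)) n,edist (w (x (i+1))) (w (x i))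
      = ∑ j ∈ Finset.range (2*n),edist (w (x (((j+1 : ℕ) : ℤ)-n))) (w (x (j-n))) := by
    symm
    refine Finset.sum_bij (fun j _ => j-n) (fun j hj => ?_) (fun j _ l _ hjl => ?_)
      (fun i hi => ?_) (fun j _ => ?_)
    · rw [Finset.mem_range] at hj; rw [Finset.mem_Ico]; omega
    · simpa using hjl
    · rw [Finset.mem_Ico] at hi
      exact ⟨(i+n).toNat,by rw [Finset.mem_range]; omega,by omega⟩
    · grind
  rw [h1]
  refine eVariationOn.sum_le (u := fun j => x (j-n)) ?_ fun _ => mem_univ _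
  intro j l hjl
  exact hx (by omega)

theorem lintegral_edist_translate_le {w : ℝ → ℝ} (hw : AEMeasurable w) {h : ℝ} (hh : 0 < h) :
    ∫⁻ x,edist (w (x+h)) (w x) ≤ ENNReal.ofReal h*eVariationOn w univ := by
  have hmeas : ∀ a : ℝ,AEMeasurable fun x => edist (w (x+a+h)) (w (x+a)) := fun a => by
    fun_prop
  have h0 : ∫⁻ x,edist (w (x+h)) (w x)
      = ∑' n : ℤ,∫⁻ x in Ioc (n • h) ((n+1) • h),edist (w (x+h)) (w x) := by
    rw [← setLIntegral_univ,← iUnion_Ioc_zsmul hh,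
      lintegral_iUnion (fun _ => measurableSet_Ioc) (pairwise_disjoint_Ioc_zsmul h)]
  rw [h0]
  have h2 : ∀ n : ℤ,∫⁻ x in Ioc (n • h) ((n+1) • h),edist (w (x+h)) (w x)
      = ∫⁻ x in Ioc 0 h,edist (w (x+n • h+h)) (w (x+n • h)) := fun n => by
    have := (measurePreserving_add_right volume (n • h)).setLIntegral_comp_preimage_emb
      (measurableEmbedding_addRight _) (fun x => edist (w (x+h)) (w x)) (Ioc (n • h) ((n+1) • h))
    rw [← this]
    congr 2
    grind
  simp only [h2]
  rw [← lintegral_tsum fun n => (hmeas _).restrict]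
  calc _≤∫⁻ _ in Ioc 0 h,eVariationOn w univ := by
        refine lintegral_mono fun x => ?_
        have := tsum_edist_le_eVariationOn w (x := fun n => x+n • h) fun a b hab => by
          measurability
        grind
    _ = _ := by simp [mul_comm]

/-- `w` has `L¹` modulus of translation `K |h|`. -/
def TranslateLe (w : ℝ → ℝ) (K : ℝ) : Prop := ∀ h : ℝ,∫ x,|w (x+h)-w x| ≤ K*|h|

theorem TranslateLe.mono {w : ℝ → ℝ} {K K' : ℝ} (h : TranslateLe w K) (hK : K ≤ K') :
    TranslateLe w K' := fun a => (h a).trans (by gcongr)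

theorem translateLe_of_eVariationOn {v w : ℝ → ℝ} (hv : AEMeasurable v) (hwv : w =ᵐ[volume] v)
    {K : ℝ} (hK0 : 0 ≤ K) (hK : eVariationOn w univ ≤ ENNReal.ofReal K) : TranslateLe v K := by
  have hpos : ∀ h : ℝ,0 < h → ∫ x,|v (x+h)-v x| ≤ K*h := fun h hh => by
    have e : (fun x => |v (x+h)-v x|) =ᵐ[volume] fun x => |w (x+h)-w x| := by
      have := (measurePreserving_add_right (volume : Measure ℝ) h).quasiMeasurePreserving.ae_eq_comp hwv
      filter_upwards [hwv,this] with x h1 h2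
      simp only [Function.comp_apply] at h2
      rw [h1,h2]
    rw [integral_congr_ae e]
    have hb := (lintegral_edist_translate_le (hv.congr hwv.symm) hh).trans (mul_le_mul_right hK _)
    rw [← ENNReal.ofReal_mul hh.le,mul_comm h] at hb
    by_cases hi : Integrable fun x => |w (x+h)-w x|
    · rw [integral_eq_lintegral_of_nonneg_ae (.of_forall fun _ => abs_nonneg _)
        hi.aestronglyMeasurable]
      refine ENNReal.toReal_le_of_le_ofReal (by positivity) (le_trans (le_of_eq ?_) hb)
      simp [edist_dist,Real.dist_eq]
    · rw [integral_undef hi]; positivity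
  intro h
  rcases lt_trichotomy h 0 with hn | rfl | hp
  · rw [abs_of_neg hn,← integral_add_right_eq_self _ (-h)]
    grind
  · simp
  · rw [abs_of_pos hp]; exact hpos h hp

theorem translateLe_of_essVariation {v : ℝ → ℝ} (hv : AEMeasurable v) {K : ℝ} (hK0 : 0 ≤ K)
    (hK : essVariation v < ENNReal.ofReal K) : TranslateLe v K := by
  obtain ⟨⟨w,hw⟩,hlt⟩ := iInf_lt_iff.1 hK
  exact translateLe_of_eVariationOn hv hw hK0 hlt.le

/-! ### Cells -/

namespace Mesh

variable {m : Mesh}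

theorem half_eq (m : Mesh) (i : ℤ) : m.half i=(i+1/2)*m.Δx := by
  simp [half,node]; push_cast; ring

theorem mem_cell_iff (hx : 0 < m.Δx) {x : ℝ} {i : ℤ} : x ∈ m.cell i ↔ m.cellIndex x = i := by
  rw [cellIndex,Int.floor_eq_iff,cell,mem_Ico,half_eq,half_eq,← sub_le_iff_le_add,
    ← lt_sub_iff_add_lt,le_div_iff₀ hx,div_lt_iff₀ hx]
  grind

theorem iUnion_cell (hx : 0 < m.Δx) : ⋃ i,m.cell i = univ :=
  eq_univ_of_forall fun _ => mem_iUnion.2 ⟨_,(mem_cell_iff hx).2 rfl⟩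

theorem disjoint_cell (hx : 0 < m.Δx) : Pairwise (Function.onFun Disjoint m.cell) :=
  fun _ _ hij => Set.disjoint_left.2 fun _ h1 h2 =>
    hij (((mem_cell_iff hx).1 h1).symm.trans ((mem_cell_iff hx).1 h2))

theorem measurableSet_cell (i : ℤ) : MeasurableSet (m.cell i) := measurableSet_Ico

theorem hasSum_cell (hx : 0 < m.Δx) {F : ℝ → ℝ} (hF : Integrable F) :
    HasSum (fun i => ∫ x in m.cell i,F x) (∫ x,F x) := by
  have := hasSum_integral_iUnion (fun i => m.measurableSet_cell i) (disjoint_cell hx)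
    (by rw [iUnion_cell hx]; exact hF.integrableOn)
  rwa [iUnion_cell hx,setIntegral_univ] at this

theorem volume_cell (hx : 0 < m.Δx) (i : ℤ) : volume (m.cell i) = ENNReal.ofReal m.Δx := by
  rw [cell,Real.volume_Ico,half_eq,half_eq]
  push_cast; ring

theorem setIntegral_cell_succ (F : ℝ → ℝ) (i : ℤ) :
    ∫ x in m.cell (i+1),F x=∫ x in m.cell i,F (x+m.Δx) := by
  have := (measurePreserving_add_right volume m.Δx).setIntegral_preimage_emb
    (measurableEmbedding_addRight _) F (m.cell (i+1))
  rw [← this]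
  congr 2
  simp only [cell,half_eq]
  grind

end Mesh

namespace Model

variable {M : Model} {m : Mesh} {β : ℝ} {u₀ : ℕ → ℝ → ℝ}

theorem InitialData.translate (hu : M.InitialData u₀) :
    ∃ K,0 ≤ K ∧ ∀ k ∈ M.lanes,TranslateLe (u₀ k) K := by
  refine ⟨∑ k ∈ M.lanes,((essVariation (u₀ k)).toReal+1),
    Finset.sum_nonneg fun _ _ => by positivity,fun k hk => ?_⟩
  have h1 : TranslateLe (u₀ k) ((essVariation (u₀ k)).toReal+1) := by
    refine translateLe_of_essVariation (hu k hk).1.aemeasurable (by positivity) ?_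
    rw [ENNReal.ofReal_add ENNReal.toReal_nonneg zero_le_one,
      ENNReal.ofReal_toReal (hu k hk).2.1.ne,ENNReal.ofReal_one]
    exact ENNReal.lt_add_right (hu k hk).2.1.ne one_ne_zero
  exact h1.mono (Finset.single_le_sum (f := fun k => (essVariation (u₀ k)).toReal+1)
    (fun _ _ => by positivity) hk)

theorem InitialData.approx_zero_mem (hx : 0 < m.Δx) (hu : M.InitialData u₀) :
    UnitValued M (M.approx m β u₀ 0) := by
  intro k hk i
  obtain ⟨h1,-,h3⟩ := hu k hk
  have hv : ∫ _ in m.cell i,1 = m.Δx := by simp [Measure.real,Mesh.volume_cell hx,hx.le]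
  constructor
  · exact mul_nonneg (by positivity) (integral_nonneg_of_ae (ae_restrict_of_ae
      (h3.mono fun x hx => hx.1)))
  · have : ∫ x in m.cell i,u₀ k x ≤ m.Δx := by
      rw [← hv]
      refine integral_mono_ae h1.integrableOn (integrableOn_const (by
        rw [Mesh.volume_cell hx]; simp)) (ae_restrict_of_ae (h3.mono fun x hx => hx.2))
    simp only [approx]
    rw [one_div,inv_mul_le_iff₀ hx,mul_one]
    exact this

theorem InitialData.hasSum_approx_zero (hx : 0 < m.Δx) (hu : M.InitialData u₀) {k : ℕ}
    (hk : k ∈ M.lanes) : HasSum (M.approx m β u₀ 0 k) ((1/m.Δx)*∫ x,u₀ k x) :=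
  (Mesh.hasSum_cell hx (hu k hk).1).mul_left _

theorem InitialData.approx_zero_tv (hx : 0 < m.Δx) (hu : M.InitialData u₀) {k : ℕ}
    (hk : k ∈ M.lanes) {K : ℝ} (hK : TranslateLe (u₀ k) K) :
    SumLe (fun i => |M.approx m β u₀ 0 k (i+1)-M.approx m β u₀ 0 k i|) K := by
  have hi := (hu k hk).1
  have hd : Integrable fun x => u₀ k (x+m.Δx)-u₀ k x := (hi.comp_add_right _).sub hi
  have h1 := (Mesh.hasSum_cell hx hd.abs).mul_left (1/m.Δx)
  have h2 : SumLe (fun i => 1/m.Δx*∫ x in m.cell i,|u₀ k (x+m.Δx)-u₀ k x|) K := by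
    refine ⟨h1.summable,?_⟩
    rw [h1.tsum_eq,one_div,inv_mul_le_iff₀ hx]
    simpa [abs_of_pos hx,mul_comm] using hK m.Δx
  refine h2.mono (fun i => abs_nonneg _) fun i => ?_
  simp only [approx]
  rw [Mesh.setIntegral_cell_succ,← mul_sub,← integral_sub (hi.comp_add_right _).integrableOn
    hi.integrableOn,abs_mul,abs_of_pos (by positivity : 0<1/m.Δx)]
  gcongr
  exact abs_integral_le_integral_abs

/-- The variation and the mass of `u_Δ(t^n)`. -/
theorem Admissible.budget (h : Admissible M m β) (hu : M.InitialData u₀) (n : ℕ) :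
    UnitValued M (M.approx m β u₀ n) ∧
    Budget M (M.approx m β u₀ n) (fun k => discreteTV (M.approx m β u₀ n k))
      (fun k => ∑' i,M.approx m β u₀ n k i) := by
  have of_summable : ∀ n,UnitValued M (M.approx m β u₀ n) →
      (∀ k ∈ M.lanes,Summable (M.approx m β u₀ n k)) →
      (∀ k ∈ M.lanes,Summable fun i => |M.approx m β u₀ n k (i+1)-M.approx m β u₀ n k i|) →
      Budget M (M.approx m β u₀ n) (fun k => discreteTV (M.approx m β u₀ n k))
      (fun k => ∑' i,M.approx m β u₀ n k i) := fun n hw h1 h2 =>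
    ⟨fun k hk => ⟨h2 k hk,le_rfl⟩,fun k hk => tsum_nonneg fun i => abs_nonneg _,
      fun k hk => ⟨h1 k hk,le_rfl⟩,fun k hk => tsum_nonneg fun i => (hw k hk i).1⟩
  induction n with
  | zero =>
    obtain ⟨K,-,hK⟩ := hu.translate
    have := hu.approx_zero_mem (β := β) h.dx_pos
    exact ⟨this,of_summable 0 this (fun k hk => (hu.hasSum_approx_zero h.dx_pos hk).summable)
      fun k hk => (hu.approx_zero_tv h.dx_pos hk (hK k hk)).1⟩
  | succ n ih =>
    obtain ⟨hw,hb⟩ := ih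
    have := h.step_mem hw
    refine ⟨this,of_summable (n+1) this (fun k hk => (h.step_summable hw hb hk).1)
      fun k hk => ?_⟩
    exact (h.step_tv hw hb (fun k hk => le_maxLane M.fLip hk)
      (fun k hk => le_maxLane (fun k => stripNorm (D1 (M.ν k))) hk)
      (fun k hk => le_maxLane (fun k => stripNorm (D2 (M.ν k))) hk)
      (fun k hk => le_maxLane (fun k => stripNorm (D1 (D1 (M.ν k)))
      + 2*stripNorm (D2 (D1 (M.ν k)))*(2*M.ω 0)
      + 2*stripNorm (D2 (D2 (M.ν k)))*(2*M.ω 0)^2) hk)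
      (maxLane_nonneg fun k => fLip_nonneg k) (maxLane_nonneg fun k => stripNorm_nonneg _)
      (maxLane_nonneg fun k => stripNorm_nonneg _) hk).1

theorem Admissible.approx_mass (h : Admissible M m β) (hu : M.InitialData u₀) (n : ℕ) :
    ∑ k ∈ M.lanes,∑' i,M.approx m β u₀ n k i=∑ k ∈ M.lanes,∑' i,M.approx m β u₀ 0 k i := by
  induction n with
  | zero => rfl
  | succ n ih =>
    rw [← ih]
    exact h.step_mass (h.budget hu n).1 (h.budget hu n).2

theorem Admissible.dx_mul_mass_le (h : Admissible M m β) (hu : M.InitialData u₀) (n : ℕ) :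
    m.Δx*∑ k ∈ M.lanes,∑' i,M.approx m β u₀ n k i ≤ M.dataL1 u₀ := by
  rw [h.approx_mass hu,Finset.mul_sum]
  refine Finset.sum_le_sum fun k hk => ?_
  rw [(hu.hasSum_approx_zero h.dx_pos hk).tsum_eq,← mul_assoc,mul_one_div_cancel h.dx_pos.ne',
    one_mul]
  exact integral_mono (hu k hk).1 (hu k hk).1.abs fun x => le_abs_self _

/-- Growth rate of the total variation. -/
def tvRate (N : ℕ) (S ω u₀ f D1 D2 D11 _D12 D21 D22 : ℝ) : ℝ :=
  f*(D1+2*D2*(2*ω))+(D11+2*D21*(2*ω)+2*D22*(2*ω)^2)*f*u₀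
    + N*(2*(4*S+4*f*D1*u₀))

/-- Rate of displacement in `L¹`. -/
noncomputable def moveRate (S ω u₀ f _ν D1 D2 lam β tv : ℝ) : ℝ :=
  2*β/lam*tv+(D1+D2*(2*ω))*f*u₀+4*S*u₀

theorem dataL1_nonneg (M : Model) (u₀ : ℕ → ℝ → ℝ) : 0 ≤ M.dataL1 u₀ :=
  Finset.sum_nonneg fun _ _ => integral_nonneg fun _ => abs_nonneg _

/-- The growth rate of the total variation for given data. -/
noncomputable def growthRate (M : Model) (u₀ : ℕ → ℝ → ℝ) : ℝ :=
  tvRate M.N M.SLip M.kernelTV (M.dataL1 u₀) (M.maxLane M.fLip) (M.nuNorm D1) (M.nuNorm D2)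
    (M.nuNorm fun q => D1 (D1 q)) (M.nuNorm fun q => D1 (D2 q)) (M.nuNorm fun q => D2 (D1 q))
    (M.nuNorm fun q => D2 (D2 q))

theorem Admissible.tv_succ (h : Admissible M m β) (hu : M.InitialData u₀) (n : ℕ) :
    ∑ k ∈ M.lanes,discreteTV (M.approx m β u₀ (n+1) k)+1 ≤
      (1+m.Δt*M.growthRate u₀)*(∑ k ∈ M.lanes,discreteTV (M.approx m β u₀ n k)+1) := by
  obtain ⟨hw,hb⟩ := h.budget hu n
  have hω := h.std.omega_zero_nonneg
  have hωT := h.std.omega_zero_le_kernelTV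
  have hT0 := hω.trans hωT
  have hm := h.dx_mul_mass_le hu n
  have hm0 := dataL1_nonneg M u₀
  have hS := SLip_nonneg (M := M)
  have hL : 0 ≤ M.maxLane M.fLip := maxLane_nonneg fun k => fLip_nonneg k
  have hP := nuNorm_nonneg (M := M) D1
  have hQ := nuNorm_nonneg (M := M) D2
  have h11 := nuNorm_nonneg (M := M) fun q => D1 (D1 q)
  have h21 := nuNorm_nonneg (M := M) fun q => D2 (D1 q)
  have h22 := nuNorm_nonneg (M := M) fun q => D2 (D2 q)
  have key := fun k (hk : k ∈ M.lanes) => (h.step_tv hw hb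
    (P := M.nuNorm D1) (Q := M.nuNorm D2)
    (K := (M.nuNorm fun q => D1 (D1 q))+2*(M.nuNorm fun q => D2 (D1 q))*(2*M.kernelTV)
      + 2*(M.nuNorm fun q => D2 (D2 q))*(2*M.kernelTV)^2)
    (fun k hk => le_maxLane M.fLip hk)
    (fun k hk => le_maxLane (fun k => stripNorm (D1 (M.ν k))) hk)
    (fun k hk => le_maxLane (fun k => stripNorm (D2 (M.ν k))) hk)
    (fun k hk => by
      have e1 := le_maxLane (fun k => stripNorm (D1 (D1 (M.ν k)))) hk
      have e2 := le_maxLane (fun k => stripNorm (D2 (D1 (M.ν k)))) hk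
      have e3 := le_maxLane (fun k => stripNorm (D2 (D2 (M.ν k)))) hk
      simp [nuNorm] at *
      gcongr) hL hP hQ hk).2
  have hsum := Finset.sum_le_sum key
  set T := ∑ k ∈ M.lanes,discreteTV (M.approx m β u₀ n k) with hTdef
  have hT := Finset.sum_nonneg hb.tv_nonneg
  set I := ∑ k ∈ M.lanes,∑' i,M.approx m β u₀ n k i with hI
  set L := M.maxLane M.fLip
  set P := M.nuNorm D1
  set Q := M.nuNorm D2
  set K := (M.nuNorm fun q => D1 (D1 q))+2*(M.nuNorm fun q => D2 (D1 q))*(2*M.kernelTV)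
      + 2*(M.nuNorm fun q => D2 (D2 q))*(2*M.kernelTV)^2 with hKdef
  have e : ∑ k ∈ M.lanes,(discreteTV (M.approx m β u₀ n k)+m.Δt *
      (L*(P+2*Q*(2*M.ω 0))*discreteTV (M.approx m β u₀ n k)
        + K*L*(m.Δx*∑' i,M.approx m β u₀ n k i)
        + 2*(4*M.SLip*T+4*L*P*(m.Δx*I))))
      = T+m.Δt*(L*(P+2*Q*(2*M.ω 0))*T+K*L*(m.Δx*I)
        + M.N*(2*(4*M.SLip*T+4*L*P*(m.Δx*I)))) := by
    rw [Finset.sum_add_distrib,← Finset.mul_sum,Finset.sum_add_distrib,Finset.sum_add_distrib,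
      ← Finset.mul_sum,← Finset.mul_sum,← Finset.mul_sum,Finset.sum_const,
      show M.lanes.card = M.N by simp [lanes],nsmul_eq_mul]
  rw [e] at hsum
  have hlhs : ∑ k ∈ M.lanes,discreteTV (M.approx m β u₀ (n+1) k) ≤ _ := hsum
  have hdt := h.dt_pos
  have b : L*(P+2*Q*(2*M.ω 0))*T+K*L*(m.Δx*I)
        + M.N*(2*(4*M.SLip*T+4*L*P*(m.Δx*I)))
      ≤ M.growthRate u₀*(T+1) := by
    calc _ ≤ L*(P+2*Q*(2*M.kernelTV))*T+K*L*M.dataL1 u₀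
        + M.N*(2*(4*M.SLip*T+4*L*P*M.dataL1 u₀)) := by gcongr
      _≤(L*(P+2*Q*(2*M.kernelTV))*T+K*L*M.dataL1 u₀
        + M.N*(2*(4*M.SLip*T+4*L*P*M.dataL1 u₀)))
        + (L*(P+2*Q*(2*M.kernelTV))+K*L*M.dataL1 u₀*T
        + M.N*(2*(4*M.SLip+4*L*P*M.dataL1 u₀*T))) :=
        le_add_of_nonneg_right (by positivity)
      _ = _ := by simp [growthRate,tvRate]; ring
  linarith [mul_mono_l b hdt.le]

theorem growthRate_nonneg (h : M.Standing) : 0 ≤ M.growthRate u₀ := by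
  have hT0 := h.omega_zero_nonneg.trans h.omega_zero_le_kernelTV
  have hm0 := dataL1_nonneg M u₀
  have hS := SLip_nonneg (M := M)
  have hL : 0 ≤ M.maxLane M.fLip := maxLane_nonneg fun k => fLip_nonneg k
  have hP := nuNorm_nonneg (M := M) D1
  have hQ := nuNorm_nonneg (M := M) D2
  have h11 := nuNorm_nonneg (M := M) fun q => D1 (D1 q)
  have h21 := nuNorm_nonneg (M := M) fun q => D2 (D1 q)
  have h22 := nuNorm_nonneg (M := M) fun q => D2 (D2 q)
  unfold growthRate tvRate
  positivity

theorem Admissible.tv_le (h : Admissible M m β) (hu : M.InitialData u₀) (n : ℕ) :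
    ∑ k ∈ M.lanes,discreteTV (M.approx m β u₀ n k)+1 ≤
      Real.exp (M.growthRate u₀*m.time n)*(∑ k ∈ M.lanes,discreteTV (M.approx m β u₀ 0 k)+1) := by
  induction n with
  | zero => simp [Mesh.time]
  | succ n ih =>
    refine (h.tv_succ hu n).trans ?_
    set C := M.growthRate u₀
    have h1 : 1+m.Δt*C ≤ Real.exp (C*m.Δt) := by
      have := Real.add_one_le_exp (C*m.Δt); linarith
    have h2 : C*m.time (n+1) = C*m.Δt+C*m.time n := by simp [Mesh.time]; ring
    have h0 := add_nonneg (Finset.sum_nonneg (h.budget hu n).2.tv_nonneg) zero_le_one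
    rw [h2,Real.exp_add,mul_assoc]
    exact mul_le_mul h1 ih h0 (Real.exp_nonneg _)

theorem tv_le_maxTV {n : ℕ} (hn : n ≤ m.NT) {k : ℕ} (hk : k ∈ M.lanes) :
    discreteTV (M.approx m β u₀ n k) ≤ M.maxTV m β u₀ := by
  refine le_csSup ?_ ⟨n,hn,k,hk,rfl⟩
  refine (((Finset.range (m.NT+1) ×ˢ M.lanes).finite_toSet.image
    fun p => discreteTV (M.approx m β u₀ p.1 p.2)).subset ?_).bddAbove
  rintro r ⟨n,hn,k,hk,rfl⟩
  measurability

theorem Admissible.move_succ (h : Admissible M m β) (hu : M.InitialData u₀) {n : ℕ} {tv : ℝ}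
    {k : ℕ} (hk : k ∈ M.lanes) (htv : discreteTV (M.approx m β u₀ n k) ≤ tv) :
    SumLe (fun i => |M.approx m β u₀ (n+1) k i-M.approx m β u₀ n k i|)
      (m.Δt/m.Δx*moveRate M.SLip M.kernelTV (M.dataL1 u₀) (M.maxLane M.fLip)
        (M.nuNorm fun q => q) (M.nuNorm D1) (M.nuNorm D2) m.lam β tv) := by
  obtain ⟨hw,hb⟩ := h.budget hu n
  have hω := h.std.omega_zero_nonneg
  have hωT := h.std.omega_zero_le_kernelTV
  have hT0 := hω.trans hωT
  have hm := h.dx_mul_mass_le hu n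
  have hS := SLip_nonneg (M := M)
  have hL : 0 ≤ M.maxLane M.fLip := maxLane_nonneg fun k => fLip_nonneg k
  have hLk := le_maxLane M.fLip hk
  have hPk : stripNorm (D1 (M.ν k)) ≤ M.nuNorm D1 :=
    le_maxLane (fun k => stripNorm (D1 (M.ν k))) hk
  have hQk : stripNorm (D2 (M.ν k)) ≤ M.nuNorm D2 :=
    le_maxLane (fun k => stripNorm (D2 (M.ν k))) hk
  have hL0 := fLip_nonneg (M := M) k
  have hmk := le_sum_lanes hb.mass_nonneg hk
  have hmk0 := hb.mass_nonneg k hk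
  refine (h.step_displacement hw hb hk).weaken ?_
  have hdt := h.dt_pos
  have hdx := h.dx_pos
  have hb0 := h.beta_pos
  set I := ∑ k ∈ M.lanes,∑' i,M.approx m β u₀ n k i with hI
  have hI' : I ≤ M.dataL1 u₀/m.Δx := by rw [le_div_iff₀ hdx,mul_comm]; exact hm
  calc _≤2*β*tv+m.Δt*((M.nuNorm D1+M.nuNorm D2*(2*M.kernelTV))
        * M.maxLane M.fLip*(M.dataL1 u₀/m.Δx)+4*M.SLip*(M.dataL1 u₀/m.Δx)) := by
        have hq1 := nuNorm_nonneg (M := M) D1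
        have hq2 := nuNorm_nonneg (M := M) D2
        have hmI := hmk.trans hI'
        gcongr
    _ = _ := by
        simp only [moveRate,Mesh.lam]
        field_simp
        ring

theorem Admissible.move_le (h : Admissible M m β) (hu : M.InitialData u₀) {k : ℕ}
    (hk : k ∈ M.lanes) {n : ℕ} {tv : ℝ} (j : ℕ)
    (htv : ∀ l < n+j,discreteTV (M.approx m β u₀ l k) ≤ tv) :
    SumLe (fun i => |M.approx m β u₀ (n+j) k i-M.approx m β u₀ n k i|)
      (j*(m.Δt/m.Δx*moveRate M.SLip M.kernelTV (M.dataL1 u₀) (M.maxLane M.fLip)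
        (M.nuNorm fun q => q) (M.nuNorm D1) (M.nuNorm D2) m.lam β tv)) := by
  induction j with
  | zero => simpa using SumLe.zero
  | succ j ih =>
    have h1 := ih fun l hl => htv l (by omega)
    have h2 := h.move_succ hu hk (htv (n+j) (by omega))
    refine ((h1.add h2).weaken (le_of_eq (by push_cast; ring))).mono (fun i => abs_nonneg _)
      fun i => ?_
    grind

variable {M : Model} {m : Mesh} {β T : ℝ} {u₀ : ℕ → ℝ → ℝ}

theorem Admissible.of_diagonal (H : M.Standing) (h0 : 0 < β) (h1 : β<2/3) (hf : m.Fits M T)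
    (hc : M.CFL m β) (hd : M.DiagonalCFL m β) : Admissible M m β :=
  ⟨H,hf.dx_pos,hf.dt_pos,hf.eta_eq,h0,h1,hc,hd⟩

end Model

/-! ### Averages -/

theorem integrable_mul_comp_sub {k q : ℝ → ℝ} (hk : Integrable k) (hq : Integrable q) :
    Integrable (fun p : ℝ × ℝ => k (p.2-p.1)*q p.2) (volume.prod volume) := by
  have := (measurePreserving_sub_prod (volume : Measure ℝ) volume).integrable_comp_of_integrable
    (hk.comp_neg.mul_prod hq)
  simpa [Function.comp_def] using this

theorem integral_abs_conv_le {k q : ℝ → ℝ} (hk : Integrable k) (hq : Integrable q) :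
    Integrable (fun x => ∫ y,k (y-x)*q y) ∧
      ∫ x,|∫ y,k (y-x)*q y|≤(∫ x,|k x|)*∫ x,|q x| := by
  have hi := integrable_mul_comp_sub hk hq
  have hj := integrable_mul_comp_sub hk.abs hq.abs
  refine ⟨hi.integral_prod_left,?_⟩
  calc ∫ x,|∫ y,k (y-x)*q y|≤∫ x,∫ y,|k (y-x)| * |q y| := by
        refine integral_mono hi.integral_prod_left.abs hj.integral_prod_left fun x => ?_
        refine abs_integral_le_integral_abs.trans (le_of_eq ?_)
        simp [abs_mul]
    _=∫ y,∫ x,|k (y-x)| * |q y| := integral_integral_swap hj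
    _ = _ := by
        simp_rw [integral_mul_const]
        simp_rw [fun y => integral_sub_left_eq_self (fun x => |k x|) volume y]
        rw [integral_const_mul]

theorem TranslateLe.nonneg {w : ℝ → ℝ} {K : ℝ} (h : TranslateLe w K) : 0 ≤ K := by
  have := h 1
  rw [abs_one,mul_one] at this
  exact (integral_nonneg fun _ => abs_nonneg _).trans this

namespace Model

variable {M : Model}

/-- The kernel extended by zero. -/
noncomputable def kernel (M : Model) (y : ℝ) : ℝ := indicator (Icc 0 M.η) M.ω y

theorem avg_eq (hη : 0 < M.η) (v : ℝ → ℝ) (x : ℝ) : M.avg v x=∫ y,M.kernel (y-x)*v y := by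
  rw [avg,intervalIntegral.integral_of_le (by linarith),← integral_Icc_eq_integral_Ioc,
    ← integral_indicator measurableSet_Icc]
  congr 1
  funext y
  by_cases hy : y ∈ Icc x (x+M.η)
  · rw [indicator_of_mem hy,kernel,indicator_of_mem]
    exact ⟨by linarith [hy.1],by linarith [hy.2]⟩
  · rw [indicator_of_notMem hy,kernel,indicator_of_notMem,zero_mul]
    grind

namespace Standing

variable (H : M.Standing)
include H

theorem kernelTV_nonneg : 0 ≤ M.kernelTV := H.omega_zero_nonneg.trans H.omega_zero_le_kernelTV

theorem kernel_nonneg (y : ℝ) : 0 ≤ M.kernel y := indicator_nonneg H.omega_nonneg y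

theorem kernel_le (y : ℝ) : M.kernel y ≤ M.kernelTV := by
  by_cases hy : y ∈ Icc 0 M.η
  · rw [kernel,indicator_of_mem hy]; exact (H.omega_le hy).trans H.omega_zero_le_kernelTV
  · rw [kernel,indicator_of_notMem hy]; exact H.kernelTV_nonneg

theorem kernel_integrable : Integrable M.kernel :=
  (H.omega_continuousOn.integrableOn_compact isCompact_Icc).integrable_indicator measurableSet_Icc

theorem kernel_measurable : Measurable M.kernel := by
  have h1 := (continuousOn_iff_continuous_domRestrict.1 H.omega_continuousOn).measurable
  refine measurable_of_restrict_of_restrict_compl (measurableSet_Icc (a := 0) (b := M.η)) ?_ ?_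
  · convert h1 using 1
    funext y
    exact indicator_of_mem y.2 _
  · convert (measurable_const) using 1
    funext y
    exact indicator_of_notMem y.2 _

theorem kernel_integral : ∫ y,M.kernel y=1 := by
  rw [← H.omega_mass,intervalIntegral.integral_of_le H.eta_pos.le,← integral_Icc_eq_integral_Ioc,
    ← integral_indicator measurableSet_Icc]
  rfl

theorem kernel_translate : TranslateLe M.kernel M.kernelTV :=
  translateLe_of_eVariationOn H.kernel_measurable.aemeasurable EventuallyEq.rfl
    H.kernelTV_nonneg (by
      rw [kernelTV,ENNReal.ofReal_toReal H.kernel_variation_ne_top]; exact le_rfl)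

theorem integrable_kernel_mul {v : ℝ → ℝ} (hv : Integrable v) (x : ℝ) :
    Integrable fun y => M.kernel (y-x)*v y :=
  hv.bdd_mul
    (H.kernel_measurable.comp (measurable_id.sub_const x)).aestronglyMeasurable
    (.of_forall fun y => by
      rw [Real.norm_eq_abs,abs_of_nonneg (H.kernel_nonneg _)]; exact H.kernel_le _)

theorem avg_sub {v w : ℝ → ℝ} (hv : Integrable v) (hw : Integrable w) (x : ℝ) :
    M.avg (fun y => v y-w y) x = M.avg v x-M.avg w x := by
  rw [avg_eq H.eta_pos,avg_eq H.eta_pos,avg_eq H.eta_pos,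
    ← integral_sub (H.integrable_kernel_mul hv x) (H.integrable_kernel_mul hw x)]
  simp [mul_sub]

theorem abs_avg_le {v : ℝ → ℝ} (hv : Integrable v) (x : ℝ) :
    |M.avg v x| ≤ M.kernelTV*∫ y,|v y| := by
  rw [avg_eq H.eta_pos,← integral_const_mul]
  refine abs_integral_le_integral_abs.trans (integral_mono (H.integrable_kernel_mul hv x).abs
    (hv.abs.const_mul _) fun y => ?_)
  simp only [abs_mul,abs_of_nonneg (H.kernel_nonneg _)]
  exact mul_mono_r (H.kernel_le _) (abs_nonneg _)

theorem abs_avg_sub_le {v w : ℝ → ℝ} (hv : Integrable v) (hw : Integrable w) (x : ℝ) :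
    |M.avg v x-M.avg w x| ≤ M.kernelTV*∫ y,|v y-w y| := by
  rw [← H.avg_sub hv hw]
  exact H.abs_avg_le (hv.sub hw) x

theorem avg_integrable {v : ℝ → ℝ} (hv : Integrable v) : Integrable (M.avg v) := by
  have := (integral_abs_conv_le H.kernel_integrable hv).1
  simpa [← avg_eq H.eta_pos] using this

theorem integral_abs_avg_le {v : ℝ → ℝ} (hv : Integrable v) : ∫ x,|M.avg v x|≤∫ x,|v x| := by
  have := (integral_abs_conv_le H.kernel_integrable hv).2
  simp [← avg_eq H.eta_pos,abs_of_nonneg (H.kernel_nonneg _),H.kernel_integral] at this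
  exact this

theorem avg_mem {v : ℝ → ℝ} (hv : Integrable v) (h01 : ∀ x,v x ∈ 𝕀) (x : ℝ) :
    M.avg v x ∈ 𝕀 := by
  rw [avg_eq H.eta_pos]
  constructor
  · exact integral_nonneg fun y => mul_nonneg (H.kernel_nonneg _) (h01 y).1
  · rw [← H.kernel_integral,← integral_sub_right_eq_self M.kernel x]
    refine integral_mono (H.integrable_kernel_mul hv x) (H.kernel_integrable.comp_sub_right x)
      fun y => ?_
    exact mul_le_of_le_one_right (H.kernel_nonneg _) (h01 y).2

theorem avg_add_sub {v : ℝ → ℝ} (hv : Integrable v) (x h : ℝ) :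
    M.avg v (x+h)-M.avg v x=∫ y,(M.kernel (y-x+-h)-M.kernel (y-x))*v y := by
  rw [avg_eq H.eta_pos,avg_eq H.eta_pos,
    ← integral_sub (H.integrable_kernel_mul hv _) (H.integrable_kernel_mul hv _)]
  grind

theorem avg_translate {v : ℝ → ℝ} (hv : Integrable v) :
    TranslateLe (M.avg v) (M.kernelTV*∫ x,|v x|) := fun h => by
  have := (integral_abs_conv_le ((H.kernel_integrable.comp_add_right (-h)).sub
    H.kernel_integrable) hv).2
  simp only [Pi.sub_apply] at this
  simp [← H.avg_add_sub hv] at this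
  refine this.trans ((mul_mono_r (H.kernel_translate (-h))
    (integral_nonneg fun _ => abs_nonneg _)).trans (le_of_eq ?_))
  rw [abs_neg]; ring

theorem avg_lipschitz {v : ℝ → ℝ} (hv : Integrable v) (h1 : ∀ x,|v x|≤1) (x y : ℝ) :
    |M.avg v x-M.avg v y| ≤ M.kernelTV*|x-y| := by
  obtain ⟨h,rfl⟩ : ∃ h,x = y+h := ⟨x-y,by ring⟩
  rw [H.avg_add_sub hv,add_sub_cancel_left]
  have hk := (((H.kernel_integrable.comp_add_right (-h)).comp_sub_right y).sub
      (H.kernel_integrable.comp_sub_right y))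
  have h2 := H.kernel_translate (-h)
  rw [abs_neg,← integral_sub_right_eq_self _ y] at h2
  refine (abs_integral_le_integral_abs.trans (integral_mono_of_nonneg ?_ hk.abs ?_)).trans h2
  · exact .of_forall fun _ => abs_nonneg _
  · refine .of_forall fun z => ?_
    simp [abs_mul]
    exact mul_le_of_le_one_right (abs_nonneg _) (h1 z)

theorem avg_congr {v w : ℝ → ℝ} (h : v =ᵐ[volume] w) : M.avg v = M.avg w := by
  funext x
  rw [avg_eq H.eta_pos,avg_eq H.eta_pos]
  refine integral_congr_ae (h.mono fun y hy => ?_)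
  simp [hy]

theorem avg_comp_add (v : ℝ → ℝ) (x h : ℝ) : M.avg v (x+h) = M.avg (fun y => v (y+h)) x := by
  rw [avg_eq H.eta_pos,avg_eq H.eta_pos,← integral_add_right_eq_self _ h]
  simp [add_sub_add_right_eq_sub]

end Standing
end Model

/-! ### Derivatives of Lipschitz functions -/

/-- Upper right derivative along `1/(n+1)`. -/
noncomputable def slope₀ (c : ℝ → ℝ) (x : ℝ) : ℝ :=
  limsup (fun n : ℕ => (n+1 : ℝ)*(c (x+1/(n+1 : ℝ))-c x)) atTop

section Slope

variable {c : ℝ → ℝ} {K : ℝ}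

theorem abs_quotient_le (hc : ∀ x y,|c x-c y| ≤ K*|x-y|) (x : ℝ) (n : ℕ) :
    |(n+1 : ℝ)*(c (x+1/(n+1 : ℝ))-c x)| ≤ K := by
  have hn : (0 : ℝ) < n+1 := by positivity
  rw [abs_mul,abs_of_pos hn]
  refine (mul_mono_l (hc _ _) hn.le).trans (le_of_eq ?_)
  grind

theorem abs_slope₀_le (hc : ∀ x y,|c x-c y| ≤ K*|x-y|) (x : ℝ) : |slope₀ c x| ≤ K := by
  have h := fun n => abs_le.1 (abs_quotient_le hc x n)
  rw [abs_le]
  constructor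
  · exact le_limsup_of_frequently_le (Frequently.of_forall fun n => (h n).1)
      ⟨K,eventually_map.2 (.of_forall fun n => (h n).2)⟩
  · exact limsup_le_of_le ⟨-K,by
      simp only [eventually_map]
      intro a ha
      obtain ⟨n,hn⟩ := ha.exists
      exact (h n).1.trans hn⟩ (.of_forall fun n => (h n).2)

theorem measurable_slope₀ (hc : Measurable c) : Measurable (slope₀ c) := by
  refine Measurable.limsup fun n => ?_
  fun_prop

theorem tendsto_quotient {d x : ℝ} (h : HasDerivAt c d x) :
    Tendsto (fun n : ℕ => (n+1 : ℝ)*(c (x+1/(n+1 : ℝ))-c x)) atTop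
      (𝓝 d) := by
  have h2 : Tendsto (fun n : ℕ => 1/(n+1 : ℝ)) atTop (nhdsWithin 0 {0}ᶜ) := by
    refine tendsto_nhdsWithin_iff.2 ⟨tendsto_one_div_add_atTop_nhds_zero_nat,?_⟩
    refine .of_forall fun n => ?_
    grind
  refine ((hasDerivAt_iff_tendsto_slope_zero.1 h).comp h2).congr fun n => ?_
  simp

theorem slope₀_eq {d x : ℝ} (h : HasDerivAt c d x) : slope₀ c x = d :=
  (tendsto_quotient h).limsup_eq

theorem lipschitzWith_of_abs (hc : ∀ x y,|c x-c y| ≤ K*|x-y|) :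
    LipschitzWith K.toNNReal c := by
  refine LipschitzWith.of_dist_le_mul fun x y => ?_
  exact (hc x y).trans (mul_mono_r (Real.le_coe_toNNReal K) (abs_nonneg _))

theorem ae_hasDerivAt_slope₀ (hc : ∀ x y,|c x-c y| ≤ K*|x-y|) :
    ∀ᵐ x,HasDerivAt c (slope₀ c x) x := by
  filter_upwards [(lipschitzWith_of_abs hc).ae_differentiableAt_real] with x hx
  rw [slope₀_eq hx.hasDerivAt]
  exact hx.hasDerivAt

theorem integral_slope₀ (hc : ∀ x y,|c x-c y| ≤ K*|x-y|) (a b : ℝ) :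
    ∫ x in a..b,slope₀ c x = c b-c a := by
  rw [← ((lipschitzWith_of_abs hc).lipschitzOnWith
   ).absolutelyContinuousOnInterval.integral_deriv_eq_sub]
  refine intervalIntegral.integral_congr_ae ?_
  filter_upwards [ae_hasDerivAt_slope₀ hc] with x hx _
  exact hx.deriv.symm

/-- Fatou's lemma for difference quotients. -/
theorem integral_abs_slope₀_le (hm : Measurable c) (hc : ∀ x y,|c x-c y| ≤ K*|x-y|)
    {L : ℝ} (hi : ∀ h,Integrable fun x => c (x+h)-c x) (hL : TranslateLe c L) :
    Integrable (slope₀ c) ∧ ∫ x,|slope₀ c x| ≤ L := by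
  have key : ∫⁻ x,‖slope₀ c x‖ₑ ≤ ENNReal.ofReal L := by
    calc ∫⁻ x,‖slope₀ c x‖ₑ=∫⁻ x,liminf (fun n : ℕ =>
          ‖(n+1 : ℝ)*(c (x+1/(n+1 : ℝ))-c x)‖ₑ) atTop := by
          refine lintegral_congr_ae ?_
          filter_upwards [ae_hasDerivAt_slope₀ hc] with x hx
          exact ((tendsto_quotient hx).enorm).liminf_eq.symm
      _ ≤ liminf (fun n : ℕ => ∫⁻ x,
          ‖(n+1 : ℝ)*(c (x+1/(n+1 : ℝ))-c x)‖ₑ) atTop := by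
          refine lintegral_liminf_le fun n => ?_
          fun_prop
      _ ≤ ENNReal.ofReal L := by
          refine liminf_le_of_le (by isBoundedDefault) fun b hb => ?_
          obtain ⟨n,hn⟩ := hb.exists
          refine hn.trans ?_
          rw [← ofReal_integral_norm_eq_lintegral_enorm ((hi _).const_mul _)]
          refine ENNReal.ofReal_le_ofReal ?_
          have hn0 : (0 : ℝ)<(n : ℝ)+1 := by positivity
          simp [Real.norm_eq_abs,abs_of_pos hn0]
          rw [integral_const_mul]
          refine (mul_mono_l (hL _) hn0.le).trans (le_of_eq ?_)
          rw [abs_of_pos (by positivity)]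
          field_simp
  have hint : Integrable (slope₀ c) :=
    ⟨(measurable_slope₀ hm).aestronglyMeasurable,key.trans_lt ENNReal.ofReal_lt_top⟩
  refine ⟨hint,?_⟩
  have := ofReal_integral_norm_eq_lintegral_enorm hint
  rw [← this] at key
  exact (ENNReal.ofReal_le_ofReal_iff hL.nonneg).1 key

theorem slope₀_sub_ae {d : ℝ → ℝ} {K' : ℝ} (hc : ∀ x y,|c x-c y| ≤ K*|x-y|)
    (hd : ∀ x y,|d x-d y| ≤ K'*|x-y|) :
    slope₀ (fun x => c x-d x) =ᵐ[volume] fun x => slope₀ c x-slope₀ d x := by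
  filter_upwards [ae_hasDerivAt_slope₀ hc,ae_hasDerivAt_slope₀ hd] with x h1 h2
  exact slope₀_eq (h1.sub h2)

theorem slope₀_comp_add (c : ℝ → ℝ) (x h : ℝ) : slope₀ c (x+h) = slope₀ (fun y => c (y+h)) x := by
  simp only [slope₀,add_right_comm]

end Slope

namespace Model.Standing

variable {M : Model} (H : M.Standing)
include H

theorem avg_measurable {v : ℝ → ℝ} (hv : Integrable v) (h1 : ∀ x,|v x|≤1) :
    Measurable (M.avg v) :=
  (lipschitzWith_of_abs (H.avg_lipschitz hv h1)).continuous.measurable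

theorem slope_avg {v : ℝ → ℝ} (hv : Integrable v) (h1 : ∀ x,|v x|≤1) :
    Integrable (slope₀ (M.avg v)) ∧ ∫ x,|slope₀ (M.avg v) x| ≤ M.kernelTV*∫ x,|v x| :=
  integral_abs_slope₀_le (H.avg_measurable hv h1) (H.avg_lipschitz hv h1)
    (fun h => ((H.avg_integrable hv).comp_add_right h).sub (H.avg_integrable hv))
    (H.avg_translate hv)

theorem slope_avg_sub {v w : ℝ → ℝ} (hv : Integrable v) (hv1 : ∀ x,v x ∈ 𝕀)
    (hw : Integrable w) (hw1 : ∀ x,w x ∈ 𝕀) :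
    ∫ x,|slope₀ (M.avg v) x-slope₀ (M.avg w) x| ≤ M.kernelTV*∫ x,|v x-w x| := by
  have hw' : ∀ x,|w x|≤1 := fun x => by rw [abs_of_nonneg (hw1 x).1]; exact (hw1 x).2
  have hd : ∀ x,|v x-w x|≤1 := fun x => by grind
  refine le_trans (le_of_eq ?_) (H.slope_avg (hv.sub hw) hd).2
  refine integral_congr_ae ?_
  filter_upwards [slope₀_sub_ae (H.avg_lipschitz hv (fun x => by rw [abs_of_nonneg (hv1 x).1]; exact (hv1 x).2)) (H.avg_lipschitz hw hw')] with x hx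
  have : M.avg (v-w) = fun x => M.avg v x-M.avg w x := funext fun x => H.avg_sub hv hw x
  rw [this,hx]

theorem slope_avg_translate {v : ℝ → ℝ} (hv : Integrable v) (hv1 : ∀ x,v x ∈ 𝕀)
    {K : ℝ} (hK : TranslateLe v K) : TranslateLe (slope₀ (M.avg v)) (M.kernelTV*K) := fun h => by
  have e : ∀ x,slope₀ (M.avg v) (x+h) = slope₀ (M.avg fun y => v (y+h)) x := fun x => by
    rw [slope₀_comp_add]
    congr 1
    funext y
    exact H.avg_comp_add v y h
  simp [e]
  refine (H.slope_avg_sub (hv.comp_add_right h) (fun x => hv1 _) hv hv1).trans ?_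
  rw [mul_assoc]
  exact mul_mono_l (hK h) H.kernelTV_nonneg

end Model.Standing

namespace Model

variable {M : Model}

/-- A common bound for all constants of the model. -/
structure Bounds (M : Model) (Λ : ℝ) : Prop where
  std : M.Standing
  one_le : 1 ≤ Λ
  kernel : M.kernelTV ≤ Λ
  f_lip : ∀ k ∈ M.lanes,∀ a ∈ 𝕀,∀ b ∈ 𝕀,
    |M.f k a-M.f k b| ≤ Λ*|a-b|
  nu_abs : ∀ k ∈ M.lanes,∀ x,∀ u ∈ 𝕀,|M.ν k x u| ≤ Λ
  D1_abs : ∀ k ∈ M.lanes,∀ x,∀ u ∈ 𝕀,|D1 (M.ν k) x u| ≤ Λ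
  D2_abs : ∀ k ∈ M.lanes,∀ x,∀ u ∈ 𝕀,|D2 (M.ν k) x u| ≤ Λ
  nu_lip : ∀ k ∈ M.lanes,∀ x y,∀ u ∈ 𝕀,∀ v ∈ 𝕀,
    |M.ν k x u-M.ν k y v| ≤ Λ*(|x-y| + |u-v|)
  D1_lip : ∀ k ∈ M.lanes,∀ x y,∀ u ∈ 𝕀,∀ v ∈ 𝕀,
    |D1 (M.ν k) x u-D1 (M.ν k) y v| ≤ Λ*(|x-y| + |u-v|)
  D2_lip : ∀ k ∈ M.lanes,∀ x y,∀ u ∈ 𝕀,∀ v ∈ 𝕀,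
    |D2 (M.ν k) x u-D2 (M.ν k) y v| ≤ Λ*(|x-y| + |u-v|)
  taylor_space : ∀ k ∈ M.lanes,∀ x y,∀ u ∈ 𝕀,
    |M.ν k y u-M.ν k x u-D1 (M.ν k) x u*(y-x)| ≤ Λ*(y-x)^2
  taylor_state : ∀ k ∈ M.lanes,∀ x,∀ u ∈ 𝕀,∀ v ∈ 𝕀,
    |M.ν k x u-M.ν k x v-D2 (M.ν k) x v*(u-v)| ≤ Λ*(u-v)^2
  S_abs : ∀ k ≤ M.N,∀ x a b A B,(1 ≤ k ∧ k < M.N → UnitBox a b A B) →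
    |M.S k x a b A B| ≤ if 1 ≤ k ∧ k < M.N then Λ*(a+b) else 0
  S_diff : ∀ k ≤ M.N,∀ x y a b A B a' b' A' B',
    (1 ≤ k ∧ k < M.N → UnitBox a b A B ∧ UnitBox a' b' A' B') →
    |M.S k x a b A B-M.S k y a' b' A' B'| ≤ if 1 ≤ k ∧ k < M.N then
      Λ*(|a-a'| + |b-b'|)+Λ*(|x-y| + |A-A'| + |B-B'|)*(a'+b') else 0

theorem abs_taylor_of_lipschitz_deriv {φ : ℝ → ℝ} (hφ : Differentiable ℝ φ) {C : ℝ} (hC0 : 0 ≤ C)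
    (hC : ∀ x y,|deriv φ x-deriv φ y| ≤ C*|x-y|) (x y : ℝ) :
    |φ y-φ x-deriv φ x*(y-x)| ≤ C*(y-x)^2 := by
  have h := (convex_uIcc x y).norm_image_sub_le_of_norm_hasDerivWithin_le
    (fun z _ => (((hφ z).hasDerivAt.sub
      (by simpa using (hasDerivAt_id z).const_mul (deriv φ x))).hasDerivWithinAt))
    (fun z hz => by
      exact (hC z x).trans (mul_mono_l (abs_sub_left_of_mem_uIcc hz) hC0))
    left_mem_uIcc right_mem_uIcc
  calc |φ y-φ x-deriv φ x*(y-x)|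
      = |φ y-deriv φ x*y-(φ x-deriv φ x*x)| := by congr 1; ring
    _ ≤ C*|y-x| * |y-x| := h
    _ = C*(y-x)^2 := by rw [mul_assoc,← sq,sq_abs]

theorem Standing.exists_bounds (H : M.Standing) : ∃ Λ,Bounds M Λ := by
  have hS := SLip_nonneg (M := M)
  have hκ := H.kernelTV_nonneg
  obtain ⟨C,hC0,hL,hν,hP,hQ,h11,h12,h21,h22⟩ : ∃ C,0 ≤ C ∧
      (∀ k ∈ M.lanes,M.fLip k ≤ C) ∧ (∀ k ∈ M.lanes,stripNorm (M.ν k) ≤ C) ∧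
      (∀ k ∈ M.lanes,stripNorm (D1 (M.ν k)) ≤ C) ∧ (∀ k ∈ M.lanes,stripNorm (D2 (M.ν k)) ≤ C) ∧
      (∀ k ∈ M.lanes,stripNorm (D1 (D1 (M.ν k))) ≤ C) ∧
      (∀ k ∈ M.lanes,stripNorm (D1 (D2 (M.ν k))) ≤ C) ∧
      (∀ k ∈ M.lanes,stripNorm (D2 (D1 (M.ν k))) ≤ C) ∧
      ∀ k ∈ M.lanes,stripNorm (D2 (D2 (M.ν k))) ≤ C := by
    have n := fun k (D : (ℝ → ℝ → ℝ) → ℝ → ℝ → ℝ) => stripNorm_nonneg (D (M.ν k))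
    have f := fLip_nonneg (M := M)
    let q k := M.fLip k+stripNorm (M.ν k)+stripNorm (D1 (M.ν k))+stripNorm (D2 (M.ν k))
      + stripNorm (D1 (D1 (M.ν k)))+stripNorm (D1 (D2 (M.ν k)))+stripNorm (D2 (D1 (M.ν k)))
      + stripNorm (D2 (D2 (M.ν k)))
    refine ⟨M.maxLane q,maxLane_nonneg fun k => ?_,?_,?_,?_,?_,?_,?_,?_,?_⟩
    · linarith [f k,n k fun q => q,n k D1,n k D2,n k fun q => D1 (D1 q),n k fun q => D1 (D2 q),
        n k fun q => D2 (D1 q),n k fun q => D2 (D2 q)]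
    all_goals
      intro k hk
      refine le_trans ?_ (le_maxLane q hk)
      linarith [f k,n k fun q => q,n k D1,n k D2,n k fun q => D1 (D1 q),n k fun q => D1 (D2 q),
        n k fun q => D2 (D1 q),n k fun q => D2 (D2 q)]
  obtain ⟨Λ,hΛ⟩ : ∃ Λ,Λ=1+M.kernelTV+C+M.SLip+C*(2*C+C) := ⟨_,rfl⟩
  have hCC : 0 ≤ C*(2*C+C) := by positivity
  have hCΛ : C ≤ Λ := by linarith
  have lip : ∀ {D : ℝ → ℝ → ℝ} {p q : ℝ},p ≤ C → q ≤ C →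
      (∀ {u} x y,u ∈ Icc 0 1 → |D x u-D y u| ≤ p*|x-y|) →
      (∀ {u v} x,u ∈ Icc 0 1 → v ∈ Icc 0 1 → |D x u-D x v| ≤ q*|u-v|) →
      ∀ x y,∀ u ∈ Icc 0 1,∀ v ∈ Icc 0 1,
        |D x u-D y v| ≤ Λ*(|x-y| + |u-v|) := fun {D p q} hp hq h1 h2 x y u hu v hv => by
    calc |D x u-D y v| ≤ |D x u-D y u| + |D y u-D y v| := abs_sub_le _ _ _
      _ ≤ p*|x-y| + q*|u-v| := add_le_add (h1 x y hu) (h2 y hu hv)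
      _ ≤ Λ*|x-y| + Λ*|u-v| := by gcongr <;> linarith
      _ = _ := by ring
  refine ⟨Λ,H,by linarith,by linarith,fun k hk a ha b hb => (H.f_lip hk ha hb).trans ?_,
    fun k hk x u hu => (abs_le_stripNorm (H.nu_bdd k hk) x hu).trans ((hν k hk).trans hCΛ),
    fun k hk x u hu => (abs_le_stripNorm (H.nu_D1_bdd k hk) x hu).trans ((hP k hk).trans hCΛ),
    fun k hk x u hu => (abs_le_stripNorm (H.nu_D2_bdd k hk) x hu).trans ((hQ k hk).trans hCΛ),
    fun k hk => lip (hP k hk) (hQ k hk) (H.nu_lip_space hk) (H.nu_lip_state hk),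
    fun k hk => lip (h11 k hk) (h21 k hk) (H.D1_lip_space hk) (H.D1_lip_state hk),
    fun k hk => lip (h12 k hk) (h22 k hk) (H.D2_lip_space hk) (H.D2_lip_state hk),
    fun k hk x y u hu => abs_taylor_of_lipschitz_deriv (H.nu_diff_space hk u) (by linarith)
      (fun x y => (H.D1_lip_space hk x y hu).trans ?_) x y,
    fun k hk x u hu v hv => (H.nu_taylor_state hk x hu hv).trans ?_,
    fun k hk x a b A B h => (H.abs_S_le hk x h).trans ?_,fun k hk x y a b A B a' b' A' B' h => ?_⟩
  · gcongr; exact (hL k hk).trans hCΛ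
  · gcongr; exact (h11 k hk).trans hCΛ
  · rw [mul_assoc,← sq,sq_abs]; gcongr; exact (h22 k hk).trans hCΛ
  · split_ifs with hk'
    · exact mul_mono_r (by linarith) (add_nonneg (h hk').a_mem.1 (h hk').b_mem.1)
    · exact le_rfl
  · have h1 := H.S_lip hk x fun hh => ⟨(h hh).1,(h hh).2.a_mem,(h hh).2.b_mem,(h hh).1.A_mem,
      (h hh).1.B_mem⟩
    have h2 := H.S_lip_coeff hL hP hQ hC0 hC0 hC0 k x y
      fun hh => ⟨⟨(h hh).2.a_mem,(h hh).2.b_mem,(h hh).1.A_mem,(h hh).1.B_mem⟩,(h hh).2⟩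
    refine (abs_sub_le _ (M.S k x a' b' A B) _).trans ((add_le_add h1 h2).trans ?_)
    split_ifs with hk'
    · rw [sub_self,sub_self,abs_zero,add_zero,add_zero]
      have := (h hk').2.a_mem.1
      have := (h hk').2.b_mem.1
      refine add_le_add (mul_mono_r (by linarith) (by positivity))
        (mul_mono_r ?_ (by positivity))
      calc _ ≤ C*((2*C+C)*|x-y| + (2*C+C)*(|A-A'| + |B-B'|)) := by
            gcongr <;> linarith
        _ = C*(2*C+C)*(|x-y| + |A-A'| + |B-B'|) := by ring
        _ ≤ _ := mul_mono_r (by linarith) (by positivity)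
    · simp

/-! ### Density profiles -/

/-- Profiles of all lanes at one time, with values in `[0,1]`, mass and modulus of translation at
most `Θ`. -/
structure Profile (M : Model) (Θ : ℝ) (w : ℕ → ℝ → ℝ) : Prop where
  meas : ∀ k ∈ M.lanes,Measurable (w k)
  mem : ∀ k ∈ M.lanes,∀ x,w k x ∈ 𝕀
  integrable : ∀ k ∈ M.lanes,Integrable (w k)
  mass : ∀ k ∈ M.lanes,∫ x,w k x ≤ Θ
  translate : ∀ k ∈ M.lanes,TranslateLe (w k) Θ

/-- `𝒰^k` for a profile. -/
noncomputable def vel (M : Model) (w : ℕ → ℝ → ℝ) (k : ℕ) (x : ℝ) : ℝ := M.ν k x (M.avg (w k) x)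

/-- `𝒰^k_x` for a profile. -/
noncomputable def dvel (M : Model) (w : ℕ → ℝ → ℝ) (k : ℕ) (x : ℝ) : ℝ :=
  D1 (M.ν k) x (M.avg (w k) x)+D2 (M.ν k) x (M.avg (w k) x)*slope₀ (M.avg (w k)) x

/-- The source for a profile. -/
noncomputable def src (M : Model) (w : ℕ → ℝ → ℝ) (k : ℕ) (x : ℝ) : ℝ :=
  M.R k x (w · x) (fun j => M.avg (w j) x)

/-- `∑_j ∫ |w_j - z_j|`. -/
noncomputable def gap (M : Model) (w z : ℕ → ℝ → ℝ) : ℝ := ∑ j ∈ M.lanes,∫ x,|w j x-z j x|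

theorem gap_nonneg (w z : ℕ → ℝ → ℝ) : 0 ≤ M.gap w z :=
  Finset.sum_nonneg fun _ _ => integral_nonneg fun _ => abs_nonneg _

theorem le_gap (w z : ℕ → ℝ → ℝ) {k : ℕ} (hk : k ∈ M.lanes) : ∫ x,|w k x-z k x| ≤ M.gap w z :=
  Finset.single_le_sum (f := fun j => ∫ x,|w j x-z j x|)
    (fun _ _ => integral_nonneg fun _ => abs_nonneg _) hk

theorem gap_comm (w z : ℕ → ℝ → ℝ) : M.gap w z = M.gap z w := by simp [gap,abs_sub_comm]

namespace Profile

variable {Θ Λ : ℝ} {w z : ℕ → ℝ → ℝ} {k : ℕ}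

theorem abs_le_one (h : Profile M Θ w) (hk : k ∈ M.lanes) (x : ℝ) : |w k x|≤1 := by
  rw [abs_of_nonneg (h.mem k hk x).1]; exact (h.mem k hk x).2

section

variable (hB : Bounds M Λ) (h : Profile M Θ w) (h' : Profile M Θ z) (hk : k ∈ M.lanes)
include hB h hk

theorem avg_mem (x : ℝ) :
    M.avg (w k) x ∈ 𝕀 := hB.std.avg_mem (h.integrable k hk) (h.mem k hk) x

theorem avg_lip (x y : ℝ) : |M.avg (w k) x-M.avg (w k) y| ≤ Λ*|x-y| :=
  (hB.std.avg_lipschitz (h.integrable k hk) (h.abs_le_one hk) x y).trans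
    (mul_mono_r hB.kernel (abs_nonneg _))

theorem avg_measurable :
    Measurable (M.avg (w k)) := hB.std.avg_measurable (h.integrable k hk) (h.abs_le_one hk)

theorem slope_le (x : ℝ) : |slope₀ (M.avg (w k)) x| ≤ Λ := abs_slope₀_le (h.avg_lip hB hk) x

theorem slope_measurable :
    Measurable (slope₀ (M.avg (w k))) := measurable_slope₀ (h.avg_measurable hB hk)

theorem slope_integrable : Integrable (slope₀ (M.avg (w k))) :=
  (hB.std.slope_avg (h.integrable k hk) (h.abs_le_one hk)).1

theorem slope_translate : TranslateLe (slope₀ (M.avg (w k))) (Λ*Θ) :=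
  (hB.std.slope_avg_translate (h.integrable k hk) (h.mem k hk) (h.translate k hk)).mono
    (mul_mono_r hB.kernel (h.translate k hk).nonneg)

theorem abs_vel_le (x : ℝ) : |M.vel w k x| ≤ Λ := hB.nu_abs k hk x _ (h.avg_mem hB hk x)

theorem vel_lip (x y : ℝ) : |M.vel w k x-M.vel w k y|≤2*Λ^2*|x-y| := by
  have h1 := hB.one_le
  refine (hB.nu_lip k hk x y _ (h.avg_mem hB hk x) _ (h.avg_mem hB hk y)).trans ?_
  have h2 := h.avg_lip hB hk x y
  calc Λ*(|x-y| + |M.avg (w k) x-M.avg (w k) y|) ≤ Λ*(Λ*|x-y| + Λ*|x-y|) := by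
        gcongr
        exact le_mul_of_one_le_left (abs_nonneg _) h1
    _ = _ := by ring

theorem abs_dvel_le (x : ℝ) : |M.dvel w k x|≤2*Λ^2 := by
  have h1 := hB.one_le
  refine (abs_add_le _ _).trans ?_
  rw [abs_mul]
  calc _ ≤ Λ+Λ*Λ := by
        gcongr
        · exact hB.D1_abs k hk x _ (h.avg_mem hB hk x)
        · exact hB.D2_abs k hk x _ (h.avg_mem hB hk x)
        · exact h.slope_le hB hk x
    _ ≤ _ := by nlinarith

theorem dvel_sub_space_le (x y : ℝ) : |M.dvel w k x-M.dvel w k y|≤4*Λ^3*|x-y|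
      + Λ*|slope₀ (M.avg (w k)) x-slope₀ (M.avg (w k)) y| := by
  have h1 := hB.one_le
  have e0 := h.avg_lip hB hk x y
  have e1 := hB.D1_lip k hk x y _ (h.avg_mem hB hk x) _ (h.avg_mem hB hk y)
  have e2 := hB.D2_lip k hk x y _ (h.avg_mem hB hk x) _ (h.avg_mem hB hk y)
  have e3 := hB.D2_abs k hk x _ (h.avg_mem hB hk x)
  have e4 := h.slope_le hB hk y
  simp [dvel]
  set c := M.avg (w k) x
  set c' := M.avg (w k) y
  set s := slope₀ (M.avg (w k)) x
  set s' := slope₀ (M.avg (w k)) y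
  have e : D1 (M.ν k) x c+D2 (M.ν k) x c*s-(D1 (M.ν k) y c'+D2 (M.ν k) y c'*s')
      = (D1 (M.ν k) x c-D1 (M.ν k) y c')+(D2 (M.ν k) x c-D2 (M.ν k) y c')*s'
        + D2 (M.ν k) x c*(s-s') := by ring
  rw [e]
  refine (abs_add_three _ _ _).trans ?_
  rw [abs_mul,abs_mul]
  have h6 : |x-y| + |c-c'|≤2*Λ*|x-y| := by nlinarith [abs_nonneg (x-y)]
  calc _ ≤ Λ*(2*Λ*|x-y|)+Λ*(2*Λ*|x-y|)*Λ+Λ*|s-s'| := by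
        gcongr
        · exact e1.trans (by gcongr)
        · exact e2.trans (by gcongr)
    _=(2*Λ^2+2*Λ^3)*|x-y| + Λ*|s-s'| := by ring
    _ ≤ _ := by
        gcongr
        nlinarith

theorem vel_taylor (x y : ℝ) :
    |M.vel w k y-M.vel w k x-(y-x)*M.dvel w k x|≤3*Λ^3*(y-x)^2
      + Λ*|M.avg (w k) y-M.avg (w k) x-(y-x)*slope₀ (M.avg (w k)) x| := by
  have h1 := hB.one_le
  have e0 := h.avg_lip hB hk y x
  have e1 := hB.taylor_space k hk x y _ (h.avg_mem hB hk y)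
  have e2 := hB.taylor_state k hk x _ (h.avg_mem hB hk y) _ (h.avg_mem hB hk x)
  have e3 := hB.D2_abs k hk x _ (h.avg_mem hB hk x)
  have e5 := hB.D1_lip k hk x x _ (h.avg_mem hB hk y) _ (h.avg_mem hB hk x)
  rw [sub_self,abs_zero,zero_add] at e5
  simp [dvel,vel]
  set c := M.avg (w k) x
  set c' := M.avg (w k) y
  set s := slope₀ (M.avg (w k)) x
  have e : M.ν k y c'-M.ν k x c-(y-x)*(D1 (M.ν k) x c+D2 (M.ν k) x c*s)
      = (M.ν k y c'-M.ν k x c'-D1 (M.ν k) x c'*(y-x))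
        + (M.ν k x c'-M.ν k x c-D2 (M.ν k) x c*(c'-c))
        + (D1 (M.ν k) x c'-D1 (M.ν k) x c)*(y-x)
        + D2 (M.ν k) x c*(c'-c-(y-x)*s) := by ring
  rw [e]
  refine (abs_add_le _ _).trans (add_le_add ((abs_add_three _ _ _).trans ?_) ?_)
  · rw [abs_mul]
    have e7 : (c'-c)^2≤(Λ*|y-x|)^2 := by rw [← sq_abs (c'-c)]; gcongr
    rw [mul_pow,sq_abs] at e7
    have e8 : |D1 (M.ν k) x c'-D1 (M.ν k) x c| * |y-x| ≤ Λ^2*(y-x)^2 := by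
      calc _ ≤ Λ*(Λ*|y-x|)*|y-x| := by
            gcongr
            exact e5.trans (by gcongr)
        _ = Λ^2*(|y-x| ^ 2) := by ring
        _ = _ := by rw [sq_abs]
    have hsq := sq_nonneg (y-x)
    have h3 : Λ^2 ≤ Λ^3 := by nlinarith
    have h2 : Λ ≤ Λ^2 := by nlinarith
    have e9 : Λ*(c'-c)^2 ≤ Λ^3*(y-x)^2 := by
      calc Λ*(c'-c)^2 ≤ Λ*(Λ^2*(y-x)^2) := by gcongr
        _ = _ := by ring
    have e10 := mul_mono_r h3 hsq
    have e11 := mul_mono_r (h2.trans h3) hsq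
    linarith
  · rw [abs_mul]
    gcongr

theorem ae_hasDerivAt_vel : ∀ᵐ x,HasDerivAt (M.vel w k) (M.dvel w k x) x := by
  filter_upwards [ae_hasDerivAt_slope₀ (h.avg_lip hB hk)] with x hx
  rw [hasDerivAt_iff_isLittleO] at hx ⊢
  have h2 : (fun y => 3*Λ^3*(y-x)^2) =o[𝓝 x] fun y => y-x := by
    refine Asymptotics.IsLittleO.const_mul_left ?_ _
    have := Asymptotics.isLittleO_pow_sub_sub x (m := 2) (by norm_num)
    simpa using this
  refine Asymptotics.IsBigO.trans_isLittleO (Asymptotics.IsBigO.of_bound 1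
    (.of_forall fun y => ?_)) (h2.add (hx.norm_left.const_mul_left Λ))
  have := h.vel_taylor hB hk x y
  simp [smul_eq_mul]
  exact this.trans (le_abs_self _)

include h'

theorem avg_sub_le (x : ℝ) : |M.avg (w k) x-M.avg (z k) x| ≤ Λ*M.gap w z :=
  (hB.std.abs_avg_sub_le (h.integrable k hk) (h'.integrable k hk) x).trans
    (mul_le_mul hB.kernel (le_gap w z hk) (integral_nonneg fun _ => abs_nonneg _)
      (zero_le_one.trans hB.one_le))

theorem integral_avg_sub_le : ∫ x,|M.avg (w k) x-M.avg (z k) x| ≤ M.gap w z := by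
  have := hB.std.integral_abs_avg_le ((h.integrable k hk).sub (h'.integrable k hk))
  refine le_trans (le_of_eq ?_) (this.trans (le_gap w z hk))
  congr 1
  funext x
  rw [← hB.std.avg_sub (h.integrable k hk) (h'.integrable k hk)]
  rfl

theorem integral_slope_sub_le :
    ∫ x,|slope₀ (M.avg (w k)) x-slope₀ (M.avg (z k)) x| ≤ Λ*M.gap w z :=
  (hB.std.slope_avg_sub (h.integrable k hk) (h.mem k hk) (h'.integrable k hk) (h'.mem k hk)).trans
    (mul_le_mul hB.kernel (le_gap w z hk) (integral_nonneg fun _ => abs_nonneg _)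
      (zero_le_one.trans hB.one_le))

theorem vel_sub_le (x : ℝ) : |M.vel w k x-M.vel z k x| ≤ Λ^2*M.gap w z := by
  have h1 := hB.one_le
  refine (hB.nu_lip k hk x x _ (h.avg_mem hB hk x) _ (h'.avg_mem hB hk x)).trans ?_
  have := h.avg_sub_le hB h' hk x
  rw [sub_self,abs_zero,zero_add]
  calc Λ*|M.avg (w k) x-M.avg (z k) x| ≤ Λ*(Λ*M.gap w z) := by gcongr
    _ = _ := by ring

theorem dvel_sub_le (x : ℝ) : |M.dvel w k x-M.dvel z k x|≤2*Λ^2*|M.avg (w k) x-M.avg (z k) x|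
      + Λ*|slope₀ (M.avg (w k)) x-slope₀ (M.avg (z k)) x| := by
  have h1 := hB.one_le
  have e1 := hB.D1_lip k hk x x _ (h.avg_mem hB hk x) _ (h'.avg_mem hB hk x)
  have e2 := hB.D2_lip k hk x x _ (h.avg_mem hB hk x) _ (h'.avg_mem hB hk x)
  have e3 := hB.D2_abs k hk x _ (h.avg_mem hB hk x)
  have e4 := h'.slope_le hB hk x
  rw [sub_self,abs_zero,zero_add] at e1 e2
  simp only [dvel]
  set c := M.avg (w k) x
  set c' := M.avg (z k) x
  set s := slope₀ (M.avg (w k)) x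
  set s' := slope₀ (M.avg (z k)) x
  have e : D1 (M.ν k) x c+D2 (M.ν k) x c*s-(D1 (M.ν k) x c'+D2 (M.ν k) x c'*s')
      = (D1 (M.ν k) x c-D1 (M.ν k) x c')+(D2 (M.ν k) x c-D2 (M.ν k) x c')*s'
        + D2 (M.ν k) x c*(s-s') := by ring
  rw [e]
  refine (abs_add_three _ _ _).trans ?_
  rw [abs_mul,abs_mul]
  have h5 : Λ*|c-c'| ≤ Λ^2*|c-c'| :=
    mul_mono_r (by nlinarith) (abs_nonneg _)
  calc _ ≤ Λ*|c-c'| + Λ*|c-c'| * Λ+Λ*|s-s'| := by gcongr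
    _ ≤ _ := by nlinarith

end

theorem sum_nonneg (h : Profile M Θ w) (x : ℝ) : 0≤∑ j ∈ M.lanes,w j x :=
  Finset.sum_nonneg fun j hj => (h.mem j hj x).1

theorem pair_le_sum {q : ℕ → ℝ} (hq : ∀ j ∈ M.lanes,0 ≤ q j) (h : 1 ≤ k ∧ k < M.N) :
    q k+q (k+1)≤∑ j ∈ M.lanes,q j := by
  obtain ⟨hk,hk1⟩ := pair_mem_lanes h
  rw [← Finset.sum_pair (by omega : k ≠ k+1)]
  refine Finset.sum_le_sum_of_subset_of_nonneg ?_ fun j hj _ => hq j hj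
  grind

theorem src_eq (w : ℕ → ℝ → ℝ) (hk : k ∈ M.lanes) (x : ℝ) : ∃ l,k = l+1 ∧ l+1 ≤ M.N ∧
    M.src w k x = M.S l x (w l x) (w (l+1) x) (M.avg (w l) x) (M.avg (w (l+1)) x)
      - M.S (l+1) x (w (l+1) x) (w (l+2) x) (M.avg (w (l+1)) x) (M.avg (w (l+2)) x) := by
  obtain ⟨h1,h2⟩ := mem_lanes.1 hk
  obtain ⟨l,rfl⟩ : ∃ l,k = l+1 := ⟨k-1,by omega⟩
  exact ⟨l,rfl,h2,by simp [src,R]⟩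

theorem unitBox (hB : Bounds M Λ) (h : Profile M Θ w) (x : ℝ) (l : ℕ) (hl : 1 ≤ l ∧ l < M.N) :
    UnitBox (w l x) (w (l+1) x) (M.avg (w l) x) (M.avg (w (l+1)) x) := by
  obtain ⟨h1,h2⟩ := pair_mem_lanes hl
  exact ⟨h.mem l h1 x,h.mem _ h2 x,h.avg_mem hB h1 x,h.avg_mem hB h2 x⟩

theorem abs_src_le (hB : Bounds M Λ) (h : Profile M Θ w) (hk : k ∈ M.lanes) (x : ℝ) :
    |M.src w k x|≤2*Λ*∑ j ∈ M.lanes,w j x := by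
  obtain ⟨l,rfl,hl,e⟩ := src_eq w hk x
  have h0 := zero_le_one.trans hB.one_le
  have key : ∀ l ≤ M.N,|M.S l x (w l x) (w (l+1) x) (M.avg (w l) x) (M.avg (w (l+1)) x)|
      ≤ Λ*∑ j ∈ M.lanes,w j x := fun l hl => by
    refine (hB.S_abs l hl x _ _ _ _ (h.unitBox hB x l)).trans ?_
    split_ifs with hl'
    · exact mul_mono_l
        (pair_le_sum (fun j hj => (h.mem j hj x).1) hl') h0
    · exact mul_nonneg h0 (h.sum_nonneg x)
  grind

/-- Difference of sources in terms of the densities and the averages. -/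
theorem abs_R_sub_le (hB : Bounds M Λ) (hk : k ∈ M.lanes) {p q P Q : ℕ → ℝ} (x y : ℝ) {d : ℝ}
    (hp : ∀ j ∈ M.lanes,p j ∈ 𝕀) (hq : ∀ j ∈ M.lanes,q j ∈ 𝕀)
    (hP : ∀ j ∈ M.lanes,P j ∈ 𝕀) (hQ : ∀ j ∈ M.lanes,Q j ∈ 𝕀)
    (hd : ∀ j ∈ M.lanes,|P j-Q j| ≤ d) :
    |M.R k x p P-M.R k y q Q|≤2*Λ*∑ j ∈ M.lanes,|p j-q j|
      + 2*Λ*(|x-y| + 2*d)*∑ j ∈ M.lanes,q j := by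
  have h0 := zero_le_one.trans hB.one_le
  obtain ⟨h1,h2⟩ := mem_lanes.1 hk
  obtain ⟨l,rfl⟩ : ∃ l,k = l+1 := ⟨k-1,by omega⟩
  have hd0 := (abs_nonneg _).trans (hd _ hk)
  have key : ∀ l ≤ M.N,|M.S l x (p l) (p (l+1)) (P l) (P (l+1))
      - M.S l y (q l) (q (l+1)) (Q l) (Q (l+1))| ≤ Λ*∑ j ∈ M.lanes,|p j-q j|
      + Λ*(|x-y| + 2*d)*∑ j ∈ M.lanes,q j := fun l hl => by
    refine (hB.S_diff l hl x y _ _ _ _ _ _ _ _ fun hl => ?_).trans ?_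
    · obtain ⟨a,b⟩ := pair_mem_lanes hl
      exact ⟨⟨hp _ a,hp _ b,hP _ a,hP _ b⟩,⟨hq _ a,hq _ b,hQ _ a,hQ _ b⟩⟩
    · have hqs := Finset.sum_nonneg fun j hj => (hq j hj).1
      split_ifs with hl'
      · obtain ⟨a,b⟩ := pair_mem_lanes hl'
        have e1 := pair_le_sum (q := fun j => |p j-q j|) (fun _ _ => abs_nonneg _) hl'
        have e2 := pair_le_sum (fun j hj => (hq j hj).1) hl'
        have e3 := hd _ a
        have e4 := hd _ b
        have e5 := add_nonneg (hq _ a).1 (hq _ b).1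
        have e6 : |x-y| + |P l-Q l| + |P (l+1)-Q (l+1)| ≤ |x-y| + 2*d := by linarith
        gcongr
      · positivity
  have e1 := key l (by omega)
  have e2 := key (l+1) h2
  simp [R]
  calc _ = |(M.S l x (p l) (p (l+1)) (P l) (P (l+1))
      - M.S l y (q l) (q (l+1)) (Q l) (Q (l+1)))
      - (M.S (l+1) x (p (l+1)) (p (l+1+1)) (P (l+1)) (P (l+1+1))
      - M.S (l+1) y (q (l+1)) (q (l+1+1)) (Q (l+1)) (Q (l+1+1)))| := by
        congr 1; ring
    _ ≤ _ := (abs_sub _ _).trans (by linarith)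

theorem src_sub_le (hB : Bounds M Λ) (h : Profile M Θ w) (h' : Profile M Θ z) (hk : k ∈ M.lanes)
    (x y : ℝ) : |M.src w k x-M.src z k y|≤2*Λ*∑ j ∈ M.lanes,|w j x-z j y|
      + 2*Λ*(3*Λ*|x-y| + 2*Λ*M.gap w z)*∑ j ∈ M.lanes,z j y := by
  have h1 := hB.one_le
  refine (abs_R_sub_le hB hk (d := Λ*M.gap w z+Λ*|x-y|) x y (fun j hj => h.mem j hj x)
    (fun j hj => h'.mem j hj y) (fun j hj => h.avg_mem hB hj x) (fun j hj => h'.avg_mem hB hj y)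
    fun j hj => ?_).trans ?_
  · exact (abs_sub_le _ (M.avg (z j) x) _).trans (add_le_add (h.avg_sub_le hB h' hj x)
      (h'.avg_lip hB hj x y))
  · have := h'.sum_nonneg y
    have h2 : |x-y| ≤ Λ*|x-y| := le_mul_of_one_le_left (abs_nonneg _) h1
    refine add_le_add_right (mul_mono_r
      (mul_mono_l ?_ (by linarith)) this) _
    linarith

end Profile
end Model

/-! ### Integrals near the diagonal -/

/-- Indicator of `[-ε, ε]`. -/
noncomputable def box (ε r : ℝ) : ℝ := indicator (Icc (-ε) ε) 1 r

theorem box_nonneg (ε r : ℝ) : 0 ≤ box ε r := indicator_nonneg (fun _ _ => zero_le_one) r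

theorem box_of_le {ε r : ℝ} (h : |r| ≤ ε) : box ε r=1 := by
  rw [box,indicator_of_mem (mem_Icc.2 (abs_le.1 h)),Pi.one_apply]

theorem box_of_lt {ε r : ℝ} (h : ε < |r|) : box ε r=0 := by
  rw [box,indicator_of_notMem]
  exact fun h' => absurd (abs_le.2 (mem_Icc.1 h')) (not_le.2 h)

theorem box_neg (ε r : ℝ) : box ε (-r) = box ε r := by
  rcases le_or_gt |r| ε with h | h
  · rw [box_of_le h,box_of_le (by rwa [abs_neg])]
  · rw [box_of_lt h,box_of_lt (by rwa [abs_neg])]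

theorem box_comm (ε x y : ℝ) : box ε (y-x) = box ε (x-y) := by rw [← box_neg,neg_sub]

theorem mul_box_le {ε r c : ℝ} {d : ℝ} (h : |r| ≤ ε → c ≤ d) : c*box ε r ≤ d*box ε r := by
  rcases le_or_gt |r| ε with h' | h'
  · rw [box_of_le h',mul_one,mul_one]; exact h h'
  · rw [box_of_lt h']; simp

theorem box_measurable (ε : ℝ) : Measurable (box ε) := measurable_one.indicator measurableSet_Icc

theorem box_integrable (ε : ℝ) : Integrable (box ε) :=
  (integrable_indicator_iff measurableSet_Icc).2 (integrableOn_const (by simp))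

theorem integral_box {ε : ℝ} (hε : 0 ≤ ε) : ∫ r,box ε r=2*ε := by
  have : ∫ r,box ε r=∫ r in Icc (-ε) ε,1 := integral_indicator measurableSet_Icc
  rw [this,setIntegral_const]
  simp [hε]
  ring

/-- The integral of `F` over `|x - y| ≤ ε` is at most `C`. -/
def BoxLe (ε : ℝ) (F : ℝ × ℝ → ℝ) (C : ℝ) : Prop :=
  Integrable (fun p : ℝ × ℝ => F p*box ε (p.1-p.2)) ∧ ∫ p,F p*box ε (p.1-p.2) ≤ C

namespace BoxLe

variable {ε C D : ℝ} {F G : ℝ × ℝ → ℝ}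

theorem add (hF : BoxLe ε F C) (hG : BoxLe ε G D) : BoxLe ε (fun p => F p+G p) (C+D) := by
  have e : (fun p => (F p+G p)*box ε (p.1-p.2))
      = fun p => F p*box ε (p.1-p.2)+G p*box ε (p.1-p.2) := by funext p; ring
  rw [BoxLe,e,integral_add hF.1 hG.1]
  exact ⟨hF.1.add hG.1,add_le_add hF.2 hG.2⟩

theorem const_mul (hF : BoxLe ε F C) {c : ℝ} (hc : 0 ≤ c) : BoxLe ε (fun p => c*F p) (c*C) := by
  simp [BoxLe,mul_assoc]
  rw [integral_const_mul]
  exact ⟨hF.1.const_mul c,mul_mono_l hF.2 hc⟩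

theorem weaken (hF : BoxLe ε F C) (h : C ≤ D) : BoxLe ε F D := ⟨hF.1,hF.2.trans h⟩

theorem sum {ι : Type*} (s : Finset ι) {F : ι → ℝ × ℝ → ℝ} {C : ι → ℝ}
    (h : ∀ i ∈ s,BoxLe ε (F i) (C i)) : BoxLe ε (fun p => ∑ i ∈ s,F i p) (∑ i ∈ s,C i) := by
  simp [BoxLe,Finset.sum_mul]
  rw [integral_finsetSum s fun i hi => (h i hi).1]
  exact ⟨integrable_finsetSum s fun i hi => (h i hi).1,Finset.sum_le_sum fun i hi => (h i hi).2⟩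

theorem snd {q : ℝ → ℝ} (hε : 0 ≤ ε) (hq : Integrable q) :
    BoxLe ε (fun p => q p.2) (2*ε*∫ x,q x) := by
  have h1 := integrable_mul_comp_sub (box_integrable ε) hq
  have e : (fun p : ℝ × ℝ => q p.2*box ε (p.1-p.2)) = fun p => box ε (p.2-p.1)*q p.2 := by
    funext p; rw [box_comm,mul_comm]
  rw [BoxLe,e]
  refine ⟨h1,le_of_eq ?_⟩
  rw [Measure.volume_eq_prod,integral_prod_symm _ h1]
  simp [integral_mul_const]
  simp_rw [fun y => integral_sub_left_eq_self (fun x => box ε x) volume y]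
  rw [integral_const_mul,integral_box hε]

theorem swap (hF : BoxLe ε F C) : BoxLe ε (fun p => F p.swap) C := by
  have e : (fun p => F p.swap*box ε (p.1-p.2))
      = (fun p => F p*box ε (p.1-p.2)) ∘ Prod.swap := by
    funext p
    simp only [Function.comp_apply,Prod.fst_swap,Prod.snd_swap]
    rw [box_comm]
  refine ⟨?_,?_⟩
  · rw [e]; exact hF.1.swap
  · rw [e]
    have := integral_prod_swap (μ := (volume : Measure ℝ)) (ν := (volume : Measure ℝ))
      (fun p => F p*box ε (p.1-p.2))
    exact (le_of_eq this).trans hF.2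

theorem fst {q : ℝ → ℝ} (hε : 0 ≤ ε) (hq : Integrable q) :
    BoxLe ε (fun p => q p.1) (2*ε*∫ x,q x) := (snd hε hq).swap

/-- Estimate along the lines `y = x + r`. -/
theorem of_shear {A : ℝ} (hε : 0 ≤ ε) (hF0 : ∀ p,0 ≤ F p)
    (hi : Integrable fun p : ℝ × ℝ => F p*box ε (p.1-p.2))
    (hA : ∀ r,|r| ≤ ε → ∫ x,F (x,x+r) ≤ A) : BoxLe ε F (2*ε*A) := by
  refine ⟨hi,?_⟩
  have mp := measurePreserving_prod_add (volume : Measure ℝ) (volume : Measure ℝ)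
  have me := (MeasurableEquiv.shearAddRight ℝ).measurableEmbedding
  have h2 := (mp.integrable_comp_emb me).2 hi
  rw [Measure.volume_eq_prod,← (mp.integral_comp me fun p => F p*box ε (p.1-p.2)),show (∫ z : ℝ × ℝ,F (z.1,z.1+z.2)*box ε (z.1-(z.1+z.2)) ∂volume.prod volume)
    = ∫ z,((fun p => F p*box ε (p.1-p.2)) ∘ fun z => (z.1,z.1+z.2)) z
      ∂volume.prod volume from rfl,integral_prod_symm _ h2]
  have e : ∀ r x : ℝ,F (x,x+r)*box ε (x-(x+r)) = F (x,x+r)*box ε r := fun r x => by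
    rw [sub_add_cancel_left,box_neg]
  have h3 := h2.integral_prod_right
  simp only [Function.comp_def,e,integral_mul_const] at h3 ⊢
  calc _≤∫ r,A*box ε r :=
        integral_mono h3 ((box_integrable ε).const_mul A) fun r => mul_box_le (hA r)
    _ = _ := by rw [integral_const_mul,integral_box hε]; ring

theorem mono (hF : BoxLe ε F C) (hG : AEStronglyMeasurable G) (h0 : ∀ p,0 ≤ G p)
    (h : ∀ p : ℝ × ℝ,|p.1-p.2| ≤ ε → G p ≤ F p) : BoxLe ε G C := by
  have hle := fun p =>
    mul_box_le (h p)
  have hb := (box_measurable ε).comp (measurable_fst.sub measurable_snd)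
  have hi : Integrable fun p => G p*box ε (p.1-p.2) := by
    refine hF.1.mono' (hG.mul hb.aestronglyMeasurable) (.of_forall fun p => ?_)
    rw [Real.norm_eq_abs,abs_of_nonneg (mul_nonneg (h0 p) (box_nonneg _ _))]
    exact hle p
  exact ⟨hi,(integral_mono hi hF.1 hle).trans hF.2⟩

theorem translate {q : ℝ → ℝ} {K : ℝ} (hε : 0 ≤ ε) (hm : Measurable q) (hq : Integrable q)
    (hK : TranslateLe q K) : BoxLe ε (fun p => |q p.1-q p.2|) (2*ε*(K*ε)) := by
  have hi := ((fst hε hq.abs).add (snd hε hq.abs)).mono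
    ((hm.comp measurable_fst).sub (hm.comp measurable_snd)).abs.aestronglyMeasurable
    (fun _ => abs_nonneg _) fun p _ => abs_sub _ _
  refine of_shear hε (fun _ => abs_nonneg _) hi.1 fun r hr => ?_
  simp [abs_sub_comm (q _) (q (_+r))]
  exact (hK r).trans (mul_mono_l hr hK.nonneg)

end BoxLe

/-- Taylor's formula in the mean for a Lipschitz function whose derivative is continuous in the
mean. -/
theorem integral_taylor_le {c : ℝ → ℝ} {Λ K : ℝ} (hc : ∀ x y,|c x-c y| ≤ Λ*|x-y|)
    (hs : Integrable (slope₀ c)) (hK : TranslateLe (slope₀ c) K) (r : ℝ) :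
    ∫ x,|c (x+r)-c x-r*slope₀ c x| ≤ K*r^2 := by
  set s := slope₀ c with hsd
  have e : ∀ x,c (x+r)-c x-r*s x=∫ t in 0..r,(s (x+t)-s x) := fun x => by
    rw [intervalIntegral.integral_sub (hs.comp_add_left x).intervalIntegrable
      intervalIntegrable_const,intervalIntegral.integral_comp_add_left (fun t => s t) x,add_zero,
      integral_slope₀ hc,intervalIntegral.integral_const,sub_zero,smul_eq_mul]
  simp [e]
  have hfin : IsFiniteMeasure ((volume : Measure ℝ).restrict (uIoc 0 r)) :=
    ⟨by rw [Measure.restrict_apply_univ,uIoc]; exact measure_Ioc_lt_top⟩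
  have j1 : Integrable (fun p => s p.1)
      ((volume : Measure ℝ).prod (volume.restrict (uIoc 0 r))) := by
    simpa using hs.mul_prod (integrable_const 1)
  have j2 : Integrable (fun p => s (p.1+p.2))
      ((volume : Measure ℝ).prod (volume.restrict (uIoc 0 r))) := by
    refine (integrable_prod_iff' ((measurable_slope₀ ((lipschitzWith_of_abs hc).continuous.measurable)).comp (measurable_fst.add
      measurable_snd)).aestronglyMeasurable).2 ⟨?_,?_⟩
    · exact .of_forall fun t => hs.comp_add_right t
    · have : ∀ t : ℝ,∫ x,‖s (x+t)‖=∫ x,‖s x‖ := fun t =>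
        integral_add_right_eq_self (fun x => ‖s x‖) t
      exact (integrable_const (∫ x,‖s x‖)).congr (.of_forall fun t => (this t).symm)
  have j := (j2.sub j1).abs
  calc ∫ x,|∫ t in (0 : ℝ)..r,(s (x+t)-s x)|
      ≤ ∫ x,∫ t in uIoc 0 r,|s (x+t)-s x| := by
        refine integral_mono_of_nonneg (.of_forall fun _ => abs_nonneg _)
          j.integral_prod_left (.of_forall fun x => ?_)
        exact intervalIntegral.norm_integral_le_integral_norm_uIoc (f := fun t => s (x+t)-s x)
    _=∫ t in uIoc 0 r,∫ x,|s (x+t)-s x| := integral_integral_swap j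
    _≤∫ t in uIoc 0 r,K*|r| := by
        refine integral_mono_ae j.integral_prod_right (integrable_const _) ?_
        filter_upwards [ae_restrict_mem measurableSet_uIoc] with t ht
        refine (hK t).trans (mul_mono_l ?_ hK.nonneg)
        have := abs_sub_left_of_mem_uIcc (uIoc_subset_uIcc ht)
        simpa using this
    _ = K*r^2 := by
        rw [setIntegral_const,smul_eq_mul,Measure.real,uIoc,Real.volume_Ioc,
          max_sub_min_eq_abs,sub_zero,ENNReal.toReal_ofReal (abs_nonneg _),← sq_abs r]
        ring

/-! ### Mollifiers -/

/-- An even mollifier supported in `[-ε, ε]`; `B` is independent of `ε`. -/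
structure Mollifier (ε B : ℝ) (ρ : ℝ → ℝ) : Prop where
  pos : 0 < ε
  B_nonneg : 0 ≤ B
  smooth : ContDiff ℝ (⊤ : ℕ∞) ρ
  nonneg : ∀ r,0 ≤ ρ r
  even : ∀ r,ρ (-r) = ρ r
  integral : ∫ r,ρ r=1
  le_box : ∀ r,ρ r ≤ B/ε*box ε r
  deriv_le_box : ∀ r,|deriv ρ r| ≤ B/ε^2*box ε r

theorem exists_mollifier : ∃ B : ℝ,∀ ε,0 < ε → ∃ ρ,Mollifier ε B ρ := by
  let b : ContDiffBump (0 : ℝ) := ⟨1/2,1,by norm_num,by norm_num⟩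
  set φ := b.normed volume with hφ
  have hs : ContDiff ℝ (⊤ : ℕ∞) φ := b.contDiff_normed
  have hc : HasCompactSupport φ := b.hasCompactSupport_normed
  have hsup : ∀ r,1 < |r| → φ r=0 := fun r hr => by
    have := b.support_normed_eq (μ := (volume : Measure ℝ))
    by_contra h
    have h2 : r ∈ Metric.ball 0 b.rOut := by rw [← this]; exact h
    rw [mem_ball_zero_iff,Real.norm_eq_abs] at h2
    exact absurd h2 (not_lt.2 hr.le)
  have hsup' : ∀ r,1 < |r| → deriv φ r=0 := fun r hr => by
    have : φ =ᶠ[𝓝 r] fun _ => 0 := by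
      filter_upwards [(isOpen_lt continuous_const continuous_abs).mem_nhds hr] with y hy
      exact hsup y hy
    rw [this.deriv_eq,deriv_const]
  obtain ⟨B1,hB1⟩ := hc.exists_bound_of_continuous hs.continuous
  obtain ⟨B2,hB2⟩ := hc.deriv.exists_bound_of_continuous (hs.continuous_deriv (by simp))
  have hB10 := (norm_nonneg _).trans (hB1 0)
  have hB20 := (norm_nonneg _).trans (hB2 0)
  refine ⟨B1+B2,fun ε hε => ⟨fun r => ε⁻¹*φ (ε⁻¹*r),hε,by positivity,?_,?_,?_,?_,?_,
    ?_⟩⟩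
  · exact contDiff_const.mul (hs.comp (contDiff_const.mul contDiff_id))
  · intro r
    exact mul_nonneg (inv_nonneg.2 hε.le) (b.nonneg_normed _)
  · intro r
    simp only [mul_neg]
    rw [hφ,b.normed_neg]
  · rw [integral_const_mul,Measure.integral_comp_mul_left,inv_inv,abs_of_pos hε,hφ,
      b.integral_normed,smul_eq_mul,mul_one,inv_mul_cancel₀ hε.ne']
  · intro r
    rcases le_or_gt |r| ε with h | h
    · rw [box_of_le h,mul_one,div_eq_inv_mul]
      refine mul_mono_l ?_ (inv_nonneg.2 hε.le)
      have := (le_abs_self _).trans (hB1 (ε⁻¹*r))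
      linarith
    · rw [box_of_lt h,hsup,mul_zero,mul_zero]
      rw [abs_mul,abs_inv,abs_of_pos hε,← div_eq_inv_mul,lt_div_iff₀ hε,one_mul]
      exact h
  · intro r
    have hd : deriv (fun r => ε⁻¹*φ (ε⁻¹*r)) r = ε⁻¹*(ε⁻¹*deriv φ (ε⁻¹*r)) := by
      have h1 : HasDerivAt φ (deriv φ (ε⁻¹*r)) (ε⁻¹*r) :=
        (hs.differentiable (by simp) _).hasDerivAt
      have h2 : HasDerivAt (fun r => ε⁻¹*r) ε⁻¹ r := by
        simpa using (hasDerivAt_id r).const_mul ε⁻¹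
      have := (h1.comp r h2).const_mul ε⁻¹
      rw [mul_comm (deriv φ _)] at this
      exact this.deriv
    rw [hd]
    rcases le_or_gt |r| ε with h | h
    · rw [box_of_le h,mul_one,← mul_assoc,abs_mul,abs_of_pos (by positivity),← sq,inv_pow,
        div_eq_inv_mul]
      refine mul_mono_l ?_ (by positivity)
      have := hB2 (ε⁻¹*r)
      rw [Real.norm_eq_abs] at this
      linarith
    · rw [box_of_lt h,hsup',mul_zero,mul_zero,mul_zero,abs_zero]
      rw [abs_mul,abs_inv,abs_of_pos hε,← div_eq_inv_mul,lt_div_iff₀ hε,one_mul]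
      exact h

namespace Mollifier

variable {ε B : ℝ} {ρ : ℝ → ℝ} (h : Mollifier ε B ρ)
include h

theorem deriv_neg (r : ℝ) : deriv ρ (-r) = -deriv ρ r := by
  have := congrFun (congrArg deriv (funext fun r => (h.even r).symm)) r
  rw [deriv_comp_neg] at this
  linarith

theorem measurable : Measurable ρ := h.smooth.continuous.measurable

theorem continuous_deriv : Continuous (deriv ρ) :=
  h.smooth.continuous_deriv (by simp)

theorem integrable : Integrable ρ :=
  integrable_of_integral_eq_one h.integral

theorem integrable_deriv : Integrable (deriv ρ) :=
  ((box_integrable ε).const_mul _).mono' h.continuous_deriv.aestronglyMeasurable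
    (.of_forall h.deriv_le_box)

theorem eq_zero {r : ℝ} (hr : ε < |r|) : ρ r=0 := by
  have := h.le_box r
  rw [box_of_lt hr,mul_zero] at this
  exact le_antisymm this (h.nonneg r)

theorem hasCompactSupport : HasCompactSupport ρ :=
  HasCompactSupport.of_support_subset_isCompact (isCompact_Icc) fun r hr => by
    by_contra h'
    exact hr (h.eq_zero (not_le.1 fun h'' => h' (abs_le.1 h'')))

theorem hasDerivAt (r : ℝ) : HasDerivAt ρ (deriv ρ r) r :=
  (h.smooth.differentiable (by simp) r).hasDerivAt

theorem integral_deriv : ∫ r,deriv ρ r=0 :=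
  integral_eq_zero_of_hasDerivAt_of_integrable h.hasDerivAt h.integrable_deriv h.integrable

theorem integrable_moment : Integrable fun r => r*deriv ρ r+ρ r := by
  refine Integrable.add ?_ h.integrable
  refine ((box_integrable ε).const_mul (ε*(B/ε^2))).mono'
    (continuous_id.mul h.continuous_deriv).aestronglyMeasurable
    (.of_forall fun r => ?_)
  rw [Real.norm_eq_abs,abs_mul,mul_assoc]
  rcases le_or_gt |r| ε with h' | h'
  · exact mul_le_mul h' (h.deriv_le_box r) (abs_nonneg _) h.pos.le
  · have := h.deriv_le_box r
    rw [box_of_lt h',mul_zero] at this ⊢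
    rw [le_antisymm this (abs_nonneg _)]; simp

theorem integral_moment : ∫ r,(r*deriv ρ r+ρ r)=0 := by
  refine integral_eq_zero_of_hasDerivAt_of_integrable (f := fun r => r*ρ r) (fun r => ?_)
    h.integrable_moment ?_
  · have := (hasDerivAt_id r).mul (h.hasDerivAt r)
    simp [id] at this
    rw [add_comm] at this
    exact this
  · exact (continuous_id.mul h.smooth.continuous).integrable_of_hasCompactSupport
      h.hasCompactSupport.mul_left

theorem abs_moment_le (r : ℝ) :
    |r*deriv ρ r+ρ r|≤2*B/ε*box ε r := by
  have hε := h.pos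
  rcases le_or_gt |r| ε with h' | h'
  · have h1 := h.deriv_le_box r
    have h2 := h.le_box r
    rw [box_of_le h',mul_one] at *
    refine (abs_add_le _ _).trans ?_
    rw [abs_mul,abs_of_nonneg (h.nonneg r)]
    calc _ ≤ ε*(B/ε^2)+B/ε := by gcongr
      _ = _ := by field_simp; ring
  · have h1 := h.deriv_le_box r
    have h2 := h.eq_zero h'
    rw [box_of_lt h',mul_zero] at *
    rw [h2,abs_eq_zero.1 (le_antisymm h1 (abs_nonneg _))]; simp

end Mollifier

/-! ### Kružkov fluxes -/

theorem abs_sign_le (r : ℝ) : |Real.sign r|≤1 := by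
  rcases Real.sign_apply_eq r with h | h | h <;> simp [h]

theorem sign_measurable : Measurable Real.sign := by
  exact Measurable.ite measurableSet_Iio measurable_const
    (Measurable.ite measurableSet_Ioi measurable_const measurable_const)

theorem abs_sign_mul_le (r x : ℝ) : |Real.sign r*x| ≤ |x| := by
  rw [abs_mul]; exact mul_le_of_le_one_left (abs_nonneg _) (abs_sign_le r)

namespace Model

variable {M : Model} {k : ℕ} {Λ : ℝ}

theorem kruzkovFlux_comm (a b : ℝ) : M.kruzkovFlux k a b = M.kruzkovFlux k b a := by
  rw [kruzkovFlux,kruzkovFlux,← neg_sub b a,Real.sign_neg]; ring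

theorem abs_kruzkovFlux_le {a b : ℝ} (h : |M.f k a-M.f k b| ≤ Λ*|a-b|) :
    |M.kruzkovFlux k a b| ≤ Λ*|a-b| := (abs_sign_mul_le _ _).trans h

theorem abs_kruzkovFlux_sub_le {s : Set ℝ}
    (hf : ∀ a ∈ s,∀ b ∈ s,|M.f k a-M.f k b| ≤ Λ*|a-b|) {a b c : ℝ} (ha : a ∈ s)
    (hb : b ∈ s) (hc : c ∈ s) :
    |M.kruzkovFlux k a b-M.kruzkovFlux k a c| ≤ Λ*|b-c| := by
  have e1 : ∀ {p q : ℝ},q ≤ p → M.kruzkovFlux k p q = M.f k p-M.f k q := fun {p q} h => by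
    rcases h.lt_or_eq with h | rfl
    · rw [kruzkovFlux,Real.sign_of_pos (sub_pos.2 h),one_mul]
    · simp [kruzkovFlux]
  have e2 : ∀ {p q : ℝ},p ≤ q → M.kruzkovFlux k p q = M.f k q-M.f k p := fun h => by
    rw [kruzkovFlux_comm,e1 h]
  have h1 := abs_le.1 (hf a ha b hb)
  have h2 := abs_le.1 (hf a ha c hc)
  have h3 := abs_le.1 (hf b hb c hc)
  rw [abs_le]
  rcases le_total b a with hab | hab <;> rcases le_total c a with hac | hac
  · rw [e1 hab,e1 hac]; constructor <;> linarith
  · rw [e1 hab,e2 hac]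
    rw [abs_of_nonneg (by linarith)] at h1
    rw [abs_of_nonpos (sub_nonpos.2 hac)] at h2
    rw [abs_of_nonpos (sub_nonpos.2 (hab.trans hac))]
    constructor <;> linarith
  · rw [e2 hab,e1 hac]
    rw [abs_of_nonpos (sub_nonpos.2 hab)] at h1
    rw [abs_of_nonneg (by linarith)] at h2
    rw [abs_of_nonneg (by linarith)]
    constructor <;> linarith
  · rw [e2 hab,e2 hac]; constructor <;> linarith

/-! ### Measurability with parameters -/

section Measurability

variable {X : Type*} [MeasurableSpace X]

theorem Standing.measurable_nu (H : M.Standing) (hk : k ∈ M.lanes) :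
    Measurable fun p : ℝ × ℝ => M.ν k p.1 p.2 := by
  have := measurable_uncurry_of_continuous_of_measurable
    (fun x => (H.nu_diff_state hk x).continuous) fun u => (H.nu_diff_space hk u).continuous.measurable
  exact this.comp measurable_swap

theorem Standing.measurable_D1 (H : M.Standing) (hk : k ∈ M.lanes) :
    Measurable fun p : ℝ × ℝ => D1 (M.ν k) p.1 p.2 := by
  have := measurable_uncurry_of_continuous_of_measurable
    (fun x => continuous_iff_continuousAt.2 fun u => (H.nu_mixed k hk x u).1.continuousAt)
    fun u => (H.nu_C2_space k hk u).differentiable_deriv_two.continuous.measurable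
  exact this.comp measurable_swap

theorem Standing.measurable_D2 (H : M.Standing) (hk : k ∈ M.lanes) :
    Measurable fun p : ℝ × ℝ => D2 (M.ν k) p.1 p.2 := by
  have := measurable_uncurry_of_continuous_of_measurable
    (fun u => continuous_iff_continuousAt.2 fun x => (H.nu_mixed k hk x u).2.continuousAt)
    fun x => (H.nu_C2_state k hk x).differentiable_deriv_two.continuous.measurable
  exact this

theorem Standing.measurable_S (H : M.Standing) {l : ℕ} {x a b A B : X → ℝ} (hx : Measurable x)
    (h : 1 ≤ l ∧ l < M.N → Measurable a ∧ Measurable b ∧ Measurable A ∧ Measurable B) :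
    Measurable fun q => M.S l (x q) (a q) (b q) (A q) (B q) := by
  by_cases hl : 1 ≤ l ∧ l < M.N
  · obtain ⟨ha,hb,hA,hB⟩ := h hl
    obtain ⟨h1,h2⟩ := pair_mem_lanes hl
    have hX := (((H.g_continuous h2).measurable.comp hb).mul ((H.measurable_nu h2).comp (hx.prodMk hB))).sub
        (((H.g_continuous h1).measurable.comp ha).mul ((H.measurable_nu h1).comp (hx.prodMk hA)))
    simp only [S_eq,hl]
    exact ((hX.max measurable_const).mul ha).sub ((hX.min measurable_const).neg.mul hb)
  · simp only [S_eq,hl]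
    exact measurable_const

theorem measurable_avg (H : M.Standing) {v : X → ℝ → ℝ} (hv : Measurable fun p : X × ℝ => v p.1 p.2) :
    Measurable fun p : X × ℝ => M.avg (v p.1) p.2 := by
  simp [avg_eq H.eta_pos]
  have := (H.kernel_measurable.comp (measurable_snd.sub measurable_fst.snd)).mul
      (hv.comp (measurable_fst.fst.prodMk measurable_snd))
  exact (this.stronglyMeasurable.integral_prod_right).measurable

theorem measurable_slope_avg (H : M.Standing) {v : X → ℝ → ℝ}
    (hv : Measurable fun p : X × ℝ => v p.1 p.2) :
    Measurable fun p : X × ℝ => slope₀ (M.avg (v p.1)) p.2 := by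
  have h := measurable_avg H hv
  refine Measurable.limsup fun n => ?_
  exact ((h.comp (measurable_fst.prodMk (measurable_snd.add_const _))).sub h).const_mul _

variable {u : ℕ → X → ℝ → ℝ} (hu : ∀ j ∈ M.lanes,Measurable fun p : X × ℝ => u j p.1 p.2)
  (H : M.Standing) (hk : k ∈ M.lanes)
include hu H hk

theorem measurable_vel : Measurable fun p : X × ℝ => M.vel (u · p.1) k p.2 :=
  (H.measurable_nu hk).comp (measurable_snd.prodMk (measurable_avg H (hu k hk)))

theorem measurable_dvel : Measurable fun p : X × ℝ => M.dvel (u · p.1) k p.2 :=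
  ((H.measurable_D1 hk).comp (measurable_snd.prodMk (measurable_avg H (hu k hk)))).add
    (((H.measurable_D2 hk).comp (measurable_snd.prodMk (measurable_avg H (hu k hk)))).mul
      (measurable_slope_avg H (hu k hk)))

theorem measurable_src : Measurable fun p : X × ℝ => M.src (u · p.1) k p.2 := by
  have key := fun l =>
    H.measurable_S measurable_snd fun hl => by
      obtain ⟨h1,h2⟩ := pair_mem_lanes hl
      exact ⟨hu l h1,hu _ h2,measurable_avg H (hu l h1),measurable_avg H (hu _ h2)⟩
  obtain ⟨l,rfl⟩ : ∃ l,k = l+1 := ⟨k-1,by have := (mem_lanes.1 hk).1; omega⟩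
  exact (key l).sub (key (l+1))

omit hu in
theorem measurable_kruzkovFlux {a b : X → ℝ}
    (ha : Measurable a) (hb : Measurable b) : Measurable fun q => M.kruzkovFlux k (a q) (b q) :=
  (sign_measurable.comp (ha.sub hb)).mul (((H.f_continuous hk).measurable.comp ha).sub
    ((H.f_continuous hk).measurable.comp hb))

end Measurability

/-! ### Doubling of the space variable -/

/-- The integrand produced by the entropy inequality for `w` with constant `z_k(y)` and test
function `ρ(· - y)`. -/
noncomputable def pairing (M : Model) (ρ : ℝ → ℝ) (w z : ℕ → ℝ → ℝ) (k : ℕ) (p : ℝ × ℝ) : ℝ :=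
  M.kruzkovFlux k (w k p.1) (z k p.2)*M.vel w k p.1*deriv ρ (p.1-p.2)
    + Real.sign (w k p.1-z k p.2)*(M.src w k p.1-M.f k (z k p.2)*M.dvel w k p.1)
      * ρ (p.1-p.2)

theorem measurable_pairing {X Y : Type*} [MeasurableSpace X] [MeasurableSpace Y] (H : M.Standing)
    {u : ℕ → X → ℝ → ℝ} {v : ℕ → Y → ℝ → ℝ}
    (hu : ∀ j ∈ M.lanes,Measurable fun p : X × ℝ => u j p.1 p.2)
    (hv : ∀ j ∈ M.lanes,Measurable fun p : Y × ℝ => v j p.1 p.2) (hk : k ∈ M.lanes) {ρ : ℝ → ℝ}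
    (hρ : Continuous ρ) :
    Measurable fun q : (X × Y) × (ℝ × ℝ) =>
      M.pairing ρ (u · q.1.1) (v · q.1.2) k q.2 := by
  have m1 : Measurable fun q : (X × Y) × (ℝ × ℝ) => (q.1.1,q.2.1) :=
    measurable_fst.fst.prodMk measurable_snd.fst
  have m2 : Measurable fun q : (X × Y) × (ℝ × ℝ) => (q.1.2,q.2.2) :=
    measurable_fst.snd.prodMk measurable_snd.snd
  have md : Measurable fun q : (X × Y) × (ℝ × ℝ) => q.2.1-q.2.2 :=
    measurable_snd.fst.sub measurable_snd.snd
  have hw := (hu k hk).comp m1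
  have hz := (hv k hk).comp m2
  exact (((measurable_kruzkovFlux H hk hw hz).mul ((measurable_vel hu H hk).comp m1)).mul
    ((measurable_deriv ρ).comp md)).add (((sign_measurable.comp (hw.sub hz)).mul
    (((measurable_src hu H hk).comp m1).sub (((H.f_continuous hk).measurable.comp hz).mul
      ((measurable_dvel hu H hk).comp m1)))).mul (hρ.measurable.comp md))

namespace Profile

variable {Θ ε B : ℝ} {w z : ℕ → ℝ → ℝ} {ρ : ℝ → ℝ}

theorem unit_meas (h : Profile M Θ w) : ∀ j ∈ M.lanes,Measurable fun p : Unit × ℝ => w j p.2 :=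
  fun j hj => (h.meas j hj).comp measurable_snd

theorem vel_measurable (hB : Bounds M Λ) (h : Profile M Θ w) (hk : k ∈ M.lanes) :
    Measurable (M.vel w k) :=
  (measurable_vel (u := fun j (_ : Unit) => w j) h.unit_meas hB.std hk).comp
    (measurable_prodMk_left (x := ()))

theorem dvel_measurable (hB : Bounds M Λ) (h : Profile M Θ w) (hk : k ∈ M.lanes) :
    Measurable (M.dvel w k) :=
  (measurable_dvel (u := fun j (_ : Unit) => w j) h.unit_meas hB.std hk).comp
    (measurable_prodMk_left (x := ()))

theorem le_sum (h : Profile M Θ w) (hk : k ∈ M.lanes) (x : ℝ) : w k x≤∑ j ∈ M.lanes,w j x :=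
  Finset.single_le_sum (fun j hj => (h.mem j hj x).1) hk

theorem f_abs_le (hB : Bounds M Λ) (h : Profile M Θ w) (hk : k ∈ M.lanes) (x : ℝ) :
    |M.f k (w k x)| ≤ Λ*w k x := by
  have := hB.f_lip k hk _ (h.mem k hk x) 0 (by simp)
  rw [sub_zero,abs_of_nonneg (h.mem k hk x).1] at this
  simpa [Model.f] using this

theorem abs_sub_le_add (h : Profile M Θ w) (h' : Profile M Θ z) (hk : k ∈ M.lanes) (x y : ℝ) :
    |w k x-z k y| ≤ w k x+z k y := by
  rw [abs_le]; constructor <;> linarith [(h.mem k hk x).1,(h'.mem k hk y).1]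

theorem boxLe_sum_fst (h : Profile M Θ w) (hε : 0 ≤ ε) :
    BoxLe ε (fun p => ∑ j ∈ M.lanes,w j p.1) (2*ε*(M.lanes.card*Θ)) := by
  refine (BoxLe.sum M.lanes (fun j hj => (BoxLe.fst hε (h.integrable j hj)).weaken
    (mul_mono_l (h.mass j hj) (by positivity)))).weaken (le_of_eq ?_)
  rw [Finset.sum_const,nsmul_eq_mul]; ring

theorem boxLe_sum_snd (h : Profile M Θ w) (hε : 0 ≤ ε) :
    BoxLe ε (fun p => ∑ j ∈ M.lanes,w j p.2) (2*ε*(M.lanes.card*Θ)) :=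
  (h.boxLe_sum_fst hε).swap

variable (hB : Bounds M Λ) (h : Profile M Θ w) (h' : Profile M Θ z) (hρ : Mollifier ε B ρ)
  (hk : k ∈ M.lanes)
include hB h h' hρ hk

theorem pairing_measurable : Measurable (M.pairing ρ w z k) :=
  (measurable_pairing (u := fun j (_ : Unit) x => w j x) (v := fun j (_ : Unit) x => z j x) hB.std
    h.unit_meas h'.unit_meas hk hρ.smooth.continuous).comp
    ((measurable_const (a := ((),()))).prodMk measurable_id)

theorem abs_pairing_le (p : ℝ × ℝ) :
    |M.pairing ρ w z k p|≤2*Λ^3*(B/ε^2+B/ε)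
      * (∑ j ∈ M.lanes,w j p.1+∑ j ∈ M.lanes,z j p.2)*box ε (p.1-p.2) := by
  have h1 := hB.one_le
  have hε := hρ.pos
  have hB0 := hρ.B_nonneg
  have a1 := h.le_sum hk p.1
  have a2 := h'.le_sum hk p.2
  have a3 := h.sum_nonneg p.1
  have a4 := h'.sum_nonneg p.2
  have b1 := hB.f_lip k hk _ (h.mem k hk p.1) _ (h'.mem k hk p.2)
  have b2 := h.abs_sub_le_add h' hk p.1 p.2
  have b3 := h.abs_src_le hB hk p.1
  have b5 := h.abs_dvel_le hB hk p.1
  have c1 := box_nonneg ε (p.1-p.2)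
  set W := ∑ j ∈ M.lanes,w j p.1
  set Z := ∑ j ∈ M.lanes,z j p.2
  have t1 : |M.kruzkovFlux k (w k p.1) (z k p.2)*M.vel w k p.1*deriv ρ (p.1-p.2)|
      ≤ Λ*(W+Z)*Λ*(B/ε^2*box ε (p.1-p.2)) := by
    rw [abs_mul,abs_mul]
    have := h.abs_vel_le hB hk p.1
    have := hρ.deriv_le_box (p.1-p.2)
    have d1 : |M.kruzkovFlux k (w k p.1) (z k p.2)| ≤ Λ*(W+Z) :=
      (abs_kruzkovFlux_le b1).trans (by gcongr; linarith)
    gcongr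
  have t2 : |Real.sign (w k p.1-z k p.2)*(M.src w k p.1-M.f k (z k p.2)*M.dvel w k p.1)
      * ρ (p.1-p.2)|≤(2*Λ*W+Λ*Z*(2*Λ^2))*(B/ε*box ε (p.1-p.2)) := by
    rw [abs_mul,abs_of_nonneg (hρ.nonneg _)]
    refine mul_le_mul ((abs_sign_mul_le _ _).trans ((abs_sub _ _).trans (add_le_add b3 ?_)))
      (hρ.le_box _) (hρ.nonneg _) (by positivity)
    rw [abs_mul]
    have : Λ*z k p.2 ≤ Λ*Z := by gcongr
    gcongr
    exact (h'.f_abs_le hB hk p.2).trans this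
  refine (abs_add_le _ _).trans ((add_le_add t1 t2).trans ?_)
  have e1 : Λ*(W+Z)*Λ*(B/ε^2*box ε (p.1-p.2))
      ≤ 2*Λ^3*(W+Z)*(B/ε^2*box ε (p.1-p.2)) := by
    have : Λ*(W+Z)*Λ≤2*Λ^3*(W+Z) := by
      have : Λ*Λ≤2*Λ^3 := by nlinarith
      nlinarith
    gcongr
  have e2 : (2*Λ*W+Λ*Z*(2*Λ^2))*(B/ε*box ε (p.1-p.2))
      ≤ 2*Λ^3*(W+Z)*(B/ε*box ε (p.1-p.2)) := by
    have : 2*Λ*W+Λ*Z*(2*Λ^2)≤2*Λ^3*(W+Z) := by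
      have : Λ ≤ Λ^3 := by nlinarith
      nlinarith
    gcongr
  refine (add_le_add e1 e2).trans (le_of_eq (by ring))

theorem pairing_integrable : Integrable (M.pairing ρ w z k) ∧
      |∫ p,M.pairing ρ w z k p|≤2*Λ^3*(B/ε^2+B/ε)
        * (2*ε*(M.lanes.card*Θ)+2*ε*(M.lanes.card*Θ)) := by
  have h1 := hB.one_le
  have hε := hρ.pos
  have hB0 := hρ.B_nonneg
  have hb := ((h.boxLe_sum_fst hε.le).add (h'.boxLe_sum_snd hε.le)).const_mul
    (c := 2*Λ^3*(B/ε^2+B/ε)) (by positivity)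
  have hi := hb.1.mono' (h.pairing_measurable hB h' hρ hk).aestronglyMeasurable
      (.of_forall fun p => h.abs_pairing_le hB h' hρ hk p)
  exact ⟨hi,abs_integral_le_integral_abs.trans ((integral_mono hi.abs hb.1 fun p =>
    h.abs_pairing_le hB h' hρ hk p).trans hb.2)⟩

end Profile
end Model

theorem Mollifier.deriv_eq_zero {ε B : ℝ} {ρ : ℝ → ℝ} (h : Mollifier ε B ρ) {r : ℝ}
    (hr : ε < |r|) : deriv ρ r=0 := by
  have := h.deriv_le_box r
  rw [box_of_lt hr,mul_zero] at this
  exact abs_eq_zero.1 (le_antisymm this (abs_nonneg _))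

namespace Model

variable {M : Model} {k : ℕ} {Λ Θ ε B : ℝ} {w z : ℕ → ℝ → ℝ} {ρ : ℝ → ℝ}

/-- First order Taylor remainder of the average of `z_k`. -/
noncomputable def avgTaylor (M : Model) (z : ℕ → ℝ → ℝ) (k : ℕ) (p : ℝ × ℝ) : ℝ :=
  |M.avg (z k) p.2-M.avg (z k) p.1-(p.2-p.1)*slope₀ (M.avg (z k)) p.1|

/-- The part of the doubled integrand that has zero integral. -/
noncomputable def nullPart (M : Model) (ρ : ℝ → ℝ) (w z : ℕ → ℝ → ℝ) (k : ℕ) (p : ℝ × ℝ) : ℝ :=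
  M.kruzkovFlux k (w k p.1) (z k p.1)*(M.vel w k p.1-M.vel z k p.1)*deriv ρ (p.1-p.2)
    + M.kruzkovFlux k (w k p.1) (z k p.1)*M.dvel z k p.1
      * ((p.1-p.2)*deriv ρ (p.1-p.2)+ρ (p.1-p.2))

/-- Upper bound for the doubled integrand after subtraction of `nullPart`. -/
noncomputable def excess (M : Model) (Λ B ε g : ℝ) (w z : ℕ → ℝ → ℝ) (k : ℕ) (p : ℝ × ℝ) : ℝ :=
  (Λ^3*g*(B/ε^2)+4*Λ^3*(B/ε))*|z k p.1-z k p.2|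
    + 3*Λ^4*B*(w k p.1+z k p.2)
    + Λ^2*(B/ε^2)*M.avgTaylor z k p
    + 2*Λ^3*(B/ε)*|M.avg (w k) p.1-M.avg (z k) p.1|
    + Λ^2*(B/ε)*|slope₀ (M.avg (w k)) p.1-slope₀ (M.avg (z k)) p.1|
    + 4*Λ^4*B*w k p.1
    + Λ^2*(B/ε)*|slope₀ (M.avg (z k)) p.1-slope₀ (M.avg (z k)) p.2|
    + 2*Λ*(B/ε)*(∑ j ∈ M.lanes,|w j p.1-z j p.1|)
    + 2*Λ*(B/ε)*(∑ j ∈ M.lanes,|z j p.1-z j p.2|)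
    + 2*Λ*(3*Λ*ε+2*Λ*g)*(B/ε)*(∑ j ∈ M.lanes,z j p.2)

namespace Profile

theorem avgTaylor_boxLe (hB : Bounds M Λ) (h : Profile M Θ z) (hε : 0 ≤ ε) (hk : k ∈ M.lanes) :
    BoxLe ε (M.avgTaylor z k) (2*ε*(Λ*Θ*ε^2)) := by
  have hc := hB.std.avg_integrable (h.integrable k hk)
  have hs := h.slope_integrable hB hk
  have hcm := h.avg_measurable hB hk
  have hsm := h.slope_measurable hB hk
  have hi : BoxLe ε (M.avgTaylor z k) _ :=
    (((BoxLe.snd hε hc.abs).add (BoxLe.fst hε hc.abs)).add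
      ((BoxLe.fst hε hs.abs).const_mul hε)).mono
    (((hcm.comp measurable_snd).sub (hcm.comp measurable_fst)).sub ((measurable_snd.sub
      measurable_fst).mul (hsm.comp measurable_fst))).abs.aestronglyMeasurable
    (fun _ => abs_nonneg _) fun p hp => by
      refine (abs_sub _ _).trans (add_le_add (abs_sub _ _) ?_)
      rw [abs_mul,abs_sub_comm]
      exact mul_mono_r hp (abs_nonneg _)
  refine BoxLe.of_shear hε (fun _ => abs_nonneg _) hi.1 fun r hr => ?_
  have h0 := (h.slope_translate hB hk)
  have := integral_taylor_le (h.avg_lip hB hk) hs h0 r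
  simp [avgTaylor]
  refine this.trans (mul_mono_l ?_ h0.nonneg)
  rw [← sq_abs]
  exact pow_le_pow_left₀ (abs_nonneg _) hr 2

variable (hB : Bounds M Λ) (h : Profile M Θ w) (h' : Profile M Θ z) (hρ : Mollifier ε B ρ)
  (hk : k ∈ M.lanes)
include hB h h' hρ hk

theorem integral_nullPart :
    Integrable (M.nullPart ρ w z k) ∧ ∫ p,M.nullPart ρ w z k p=0 := by
  have mK := measurable_kruzkovFlux hB.std hk (h.meas k hk) (h'.meas k hk)
  have h1 := hB.one_le
  have gen : ∀ {q r : ℝ → ℝ} {C : ℝ},Measurable q → (∀ x,|q x| ≤ C) → Integrable r →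
      ∫ x,r x=0 →
      Integrable (fun p : ℝ × ℝ => M.kruzkovFlux k (w k p.1) (z k p.1)*q p.1*r (p.1-p.2)) ∧
      ∫ p : ℝ × ℝ,M.kruzkovFlux k (w k p.1) (z k p.1)*q p.1*r (p.1-p.2)=0 := by
    intro q r C hq hC hr hr0
    have hK : Integrable fun x => M.kruzkovFlux k (w k x) (z k x) := by
      refine (((h.integrable k hk).add (h'.integrable k hk)).const_mul Λ).mono'
        mK.aestronglyMeasurable (.of_forall fun x => ?_)
      refine (abs_kruzkovFlux_le (hB.f_lip k hk _ (h.mem k hk x) _ (h'.mem k hk x))).trans ?_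
      exact mul_mono_l (h.abs_sub_le_add h' hk x x) (by linarith)
    have hKq : Integrable fun x => M.kruzkovFlux k (w k x) (z k x)*q x := by
      simp [mul_comm _ (q _)]
      exact hK.bdd_mul hq.aestronglyMeasurable (.of_forall hC)
    have hi := (integrable_mul_comp_sub hr hKq).swap
    have e : (fun p => M.kruzkovFlux k (w k p.1) (z k p.1)*q p.1*r (p.1-p.2))
        = (fun p => r (p.2-p.1)*(M.kruzkovFlux k (w k p.2) (z k p.2)*q p.2))
          ∘ Prod.swap := by
      funext p
      simp [Function.comp_apply]
      ring
    rw [e]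
    refine ⟨hi,?_⟩
    rw [Measure.volume_eq_prod,integral_prod _ hi]
    simp [integral_mul_const]
    simp_rw [fun x => integral_sub_left_eq_self (fun y => r y) volume x]
    simp [hr0]
  obtain ⟨i1,e1⟩ := gen (q := fun x => M.vel w k x-M.vel z k x)
    ((h.vel_measurable hB hk).sub (h'.vel_measurable hB hk))
    (fun x => (abs_sub _ _).trans (add_le_add (h.abs_vel_le hB hk x) (h'.abs_vel_le hB hk x)))
    hρ.integrable_deriv hρ.integral_deriv
  obtain ⟨i2,e2⟩ := gen (h'.dvel_measurable hB hk)
    (h'.abs_dvel_le hB hk) hρ.integrable_moment hρ.integral_moment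
  refine ⟨i1.add i2,?_⟩
  simp [nullPart]
  rw [integral_add i1 i2,e1,e2,add_zero]

theorem excess_boxLe :
    BoxLe ε (M.excess Λ B ε (M.gap w z) w z k)
      (B*(2*Λ^3*Θ+6*Λ^3+4*Λ+8*Λ^2*M.lanes.card*Θ)*M.gap w z
        + B*(20*Λ^4*Θ+12*Λ^3*Θ+4*Λ*M.lanes.card*Θ
          + 12*Λ^2*M.lanes.card*Θ)*ε) := by
  have h1 := hB.one_le
  have hg := gap_nonneg (M := M) w z
  have hε := hρ.pos
  have hB0 := hρ.B_nonneg
  have bw := (BoxLe.fst hε.le (h.integrable k hk)).weaken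
    (mul_mono_l (h.mass k hk) (by positivity))
  have bz2 := (BoxLe.snd hε.le (h'.integrable k hk)).weaken
    (mul_mono_l (h'.mass k hk) (by positivity))
  have bc := (BoxLe.fst hε.le ((hB.std.avg_integrable (h.integrable k hk)).sub
      (hB.std.avg_integrable (h'.integrable k hk))).abs).weaken
    (mul_mono_l (h.integral_avg_sub_le hB h' hk) (by positivity))
  have bs := (BoxLe.fst hε.le ((h.slope_integrable hB hk).sub (h'.slope_integrable hB hk)).abs).weaken
    (mul_mono_l (h.integral_slope_sub_le hB h' hk) (by positivity))
  have bss := BoxLe.translate hε.le (h'.slope_measurable hB hk) (h'.slope_integrable hB hk)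
    (h'.slope_translate hB hk)
  have bd : BoxLe ε (fun p => ∑ j ∈ M.lanes,|w j p.1-z j p.1|) (2*ε*M.gap w z) :=
    (BoxLe.sum M.lanes fun j hj => BoxLe.fst hε.le
      ((h.integrable j hj).sub (h'.integrable j hj)).abs).weaken
      (le_of_eq (by rw [gap,Finset.mul_sum]; rfl))
  have bzz : BoxLe ε (fun p => ∑ j ∈ M.lanes,|z j p.1-z j p.2|)
      (M.lanes.card*(2*ε*(Θ*ε))) :=
    (BoxLe.sum M.lanes fun j hj => BoxLe.translate hε.le (h'.meas j hj) (h'.integrable j hj)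
      (h'.translate j hj)).weaken (le_of_eq (by simp))
  have := (((((((((((BoxLe.translate hε.le (h'.meas k hk) (h'.integrable k hk) (h'.translate k hk)).const_mul (c := Λ^3*M.gap w z*(B/ε^2)+4*Λ^3*(B/ε))
    (by positivity)).add
    ((bw.add bz2).const_mul (c := 3*Λ^4*B) (by positivity))).add
    ((h'.avgTaylor_boxLe hB hε.le hk).const_mul (c := Λ^2*(B/ε^2)) (by positivity))).add
    (bc.const_mul (c := 2*Λ^3*(B/ε)) (by positivity))).add
    (bs.const_mul (c := Λ^2*(B/ε)) (by positivity))).add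
    (bw.const_mul (c := 4*Λ^4*B) (by positivity))).add
    (bss.const_mul (c := Λ^2*(B/ε)) (by positivity))).add
    (bd.const_mul (c := 2*Λ*(B/ε)) (by positivity))).add
    (bzz.const_mul (c := 2*Λ*(B/ε)) (by positivity))).add
    ((h'.boxLe_sum_snd hε.le).const_mul (c := 2*Λ*(3*Λ*ε+2*Λ*M.gap w z)*(B/ε)) (by positivity)))
  refine this.weaken (le_of_eq ?_)
  field_simp
  ring

theorem pairing_add_le_excess (p : ℝ × ℝ) :
    M.pairing ρ w z k p+M.pairing ρ z w k p.swap ≤ M.nullPart ρ w z k p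
      + M.excess Λ B ε (M.gap w z) w z k p*box ε (p.1-p.2) := by
  obtain ⟨x,y⟩ := p
  have hρ1 : ρ (y-x) = ρ (x-y) := by rw [← hρ.even,neg_sub]
  have hρ2 : deriv ρ (y-x) = -deriv ρ (x-y) := by rw [← hρ.deriv_neg,neg_sub]
  simp [pairing,nullPart]
  rw [hρ1,hρ2,kruzkovFlux_comm (z k y)]
  rcases lt_or_ge ε |x-y| with hd | hd
  · rw [box_of_lt hd,hρ.eq_zero hd,hρ.deriv_eq_zero hd]; simp
  have h1 := hB.one_le
  have hε := hρ.pos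
  have hB0 := hρ.B_nonneg
  have hg := gap_nonneg (M := M) w z
  have hbox := box_of_le hd
  have r1 := hρ.le_box (x-y)
  have r2 := hρ.deriv_le_box (x-y)
  have r3 := hρ.abs_moment_le (x-y)
  have r0 := hρ.nonneg (x-y)
  rw [hbox,mul_one] at r1 r2 r3
  rw [hbox,mul_one]
  have hwx := h.mem k hk x
  have hzx := h'.mem k hk x
  have hzy := h'.mem k hk y
  have a1 := abs_kruzkovFlux_sub_le (hB.f_lip k hk) hwx hzy hzx
  have a2 := abs_kruzkovFlux_le (hB.f_lip k hk _ hwx _ hzy)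
  have a3 := h.vel_sub_le hB h' hk x
  have a5 := h'.abs_dvel_le hB hk x
  have a6 := h.dvel_sub_le hB h' hk x
  have a7 := h'.dvel_sub_space_le hB hk x y
  have a9 := h'.f_abs_le hB hk y
  have a10 := h.f_abs_le hB hk x
  have a11 := h.abs_sub_le_add h' hk x y
  have a12 := h'.sum_nonneg y
  have a13 : ∑ j ∈ M.lanes,|w j x-z j y|≤∑ j ∈ M.lanes,|w j x-z j x|
      + ∑ j ∈ M.lanes,|z j x-z j y| := by
    rw [← Finset.sum_add_distrib]
    exact Finset.sum_le_sum fun j _ => abs_sub_le _ _ _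
  have hsg : Real.sign (z k y-w k x) = -Real.sign (w k x-z k y) := by
    rw [← Real.sign_neg,neg_sub]
  rw [hsg]
  simp [excess,avgTaylor]
  set Sd := ∑ j ∈ M.lanes,|w j x-z j x|
  set St := ∑ j ∈ M.lanes,|z j x-z j y|
  set Sz := ∑ j ∈ M.lanes,z j y
  set c₁ := |M.avg (w k) x-M.avg (z k) x|
  set c₂ := |slope₀ (M.avg (w k)) x-slope₀ (M.avg (z k)) x|
  set c₃ := |slope₀ (M.avg (z k)) x-slope₀ (M.avg (z k)) y|
  set τ := |M.avg (z k) y-M.avg (z k) x-(y-x)*slope₀ (M.avg (z k)) x| with hτ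
  have hK : M.kruzkovFlux k (w k x) (z k y)
      = Real.sign (w k x-z k y)*(M.f k (w k x)-M.f k (z k y)) := rfl
  set K := M.kruzkovFlux k (w k x) (z k y)
  set K0 := M.kruzkovFlux k (w k x) (z k x)
  set σ := Real.sign (w k x-z k y)
  set g := M.gap w z
  have hσ : ∀ q : ℝ,|σ*q| ≤ |q| := fun q => abs_sign_mul_le _ _
  have t1 : |(K-K0)*(M.vel w k x-M.vel z k x)*deriv ρ (x-y)|
      ≤ Λ^3*g*(B/ε^2)*|z k x-z k y| := by
    rw [abs_mul,abs_mul]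
    rw [abs_sub_comm (z k y)] at a1
    calc _ ≤ Λ*|z k x-z k y| * (Λ^2*g)*(B/ε^2) := by gcongr
      _ = _ := by ring
  have t2 : |K*(M.vel z k y-M.vel z k x-(y-x)*M.dvel z k x)*deriv ρ (x-y)|
      ≤ 3*Λ^4*B*(w k x+z k y)+Λ^2*(B/ε^2)*τ := by
    rw [abs_mul,abs_mul]
    have b1 : |K| ≤ Λ*(w k x+z k y) := a2.trans (by gcongr)
    have b2 : |K| ≤ Λ := by
      have : |w k x-z k y|≤1 := abs_le.2 ⟨by linarith [hwx.1,hzy.2],by linarith [hwx.2,hzy.1]⟩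
      exact a2.trans (mul_le_of_le_one_right (by linarith) this)
    have b3 : (y-x)^2 ≤ ε^2 := by
      rw [← sq_abs,abs_sub_comm]; exact pow_le_pow_left₀ (abs_nonneg _) hd 2
    calc _ ≤ |K| * (3*Λ^3*ε^2+Λ*τ)*(B/ε^2) := by
          gcongr
          exact (h'.vel_taylor hB hk x y).trans (by gcongr)
      _ = |K| * (3*Λ^3*B)+|K| * (Λ*τ*(B/ε^2)) := by field_simp
      _ ≤ Λ*(w k x+z k y)*(3*Λ^3*B)+Λ*(Λ*τ*(B/ε^2)) := by gcongr
      _ = _ := by ring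
  have t3 : |(K-K0)*M.dvel z k x*((x-y)*deriv ρ (x-y)+ρ (x-y))|
      ≤ 4*Λ^3*(B/ε)*|z k x-z k y| := by
    rw [abs_mul,abs_mul]
    rw [abs_sub_comm (z k y)] at a1
    calc _ ≤ Λ*|z k x-z k y| * (2*Λ^2)*(2*B/ε) := by gcongr
      _ = _ := by ring
  have t4 : |σ*(M.f k (z k y)*(M.dvel z k x-M.dvel w k x))*ρ (x-y)|
      ≤ 2*Λ^3*(B/ε)*c₁+Λ^2*(B/ε)*c₂ := by
    rw [abs_mul,abs_of_nonneg r0]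
    rw [abs_sub_comm] at a6
    have b1 := a9.trans (mul_le_of_le_one_right (by linarith) hzy.2)
    calc _≤(Λ*(2*Λ^2*c₁+Λ*c₂))*(B/ε) := by
          gcongr
          refine (hσ _).trans ?_
          rw [abs_mul]
          gcongr
      _ = _ := by ring
  have t5 : |σ*(M.f k (w k x)*(M.dvel z k y-M.dvel z k x))*ρ (x-y)|
      ≤ 4*Λ^4*B*w k x+Λ^2*(B/ε)*c₃ := by
    rw [abs_mul,abs_of_nonneg r0]
    rw [abs_sub_comm] at a7
    have b1 : |M.f k (w k x)| ≤ Λ := a10.trans (mul_le_of_le_one_right (by linarith) hwx.2)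
    have hw0 := hwx.1
    calc _≤(Λ*w k x*(4*Λ^3*ε)+Λ*(Λ*c₃))*(B/ε) := by
          gcongr
          refine (hσ _).trans ?_
          rw [abs_mul]
          calc _ ≤ |M.f k (w k x)| * (4*Λ^3*ε+Λ*c₃) := by
                gcongr
                exact a7.trans (by gcongr)
            _ = |M.f k (w k x)| * (4*Λ^3*ε)+|M.f k (w k x)| * (Λ*c₃) := by ring
            _ ≤ _ := by
                have := abs_nonneg (slope₀ (M.avg (z k)) x-slope₀ (M.avg (z k)) y)
                gcongr
      _ = _ := by field_simp
  have t6 : |σ*(M.src w k x-M.src z k y)*ρ (x-y)|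
      ≤ 2*Λ*(B/ε)*Sd+2*Λ*(B/ε)*St
        + 2*Λ*(3*Λ*ε+2*Λ*g)*(B/ε)*Sz := by
    rw [abs_mul,abs_of_nonneg r0]
    calc _≤(2*Λ*(Sd+St)+2*Λ*(3*Λ*ε+2*Λ*g)*Sz)*(B/ε) := by
          gcongr
          refine (hσ _).trans ((h.src_sub_le hB h' hk x y).trans ?_)
          gcongr
      _ = _ := by ring
  have id : K*M.vel w k x*deriv ρ (x-y)
        + σ*(M.src w k x-M.f k (z k y)*M.dvel w k x)*ρ (x-y)
        + (K*M.vel z k y*-deriv ρ (x-y)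
        + -σ*(M.src z k y-M.f k (w k x)*M.dvel z k y)*ρ (x-y))
      = K0*(M.vel w k x-M.vel z k x)*deriv ρ (x-y)
        + K0*M.dvel z k x*((x-y)*deriv ρ (x-y)+ρ (x-y))
      + (K-K0)*(M.vel w k x-M.vel z k x)*deriv ρ (x-y)
      - K*(M.vel z k y-M.vel z k x-(y-x)*M.dvel z k x)*deriv ρ (x-y)
      + (K-K0)*M.dvel z k x*((x-y)*deriv ρ (x-y)+ρ (x-y))
      + σ*(M.f k (z k y)*(M.dvel z k x-M.dvel w k x))*ρ (x-y)
      + σ*(M.f k (w k x)*(M.dvel z k y-M.dvel z k x))*ρ (x-y)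
      + σ*(M.src w k x-M.src z k y)*ρ (x-y) := by
    rw [hK]; ring
  have := le_abs_self ((K-K0)*(M.vel w k x-M.vel z k x)*deriv ρ (x-y))
  have := neg_abs_le (K*(M.vel z k y-M.vel z k x-(y-x)*M.dvel z k x)*deriv ρ (x-y))
  have := le_abs_self ((K-K0)*M.dvel z k x*((x-y)*deriv ρ (x-y)+ρ (x-y)))
  have := le_abs_self (σ*(M.f k (z k y)*(M.dvel z k x-M.dvel w k x))*ρ (x-y))
  have := le_abs_self (σ*(M.f k (w k x)*(M.dvel z k y-M.dvel z k x))*ρ (x-y))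
  linarith [le_abs_self (σ*(M.src w k x-M.src z k y)*ρ (x-y))]

/-- Stability: the entropy production of two profiles against each other. -/
theorem pairing_add_le :
    (∫ p,M.pairing ρ w z k p)+∫ p,M.pairing ρ z w k p ≤
      B*(2*Λ^3*Θ+6*Λ^3+4*Λ+8*Λ^2*M.lanes.card*Θ)*M.gap w z
        + B*(20*Λ^4*Θ+12*Λ^3*Θ+4*Λ*M.lanes.card*Θ
          + 12*Λ^2*M.lanes.card*Θ)*ε := by
  have i1 := (h.pairing_integrable hB h' hρ hk).1
  have i2 := (h'.pairing_integrable hB h hρ hk).1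
  have e2 : ∫ p,M.pairing ρ z w k p=∫ p : ℝ × ℝ,M.pairing ρ z w k p.swap :=
    (integral_prod_swap _).symm
  have i2' : Integrable fun p : ℝ × ℝ => M.pairing ρ z w k p.swap := i2.swap
  obtain ⟨i3,e3⟩ := h.integral_nullPart hB h' hρ hk
  have i4 := h.excess_boxLe hB h' hρ hk
  rw [e2,← integral_add i1 i2']
  calc _≤∫ p : ℝ × ℝ,(M.nullPart ρ w z k p
        + M.excess Λ B ε (M.gap w z) w z k p*box ε (p.1-p.2)) :=
        integral_mono (i1.add i2') (i3.add i4.1) fun p => h.pairing_add_le_excess hB h' hρ hk p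
    _ ≤ _ := by rw [integral_add i3 i4.1,e3,zero_add]; exact i4.2

end Profile
end Model

/-! ### Doubling of the time variable -/

theorem intervalIntegrable_of_bound {f : ℝ → ℝ} {b : ℝ} (hf : Measurable f) (hb : ∀ t,|f t| ≤ b)
    (a c : ℝ) : IntervalIntegrable f volume a c :=
  ⟨Integrable.of_bound hf.aestronglyMeasurable b (.of_forall hb),
    Integrable.of_bound hf.aestronglyMeasurable b (.of_forall hb)⟩

theorem abs_intervalIntegral_le {f : ℝ → ℝ} {b : ℝ} (hb : ∀ t,|f t| ≤ b) (a c : ℝ) :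
    |∫ t in a..c,f t| ≤ b*|c-a| := by
  simpa [Real.norm_eq_abs] using intervalIntegral.norm_integral_le_of_norm_le_const (f := f)
    fun t _ => hb t

/-- A function with quadratically small increments does not increase. -/
theorem le_of_increment_le_sq {F : ℝ → ℝ} {C T : ℝ} (hT : 0 ≤ T)
    (h : ∀ a b,0 ≤ a → a ≤ b → b ≤ T → F b-F a ≤ C*(b-a)^2) : F T ≤ F 0 := by
  rw [← sub_nonpos]
  refine ge_of_tendsto (tendsto_const_div_atTop_nhds_zero_nat (C*T^2)) ?_
  filter_upwards [eventually_gt_atTop 0] with n hn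
  have hn' : (0 : ℝ) < n := by exact_mod_cast hn
  have e := Finset.sum_range_sub (fun i => F (i*(T/n))) n
  rw [Nat.cast_zero,zero_mul,mul_div_cancel₀ _ hn'.ne'] at e
  rw [← e]
  refine (Finset.sum_le_sum (g := fun _ => C*(T/n)^2) fun i hi => ?_).trans (le_of_eq ?_)
  · have h1 : ((i+1 : ℕ) : ℝ) ≤ n := by exact_mod_cast Finset.mem_range.1 hi
    refine (h _ _ (by positivity) (by gcongr; omega) ?_).trans (le_of_eq ?_)
    · calc _ ≤ n*(T/n) := by gcongr
        _ = T := mul_div_cancel₀ _ hn'.ne'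
    · push_cast; ring
  · rw [Finset.sum_const,Finset.card_range,nsmul_eq_mul]
    field_simp

theorem gronwall_of_increment {G : ℝ → ℝ} {C ε K T : ℝ} (hC : 1 ≤ C) (hT : 0 ≤ T) (hε : 0 ≤ ε)
    (hK : 0 ≤ K) (hG : ∀ t,0 ≤ G t) (h : ∀ a b,0 ≤ a → a ≤ b → b ≤ T →
      G b-G a≤(b-a)*(C*G a+ε)+K*(b-a)^2) :
    G T ≤ Real.exp (C*T)*(G 0+ε) := by
  have := le_of_increment_le_sq (F := fun t => Real.exp (-(C*t))*(G t+ε)) hT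
    fun a b ha hab hb => by
      have h1 : G b+ε ≤ Real.exp (C*(b-a))*(G a+ε)+K*(b-a)^2 := by
        have h2 := mul_mono_r (Real.add_one_le_exp (C*(b-a)))
          (add_nonneg (hG a) hε)
        have h3 := mul_nonneg (sub_nonneg.2 hab) (mul_nonneg (sub_nonneg.2 hC) hε)
        linarith [h a b ha hab hb]
      have e : Real.exp (-(C*b))*Real.exp (C*(b-a)) = Real.exp (-(C*a)) := by
        rw [← Real.exp_add]; ring_nf
      have h4 : Real.exp (-(C*b))≤1 :=
        Real.exp_le_one_iff.2 (neg_nonpos.2 (mul_nonneg (by linarith) (by linarith)))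
      have h5 := mul_mono_l h1 (Real.exp_pos (-(C*b))).le
      rw [mul_add (Real.exp _),mul_add (Real.exp _) (_*_),← mul_assoc,e] at h5
      linarith [mul_le_of_le_one_left (by positivity : 0 ≤ K*(b-a)^2) h4]
  simp [mul_zero] at this
  rw [Real.exp_neg,inv_mul_le_iff₀ (Real.exp_pos _)] at this
  linarith

/-- Measurable functions of one variable with absolute value at most `b`. -/
def Tame (b : ℝ) (f : ℝ → ℝ) : Prop := Measurable f ∧ ∀ t,|f t| ≤ b

/-- Measurable functions of two variables with absolute value at most `b`. -/
def Tame₂ (b : ℝ) (F : ℝ → ℝ → ℝ) : Prop := Measurable (Function.uncurry F) ∧ ∀ t s,|F t s| ≤ b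

section TimeDoubling

variable {F Φ p q : ℝ → ℝ → ℝ} {f g : ℝ → ℝ} {b b' T C κ δ L h r τ : ℝ}

namespace Tame

theorem ii (hf : Tame b f) (a c : ℝ) : IntervalIntegrable f volume a c :=
  intervalIntegrable_of_bound hf.1 hf.2 a c

theorem abs_window_sub_le (hf : Tame b f) (σ τ h : ℝ) :
    |(∫ t in σ..(σ+h),f t)-∫ t in τ..(τ+h),f t|≤2*b*|σ-τ| := by
  rw [intervalIntegral.integral_interval_sub_interval_comm (hf.ii _ _) (hf.ii _ _) (hf.ii _ _)]
  have g1 := abs_intervalIntegral_le hf.2 σ τ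
  have g2 := abs_intervalIntegral_le hf.2 (σ+h) (τ+h)
  rw [add_sub_add_right_eq_sub] at g2
  rw [abs_sub_comm] at g1 g2
  linarith [abs_sub (∫ t in σ..τ,f t) (∫ t in (σ+h)..(τ+h),f t)]

theorem window_affine (hf : Tame b f) (c d τ h : ℝ) :
    ∫ t in τ..(τ+h),(c*f t+d) = c*(∫ t in τ..(τ+h),f t)+h*d := by
  rw [intervalIntegral.integral_add ((hf.ii _ _).const_mul c) intervalIntegrable_const,
    intervalIntegral.integral_const_mul,intervalIntegral.integral_const,add_sub_cancel_left,
    smul_eq_mul]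

theorem affine_ii (hf : Tame b f) (c d x y : ℝ) :
    IntervalIntegrable (fun t => c*f t+d) volume x y :=
  ((hf.ii x y).const_mul c).add intervalIntegrable_const

theorem slide_le (hf : Tame b' f) (hg : Tame b g) (hh : 0 ≤ h) (hr : 0 ≤ r)
    (hinc : ∀ t ∈ Icc τ (τ+r),f (t+h)-f t≤(∫ x in t..(t+h),g x)+δ) :
    (∫ t in (τ+r)..(τ+r+h),f t)-∫ t in τ..(τ+h),f t
      ≤ r*((∫ t in τ..(τ+h),g t)+δ)+2*b*r^2 := by
  have hb0 := (abs_nonneg _).trans (hg.2 0)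
  have fh : Tame b' fun t => f (t+h) := ⟨hf.1.comp (measurable_id.add_const h),fun t => hf.2 _⟩
  have e1 : (∫ t in (τ+r)..(τ+r+h),f t)-∫ t in τ..(τ+h),f t
      = ∫ t in τ..(τ+r),(f (t+h)-f t) := by
    rw [intervalIntegral.integral_sub (fh.ii _ _) (hf.ii _ _),
      intervalIntegral.integral_comp_add_right,intervalIntegral.integral_interval_sub_interval_comm'
      (hf.ii _ _) (hf.ii _ _) (hf.ii _ _),add_right_comm]
  rw [e1]
  refine (intervalIntegral.integral_mono_on (by linarith) ((fh.ii _ _).sub (hf.ii _ _))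
    (intervalIntegrable_const (c := (∫ x in τ..(τ+h),g x)+δ+2*b*r)) fun t ht => ?_).trans
    (le_of_eq ?_)
  · have h1 := (abs_le.1 (hg.abs_window_sub_le t τ h)).2
    rw [abs_of_nonneg (by linarith [ht.1])] at h1
    have : 2*b*(t-τ)≤2*b*r := by gcongr; linarith [ht.2]
    linarith [hinc t ht]
  · rw [intervalIntegral.integral_const,smul_eq_mul]; ring

end Tame

namespace Tame₂

theorem sec (hF : Tame₂ b F) (t : ℝ) : Tame b (F t) := ⟨hF.1.comp measurable_prodMk_left,hF.2 t⟩

theorem swap (hF : Tame₂ b F) : Tame₂ b fun s t => F t s :=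
  ⟨hF.1.comp measurable_swap,fun s t => hF.2 t s⟩

theorem window (hF : Tame₂ b F) (c : ℝ) (hh : 0 ≤ h) : Tame (b*h) fun t => ∫ s in c..(c+h),F t s := by
  refine ⟨?_,fun t => by simpa [abs_of_nonneg hh] using abs_intervalIntegral_le (hF.2 t) c (c+h)⟩
  exact (hF.1.stronglyMeasurable.integral_prod_right (ν := volume.restrict (Ioc c (c+h)))).measurable.sub
    (hF.1.stronglyMeasurable.integral_prod_right (ν := volume.restrict (Ioc (c+h) c))).measurable

theorem sum {ι : Type*} {A : Finset ι} {F : ι → ℝ → ℝ → ℝ} (hF : ∀ k ∈ A,Tame₂ b (F k)) :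
    Tame₂ (A.card*b) fun t s => ∑ k ∈ A,F k t s := by
  refine ⟨?_,fun t s => (Finset.abs_sum_le_sum_abs _ _).trans
    ((Finset.sum_le_card_nsmul A _ b fun k hk => (hF k hk).2 t s).trans_eq (nsmul_eq_mul _ _))⟩
  exact Finset.measurable_fun_sum _ fun k hk => (hF k hk).1

theorem mono (hF : Tame₂ b F) (h : b ≤ b') : Tame₂ b' F := ⟨hF.1,fun t s => (hF.2 t s).trans h⟩

end Tame₂

/-- Integral over the square `[τ, τ + h]²`. -/
noncomputable def squareIntegral (F : ℝ → ℝ → ℝ) (h τ : ℝ) : ℝ :=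
  ∫ t in τ..(τ+h),∫ s in τ..(τ+h),F t s

theorem squareIntegral_step (hΦ : Tame₂ b Φ) (hp : Tame₂ b p) (hq : Tame₂ b q)
    (h1 : ∀ s t₁ t₂,0 ≤ t₁ → t₁ ≤ t₂ → t₂ ≤ T → Φ t₂ s-Φ t₁ s≤(∫ t in t₁..t₂,p t s)+δ)
    (h2 : ∀ t s₁ s₂,0 ≤ s₁ → s₁ ≤ s₂ → s₂ ≤ T → Φ t s₂-Φ t s₁≤(∫ s in s₁..s₂,q t s)+δ)
    (h3 : ∀ t s,p t s+q t s ≤ C*Φ t s+κ) (hh : 0 ≤ h) (hr : 0 ≤ r)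
    (hτ : 0 ≤ τ) (hT : τ+r+h ≤ T) :
    squareIntegral Φ h (τ+r)-squareIntegral Φ h τ
      ≤ r*(C*squareIntegral Φ h τ+(κ*h^2+2*h*δ))+6*b*h*r^2 := by
  have W : ∀ {F},Tame₂ b F → Tame (b*h) fun t => ∫ s in τ..(τ+h),F t s :=
    fun hF => hF.window τ hh
  have A : (∫ t in (τ+r)..(τ+r+h),∫ s in (τ+r)..(τ+r+h),Φ t s)
      - (∫ t in (τ+r)..(τ+r+h),∫ s in τ..(τ+h),Φ t s)
      ≤ r*squareIntegral q h τ+r*h*δ+4*b*h*r^2 := by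
    rw [← intervalIntegral.integral_sub ((hΦ.window _ hh).ii _ _) ((W hΦ).ii _ _)]
    refine (intervalIntegral.integral_mono_on (by linarith) (((hΦ.window (τ+r) hh).ii (τ+r) (τ+r+h)).sub ((W hΦ).ii _ _)) ((W hq).affine_ii r
      (r*δ+2*b*r^2) _ _) fun t _ => ?_).trans ?_
    · linarith [(hΦ.sec t).slide_le (hq.sec t) hh hr (τ := τ) fun s hs =>
        h2 t s (s+h) (by linarith [hs.1]) (by linarith) (by linarith [hs.2])]
    · have g := (abs_le.1 ((W hq).abs_window_sub_le (τ+r) τ h)).2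
      rw [add_sub_cancel_left,abs_of_nonneg hr] at g
      rw [(W hq).window_affine,squareIntegral]
      linarith [mul_mono_l g hr]
  have B : (∫ t in (τ+r)..(τ+r+h),∫ s in τ..(τ+h),Φ t s)-squareIntegral Φ h τ
      ≤ r*(squareIntegral p h τ+h*δ)+2*(b*h)*r^2 :=
    (W hΦ).slide_le (W hp) hh hr fun t ht => by
      have hsw : ∫ t' in t..(t+h),∫ s in τ..(τ+h),p t' s
          = ∫ s in τ..(τ+h),∫ t' in t..(t+h),p t' s := by
        simp [intervalIntegral.integral_of_le (le_add_of_nonneg_right hh)]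
        exact integral_integral_swap (.of_bound hp.1.aestronglyMeasurable b
          (.of_forall fun z => hp.2 z.1 z.2))
      have pw := hp.swap.window t hh
      rw [hsw,← intervalIntegral.integral_sub ((hΦ.sec _).ii _ _) ((hΦ.sec _).ii _ _),← one_mul
        (∫ s in τ..(τ+h),∫ t' in t..(t+h),p t' s),← pw.window_affine]
      refine intervalIntegral.integral_mono_on (by linarith) (((hΦ.sec _).ii _ _).sub
        ((hΦ.sec _).ii _ _)) (pw.affine_ii _ _ _ _) fun s _ => ?_
      rw [one_mul]
      exact h1 s t (t+h) (by linarith [ht.1]) (by linarith) (by linarith [ht.2])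
  have Csum : squareIntegral p h τ+squareIntegral q h τ
      ≤ C*squareIntegral Φ h τ+h*(h*κ) := by
    simp [squareIntegral]
    rw [← intervalIntegral.integral_add ((W hp).ii _ _) ((W hq).ii _ _),← (W hΦ).window_affine]
    refine intervalIntegral.integral_mono_on (by linarith) (((W hp).ii _ _).add ((W hq).ii _ _))
      ((W hΦ).affine_ii _ _ _ _) fun t _ => ?_
    rw [← intervalIntegral.integral_add ((hp.sec t).ii _ _) ((hq.sec t).ii _ _),
      ← (hΦ.sec t).window_affine]
    exact intervalIntegral.integral_mono_on (by linarith) (((hp.sec t).ii _ _).add ((hq.sec t).ii _ _))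
      ((hΦ.sec t).affine_ii _ _ _ _) fun s _ => h3 t s
  have := mul_mono_l Csum hr
  rw [show squareIntegral Φ h (τ+r)
      = ∫ t in (τ+r)..(τ+r+h),∫ s in (τ+r)..(τ+r+h),Φ t s from rfl]
  linarith

/-- Grönwall's inequality for functions of two times. -/
theorem doubled_gronwall (hΦ : Tame₂ b Φ) (hp : Tame₂ b p) (hq : Tame₂ b q)
    (h1 : ∀ s t₁ t₂,0 ≤ t₁ → t₁ ≤ t₂ → t₂ ≤ T → Φ t₂ s-Φ t₁ s≤(∫ t in t₁..t₂,p t s)+δ)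
    (h2 : ∀ t s₁ s₂,0 ≤ s₁ → s₁ ≤ s₂ → s₂ ≤ T → Φ t s₂-Φ t s₁≤(∫ s in s₁..s₂,q t s)+δ)
    (h3 : ∀ t s,p t s+q t s ≤ C*Φ t s+κ)
    (hL : ∀ t s t' s',|Φ t s-Φ t' s'| ≤ L*(|t-t'| + |s-s'|)+2*δ)
    (hC : 1 ≤ C) (hκ : 0 ≤ κ) (hδ : 0 ≤ δ) (hL0 : 0 ≤ L) (hΦ0 : ∀ t s,0 ≤ Φ t s) (hh : 0 < h)
    (hhT : h ≤ T) {t : ℝ} (ht : t ∈ Icc 0 T) :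
    Φ t t ≤ Real.exp (C*T)*(Φ 0 0+κ+6*L*h+6*δ+2*δ/h) := by
  have hb0 := (abs_nonneg _).trans (hΦ.2 0 0)
  set G := squareIntegral Φ h with hG
  have gron : ∀ τ,0 ≤ τ → τ ≤ T-h → G τ ≤ Real.exp (C*τ)*(G 0+(κ*h^2+2*h*δ)) :=
    fun τ h0 hτ => gronwall_of_increment (K := 6*b*h) hC h0 (by positivity) (by positivity)
      (fun t => intervalIntegral.integral_nonneg (by linarith) fun t _ =>
        intervalIntegral.integral_nonneg (by linarith) fun s _ => hΦ0 t s) fun a c ha hac hc => by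
      have := squareIntegral_step hΦ hp hq h1 h2 h3 hh.le (sub_nonneg.2 hac) ha (by linarith)
      rwa [add_sub_cancel] at this
  have corner : ∀ τ,|G τ-h^2*Φ τ τ| ≤ h^2*(2*L*h+2*δ) := fun τ => by
    have mean : ∀ {f : ℝ → ℝ} {b c d : ℝ},Tame b f → (∀ t ∈ Icc τ (τ+h),|f t-c| ≤ d) →
        |(∫ t in τ..(τ+h),f t)-h*c| ≤ h*d := fun {f b c d} hf hd => by
      have := intervalIntegral.norm_integral_le_of_norm_le_const (b := τ+h)
        (f := fun t => 1*f t+-c) fun t ht => by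
          rw [uIoc_of_le (by linarith)] at ht
          rw [one_mul,← sub_eq_add_neg]
          exact hd t ⟨ht.1.le,ht.2⟩
      rwa [hf.window_affine,one_mul,mul_neg,← sub_eq_add_neg,add_sub_cancel_left,abs_of_pos hh,
        mul_comm d] at this
    have := mean (hΦ.window τ hh.le) fun t ht => mean (hΦ.sec t) fun s hs =>
      show |Φ t s-Φ τ τ|≤2*L*h+2*δ from (hL t s τ τ).trans (by
        rw [abs_of_nonneg (by linarith [ht.1]),abs_of_nonneg (by linarith [hs.1])]
        nlinarith [ht.2,hs.2])
    rw [← mul_assoc,← mul_assoc,← sq] at this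
    exact this
  have hE1 : 1 ≤ Real.exp (C*T) := Real.one_le_exp (mul_nonneg (by linarith) (by linarith))
  have hX : 0 ≤ L*h := by positivity
  have main : ∀ τ,0 ≤ τ → τ ≤ T-h → Φ τ τ
      ≤ Real.exp (C*T)*(Φ 0 0+κ+2*L*h+2*δ+2*δ/h)+2*L*h+2*δ := by
    intro τ h0 hτ
    have c1 := (abs_le.1 (corner τ)).1
    have c0 := (abs_le.1 (corner 0)).2
    refine le_of_mul_le_mul_left (a := h^2) ?_ (by positivity)
    have e1 : G 0+(κ*h^2+2*h*δ)
        ≤ h^2*(Φ 0 0+κ+2*L*h+2*δ+2*δ/h) := by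
      have : h^2*(2*δ/h)=2*h*δ := by field_simp
      linarith
    have e2 := (gron τ h0 hτ).trans (mul_le_mul (Real.exp_le_exp.2 (mul_mono_l
      (by linarith : τ ≤ T) (by linarith))) e1 (add_nonneg (intervalIntegral.integral_nonneg
      (by linarith) fun t _ => intervalIntegral.integral_nonneg (by linarith) fun s _ => hΦ0 t s)
      (by positivity)) (Real.exp_pos _).le)
    linarith
  rcases le_total t (T-h) with htT | htT
  · nlinarith [main t ht.1 htT]
  · have m1 := main (T-h) (by linarith) le_rfl
    have m2 := (abs_le.1 (hL t t (T-h) (T-h))).2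
    rw [abs_of_nonneg (by linarith)] at m2
    have m4 := mul_mono_l (show t-(T-h) ≤ h by linarith [ht.2]) hL0
    nlinarith

end TimeDoubling

/-! ### The mollified distance -/

/-- `∫∫ |a(x) - b(y)| ρ(x - y) dx dy`. -/
noncomputable def laneGap (ρ a b : ℝ → ℝ) : ℝ := ∫ p : ℝ × ℝ,|a p.1-b p.2| * ρ (p.1-p.2)

namespace Mollifier

variable {ε B : ℝ} {ρ a b c : ℝ → ℝ}

theorem integral_snd_mul (h : Mollifier ε B ρ) {q : ℝ → ℝ} (hq : Integrable q) :
    Integrable (fun p : ℝ × ℝ => q p.2*ρ (p.1-p.2)) ∧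
      ∫ p : ℝ × ℝ,q p.2*ρ (p.1-p.2)=∫ x,q x := by
  have e : (fun p : ℝ × ℝ => q p.2*ρ (p.1-p.2)) = fun p => ρ (p.2-p.1)*q p.2 := by
    funext p; rw [← h.even,neg_sub,mul_comm]
  have h1 := integrable_mul_comp_sub h.integrable hq
  rw [e]
  refine ⟨h1,?_⟩
  rw [Measure.volume_eq_prod,integral_prod_symm _ h1]
  simp [integral_mul_const]
  simp_rw [fun y => integral_sub_left_eq_self (fun x => ρ x) volume y]
  rw [integral_const_mul,h.integral,one_mul]

theorem integral_fst_mul (h : Mollifier ε B ρ) {q : ℝ → ℝ} (hq : Integrable q) :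
    Integrable (fun p : ℝ × ℝ => q p.1*ρ (p.1-p.2)) ∧
      ∫ p : ℝ × ℝ,q p.1*ρ (p.1-p.2)=∫ x,q x := by
  obtain ⟨h1,h2⟩ := h.integral_snd_mul hq
  have e : (fun p => q p.1*ρ (p.1-p.2))
      = (fun p => q p.2*ρ (p.1-p.2)) ∘ Prod.swap := by
    funext p
    simp only [Function.comp_apply,Prod.fst_swap,Prod.snd_swap]
    rw [← h.even,neg_sub]
  refine ⟨by rw [e]; exact h1.swap,?_⟩
  rw [e,← h2]
  exact integral_prod_swap
    (fun p => q p.2*ρ (p.1-p.2))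

theorem laneGap_integrable (h : Mollifier ε B ρ) (ha : Integrable a) (hb : Integrable b)
    (ma : Measurable a) (mb : Measurable b) :
    Integrable fun p : ℝ × ℝ => |a p.1-b p.2| * ρ (p.1-p.2) :=
  ((h.integral_fst_mul ha.abs).1.add (h.integral_snd_mul hb.abs).1).mono'
    (((ma.comp measurable_fst).sub (mb.comp measurable_snd)).abs.mul
      (h.measurable.comp (measurable_fst.sub measurable_snd))).aestronglyMeasurable
    (.of_forall fun p => by
      rw [Real.norm_eq_abs,abs_mul,abs_abs,abs_of_nonneg (h.nonneg _),Pi.add_apply,← add_mul]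
      exact mul_mono_r (abs_sub _ _) (h.nonneg _))

theorem laneGap_nonneg (h : Mollifier ε B ρ) (a b : ℝ → ℝ) : 0 ≤ laneGap ρ a b :=
  integral_nonneg fun _ => mul_nonneg (abs_nonneg _) (h.nonneg _)

theorem laneGap_comm (h : Mollifier ε B ρ) (a b : ℝ → ℝ) : laneGap ρ a b = laneGap ρ b a := by
  refine Eq.trans (integral_congr_ae (.of_forall fun p => ?_))
    (integral_prod_swap
      (fun p => |b p.1-a p.2| * ρ (p.1-p.2)))
  simp [Prod.fst_swap]
  rw [← h.even (p.1-p.2),neg_sub,abs_sub_comm]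

theorem abs_laneGap_sub_le (h : Mollifier ε B ρ) (ha : Integrable a) (hb : Integrable b)
    (hc : Integrable c) (ma : Measurable a) (mb : Measurable b) (mc : Measurable c) :
    |laneGap ρ a c-laneGap ρ b c|≤∫ x,|a x-b x| := by
  obtain ⟨h1,h2⟩ := h.integral_fst_mul (ha.sub hb).abs
  have i1 := h.laneGap_integrable ha hc ma mc
  have i2 := h.laneGap_integrable hb hc mb mc
  rw [laneGap,laneGap,← integral_sub i1 i2]
  refine abs_integral_le_integral_abs.trans ((integral_mono (i1.sub i2).abs h1 fun p => ?_).trans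
    h2.le)
  simp [Pi.sub_apply]
  rw [← sub_mul,abs_mul,abs_of_nonneg (h.nonneg _)]
  refine mul_mono_r ((abs_abs_sub_abs_le _ _).trans (le_of_eq ?_)) (h.nonneg _)
  congr 1; ring

theorem abs_laneGap_sub_integral_le (h : Mollifier ε B ρ) {K : ℝ} (ha : Integrable a)
    (hb : Integrable b) (ma : Measurable a) (mb : Measurable b) (hK : TranslateLe b K) :
    |laneGap ρ a b-(∫ x,|a x-b x|)|≤2*B*K*ε := by
  obtain ⟨h1,h2⟩ := h.integral_fst_mul (ha.sub hb).abs
  have hbox := (BoxLe.translate h.pos.le mb hb hK).const_mul (c := B/ε)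
    (div_nonneg h.B_nonneg h.pos.le)
  have i1 := h.laneGap_integrable ha hb ma mb
  simp [Pi.sub_apply] at h1 h2
  rw [← h2,laneGap,← integral_sub i1 h1]
  refine abs_integral_le_integral_abs.trans ((integral_mono (i1.sub h1).abs hbox.1
    fun p => ?_).trans (hbox.2.trans (le_of_eq ?_)))
  · simp only [Pi.sub_apply]
    rw [← sub_mul,abs_mul,abs_of_nonneg (h.nonneg _),mul_right_comm,mul_comm]
    refine mul_le_mul (h.le_box _) ((abs_abs_sub_abs_le _ _).trans (le_of_eq ?_)) (abs_nonneg _)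
      (mul_nonneg (div_nonneg h.B_nonneg h.pos.le) (box_nonneg _ _))
    congr 1; ring
  · have := h.pos.ne'
    field_simp

end Mollifier

namespace Model

/-! ### Approximate entropy solutions -/

/-- Profiles depending on time, with the entropy inequality tested against the profiles of
bounded variation, up to an error `δ`. -/
structure Curve (M : Model) (T Θ : ℝ) (ρ : ℝ → ℝ) (δ : ℝ) (u : ℕ → ℝ → ℝ → ℝ) : Prop where
  meas : ∀ k ∈ M.lanes,Measurable fun p : ℝ × ℝ => u k p.1 p.2
  profile : ∀ t,Profile M Θ fun k => u k t
  move : ∀ s t,M.gap (u · s) (u · t) ≤ Θ*|s-t| + δ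
  entropy : ∀ z,Profile M Θ z → ∀ k ∈ M.lanes,∀ t₁ t₂,0 ≤ t₁ → t₁ ≤ t₂ → t₂ ≤ T →
    laneGap ρ (u k t₂) (z k)-laneGap ρ (u k t₁) (z k)
      ≤ (∫ t in t₁..t₂,∫ p,M.pairing ρ (u · t) z k p)+δ

namespace Curve

variable {M : Model} {T Θ δ ε B Λ : ℝ} {ρ : ℝ → ℝ} {u v : ℕ → ℝ → ℝ → ℝ} {k : ℕ}

theorem tame_pairing (hB : Bounds M Λ) (hρ : Mollifier ε B ρ) (hu : Curve M T Θ ρ δ u)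
    (hv : Curve M T Θ ρ δ v) (hk : k ∈ M.lanes) :
    Tame₂ (2*Λ^3*(B/ε^2+B/ε)*(2*ε*(M.lanes.card*Θ)
      + 2*ε*(M.lanes.card*Θ))) fun t s => ∫ p,M.pairing ρ (u · t) (v · s) k p :=
  ⟨((measurable_pairing hB.std hu.meas hv.meas hk
    hρ.smooth.continuous).stronglyMeasurable.integral_prod_right).measurable,
    fun t s => ((hu.profile t).pairing_integrable hB (hv.profile s) hρ hk).2⟩

theorem measurable_laneGap (hρ : Mollifier ε B ρ) (hu : Curve M T Θ ρ δ u)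
    (hv : Curve M T Θ ρ δ v) (hk : k ∈ M.lanes) : Measurable (Function.uncurry fun t s =>
      laneGap ρ (u k t) (v k s)) := by
  have m : Measurable fun q : (ℝ × ℝ) × (ℝ × ℝ) =>
      |u k q.1.1 q.2.1-v k q.1.2 q.2.2| * ρ (q.2.1-q.2.2) := by
    have m1 : Measurable fun q : (ℝ × ℝ) × (ℝ × ℝ) => (q.1.1,q.2.1) := by fun_prop
    have m2 : Measurable fun q : (ℝ × ℝ) × (ℝ × ℝ) => (q.1.2,q.2.2) := by fun_prop
    exact (((hu.meas k hk).comp m1).sub ((hv.meas k hk).comp m2)).abs.mul (hρ.measurable.comp (by fun_prop))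
  exact m.stronglyMeasurable.integral_prod_right.measurable

theorem increment_sum_le (hB : Bounds M Λ) (hρ : Mollifier ε B ρ) (hu : Curve M T Θ ρ δ u)
    (hv : Curve M T Θ ρ δ v) (hδ : 0 ≤ δ) (s : ℝ) {t₁ t₂ : ℝ} (h1 : 0 ≤ t₁) (h2 : t₁ ≤ t₂)
    (h3 : t₂ ≤ T) :
    (∑ k ∈ M.lanes,laneGap ρ (u k t₂) (v k s))-∑ k ∈ M.lanes,laneGap ρ (u k t₁) (v k s)
      ≤ (∫ t in t₁..t₂,∑ k ∈ M.lanes,∫ p,M.pairing ρ (u · t) (v · s) k p)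
        + (M.lanes.card+1)*δ := by
  have hi : ∀ k ∈ M.lanes,IntervalIntegrable (fun t => ∫ p,M.pairing ρ (u · t)
      (v · s) k p) volume t₁ t₂ := fun k hk =>
    ((tame_pairing hB hρ hu hv hk).swap.sec s).ii _ _
  rw [intervalIntegral.integral_finsetSum hi,← Finset.sum_sub_distrib]
  refine (Finset.sum_le_sum fun k hk => hu.entropy _ (hv.profile s) k hk t₁ t₂ h1 h2 h3).trans ?_
  rw [Finset.sum_add_distrib,Finset.sum_const,nsmul_eq_mul]
  linarith

/-- Two approximate entropy solutions stay close. -/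
theorem exists_comparison (hB : Bounds M Λ) (hΘ : 0 ≤ Θ) (hB0 : 0 ≤ B) (T : ℝ) :
    ∃ K,0 ≤ K ∧ ∀ ε ρ,Mollifier ε B ρ → ∀ δ,0 ≤ δ → ∀ u v,Curve M T Θ ρ δ u →
      Curve M T Θ ρ δ v → ∀ h,0 < h → h ≤ T → ∀ t ∈ Icc 0 T,
        M.gap (u · t) (v · t)
          ≤ K*(M.gap (u · 0) (v · 0)+ε+h+δ+δ/h) := by
  have hΛ := hB.one_le
  set n : ℝ := (M.lanes.card : ℝ) with hn
  have hn0 : 0 ≤ n := Nat.cast_nonneg _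
  obtain ⟨G,hG⟩ : ∃ G,G = B*(2*Λ^3*Θ+6*Λ^3+4*Λ+8*Λ^2*n*Θ) := ⟨_,rfl⟩
  obtain ⟨E,hE⟩ : ∃ E,E = B*(20*Λ^4*Θ+12*Λ^3*Θ+4*Λ*n*Θ
    + 12*Λ^2*n*Θ) := ⟨_,rfl⟩
  have hG0 : 0 ≤ G := by rw [hG]; positivity
  have hE0 : 0 ≤ E := by rw [hE]; positivity
  obtain ⟨D,hD⟩ : ∃ D,D=2*B*Θ*n := ⟨_,rfl⟩
  have hD0 : 0 ≤ D := by rw [hD]; positivity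
  set C := n*G+1 with hC
  set X := Real.exp (C*T)
  have hX : 0 < X := Real.exp_pos _
  refine ⟨D+X*(1+D+n*E+C*D+6*Θ+8*(n+1)),by positivity,?_⟩
  intro ε ρ hρ δ hδ u v hu hv h hh hhT t ht
  have hε := hρ.pos
  set Φ : ℝ → ℝ → ℝ := fun t s => ∑ k ∈ M.lanes,laneGap ρ (u k t) (v k s) with hΦ
  set p : ℝ → ℝ → ℝ := fun t s =>
    ∑ k ∈ M.lanes,∫ q,M.pairing ρ (u · t) (v · s) k q with hp
  set q : ℝ → ℝ → ℝ := fun t s =>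
    ∑ k ∈ M.lanes,∫ q,M.pairing ρ (v · s) (u · t) k q with hq
  have near : ∀ t s,|Φ t s-M.gap (u · t) (v · s)| ≤ D*ε := fun t s => by
    rw [hΦ,gap,← Finset.sum_sub_distrib]
    refine (Finset.abs_sum_le_sum_abs _ _).trans ((Finset.sum_le_sum fun k hk =>
      hρ.abs_laneGap_sub_integral_le ((hu.profile t).integrable k hk)
      ((hv.profile s).integrable k hk) ((hu.profile t).meas k hk) ((hv.profile s).meas k hk)
      ((hv.profile s).translate k hk)).trans (le_of_eq ?_))
    rw [Finset.sum_const,nsmul_eq_mul,hD]; ring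
  have lip₁ : ∀ {w w' z},Profile M Θ w → Profile M Θ w' → Profile M Θ z →
      |(∑ k ∈ M.lanes,laneGap ρ (w k) (z k))-∑ k ∈ M.lanes,laneGap ρ (w' k) (z k)|
        ≤ M.gap w w' := fun h h' h'' => by
    rw [gap,← Finset.sum_sub_distrib]
    exact (Finset.abs_sum_le_sum_abs _ _).trans (Finset.sum_le_sum fun k hk =>
      hρ.abs_laneGap_sub_le (h.integrable k hk) (h'.integrable k hk) (h''.integrable k hk)
      (h.meas k hk) (h'.meas k hk) (h''.meas k hk))
  have lip : ∀ t s t' s',|Φ t s-Φ t' s'| ≤ Θ*(|t-t'| + |s-s'|)+2*((n+1)*δ) := by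
    intro t s t' s'
    have e1 := lip₁ (hu.profile t) (hu.profile t') (hv.profile s)
    have e2 : |Φ t' s-Φ t' s'| ≤ M.gap (v · s) (v · s') := by
      simp [hΦ,hρ.laneGap_comm (u _ t')]
      exact lip₁ (hv.profile s) (hv.profile s') (hu.profile t')
    have := hu.move t t'
    have := hv.move s s'
    have := abs_sub_le (Φ t s) (Φ t' s) (Φ t' s')
    have : 0 ≤ n*δ := by positivity
    linarith
  obtain ⟨A,hA⟩ : ∃ A,A=2*Λ^3*(B/ε^2+B/ε)*(2*ε*(n*Θ)+2*ε*(n*Θ)) :=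
    ⟨_,rfl⟩
  have hA0 : 0 ≤ A := by rw [hA]; positivity
  have bp : Tame₂ (n*A) p := hA ▸ .sum fun k hk => tame_pairing hB hρ hu hv hk
  have bq : Tame₂ (n*A) q := hA ▸ .sum fun k hk => (tame_pairing hB hρ hv hu hk).swap
  have bgap : ∀ t s,M.gap (u · t) (v · s) ≤ n*(2*Θ) := fun t s => by
    refine (Finset.sum_le_sum fun k hk => ?_).trans
      (le_of_eq (by rw [Finset.sum_const,nsmul_eq_mul]))
    have i1 := (hu.profile t).integrable k hk
    have i2 := (hv.profile s).integrable k hk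
    calc _≤∫ x,(u k t x+v k s x) := integral_mono (i1.sub i2).abs (i1.add i2) fun x =>
          (hu.profile t).abs_sub_le_add (hv.profile s) hk x x
      _ ≤ _ := by
          rw [integral_add i1 i2]
          linarith [(hu.profile t).mass k hk,(hv.profile s).mass k hk]
  have Φ0 : ∀ t s,0 ≤ Φ t s := fun t s => Finset.sum_nonneg fun k _ => hρ.laneGap_nonneg _ _
  have bΦ : Tame₂ (D*ε+n*(2*Θ)) Φ := by
    refine ⟨?_,fun t s => ?_⟩
    · exact Finset.measurable_fun_sum _ fun k hk => measurable_laneGap hρ hu hv hk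
    · rw [abs_of_nonneg (Φ0 t s)]
      linarith [(abs_le.1 (near t s)).2,bgap t s]
  have b1 : n*A ≤ n*A+(D*ε+n*(2*Θ)) := le_add_of_nonneg_right (by positivity)
  have main := doubled_gronwall (C := C) (κ := n*E*ε+C*D*ε)
    (bΦ.mono (le_add_of_nonneg_left (by positivity))) (bp.mono b1) (bq.mono b1)
    (fun s t₁ t₂ h1 h2 h3 => increment_sum_le hB hρ hu hv hδ s h1 h2 h3)
    (fun t s₁ s₂ h1 h2 h3 => by
      simp only [hΦ,hρ.laneGap_comm (u _ t)]
      exact increment_sum_le hB hρ hv hu hδ t h1 h2 h3)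
    (fun t s => by
      have e : p t s+q t s ≤ n*(G*M.gap (u · t) (v · s)+E*ε) := by
        rw [hp,hq,← Finset.sum_add_distrib,hn,← nsmul_eq_mul,← Finset.sum_const]
        refine Finset.sum_le_sum fun k hk => ?_
        rw [hG,hE]
        exact (hu.profile t).pairing_add_le hB (hv.profile s) hρ hk
      have e2 : M.gap (u · t) (v · s) ≤ Φ t s+D*ε := by linarith [(abs_le.1 (near t s)).1]
      have e3 := mul_mono_l e2 (mul_nonneg hn0 hG0)
      nlinarith [Φ0 t s])
    lip (by rw [hC]; linarith [mul_nonneg hn0 hG0]) (by positivity) (by positivity) hΘ Φ0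
    hh hhT ht
  have g0 : Φ 0 0 ≤ M.gap (u · 0) (v · 0)+D*ε := by linarith [(abs_le.1 (near 0 0)).2]
  have g1 : M.gap (u · t) (v · t) ≤ Φ t t+D*ε := by linarith [(abs_le.1 (near t t)).1]
  have hg : 0 ≤ M.gap (u · 0) (v · 0) := gap_nonneg _ _
  have hdh : 0 ≤ δ/h := by positivity
  have e5 : 2*((n+1)*δ)/h=2*(n+1)*(δ/h) := by ring
  rw [e5] at main
  set g := M.gap (u · 0) (v · 0)
  obtain ⟨W,hW⟩ : ∃ W,W = g+ε+h+δ+δ/h := ⟨_,rfl⟩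
  rw [← hW]
  have w2 : ε ≤ W := by linarith
  have inner : Φ 0 0+(n*E*ε+C*D*ε)+6*Θ*h+6*((n+1)*δ)
      + 2*(n+1)*(δ/h)≤(1+D+n*E+C*D+6*Θ+8*(n+1))*W := by
    have c1 : D*ε ≤ D*W := by gcongr
    have c2 : (n*E+C*D)*ε≤(n*E+C*D)*W := by gcongr
    have c3 : 6*Θ*h≤6*Θ*W := by gcongr; linarith
    have c4 : 8*(n+1)*(δ+δ/h)≤8*(n+1)*W := by gcongr; linarith
    have c5 : 0≤(n+1)*δ := by positivity
    have c6 : 0≤(n+1)*(δ/h) := by positivity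
    linarith
  have c7 := mul_mono_l inner hX.le
  have c8 : D*ε ≤ D*W := by gcongr
  linarith

end Curve
end Model

/-! ### Step functions -/

/-- The function that is constant on the cells of a mesh. -/
noncomputable def stepFn (m : Mesh) (v : ℤ → ℝ) (x : ℝ) : ℝ := v (m.cellIndex x)

namespace Mesh

variable {m : Mesh} {v : ℤ → ℝ}

theorem measurable_cellIndex (m : Mesh) : Measurable m.cellIndex :=
  ((measurable_id.div_const _).add_const _).floor

theorem measurable_stepFn (m : Mesh) (v : ℤ → ℝ) : Measurable (stepFn m v) :=
  (measurable_of_countable v).comp m.measurable_cellIndex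

theorem cellIndex_add (hx : 0 < m.Δx) (x : ℝ) : m.cellIndex (x+m.Δx) = m.cellIndex x+1 := by
  rw [cellIndex,cellIndex,add_div,div_self hx.ne',← Int.floor_add_one]
  congr 1; ring

theorem half_bounds (hx : 0 < m.Δx) (x : ℝ) :
    m.half (m.cellIndex x)-m.Δx ≤ x ∧ x < m.half (m.cellIndex x) := by
  have h := (mem_cell_iff hx (x := x)).2 rfl
  refine ⟨?_,h.2⟩
  have := Model.Admissible.half_succ_sub m (m.cellIndex x-1)
  rw [sub_add_cancel] at this
  linarith [h.1]

theorem half_pred (m : Mesh) (i : ℤ) : m.half (i-1) = m.half i-m.Δx := by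
  have := Model.Admissible.half_succ_sub m (i-1)
  rw [sub_add_cancel] at this
  linarith

theorem node_eq (m : Mesh) (i : ℤ) : m.node i = m.half i-m.Δx/2 := by rw [half_eq,node]; ring

theorem setIntegral_stepFn (hx : 0 < m.Δx) (v : ℤ → ℝ) (i : ℤ) :
    ∫ x in m.cell i,stepFn m v x = m.Δx*v i := by
  have : ∫ x in m.cell i,stepFn m v x=∫ x in m.cell i,v i :=
    setIntegral_congr_fun (m.measurableSet_cell i) fun x hxi => by
      simp [stepFn,(mem_cell_iff hx).1 hxi]
  rw [this,setIntegral_const,Measure.real,volume_cell hx,ENNReal.toReal_ofReal hx.le,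
    smul_eq_mul]

theorem integral_stepFn (hx : 0 < m.Δx) (h0 : ∀ i,0 ≤ v i) (hv : Summable v) :
    Integrable (stepFn m v) ∧ ∫ x,stepFn m v x = m.Δx*∑' i,v i := by
  have hi : Integrable (stepFn m v) := by
    rw [← integrableOn_univ,← iUnion_cell hx]
    refine integrableOn_iUnion_of_summable_integral_norm (fun i => ?_) ?_
    · refine Measure.integrableOn_of_bounded (M := |v i|) ?_
        (m.measurable_stepFn v).aestronglyMeasurable ?_
      · rw [volume_cell hx]; exact ENNReal.ofReal_ne_top
      · refine (ae_restrict_iff' (m.measurableSet_cell i)).2 (.of_forall ?_)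
        intro x hxi
        rw [stepFn,(mem_cell_iff hx).1 hxi,Real.norm_eq_abs]
    · have e : (fun i => ∫ x in m.cell i,‖stepFn m v x‖) = fun i => m.Δx*v i := by
        funext i
        rw [← setIntegral_stepFn hx v i]
        congr 1
        funext x
        rw [Real.norm_eq_abs,stepFn,abs_of_nonneg (h0 _)]
      rw [e]
      exact hv.mul_left _
  refine ⟨hi,?_⟩
  rw [← (hasSum_cell hx hi).tsum_eq,← tsum_mul_left]
  exact tsum_congr fun i => setIntegral_stepFn hx v i

theorem abs_sub_le_sum_Ico (v : ℤ → ℝ) {a b : ℤ} (hab : a ≤ b) :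
    |v b-v a|≤∑ i ∈ Finset.Ico a b,|v (i+1)-v i| := by
  obtain ⟨n,rfl⟩ := Int.le.dest hab
  induction n with
  | zero => simp
  | succ n ih =>
    have e : Finset.Ico a (a+(n+1 : ℕ)) = insert (a+n : ℤ) (Finset.Ico a (a+n)) := by
      ext i; simp only [Finset.mem_Ico,Finset.mem_insert]; push_cast; omega
    rw [e,Finset.sum_insert (by simp)]
    have := ih (by omega)
    have h2 : (a+(n+1 : ℕ) : ℤ) = a+n+1 := by push_cast; ring
    rw [h2]
    linarith [abs_sub_le (v (a+n+1)) (v (a+n)) (v a)]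

theorem eVariationOn_stepFn_le (hx : 0 < m.Δx) {K : ℝ} (hv : SumLe (fun i => |v (i+1)-v i|) K) :
    eVariationOn (stepFn m v) univ ≤ ENNReal.ofReal K := by
  have hmono : Monotone m.cellIndex := fun x y hxy => by unfold cellIndex; gcongr
  refine iSup_le fun p => ?_
  obtain ⟨n,u,hu,-⟩ := p
  set j : ℕ → ℤ := fun i => m.cellIndex (u i) with hj
  have hjm : Monotone j := hmono.comp hu
  have key : ∀ n,∑ i ∈ Finset.range n,|v (j (i+1))-v (j i)|
      ≤ ∑ i ∈ Finset.Ico (j 0) (j n),|v (i+1)-v i| := fun n => by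
    induction n with
    | zero => simp
    | succ n ih =>
      rw [Finset.sum_range_succ,← Finset.Ico_union_Ico_eq_Ico (hjm (Nat.zero_le n))
        (hjm n.le_succ),Finset.sum_union (Finset.Ico_disjoint_Ico_consecutive _ _ _)]
      exact add_le_add ih (abs_sub_le_sum_Ico v (hjm n.le_succ))
  have e : ∑ i ∈ Finset.range n,edist (stepFn m v (u (i+1))) (stepFn m v (u i))
      = ENNReal.ofReal (∑ i ∈ Finset.range n,|v (j (i+1))-v (j i)|) := by
    rw [ENNReal.ofReal_sum_of_nonneg fun _ _ => abs_nonneg _]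
    simp [edist_dist,Real.dist_eq,stepFn,hj]
  refine e.le.trans (ENNReal.ofReal_le_ofReal ((key n).trans ?_))
  exact (hv.1.sum_le_tsum _ fun _ _ => abs_nonneg _).trans hv.2

end Mesh

namespace Model

variable {M : Model} {m : Mesh} {β Θ Λ : ℝ}

theorem Admissible.avg_stepFn (h : Admissible M m β) (v : ℤ → ℝ) (i : ℤ) :
    M.avg (stepFn m v) (m.half i) = M.cHalf m v i := by
  have e1 : M.avg (stepFn m v) (m.half i)
      = ∫ s in 0..M.η,M.ω s*stepFn m v (s+m.half i) := by
    have := intervalIntegral.integral_comp_add_right (a := 0) (b := M.η)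
      (fun y => M.ω (y-m.half i)*stepFn m v y) (m.half i)
    simp only [add_sub_cancel_right] at this
    rw [this,avg,zero_add,add_comm]
  have key : ∀ p < m.Nη,EqOn (fun s => M.ω s*stepFn m v (s+m.half i))
      (fun s => M.ω s*v (i+p+1)) (Ioo (p*m.Δx) ((p+1)*m.Δx)) := by
    intro p _ s hs
    have : m.cellIndex (s+m.half i) = i+p+1 := by
      rw [← Mesh.mem_cell_iff h.dx_pos,Mesh.cell,mem_Ico,Mesh.half_eq,Mesh.half_eq,Mesh.half_eq]
      push_cast
      constructor <;> nlinarith [hs.1,hs.2]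
    simp [stepFn,this]
  have e2 : ∀ p < m.Nη,∫ s in (p*m.Δx)..((p+1)*m.Δx),M.ω s*stepFn m v (s+m.half i)
      = M.zeta m p*v (i+p+1) := fun p hp => by
    rw [zeta,← intervalIntegral.integral_mul_const,intervalIntegral.integral_of_le (h.le_next p),
      intervalIntegral.integral_of_le (h.le_next p),integral_Ioc_eq_integral_Ioo,
      integral_Ioc_eq_integral_Ioo]
    exact setIntegral_congr_fun measurableSet_Ioo (key p hp)
  have e3 : ∀ p < m.Nη,IntervalIntegrable (fun s => M.ω s*stepFn m v (s+m.half i)) volume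
      (p*m.Δx) ((p+1)*m.Δx) := fun p hp => by
    rw [intervalIntegrable_iff_integrableOn_Ioo_of_le (h.le_next p)]
    refine IntegrableOn.congr_fun ?_ (key p hp).symm measurableSet_Ioo
    have := (h.omega_intervalIntegrable hp).mul_const (v (i+p+1))
    rwa [intervalIntegrable_iff_integrableOn_Ioo_of_le (h.le_next p)] at this
  rw [e1,cHalf,h.eta_eq]
  have := intervalIntegral.sum_integral_adjacent_intervals
    (a := fun p => p*m.Δx)
    fun p hp => by have := e3 p hp; push_cast; exact this
  simp only [Nat.cast_zero,zero_mul] at this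
  rw [← this]
  refine Finset.sum_congr rfl fun p hp => ?_
  rw [← e2 p (Finset.mem_range.1 hp)]
  push_cast
  rfl

theorem Admissible.stepProfile (h : Admissible M m β) {w : ℕ → ℤ → ℝ} (hw : UnitValued M w)
    {TV mass : ℕ → ℝ} (hb : Budget M w TV mass) (hΘ : 0 ≤ Θ) (hTV : ∀ k ∈ M.lanes,TV k ≤ Θ)
    (hmass : ∀ k ∈ M.lanes,m.Δx*mass k ≤ Θ) : Profile M Θ fun k => stepFn m (w k) where
  meas k _ := m.measurable_stepFn _
  mem k hk x := hw k hk _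
  integrable k hk :=
    (Mesh.integral_stepFn h.dx_pos (fun i => (hw k hk i).1) (hb.mass_le k hk).1).1
  mass k hk := by
    rw [(Mesh.integral_stepFn h.dx_pos (fun i => (hw k hk i).1) (hb.mass_le k hk).1).2]
    exact (mul_mono_l (hb.mass_le k hk).2 h.dx_pos.le).trans (hmass k hk)
  translate k hk := translateLe_of_eVariationOn (m.measurable_stepFn _).aemeasurable
    (EventuallyEq.refl _ _) hΘ
    (Mesh.eVariationOn_stepFn_le h.dx_pos ((hb.tv k hk).weaken (hTV k hk)))

variable {M : Model} {m : Mesh} {β Θ Λ : ℝ} {k : ℕ}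

/-! ### The entropy inequality of one time step -/

theorem kruzkovFlux_eq_max_min (a b : ℝ) :
    M.f k (max a b)-M.f k (min a b) = M.kruzkovFlux k a b := by
  rcases lt_trichotomy a b with h | rfl | h
  · rw [max_eq_right h.le,min_eq_left h.le,kruzkovFlux,Real.sign_of_neg (sub_neg.2 h)]; ring
  · simp [kruzkovFlux]
  · rw [max_eq_left h.le,min_eq_right h.le,kruzkovFlux,Real.sign_of_pos (sub_pos.2 h)]; ring

theorem entropyFlux_eq (v : ℤ → ℝ) (i : ℤ) (a b α : ℝ) : M.entropyFlux m β k v i a b α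
    = 1/2*M.ν k (m.half i) (M.cHalf m v i)*(M.kruzkovFlux k a α+M.kruzkovFlux k b α)
      - β/(2*m.lam)*(|b-α| - |a-α|) := by
  rw [entropyFlux,flux,flux,← kruzkovFlux_eq_max_min,← kruzkovFlux_eq_max_min,
    ← max_sub_min_eq_abs',← max_sub_min_eq_abs']
  ring

/-- First order Taylor remainder of a Lipschitz function at a variable increment. -/
theorem integral_taylor_variable_le {c τ : ℝ → ℝ} {Λ K d : ℝ}
    (hc : ∀ x y,|c x-c y| ≤ Λ*|x-y|) (hs : Integrable (slope₀ c))
    (hK : TranslateLe (slope₀ c) K) (hd : 0 ≤ d) (hτm : Measurable τ) (hτ : ∀ x,|τ x| ≤ d) :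
    Integrable (fun x => |c (x+τ x)-c x-τ x*slope₀ c x|) ∧
      ∫ x,|c (x+τ x)-c x-τ x*slope₀ c x|≤2*K*d^2 := by
  have hcm := (lipschitzWith_of_abs hc).continuous.measurable
  have hsm := measurable_slope₀ hcm
  set s := slope₀ c with hsd
  obtain ⟨hi,hle⟩ := BoxLe.translate hd hsm hs hK
  have key : ∀ᵐ x,|c (x+τ x)-c x-τ x*s x|≤∫ y,|s x-s y| * box d (x-y) := by
    filter_upwards [hi.prod_right_ae] with x hx
    have e : c (x+τ x)-c x-τ x*s x=∫ y in x..(x+τ x),(s y-s x) := by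
      rw [intervalIntegral.integral_sub hs.intervalIntegrable intervalIntegrable_const,
        integral_slope₀ hc,intervalIntegral.integral_const,add_sub_cancel_left,smul_eq_mul]
    rw [e]
    refine (intervalIntegral.abs_integral_eq_abs_integral_uIoc _).trans_le ?_
    refine abs_integral_le_integral_abs.trans ?_
    have h1 : ∫ y in uIoc x (x+τ x),|s y-s x|
        = ∫ y in uIoc x (x+τ x),|s x-s y| * box d (x-y) :=
      setIntegral_congr_fun measurableSet_uIoc fun y hy => by
        have : |x-y| ≤ d := by grind
        rw [box_of_le this,mul_one,abs_sub_comm]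
    rw [h1]
    exact setIntegral_le_integral hx (.of_forall fun y =>
      mul_nonneg (abs_nonneg _) (box_nonneg _ _))
  have hm : Measurable fun x => |c (x+τ x)-c x-τ x*s x| :=
    ((((hcm.comp (measurable_id.add hτm))).sub hcm).sub (hτm.mul hsm)).abs
  have hR := hi.integral_prod_left
  have hI := hR.mono' hm.aestronglyMeasurable (by simpa [Real.norm_eq_abs] using key)
  refine ⟨hI,(integral_mono_ae hI hR key).trans ?_⟩
  rw [← integral_prod _ hi]
  exact hle.trans (le_of_eq (by ring))

/-- Taylor remainder of the average at the point `x_{i+1/2} + r`, where `x` lies in the cell `i`. -/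
noncomputable def halfTaylor (M : Model) (m : Mesh) (v : ℝ → ℝ) (r x : ℝ) : ℝ :=
  |M.avg v (m.half (m.cellIndex x)+r)-M.avg v x
    - (m.half (m.cellIndex x)+r-x)*slope₀ (M.avg v) x|

theorem Profile.integral_halfTaylor_le (hB : Bounds M Λ) {w : ℕ → ℝ → ℝ} (hw : Profile M Θ w)
    (hk : k ∈ M.lanes) (hx : 0 < m.Δx) {r : ℝ} (hr0 : -m.Δx ≤ r) (hr1 : r≤0) :
    Integrable (halfTaylor M m (w k) r) ∧
      ∫ x,halfTaylor M m (w k) r x≤2*(Λ*Θ)*m.Δx^2 := by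
  have hm : Measurable fun x => m.half (m.cellIndex x)+r-x :=
    (((measurable_of_countable m.half).comp m.measurable_cellIndex).add_const _).sub measurable_id
  have := integral_taylor_variable_le
    (hw.avg_lip hB hk) (hw.slope_integrable hB hk) (hw.slope_translate hB hk) hx.le hm fun x => by
      have := Mesh.half_bounds hx x
      rw [abs_le]; constructor <;> linarith
  simp [add_sub_cancel] at this
  exact this

/-- The part of the error in the velocity gradient that is small in the mean. -/
noncomputable def gradError (M : Model) (m : Mesh) (Λ : ℝ) (w z : ℕ → ℝ → ℝ) (k : ℕ) (x : ℝ) : ℝ :=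
  Λ/m.Δx*(halfTaylor M m (w k) 0 x+halfTaylor M m (w k) (-m.Δx) x)
    + Λ*|slope₀ (M.avg (w k)) x-slope₀ (M.avg (z k)) x|

theorem Profile.integral_gradError_le (hB : Bounds M Λ) {w z : ℕ → ℝ → ℝ} (hw : Profile M Θ w)
    (hz : Profile M Θ z) (hk : k ∈ M.lanes) (hx : 0 < m.Δx) (hΘ : 0 ≤ Θ) :
    Integrable (gradError M m Λ w z k) ∧ ∫ x,gradError M m Λ w z k x
      ≤ 4*Λ^2*(Θ+1)*(m.Δx+M.gap w z) := by
  have h1 := hB.one_le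
  obtain ⟨i0,e0⟩ := hw.integral_halfTaylor_le hB hk hx (by linarith) le_rfl
  obtain ⟨i1,e1⟩ := hw.integral_halfTaylor_le hB hk hx le_rfl (by linarith)
  have i2 := ((hw.slope_integrable hB hk).sub (hz.slope_integrable hB hk)).abs
  have e2 := hw.integral_slope_sub_le hB hz hk
  have g0 := gap_nonneg (M := M) w z
  refine ⟨((i0.add i1).const_mul _).add (i2.const_mul _),?_⟩
  have e : ∫ x,gradError M m Λ w z k x = Λ/m.Δx*((∫ x,halfTaylor M m (w k) 0 x)
      + ∫ x,halfTaylor M m (w k) (-m.Δx) x)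
      + Λ*∫ x,|slope₀ (M.avg (w k)) x-slope₀ (M.avg (z k)) x| := by
    rw [← integral_add i0 i1,← integral_const_mul,← integral_const_mul]
    exact integral_add ((i0.add i1).const_mul _) (i2.const_mul _)
  rw [e]
  calc _ ≤ Λ/m.Δx*(2*(Λ*Θ)*m.Δx^2+2*(Λ*Θ)*m.Δx^2)
        + Λ*(Λ*M.gap w z) := by gcongr
    _=4*Λ^2*Θ*m.Δx+Λ^2*M.gap w z := by field_simp; ring
    _ ≤ _ := by
        have : 0 ≤ Λ^2*m.Δx := by positivity
        have : 0 ≤ Λ^2*Θ*M.gap w z := by positivity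
        have : 0 ≤ Λ^2*M.gap w z := by positivity
        linarith

/-- Bounds for a test function: values and derivative are dominated by `Γ`, as is the Taylor
remainder for the increment `d`. -/
structure TestBound (ψ Γ : ℝ → ℝ) (d : ℝ) : Prop where
  cont : Continuous ψ
  nonneg : ∀ x,0 ≤ ψ x
  le : ∀ x,ψ x ≤ Γ x
  deriv_le : ∀ x,|deriv ψ x| ≤ Γ x
  taylor : ∀ x,|ψ (x+d)-ψ x-d*deriv ψ x| ≤ d^2*Γ x
  integrable : Integrable Γ
  bounded : ∃ c,∀ x,Γ x ≤ c

/-- Entropy production of the profile `w` for the constant `α` and the test function `ψ`. -/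
noncomputable def productionDensity (M : Model) (w : ℕ → ℝ → ℝ) (k : ℕ) (α : ℝ) (ψ : ℝ → ℝ)
    (x : ℝ) : ℝ :=
  M.kruzkovFlux k (w k x) α*M.vel w k x*deriv ψ x
    + Real.sign (w k x-α)*(M.src w k x-M.f k α*M.dvel w k x)*ψ x

/-- The error density of one time step. -/
noncomputable def stepError (M : Model) (m : Mesh) (Λ L ℓ r μ : ℝ) (w z : ℕ → ℝ → ℝ) (k : ℕ)
    (x : ℝ) : ℝ :=
  15*L*Λ^2*(1+ℓ)*((∑ j ∈ M.lanes,|w j x-z j x|)+|w k (x+m.Δx)-w k x|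
    + μ*∑ j ∈ M.lanes,z j x)+L*r*gradError M m Λ w z k x

variable {w : ℕ → ℤ → ℝ} {L ℓ r μ α : ℝ}

local notation "st[" m "," w "]" => fun j => stepFn m (w j)

namespace Admissible

variable (h : Admissible M m β) (hB : Bounds M Λ) (hw : UnitValued M w)
  (hW : Profile M Θ st[m,w]) (hZ : Profile M Θ st[m,M.step m β w])
  (hk : k ∈ M.lanes)
include h hB hw hW hZ hk

theorem source_error (hμ : m.Δx+M.gap st[m,w] st[m,M.step m β w] ≤ μ) (x : ℝ) :
    |M.discreteSource m w k (m.cellIndex x)-M.src st[m,M.step m β w] k x|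
      ≤ 2*Λ*(∑ j ∈ M.lanes,|stepFn m (w j) x-stepFn m (M.step m β w j) x|)
        + 10*Λ^2*μ*∑ j ∈ M.lanes,stepFn m (M.step m β w j) x := by
  have h1 := hB.one_le
  have hdx := h.dx_pos
  have hb := Mesh.half_bounds hdx x
  have g0 := gap_nonneg (M := M) st[m,w] st[m,M.step m β w]
  refine (Profile.abs_R_sub_le hB hk (d := 2*Λ*m.Δx+Λ*M.gap st[m,w]
    st[m,M.step m β w]) _ _ (fun j hj => hw j hj _) (fun j hj => hZ.mem j hj x)
    (fun j hj => h.cMid_mem (hw j hj) _) (fun j hj => hZ.avg_mem hB hj x) fun j hj => ?_).trans ?_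
  · have a1 := hW.avg_lip hB hj (m.half (m.cellIndex x)) x
    have a2 := hW.avg_lip hB hj (m.half (m.cellIndex x+1)) x
    have a3 := hW.avg_sub_le hB hZ hj x
    rw [h.avg_stepFn] at a1 a2
    have b1 : |m.half (m.cellIndex x)-x| ≤ m.Δx := by rw [abs_of_nonneg (by linarith)]; linarith
    have b2 : |m.half (m.cellIndex x+1)-x|≤2*m.Δx := by
      have := Admissible.half_succ_sub m (m.cellIndex x)
      rw [abs_of_nonneg (by linarith)]; linarith
    have c1 : Λ*|m.half (m.cellIndex x)-x| ≤ Λ*m.Δx := by gcongr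
    have c2 : Λ*|m.half (m.cellIndex x+1)-x| ≤ Λ*(2*m.Δx) := by gcongr
    rw [cMid]
    grind
  · have b3 : |m.node (m.cellIndex x)-x| ≤ m.Δx := by
      rw [Mesh.node_eq,abs_le]; constructor <;> linarith
    refine add_le_add le_rfl (mul_mono_r ?_ (hZ.sum_nonneg x))
    have := le_mul_of_one_le_left hdx.le h1
    have : 0 ≤ Λ*M.gap st[m,w] st[m,M.step m β w] := by positivity
    calc _≤2*Λ*(5*Λ*(m.Δx+M.gap st[m,w]
          st[m,M.step m β w])) := by
          gcongr
          linarith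
      _≤2*Λ*(5*Λ*μ) := by gcongr
      _ = _ := by ring

theorem gradient_error (hμ : m.Δx+M.gap st[m,w] st[m,M.step m β w] ≤ μ) (x : ℝ) :
    |(M.ν k (m.half (m.cellIndex x)) (M.cHalf m (w k) (m.cellIndex x))
        - M.ν k (m.half (m.cellIndex x-1)) (M.cHalf m (w k) (m.cellIndex x-1)))/m.Δx
        - M.dvel st[m,M.step m β w] k x|
      ≤ 6*Λ^3*μ+gradError M m Λ st[m,w] st[m,M.step m β w] k x := by
  have h1 := hB.one_le
  have hdx := h.dx_pos
  have hb := Mesh.half_bounds hdx x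
  set W : ℕ → ℝ → ℝ := st[m,w] with hWd
  set Z : ℕ → ℝ → ℝ := st[m,M.step m β w]
  set i := m.cellIndex x with hi
  have g0 := gap_nonneg (M := M) W Z
  have v1 : M.ν k (m.half i) (M.cHalf m (w k) i) = M.vel W k (m.half i) := by
    rw [vel,← h.avg_stepFn]
  have v0 : M.ν k (m.half (i-1)) (M.cHalf m (w k) (i-1)) = M.vel W k (m.half i-m.Δx) := by
    rw [vel,← h.avg_stepFn,Mesh.half_pred]
  rw [v1,v0]
  have t1 := hW.vel_taylor hB hk x (m.half i)
  have t0 := hW.vel_taylor hB hk x (m.half i-m.Δx)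
  have d2 := hW.avg_sub_le hB hZ hk x
  have s1 : (m.half i-x)^2 ≤ m.Δx^2 :=
    pow_le_pow_left₀ (by linarith) (by linarith) 2
  have s0 : (m.half i-m.Δx-x)^2 ≤ m.Δx^2 := sq_le_sq' (by linarith) (by linarith)
  have q1 : halfTaylor M m (W k) 0 x = |M.avg (W k) (m.half i)-M.avg (W k) x
      - (m.half i-x)*slope₀ (M.avg (W k)) x| := by rw [halfTaylor,← hi,add_zero]
  have q0 : halfTaylor M m (W k) (-m.Δx) x = |M.avg (W k) (m.half i-m.Δx)-M.avg (W k) x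
      - (m.half i-m.Δx-x)*slope₀ (M.avg (W k)) x| := by
    rw [halfTaylor,← hi,← sub_eq_add_neg]
  rw [← q1] at t1
  rw [← q0] at t0
  have e : (M.vel W k (m.half i)-M.vel W k (m.half i-m.Δx))/m.Δx-M.dvel Z k x
      = (M.vel W k (m.half i)-M.vel W k x-(m.half i-x)*M.dvel W k x)/m.Δx
        - (M.vel W k (m.half i-m.Δx)-M.vel W k x-(m.half i-m.Δx-x)*M.dvel W k x)/m.Δx
        + (M.dvel W k x-M.dvel Z k x) := by
    field_simp
    ring
  rw [e]
  have r1 : |(M.vel W k (m.half i)-M.vel W k x-(m.half i-x)*M.dvel W k x)/m.Δx|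
      ≤ 3*Λ^3*m.Δx+Λ/m.Δx*halfTaylor M m (W k) 0 x := by
    rw [abs_div,abs_of_pos hdx,div_le_iff₀ hdx]
    refine t1.trans ?_
    have : 3*Λ^3*(m.half i-x)^2≤3*Λ^3*m.Δx^2 := by gcongr
    refine (add_le_add_left this _).trans (le_of_eq ?_)
    field_simp
  have r0 : |(M.vel W k (m.half i-m.Δx)-M.vel W k x
      - (m.half i-m.Δx-x)*M.dvel W k x)/m.Δx|
      ≤ 3*Λ^3*m.Δx+Λ/m.Δx*halfTaylor M m (W k) (-m.Δx) x := by
    rw [abs_div,abs_of_pos hdx,div_le_iff₀ hdx]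
    refine t0.trans ?_
    have : 3*Λ^3*(m.half i-m.Δx-x)^2≤3*Λ^3*m.Δx^2 := by gcongr
    refine (add_le_add_left this _).trans (le_of_eq ?_)
    field_simp
  have d3 : 2*Λ^2*|M.avg (W k) x-M.avg (Z k) x|≤2*Λ^2*(Λ*M.gap W Z) := by gcongr
  refine (abs_add_le _ _).trans ((add_le_add (abs_sub _ _) (hW.dvel_sub_le hB hZ hk x)).trans ?_)
  have d4 : 6*Λ^3*(m.Δx+M.gap W Z)≤6*Λ^3*μ := by gcongr
  have d5 : 0 ≤ Λ^3*M.gap W Z := by positivity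
  rw [gradError]
  linarith

theorem flux_error (hl : 1 ≤ ℓ*m.lam) (hL : 1 ≤ L) (hr : 1 ≤ r)
    (hf : ∀ a ∈ Icc (-r) r,∀ b ∈ Icc (-r) r,|M.f k a-M.f k b| ≤ L*|a-b|)
    (hα : |α| ≤ r) (hμ : m.Δx+M.gap st[m,w] st[m,M.step m β w] ≤ μ) (x : ℝ) :
    |M.entropyFlux m β k (w k) (m.cellIndex x) (w k (m.cellIndex x)) (w k (m.cellIndex x+1)) α
      - M.kruzkovFlux k (stepFn m (M.step m β w k) x) α*M.vel st[m,M.step m β w] k x|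
      ≤ L*Λ*|stepFn m (w k) x-stepFn m (M.step m β w k) x|
        + (L*Λ+ℓ)*|stepFn m (w k) (x+m.Δx)-stepFn m (w k) x|
        + 2*L*Λ^2*μ*(stepFn m (M.step m β w k) x+|α|) := by
  have h1 := hB.one_le
  have hdx := h.dx_pos
  have hlam := h.lam_pos
  have hb := Mesh.half_bounds hdx x
  have hsucc : w k (m.cellIndex x+1) = stepFn m (w k) (x+m.Δx) := by
    rw [stepFn,Mesh.cellIndex_add hdx]
  set i := m.cellIndex x with hi
  set W : ℕ → ℝ → ℝ := st[m,w] with hWd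
  set Z : ℕ → ℝ → ℝ := st[m,M.step m β w] with hZd
  have mem : ∀ {y : ℝ},y ∈ Icc 0 1 → y ∈ Icc (-r) r := fun hy =>
    ⟨by linarith [hy.1],by linarith [hy.2]⟩
  have ma := mem (hW.mem k hk x)
  have mb := mem (hW.mem k hk (x+m.Δx))
  have mz := mem (hZ.mem k hk x)
  have mα : α ∈ Icc (-r) r := abs_le.1 hα
  have hz0 := (hZ.mem k hk x).1
  have v1 : M.ν k (m.half i) (M.cHalf m (w k) i) = M.vel W k (m.half i) := by
    rw [vel,← h.avg_stepFn]
  have hwi : w k i = W k x := rfl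
  rw [entropyFlux_eq,hsucc,v1,hwi]
  set a := W k x
  set b := W k (x+m.Δx)
  set z := Z k x
  have k1 : |M.kruzkovFlux k a α-M.kruzkovFlux k z α| ≤ L*|a-z| := by
    rw [kruzkovFlux_comm a,kruzkovFlux_comm z]
    exact abs_kruzkovFlux_sub_le hf mα ma mz
  have k2 : |M.kruzkovFlux k b α-M.kruzkovFlux k a α| ≤ L*|b-a| := by
    rw [kruzkovFlux_comm a,kruzkovFlux_comm b]
    exact abs_kruzkovFlux_sub_le hf mα mb ma
  have k3 : |M.kruzkovFlux k z α| ≤ L*(z+|α|) := by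
    refine (abs_kruzkovFlux_le (hf _ mz _ mα)).trans ?_
    gcongr
    exact (abs_sub _ _).trans (by rw [abs_of_nonneg hz0])
  have n1 : |M.vel W k (m.half i)| ≤ Λ := hW.abs_vel_le hB hk _
  have n2 : |M.vel W k (m.half i)-M.vel Z k x|≤2*Λ^2*μ := by
    have e1 := hW.vel_lip hB hk (m.half i) x
    have e2 := hW.vel_sub_le hB hZ hk x
    have e3 := abs_sub_le (M.vel W k (m.half i)) (M.vel W k x) (M.vel Z k x)
    have e4 : |m.half i-x| ≤ m.Δx := by rw [abs_of_nonneg (by linarith)]; linarith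
    have e5 : 2*Λ^2*|m.half i-x|≤2*Λ^2*m.Δx := by gcongr
    have e6 : 2*Λ^2*(m.Δx+M.gap W Z)≤2*Λ^2*μ := by gcongr
    have e7 : 0 ≤ Λ^2*M.gap W Z := mul_nonneg (by positivity) (gap_nonneg _ _)
    linarith
  have p1 : |β/(2*m.lam)*(|b-α| - |a-α|)| ≤ ℓ*|b-a| := by
    rw [abs_mul,abs_of_pos (div_pos h.beta_pos (by linarith))]
    have c1 : |(|b-α| - |a-α|)| ≤ |b-a| :=
      (abs_abs_sub_abs_le _ _).trans (le_of_eq (by congr 1; ring))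
    have c2 : β/(2*m.lam) ≤ ℓ := by
      rw [div_le_iff₀ (by linarith)]
      nlinarith [h.beta_lt]
    exact mul_le_mul c2 c1 (abs_nonneg _) ((div_nonneg h.beta_pos.le (by linarith)).trans c2)
  have e : 1/2*M.vel W k (m.half i)*(M.kruzkovFlux k a α+M.kruzkovFlux k b α)
      - β/(2*m.lam)*(|b-α| - |a-α|)-M.kruzkovFlux k z α*M.vel Z k x
      = M.vel W k (m.half i)*(M.kruzkovFlux k a α-M.kruzkovFlux k z α)
        + 1/2*(M.vel W k (m.half i)*(M.kruzkovFlux k b α-M.kruzkovFlux k a α))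
        + M.kruzkovFlux k z α*(M.vel W k (m.half i)-M.vel Z k x)
        - β/(2*m.lam)*(|b-α| - |a-α|) := by ring
  rw [e]
  have t1 : |M.vel W k (m.half i)*(M.kruzkovFlux k a α-M.kruzkovFlux k z α)|
      ≤ Λ*(L*|a-z|) := by rw [abs_mul]; gcongr
  have t2 : |1/2*(M.vel W k (m.half i)*(M.kruzkovFlux k b α-M.kruzkovFlux k a α))|
      ≤ Λ*(L*|b-a|) := by
    rw [abs_mul,abs_mul,abs_of_pos (by norm_num : (0 : ℝ)<1/2)]
    have : |M.vel W k (m.half i)| * |M.kruzkovFlux k b α-M.kruzkovFlux k a α|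
      ≤ Λ*(L*|b-a|) := by gcongr
    have : 0 ≤ Λ*(L*|b-a|) := by positivity
    linarith
  have t3 : |M.kruzkovFlux k z α*(M.vel W k (m.half i)-M.vel Z k x)|
      ≤ L*(z+|α|)*(2*Λ^2*μ) := by rw [abs_mul]; gcongr
  refine (abs_sub _ _).trans ((add_le_add ((abs_add_three _ _ _).trans
    (add_le_add (add_le_add t1 t2) t3)) p1).trans (le_of_eq ?_))
  ring

end Admissible
end Model

theorem integrable_of_dominated {F Γ : ℝ → ℝ} {c : ℝ} (hΓ : Integrable Γ) (hF : Measurable F)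
    (h : ∀ x,|F x| ≤ c*Γ x) : Integrable F :=
  (hΓ.const_mul c).mono' hF.aestronglyMeasurable (.of_forall h)

theorem stepError_arith {Λ L ℓ r μ q Q D S z a e : ℝ} (h1 : 1 ≤ Λ) (hL : 1 ≤ L) (hℓ : 0 ≤ ℓ)
    (hμ00 : 0 ≤ μ) (hqQ : q ≤ Q) (hQ0 : 0 ≤ Q) (hD0 : 0 ≤ D) (hzS : z ≤ S) (hS0 : 0 ≤ S)
    (ha : 0 ≤ a) :
    2*Λ*Q+10*Λ^2*μ*S+L*a*(6*Λ^3*μ)+L*r*e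
      + (2*(L*Λ*q+(L*Λ+ℓ)*D+2*L*Λ^2*μ*(z+a))+μ*(L*Λ*(z+a)))
      ≤ 15*L*Λ^2*(1+ℓ)*(Q+D+μ*S)+L*r*e+11*L*Λ^3*μ*a := by
  have hΛ2 : Λ ≤ Λ^2 := by nlinarith
  have hΛ3 : Λ^2 ≤ Λ^3 := by nlinarith
  have a1 : L*Λ*q ≤ L*Λ*Q := by gcongr
  have a2 : 2*L*Λ^2*μ*z≤2*L*Λ^2*μ*S := by gcongr
  have a3 : μ*(L*Λ*z) ≤ μ*(L*Λ*S) := by gcongr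
  have x1 : L*Λ ≤ L*Λ^2 := by gcongr
  have x2 : Λ^2 ≤ L*Λ^2 := le_mul_of_one_le_left (by positivity) hL
  have x3 : ℓ ≤ L*Λ^2*ℓ := le_mul_of_one_le_left hℓ (by grind)
  have x5 : L*Λ^2 ≤ L*Λ^3 := by gcongr
  have y1 : (2*Λ+2*(L*Λ))*Q≤15*L*Λ^2*(1+ℓ)*Q := by
    refine mul_mono_r ?_ (by positivity)
    linarith
  have y2 : 2*(L*Λ+ℓ)*D≤15*L*Λ^2*(1+ℓ)*D := by
    refine mul_mono_r ?_ (by positivity)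
    linarith
  have y3 : (10*Λ^2+4*L*Λ^2+L*Λ)*(μ*S)
      ≤ 15*L*Λ^2*(1+ℓ)*(μ*S) := by
    refine mul_mono_r ?_ (by positivity)
    linarith
  have y4 : (6*(L*Λ^3)+4*(L*Λ^2)+L*Λ)*(μ*a)≤11*L*Λ^3*(μ*a) := by
    gcongr
    linarith
  linarith

namespace Model

variable {M : Model} {m : Mesh} {β Θ Λ : ℝ} {k : ℕ} {w : ℕ → ℤ → ℝ} {L ℓ r μ α d : ℝ}
  {ψ Γ : ℝ → ℝ}

theorem TestBound.gamma_nonneg (h : TestBound ψ Γ d) (x : ℝ) : 0 ≤ Γ x := (h.nonneg x).trans (h.le x)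

theorem Profile.abs_f_le (hB : Bounds M Λ)
    (hf : ∀ a ∈ Icc (-r) r,∀ b ∈ Icc (-r) r,|M.f k a-M.f k b| ≤ L*|a-b|)
    (hα : |α| ≤ r) : |M.f k α| ≤ L*|α| := by
  have := hf α (abs_le.1 hα) 0 ⟨by linarith [abs_nonneg α],(abs_nonneg α).trans hα⟩
  simpa [Model.f] using this

/-- Bound of the production density by the test function and its derivative. -/
noncomputable def productionBound (M : Model) (Λ L r : ℝ) : ℝ :=
  L*(1+r)*Λ+(2*Λ*M.lanes.card+L*r*(2*Λ^2))

theorem Profile.abs_productionDensity_le (hB : Bounds M Λ) {z : ℕ → ℝ → ℝ} (hz : Profile M Θ z)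
    (hk : k ∈ M.lanes) (hL : 0 ≤ L) (hr : 1 ≤ r)
    (hf : ∀ a ∈ Icc (-r) r,∀ b ∈ Icc (-r) r,|M.f k a-M.f k b| ≤ L*|a-b|)
    (hα : |α| ≤ r) {x g : ℝ} (a7 : |ψ x| ≤ g) (a6 : |deriv ψ x| ≤ g) :
    |productionDensity M z k α ψ x| ≤ productionBound M Λ L r*g := by
  have h1 := hB.one_le
  have hx := hz.mem k hk x
  have a1 : |M.kruzkovFlux k (z k x) α| ≤ L*(1+r) := by
    refine (abs_kruzkovFlux_le (hf _ ⟨by linarith [hx.1],by linarith [hx.2]⟩ _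
      (abs_le.1 hα))).trans (mul_mono_l ?_ hL)
    refine (abs_sub _ _).trans (add_le_add ?_ hα)
    rw [abs_of_nonneg hx.1]; exact hx.2
  have a2 := hz.abs_vel_le hB hk x
  have a3 : |M.src z k x|≤2*Λ*M.lanes.card := by
    refine (hz.abs_src_le hB hk x).trans (mul_mono_l ?_ (by linarith))
    refine (Finset.sum_le_sum fun j hj => (hz.mem j hj x).2).trans (le_of_eq ?_)
    simp
  have a4 := (Profile.abs_f_le hB hf hα).trans (mul_mono_l hα hL)
  have a5 := hz.abs_dvel_le hB hk x
  rw [productionDensity,productionBound,add_mul]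
  refine (abs_add_le _ _).trans (add_le_add ?_ ?_)
  · rw [abs_mul,abs_mul]
    gcongr
  · rw [abs_mul]
    refine mul_le_mul ((abs_sign_mul_le _ _).trans ((abs_sub _ _).trans (add_le_add a3 ?_))) a7
      (abs_nonneg _) (by positivity)
    rw [abs_mul]
    gcongr

theorem measurable_productionDensity {X : Type*} [MeasurableSpace X] (H : M.Standing)
    {u : ℕ → X → ℝ → ℝ} (hu : ∀ j ∈ M.lanes,Measurable fun p : X × ℝ => u j p.1 p.2)
    (hk : k ∈ M.lanes) {φ : X → ℝ → ℝ} (hφ : Measurable fun p : X × ℝ => φ p.1 p.2)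
    (hφ' : Measurable fun p : X × ℝ => deriv (φ p.1) p.2) :
    Measurable fun p : X × ℝ => productionDensity M (u · p.1) k α (φ p.1) p.2 :=
  (((measurable_kruzkovFlux H hk (hu k hk) measurable_const).mul (measurable_vel hu H hk)).mul
    hφ').add (((sign_measurable.comp ((hu k hk).sub_const α)).mul
    ((measurable_src hu H hk).sub ((measurable_dvel hu H hk).const_mul _))).mul hφ)

theorem TestBound.abs_le (h : TestBound ψ Γ d) (x : ℝ) : |ψ x| ≤ Γ x := by
  rw [abs_of_nonneg (h.nonneg x)]; exact h.le x

theorem Profile.integrable_productionDensity (hB : Bounds M Λ) {z : ℕ → ℝ → ℝ}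
    (hz : Profile M Θ z) (hk : k ∈ M.lanes) (hL : 0 ≤ L) (hr : 1 ≤ r)
    (hf : ∀ a ∈ Icc (-r) r,∀ b ∈ Icc (-r) r,|M.f k a-M.f k b| ≤ L*|a-b|)
    (hα : |α| ≤ r) (hψ : TestBound ψ Γ d) : Integrable (productionDensity M z k α ψ) :=
  integrable_of_dominated hψ.integrable ((measurable_productionDensity (u := fun j (_ : Unit) => z j)
    (φ := fun _ => ψ) hB.std hz.unit_meas hk (hψ.cont.measurable.comp measurable_snd)
    ((measurable_deriv ψ).comp measurable_snd)).comp
    (measurable_const.prodMk measurable_id : Measurable fun x => ((),x)))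
    fun x => hz.abs_productionDensity_le hB hk hL hr hf hα (hψ.abs_le x) (hψ.deriv_le x)

local notation "st[" m "," w "]" => fun j => stepFn m (w j)

namespace Admissible

variable (h : Admissible M m β) (hB : Bounds M Λ) (hw : UnitValued M w)
  (hW : Profile M Θ st[m,w]) (hZ : Profile M Θ st[m,M.step m β w])
  (hk : k ∈ M.lanes) (hdx : m.Δx≤1) (hl : 1 ≤ ℓ*m.lam) (hL : 1 ≤ L) (hr : 1 ≤ r)
  (hf : ∀ a ∈ Icc (-r) r,∀ b ∈ Icc (-r) r,|M.f k a-M.f k b| ≤ L*|a-b|)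
  (hμ : m.Δx+M.gap st[m,w] st[m,M.step m β w] ≤ μ)
include h hB hw hW hZ hk hdx hl hL hr hf hμ

/-- The entropy flux through the right boundary of the cell of `x`. -/
theorem entropy_step_pointwise (hα : |α| ≤ r) (hψ : TestBound ψ Γ m.Δx) (x : ℝ) :
    (|stepFn m (M.step m β w k) x-α| - |stepFn m (w k) x-α|)*ψ x
      + m.lam*(stepFn m (fun i => M.entropyFlux m β k (w k) i (w k i) (w k (i+1)) α) x
          * ψ (x+m.Δx)
        - stepFn m (fun i => M.entropyFlux m β k (w k) i (w k i) (w k (i+1)) α) (x-m.Δx)*ψ x)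
      ≤ m.Δt*productionDensity M st[m,M.step m β w] k α ψ x+m.Δt*((stepError M m Λ L ℓ r μ st[m,w]
          st[m,M.step m β w] k x+11*L*Λ^3*μ*|α|)*Γ x) := by
  have h1 := hB.one_le
  have hdx0 := h.dx_pos
  have hdt := h.dt_pos
  have hℓ := nonneg_of_mul_nonneg_left (zero_le_one.trans hl) h.lam_pos
  have hcell := h.cell_entropy hw α (m.cellIndex x) hk
  have hR := h.source_error hB hw hW hZ hk hμ x
  have hD := h.gradient_error hB hw hW hZ hk hμ x
  have hF := h.flux_error hB hw hW hZ hk hl hL hr hf hα hμ x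
  have hz := hZ.mem k hk x
  have hpred : m.cellIndex (x-m.Δx) = m.cellIndex x-1 := by
    have := Mesh.cellIndex_add hdx0 (x-m.Δx)
    rw [sub_add_cancel] at this
    omega
  have hG1 : stepFn m (fun i => M.entropyFlux m β k (w k) i (w k i) (w k (i+1)) α) (x-m.Δx)
      = M.entropyFlux m β k (w k) (m.cellIndex x-1) (w k (m.cellIndex x-1))
        (w k (m.cellIndex x)) α := by
    simp only [stepFn,hpred,sub_add_cancel]
  have hG : stepFn m (fun i => M.entropyFlux m β k (w k) i (w k i) (w k (i+1)) α) x
      = M.entropyFlux m β k (w k) (m.cellIndex x) (w k (m.cellIndex x))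
        (w k (m.cellIndex x+1)) α := rfl
  rw [hG1,hG]
  set G := M.entropyFlux m β k (w k) (m.cellIndex x) (w k (m.cellIndex x))
        (w k (m.cellIndex x+1)) α
  set G' := M.entropyFlux m β k (w k) (m.cellIndex x-1) (w k (m.cellIndex x-1))
        (w k (m.cellIndex x)) α
  have hfα := Profile.abs_f_le hB hf hα
  have hkr : |M.kruzkovFlux k (stepFn m (M.step m β w k) x) α|
      ≤ L*(stepFn m (M.step m β w k) x+|α|) := by
    refine (abs_kruzkovFlux_le (hf _ ⟨by linarith [hz.1],by linarith [hz.2]⟩ _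
      (abs_le.1 hα))).trans ?_
    gcongr
    exact (abs_sub _ _).trans (by rw [abs_of_nonneg hz.1])
  have hvel := hZ.abs_vel_le hB hk x
  have hsq := hW.abs_sub_le_add hZ hk x x
  rw [productionDensity,stepError]
  have hqQ : |stepFn m (w k) x-stepFn m (M.step m β w k) x|
      ≤ ∑ j ∈ M.lanes,|stepFn m (w j) x-stepFn m (M.step m β w j) x| :=
    Finset.single_le_sum (f := fun j => |stepFn m (w j) x-stepFn m (M.step m β w j) x|)
      (fun _ _ => abs_nonneg _) hk
  have hzS := hZ.le_sum hk x
  have he0 : 0 ≤ gradError M m Λ st[m,w] st[m,M.step m β w] k x := by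
    unfold gradError halfTaylor
    positivity
  have hwx : w k (m.cellIndex x) = stepFn m (w k) x := rfl
  have hzx : M.step m β w k (m.cellIndex x) = stepFn m (M.step m β w k) x := rfl
  rw [hzx,hwx] at hcell
  set z := stepFn m (M.step m β w k) x
  set a := stepFn m (w k) x
  set R := M.discreteSource m w k (m.cellIndex x)
  set src := M.src st[m,M.step m β w] k x
  set dvel := M.dvel st[m,M.step m β w] k x
  set vel := M.vel st[m,M.step m β w] k x
  set n1 := M.ν k (m.half (m.cellIndex x)) (M.cHalf m (w k) (m.cellIndex x))
  set n0 := M.ν k (m.half (m.cellIndex x-1)) (M.cHalf m (w k) (m.cellIndex x-1))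
  set Q := ∑ j ∈ M.lanes,|stepFn m (w j) x-stepFn m (M.step m β w j) x|
  set S := ∑ j ∈ M.lanes,stepFn m (M.step m β w j) x
  set D := |stepFn m (w k) (x+m.Δx)-a|
  set e := gradError M m Λ st[m,w] st[m,M.step m β w] k x
  set σ := Real.sign (z-α)
  set K := M.kruzkovFlux k z α
  have hμ0 : m.Δx ≤ μ := le_trans (le_add_of_nonneg_right (gap_nonneg _ _)) hμ
  have hμ00 : 0 ≤ μ := hdx0.le.trans hμ0
  have hQ0 : 0 ≤ Q := (abs_nonneg _).trans hqQ
  have hD0 : 0 ≤ D := abs_nonneg _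
  have hS0 : 0 ≤ S := hz.1.trans hzS
  have hα0 := abs_nonneg α
  have hΓ := hψ.gamma_nonneg x
  have hlam : m.lam*m.Δx = m.Δt := h.lam_mul_dx
  have c1 : |z-α| - |a-α| + m.lam*(G-G') ≤ m.Δt*(σ*(src-M.f k α*dvel))
      + m.Δt*(2*Λ*Q+10*Λ^2*μ*S+L*|α| * (6*Λ^3*μ)+L*r*e) := by
    have e1 : m.Δt*σ*R-m.lam*σ*M.f k α*(n1-n0) = m.Δt*(σ*(src-M.f k α*dvel))
          + m.Δt*(σ*((R-src)-M.f k α*((n1-n0)/m.Δx-dvel))) := by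
      rw [← hlam]
      field_simp
      ring
    have e2 : σ*((R-src)-M.f k α*((n1-n0)/m.Δx-dvel))
        ≤ 2*Λ*Q+10*Λ^2*μ*S+L*|α| * (6*Λ^3*μ)+L*r*e := by
      refine (sign_mul_le_abs _ _).trans ((abs_sub _ _).trans ?_)
      rw [abs_mul]
      have b1 : |M.f k α| * |(n1-n0)/m.Δx-dvel| ≤ L*|α| * (6*Λ^3*μ+e) := by
        gcongr
      have b2 : L*|α| * e ≤ L*r*e := by gcongr
      linarith
    have := mul_mono_l e2 hdt.le
    linarith
  set F := L*Λ*|a-z| + (L*Λ+ℓ)*D+2*L*Λ^2*μ*(z+|α|) with hFd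
  have hF0 : 0 ≤ F := (abs_nonneg _).trans hF
  have hKv : |K*vel| ≤ L*Λ*(z+|α|) := by
    rw [abs_mul]
    have hz0 := hz.1
    calc _ ≤ L*(z+|α|)*Λ := by gcongr
      _ = _ := by ring
  have hGabs : |G| ≤ F+L*Λ*(z+|α|) := by
    have := abs_sub_abs_le_abs_sub G (K*vel)
    linarith
  have c2 : G*(ψ (x+m.Δx)-ψ x) ≤ m.Δx*(K*vel*deriv ψ x)
      + m.Δx*((2*F+μ*(L*Λ*(z+|α|)))*Γ x) := by
    have e1 : G*(ψ (x+m.Δx)-ψ x) = m.Δx*(K*vel*deriv ψ x)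
        + m.Δx*((G-K*vel)*deriv ψ x)
        + G*(ψ (x+m.Δx)-ψ x-m.Δx*deriv ψ x) := by ring
    have e2 : (G-K*vel)*deriv ψ x ≤ F*Γ x := by
      refine (le_abs_self _).trans ?_
      rw [abs_mul]
      exact mul_le_mul hF (hψ.deriv_le x) (abs_nonneg _) hF0
    have e3 : G*(ψ (x+m.Δx)-ψ x-m.Δx*deriv ψ x)
        ≤ (F+L*Λ*(z+|α|))*(m.Δx^2*Γ x) := by
      refine (le_abs_self _).trans ?_
      rw [abs_mul]
      exact mul_le_mul hGabs (hψ.taylor x) (abs_nonneg _) ((abs_nonneg _).trans hGabs)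
    have e4 : (F+L*Λ*(z+|α|))*m.Δx ≤ F+μ*(L*Λ*(z+|α|)) := by
      have hz0 := hz.1
      have h0 : 0 ≤ L*Λ*(z+|α|) := by positivity
      rw [add_mul,mul_comm μ]
      exact add_le_add (mul_le_of_le_one_right hF0 hdx) (mul_mono_l hμ0 h0)
    have e5 := mul_mono_l e2 hdx0.le
    have e6 : (F+L*Λ*(z+|α|))*(m.Δx^2*Γ x)
        ≤ m.Δx*((F+μ*(L*Λ*(z+|α|)))*Γ x) := by
      have := mul_mono_r e4 (mul_nonneg hdx0.le hΓ)
      linarith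
    rw [e1]
    linarith
  have total := stepError_arith (e := e) (r := r) h1 hL hℓ hμ00 hqQ hQ0 hD0 hzS hS0 hα0
  have c3 := mul_mono_r c1 (hψ.nonneg x)
  have hE1 : 0≤2*Λ*Q+10*Λ^2*μ*S+L*|α| * (6*Λ^3*μ)+L*r*e := by
    positivity
  have c4 : (2*Λ*Q+10*Λ^2*μ*S+L*|α| * (6*Λ^3*μ)+L*r*e)*ψ x
      ≤ (2*Λ*Q+10*Λ^2*μ*S+L*|α| * (6*Λ^3*μ)+L*r*e)*Γ x :=
    mul_mono_l (hψ.le x) hE1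
  have c5 := mul_mono_l c2 h.lam_pos.le
  have c6 := mul_mono_r total hΓ
  have c7 := mul_mono_l c4 hdt.le
  have c8 := mul_mono_l c6 hdt.le
  have e9 : m.lam*(m.Δx*(K*vel*deriv ψ x)
      + m.Δx*((2*F+μ*(L*Λ*(z+|α|)))*Γ x))
      = m.Δt*(K*vel*deriv ψ x)+m.Δt*((2*F+μ*(L*Λ*(z+|α|)))*Γ x) := by
    rw [← hlam]; ring
  linarith

theorem stepError_integrable (hΘ : 0 ≤ Θ) : Integrable (stepError M m Λ L ℓ r μ st[m,w] st[m,M.step m β w] k) ∧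
    ∫ x,stepError M m Λ L ℓ r μ st[m,w] st[m,M.step m β w] k x≤(15*L*Λ^2*(1+ℓ)*(1+Θ+M.lanes.card*Θ)
        + L*r*(4*Λ^2*(Θ+1)))*μ := by
  have hdx0 := h.dx_pos
  have hℓ : 0 ≤ ℓ := by
    by_contra hneg
    linarith [mul_neg_of_neg_of_pos (not_le.1 hneg) h.lam_pos]
  obtain ⟨ig,eg⟩ := hW.integral_gradError_le hB hZ hk hdx0 hΘ
  set W : ℕ → ℝ → ℝ := st[m,w]
  set Z : ℕ → ℝ → ℝ := st[m,M.step m β w]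
  have g0 := gap_nonneg (M := M) W Z
  have i1 : Integrable fun x => ∑ j ∈ M.lanes,|W j x-Z j x| :=
    integrable_finsetSum _ fun j hj => ((hW.integrable j hj).sub (hZ.integrable j hj)).abs
  have i2 : Integrable fun x => |W k (x+m.Δx)-W k x| :=
    (((hW.integrable k hk).comp_add_right m.Δx).sub (hW.integrable k hk)).abs
  have i3 : Integrable fun x => μ*∑ j ∈ M.lanes,Z j x :=
    (integrable_finsetSum _ fun j hj => hZ.integrable j hj).const_mul μ
  have e1 : ∫ x,∑ j ∈ M.lanes,|W j x-Z j x| = M.gap W Z := by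
    exact integral_finsetSum _ fun j hj => ((hW.integrable j hj).sub (hZ.integrable j hj)).abs
  have e2 := hW.translate k hk m.Δx
  rw [abs_of_pos hdx0] at e2
  have e3 : ∫ x,μ*∑ j ∈ M.lanes,Z j x ≤ μ*(M.lanes.card*Θ) := by
    rw [integral_const_mul,integral_finsetSum _ fun j hj => hZ.integrable j hj]
    refine mul_mono_l ((Finset.sum_le_sum fun j hj => hZ.mass j hj).trans
      (le_of_eq (by simp))) (by linarith)
  have isum : Integrable fun x => (∑ j ∈ M.lanes,|W j x-Z j x|)+|W k (x+m.Δx)-W k x|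
    + μ*∑ j ∈ M.lanes,Z j x := (i1.add i2).add i3
  have esum : ∫ x,((∑ j ∈ M.lanes,|W j x-Z j x|)+|W k (x+m.Δx)-W k x|
      + μ*∑ j ∈ M.lanes,Z j x)≤(1+Θ+M.lanes.card*Θ)*μ := by
    have i12 : Integrable fun x => (∑ j ∈ M.lanes,|W j x-Z j x|)+|W k (x+m.Δx)-W k x| :=
      i1.add i2
    rw [integral_add i12 i3,integral_add i1 i2,e1]
    have : Θ*m.Δx ≤ Θ*μ := by gcongr; linarith
    linarith
  refine ⟨(isum.const_mul _).add (ig.const_mul _),?_⟩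
  have e : ∫ x,stepError M m Λ L ℓ r μ W Z k x=15*L*Λ^2*(1+ℓ) *
      (∫ x,((∑ j ∈ M.lanes,|W j x-Z j x|)+|W k (x+m.Δx)-W k x|
        + μ*∑ j ∈ M.lanes,Z j x))+L*r*∫ x,gradError M m Λ W Z k x := by
    rw [← integral_const_mul,← integral_const_mul]
    exact integral_add (isum.const_mul _) (ig.const_mul _)
  rw [e]
  have eg' := eg.trans (mul_mono_l hμ (by positivity))
  calc _≤15*L*Λ^2*(1+ℓ)*((1+Θ+M.lanes.card*Θ)*μ)
        + L*r*(4*Λ^2*(Θ+1)*μ) := by gcongr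
    _ = _ := by ring

/-- Entropy inequality of one time step, tested with `ψ`. -/
theorem entropy_step (hΘ : 0 ≤ Θ) (hα : |α| ≤ r) (hψ : TestBound ψ Γ m.Δx) :
    (∫ x,|stepFn m (M.step m β w k) x-α| * ψ x)-∫ x,|stepFn m (w k) x-α| * ψ x
      ≤ m.Δt*(∫ x,productionDensity M st[m,M.step m β w] k α ψ x)+m.Δt*∫ x,(stepError M m Λ L ℓ r μ st[m,w]
          st[m,M.step m β w] k x+11*L*Λ^3*μ*|α|)*Γ x := by
  have h1 := hB.one_le
  have hdx0 := h.dx_pos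
  have hpt := h.entropy_step_pointwise hB hw hW hZ hk hdx hl hL hr hf hμ hα hψ
  have hflux := h.flux_error hB hw hW hZ hk hl hL hr hf hα hμ
  obtain ⟨ie,-⟩ := h.stepError_integrable hB hw hW hZ hk hdx hl hL hr hf hμ hΘ
  have ip := hZ.integrable_productionDensity hB hk (by linarith) hr hf hα hψ
  have hℓ : 0 ≤ ℓ := by
    by_contra hneg
    linarith [mul_neg_of_neg_of_pos (not_le.1 hneg) h.lam_pos]
  have hμ0 := (add_nonneg hdx0.le (gap_nonneg _ _)).trans hμ
  set Gs : ℤ → ℝ := fun i => M.entropyFlux m β k (w k) i (w k i) (w k (i+1)) α with hGs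
  have hGm := m.measurable_stepFn Gs
  have hGb : ∃ b,∀ x,|stepFn m Gs x| ≤ b := by
    refine ⟨L*Λ*1+(L*Λ+ℓ)*1+2*L*Λ^2*μ*(1+|α|)+L*(1+r)*Λ,
      fun x => ?_⟩
    have a := hflux x
    have hz := hZ.mem k hk x
    have ha := hW.mem k hk x
    have hb := hW.mem k hk (x+m.Δx)
    have b1 : |stepFn m (w k) x-stepFn m (M.step m β w k) x|≤1 := by
      rw [abs_le]; constructor <;> linarith [hz.1,hz.2,ha.1,ha.2]
    have b2 : |stepFn m (w k) (x+m.Δx)-stepFn m (w k) x|≤1 := by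
      rw [abs_le]; constructor <;> linarith [hb.1,hb.2,ha.1,ha.2]
    have b3 : |M.kruzkovFlux k (stepFn m (M.step m β w k) x) α| ≤ L*(1+r) := by
      refine (abs_kruzkovFlux_le (hf _ ⟨by linarith [hz.1],by linarith [hz.2]⟩ _
        (abs_le.1 hα))).trans (mul_mono_l ?_ (by linarith))
      refine (abs_sub _ _).trans (add_le_add ?_ hα)
      rw [abs_of_nonneg hz.1]; exact hz.2
    have b4 : |M.kruzkovFlux k (stepFn m (M.step m β w k) x) α
        * M.vel st[m,M.step m β w] k x| ≤ L*(1+r)*Λ := by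
      rw [abs_mul]
      have := hZ.abs_vel_le hB hk x
      gcongr
    have b5 := abs_sub_abs_le_abs_sub (stepFn m Gs x) (M.kruzkovFlux k (stepFn m (M.step m β w k) x) α
        * M.vel st[m,M.step m β w] k x)
    have b6 : L*Λ*|stepFn m (w k) x-stepFn m (M.step m β w k) x|
        + (L*Λ+ℓ)*|stepFn m (w k) (x+m.Δx)-stepFn m (w k) x|
        + 2*L*Λ^2*μ*(stepFn m (M.step m β w k) x+|α|)
        ≤ L*Λ*1+(L*Λ+ℓ)*1+2*L*Λ^2*μ*(1+|α|) := by
      have := hz.2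
      gcongr
    have a' : |stepFn m Gs x-M.kruzkovFlux k (stepFn m (M.step m β w k) x) α
        * M.vel st[m,M.step m β w] k x| ≤ _ := a
    linarith
  obtain ⟨b,hb⟩ := hGb
  have hψb := hψ.abs_le
  have iA : ∀ {v : ℤ → ℝ},(∀ i,v i ∈ Icc 0 1) →
      Integrable fun x => |stepFn m v x-α| * ψ x := fun {v} hv =>
    integrable_of_dominated (c := 1+|α|) hψ.integrable
      (((m.measurable_stepFn v).sub_const α).abs.mul hψ.cont.measurable) fun x => by
        rw [abs_mul,abs_abs]
        refine mul_le_mul ((abs_sub _ _).trans (add_le_add ?_ le_rfl)) (hψb x) (abs_nonneg _)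
          (by positivity)
        rw [stepFn,abs_of_nonneg (hv _).1]; exact (hv _).2
  have iA1 := iA (h.step_mem hw k hk)
  have iA0 := iA (hw k hk)
  have iG0 : Integrable fun x => stepFn m Gs (x-m.Δx)*ψ x :=
    integrable_of_dominated hψ.integrable
      ((hGm.comp (measurable_id.sub_const _)).mul hψ.cont.measurable) fun x => by
        rw [abs_mul]
        exact mul_le_mul (hb _) (hψb x) (abs_nonneg _) ((abs_nonneg _).trans (hb x))
  have eG : (fun x => stepFn m Gs x*ψ (x+m.Δx))
      = fun x => (fun x => stepFn m Gs (x-m.Δx)*ψ x) (x+m.Δx) := by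
    funext x; simp [add_sub_cancel_right]
  have iG1 : Integrable fun x => stepFn m Gs x*ψ (x+m.Δx) := by
    rw [eG]; exact iG0.comp_add_right m.Δx
  have eqG : ∫ x,stepFn m Gs x*ψ (x+m.Δx)=∫ x,stepFn m Gs (x-m.Δx)*ψ x := by
    rw [eG]; exact integral_add_right_eq_self (fun x => stepFn m Gs (x-m.Δx)*ψ x) _
  have iE : Integrable fun x => (stepError M m Λ L ℓ r μ st[m,w]
      st[m,M.step m β w] k x+11*L*Λ^3*μ*|α|)*Γ x := by
    obtain ⟨c,hc⟩ := hψ.bounded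
    have i1 := ie.mul_bdd hψ.integrable.aestronglyMeasurable (.of_forall fun x => by
        rw [Real.norm_eq_abs,abs_of_nonneg (hψ.gamma_nonneg x)]; exact hc x)
    have i2 := i1.add (hψ.integrable.const_mul (11*L*Λ^3*μ*|α|))
    refine i2.congr (.of_forall fun x => ?_)
    simp [Pi.add_apply]
    ring
  have iL : Integrable fun x => (|stepFn m (M.step m β w k) x-α| - |stepFn m (w k) x-α|)*ψ x
      := by
    refine (iA1.sub iA0).congr (.of_forall fun x => ?_)
    simp [Pi.sub_apply]
    ring
  have e0 : ∫ x,(|stepFn m (M.step m β w k) x-α| - |stepFn m (w k) x-α|)*ψ x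
      = (∫ x,|stepFn m (M.step m β w k) x-α| * ψ x)-∫ x,|stepFn m (w k) x-α| * ψ x := by
    rw [← integral_sub iA1 iA0]
    congr 1
    funext x
    ring
  have iGd := (iG1.sub iG0).const_mul m.lam
  have hint := integral_mono (iL.add iGd) ((ip.const_mul m.Δt).add (iE.const_mul m.Δt)) hpt
  simp only [Pi.add_apply] at hint
  have eGd : ∫ x,m.lam*((fun x => stepFn m Gs x*ψ (x+m.Δx))
      - fun x => stepFn m Gs (x-m.Δx)*ψ x) x=0 := by
    rw [integral_const_mul,integral_sub' iG1 iG0,eqG,sub_self,mul_zero]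
  rw [integral_add iL iGd,integral_add (ip.const_mul _) (iE.const_mul _),e0,eGd,
    integral_const_mul,integral_const_mul,add_zero] at hint
  exact hint

end Admissible
end Model

/-! ### The scheme as an approximate entropy solution -/

theorem box_le_one (ε r : ℝ) : box ε r≤1 := by
  rcases le_or_gt |r| ε with h | h
  · rw [box_of_le h]
  · rw [box_of_lt h]; exact zero_le_one

theorem le_mul_box {c C R x : ℝ} (h : c ≤ C) (h0 : R < |x| → c≤0) : c ≤ C*box R x := by
  rcases le_or_gt |x| R with hx | hx
  · rwa [box_of_le hx,mul_one]
  · rw [box_of_lt hx,mul_zero]; exact h0 hx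

theorem integral_abs_sub_le_add {a b c : ℝ → ℝ} (ha : Integrable a) (hb : Integrable b)
    (hc : Integrable c) : ∫ x,|a x-c x|≤(∫ x,|a x-b x|)+∫ x,|b x-c x| := by
  rw [← integral_add (f := fun x => |a x-b x|) (g := fun x => |b x-c x|) (ha.sub hb).abs
    (hb.sub hc).abs]
  exact integral_mono (ha.sub hc).abs ((ha.sub hb).abs.add (hb.sub hc).abs)
    fun x => abs_sub_le _ _ _

theorem exists_testBound {ψ : ℝ → ℝ} (hs : ContDiff ℝ (⊤ : ℕ∞) ψ) (h0 : ∀ x,0 ≤ ψ x) {R : ℝ}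
    (hR : ∀ x,R < |x| → ψ x=0) (e : ℝ) :
    ∃ C,0 ≤ C ∧ ∀ d,0 ≤ d → d ≤ e → Model.TestBound ψ (fun x => C*box (R+e) x) d := by
  have hcs := HasCompactSupport.of_support_subset_isCompact
    (isCompact_Icc) fun x hx => by
      by_contra h
      exact hx (hR x (not_le.1 fun h' => h (abs_le.1 h')))
  have hd2 : ContDiff ℝ 1 (deriv ψ) := by
    have := (contDiff_succ_iff_deriv).1 (hs.of_le (by
      rw [show ((1 : WithTop ℕ∞)+1)=((2 : ℕ∞) : WithTop ℕ∞) from by norm_num]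
      exact_mod_cast le_top))
    exact this.2.2
  obtain ⟨K,hK⟩ := hd2.lipschitzWith_of_hasCompactSupport hcs.deriv (by norm_num)
  obtain ⟨c₀,hc₀⟩ := hcs.exists_bound_of_continuous hs.continuous
  obtain ⟨c₁,hc₁⟩ := hcs.deriv.exists_bound_of_continuous hd2.continuous
  simp [Real.norm_eq_abs] at hc₀ hc₁
  have p0 := (abs_nonneg _).trans (hc₀ 0)
  have p1 := (abs_nonneg _).trans (hc₁ 0)
  have p2 : (0 : ℝ) ≤ K := K.2
  have dz : ∀ x,R < |x| → deriv ψ x=0 := fun x hx => by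
    have : ψ =ᶠ[𝓝 x] fun _ => 0 := by
      filter_upwards [(isOpen_lt continuous_const continuous_abs).mem_nhds hx] with y hy
      exact hR y hy
    rw [this.deriv_eq,deriv_const]
  refine ⟨c₀+c₁+K,by positivity,fun d hd0 hd => ⟨hs.continuous,h0,fun x =>
    le_mul_box (by linarith [le_abs_self (ψ x),hc₀ x]) fun hx => (hR x (by linarith)).le,fun x =>
    le_mul_box (by linarith [hc₁ x]) fun hx => by rw [dz x (by linarith),abs_zero],fun x => ?_,
    (box_integrable _).const_mul _,_,fun x =>
    mul_le_of_le_one_right (by positivity) (box_le_one _ _)⟩⟩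
  rw [← mul_assoc]
  refine le_mul_box ?_ fun hx => ?_
  · have := Model.abs_taylor_of_lipschitz_deriv (hs.differentiable (by simp)) p2
      (fun p q => by simpa [Real.dist_eq] using hK.dist_le_mul p q) x (x+d)
    rw [add_sub_cancel_left,mul_comm (deriv ψ _)] at this
    nlinarith
  · grind

theorem Mollifier.exists_testBound {ε B : ℝ} {ρ : ℝ → ℝ} (h : Mollifier ε B ρ) :
    ∃ C,0 ≤ C ∧ ∀ d,0 ≤ d → d ≤ ε → ∀ y,
      Model.TestBound (fun x => ρ (x-y)) (fun x => C*box (2*ε) (x-y)) d := by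
  obtain ⟨C,hC,hb⟩ := MultiLane.exists_testBound h.smooth h.nonneg (fun x hx => h.eq_zero hx) ε
  refine ⟨C,hC,fun d h0 hd y => ?_⟩
  obtain ⟨b1,b2,b3,b4,b5,b6,c,b7⟩ := hb d h0 hd
  rw [← two_mul] at b3 b4 b5 b6 b7
  exact ⟨b1.comp (by fun_prop),fun x => b2 _,fun x => b3 _,fun x => by
    rw [deriv_comp_sub_const]; exact b4 _,fun x => by
    rw [deriv_comp_sub_const,add_sub_right_comm]; exact b5 _,b6.comp_sub_right y,c,fun x => b7 _⟩

namespace Model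

variable {M : Model} {m : Mesh} {β Θ Λ ε B T : ℝ} {k : ℕ} {w : ℕ → ℤ → ℝ} {L ℓ μ : ℝ} {ρ : ℝ → ℝ}
  {u₀ : ℕ → ℝ → ℝ}

theorem Profile.gap_triangle {a b c : ℕ → ℝ → ℝ} (ha : Profile M Θ a) (hb : Profile M Θ b)
    (hc : Profile M Θ c) : M.gap a c ≤ M.gap a b+M.gap b c := by
  rw [gap,gap,gap,← Finset.sum_add_distrib]
  exact Finset.sum_le_sum fun k hk => integral_abs_sub_le_add (ha.integrable k hk)
    (hb.integrable k hk) (hc.integrable k hk)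

theorem productionDensity_eq (z : ℕ → ℝ → ℝ) (v : ℕ → ℝ → ℝ) (x y : ℝ) :
    productionDensity M z k (v k y) (fun x => ρ (x-y)) x = M.pairing ρ z v k (x,y) := by
  rw [productionDensity,pairing,deriv_comp_sub_const]

/-- One time step, tested with a profile. -/
theorem Admissible.laneGap_step (h : Admissible M m β) (hB : Bounds M Λ) (hw : UnitValued M w)
    (hW : Profile M Θ fun j => stepFn m (w j)) (hZ : Profile M Θ fun j => stepFn m (M.step m β w j))
    (hk : k ∈ M.lanes) (hdx : m.Δx≤1) (hl : 1 ≤ ℓ*m.lam) (hL : 1 ≤ L)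
    (hf : ∀ a ∈ Icc (-1 : ℝ) 1,∀ b ∈ Icc (-1 : ℝ) 1,|M.f k a-M.f k b| ≤ L*|a-b|)
    (hμ : m.Δx+M.gap (fun j => stepFn m (w j)) (fun j => stepFn m (M.step m β w j)) ≤ μ)
    (hΘ : 0 ≤ Θ) (hρ : Mollifier ε B ρ) {C : ℝ} (hC : 0 ≤ C)
    (hψ : ∀ y,TestBound (fun x => ρ (x-y)) (fun x => C*box (2*ε) (x-y)) m.Δx)
    {v : ℕ → ℝ → ℝ} (hv : Profile M Θ v) :
    laneGap ρ (stepFn m (M.step m β w k)) (v k)-laneGap ρ (stepFn m (w k)) (v k)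
      ≤ m.Δt*(∫ p,M.pairing ρ (fun j => stepFn m (M.step m β w j)) v k p)
        + m.Δt*(4*ε*C*((15*L*Λ^2*(1+ℓ)*(1+Θ+M.lanes.card*Θ)
        + L*1*(4*Λ^2*(Θ+1)))+11*L*Λ^3*Θ)*μ) := by
  have h1 := hB.one_le
  have hε := hρ.pos
  have hμ0 : 0 ≤ μ := (add_nonneg h.dx_pos.le (gap_nonneg _ _)).trans hμ
  obtain ⟨ie,ee⟩ := h.stepError_integrable hB hw hW hZ hk hdx hl hL le_rfl hf hμ hΘ
  have hvi := hv.integrable k hk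
  have step := fun y => h.entropy_step hB hw hW hZ hk hdx hl hL le_rfl hf hμ hΘ
    (hv.abs_le_one hk y) (hψ y)
  set Z : ℕ → ℝ → ℝ := fun j => stepFn m (M.step m β w j) with hZd
  set E := stepError M m Λ L ℓ 1 μ (fun j => stepFn m (w j)) Z k with hE
  have b1 := ((BoxLe.fst (by positivity : 0≤2*ε) ie).add ((BoxLe.snd (by positivity : 0≤2*ε)
    hvi).const_mul (c := 11*L*Λ^3*μ) (by positivity))).const_mul hC
  have i1 := hρ.laneGap_integrable (hZ.integrable k hk) hvi (hZ.meas k hk) (hv.meas k hk)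
  have i0 := hρ.laneGap_integrable (hW.integrable k hk) hvi (hW.meas k hk) (hv.meas k hk)
  have ip := (hZ.pairing_integrable hB hv hρ hk).1
  have i4 := b1.1
  have e4 := b1.2
  simp only [laneGap]
  rw [Measure.volume_eq_prod] at i1 i0 ip i4 e4 ⊢
  rw [integral_prod_symm _ i1,integral_prod_symm _ i0,integral_prod_symm _ ip,
    ← integral_sub i1.integral_prod_right i0.integral_prod_right,← integral_const_mul]
  rw [integral_prod_symm _ i4] at e4
  have hmono := integral_mono (i1.integral_prod_right.sub i0.integral_prod_right)
    ((ip.integral_prod_right.const_mul m.Δt).add (i4.integral_prod_right.const_mul m.Δt))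
    fun y => by
      have := step y
      refine this.trans (add_le_add (le_of_eq ?_) (le_of_eq ?_))
      · simp only [productionDensity_eq]
      · congr 1
        refine integral_congr_ae (.of_forall fun x => ?_)
        simp [abs_of_nonneg (hv.mem k hk y).1]
        ring
  refine hmono.trans ?_
  rw [integral_add' (ip.integral_prod_right.const_mul m.Δt)
    (i4.integral_prod_right.const_mul m.Δt),integral_const_mul m.Δt
    (fun y => ∫ x,C*(E x+11*L*Λ^3*μ*v k y)*box (2*ε) (x-y))]
  refine add_le_add le_rfl (mul_mono_l (e4.trans ?_) h.dt_pos.le)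
  have hm := hv.mass k hk
  calc _ ≤ C*(2*(2*ε)*(((15*L*Λ^2*(1+ℓ)*(1+Θ+M.lanes.card*Θ)
        + L*1*(4*Λ^2*(Θ+1))))*μ)
        + 11*L*Λ^3*μ*(2*(2*ε)*Θ)) := by gcongr
    _ = _ := by ring

/-! ### Uniform bounds for the scheme -/

theorem Mesh.integral_abs_sub_stepFn (hx : 0 < m.Δx) {v v' : ℤ → ℝ} {A : ℝ}
    (h : SumLe (fun i => |v' i-v i|) A) : ∫ x,|stepFn m v x-stepFn m v' x| ≤ m.Δx*A := by
  have := (Mesh.integral_stepFn hx (fun i => abs_nonneg (v' i-v i)) h.1).2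
  have e : (fun x => |stepFn m v x-stepFn m v' x|) = stepFn m fun i => |v' i-v i| := by
    funext x; simp [stepFn]; rw [abs_sub_comm]
  rw [e,this]
  exact mul_mono_l h.2 hx.le

local notation "st[" m "," w "]" => fun j => stepFn m (w j)

theorem exists_uniform_profile (H : M.Standing) (hu : M.InitialData u₀) (hT : 0 ≤ T) (hℓ : 0 ≤ ℓ) :
    ∃ Θ,1 ≤ Θ ∧ ∀ m β,Admissible M m β → m.Fits M T → 1 ≤ ℓ*m.lam → ∀ n ≤ m.NT,
      Profile M Θ st[m,M.approx m β u₀ n] ∧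
      M.gap st[m,M.approx m β u₀ n] st[m,M.approx m β u₀ (n+1)] ≤ Θ*m.Δt ∧
      ∀ k ∈ M.lanes,eVariationOn (stepFn m (M.approx m β u₀ n k)) univ ≤ ENNReal.ofReal Θ := by
  obtain ⟨K,hK0,hK⟩ := hu.translate
  set r := M.growthRate u₀ with hr
  have hm0 := dataL1_nonneg M u₀
  have hS := SLip_nonneg (M := M)
  have hLp : 0 ≤ M.maxLane M.fLip := maxLane_nonneg fun k => fLip_nonneg k
  have hP := nuNorm_nonneg (M := M) D1
  have hQ := nuNorm_nonneg (M := M) D2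
  have hκ := H.kernelTV_nonneg
  obtain ⟨V,hV⟩ : ∃ V,V = Real.exp (r*T)*(M.lanes.card*K+1) := ⟨_,rfl⟩
  have hV0 : 0 ≤ V := by rw [hV]; positivity
  obtain ⟨Y,hY⟩ : ∃ Y,Y=2*ℓ*V+(M.nuNorm D1+M.nuNorm D2*(2*M.kernelTV))
    * M.maxLane M.fLip*M.dataL1 u₀+4*M.SLip*M.dataL1 u₀ := ⟨_,rfl⟩
  have hY0 : 0 ≤ Y := by rw [hY]; positivity
  refine ⟨1+M.dataL1 u₀+V+M.lanes.card*Y,by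
    have : 0 ≤ M.lanes.card*Y := by positivity
    linarith,fun m β h hfit hl n hn => ?_⟩
  have hdx := h.dx_pos
  have hdt := h.dt_pos
  obtain ⟨hw,hb⟩ := h.budget hu n
  have htv : ∀ k ∈ M.lanes,discreteTV (M.approx m β u₀ n k) ≤ V := fun k hk => by
    have h1 := h.tv_le hu n
    have h2 := le_sum_lanes hb.tv_nonneg hk
    have h3 : ∑ k ∈ M.lanes,discreteTV (M.approx m β u₀ 0 k) ≤ M.lanes.card*K :=
      (Finset.sum_le_sum fun k hk => (hu.approx_zero_tv hdx hk (hK k hk)).2).trans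
        (le_of_eq (by simp))
    have h4 : m.time n ≤ T := by
      rw [hfit.T_eq,Mesh.time]
      gcongr
    have h5 : Real.exp (r*m.time n) ≤ Real.exp (r*T) :=
      Real.exp_le_exp.2 (mul_mono_l h4 (growthRate_nonneg H))
    have h6 := Finset.sum_nonneg (h.budget hu 0).2.tv_nonneg
    have h7 : Real.exp (r*m.time n)*(∑ k ∈ M.lanes,discreteTV (M.approx m β u₀ 0 k)+1)
        ≤ V := by rw [hV]; gcongr
    linarith
  have hnY : 0 ≤ M.lanes.card*Y := by positivity
  refine ⟨h.stepProfile hw hb (by linarith) (fun k hk => by linarith [htv k hk]) fun k hk => ?_,?_,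
    fun k hk => Mesh.eVariationOn_stepFn_le hdx ((hb.tv k hk).weaken (by linarith [htv k hk]))⟩
  · have := h.dx_mul_mass_le hu n
    linarith [mul_mono_l (le_sum_lanes hb.mass_nonneg hk) hdx.le]
  · have hmove : ∀ k ∈ M.lanes,∫ x,|stepFn m (M.approx m β u₀ n k) x
        - stepFn m (M.approx m β u₀ (n+1) k) x| ≤ m.Δt*Y := fun k hk => by
      refine (Mesh.integral_abs_sub_stepFn hdx (h.move_succ hu hk (htv k hk))).trans ?_
      rw [← mul_assoc,mul_div_cancel₀ _ hdx.ne']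
      refine mul_mono_l ?_ hdt.le
      have h8 : 2*β/m.lam≤2*ℓ := by
        rw [div_le_iff₀ h.lam_pos]
        linarith [h.beta_lt]
      have h9 : 2*β/m.lam*V≤2*ℓ*V := by gcongr
      rw [moveRate,hY]
      linarith
    calc _≤∑ _k ∈ M.lanes,m.Δt*Y := Finset.sum_le_sum hmove
      _=(M.lanes.card*Y)*m.Δt := by rw [Finset.sum_const,nsmul_eq_mul]; ring
      _ ≤ _ := mul_mono_r (by linarith) hdt.le

/-- The time level used at time `t`. -/
noncomputable def _root_.MultiLane.Mesh.level (m : Mesh) (t : ℝ) : ℕ := min ⌈t/m.Δt⌉₊ m.NT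

/-- The approximate solution as a function on `ℝ × ℝ`. -/
noncomputable def schemeCurve (M : Model) (m : Mesh) (β : ℝ) (u₀ : ℕ → ℝ → ℝ) (k : ℕ) (t x : ℝ) : ℝ :=
  stepFn m (M.approx m β u₀ (m.level t) k) x

theorem Mesh.level_sub_le (ht : 0 < m.Δt) {s t : ℝ} (hst : s ≤ t) :
    m.level s ≤ m.level t ∧
      (m.level t : ℝ)*m.Δt ≤ m.level s*m.Δt+(t-s)+m.Δt := by
  refine ⟨min_le_min_right _ (Nat.ceil_mono (by gcongr)),?_⟩
  have h1 : m.level t ≤ m.level s+⌈(t-s)/m.Δt⌉₊ := by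
    have : ⌈t/m.Δt⌉₊ ≤ ⌈s/m.Δt⌉₊+⌈(t-s)/m.Δt⌉₊ := by
      have := Nat.ceil_add_le (s/m.Δt) ((t-s)/m.Δt)
      rwa [← add_div,add_sub_cancel] at this
    unfold Mesh.level
    omega
  have h2 : (⌈(t-s)/m.Δt⌉₊ : ℝ)*m.Δt≤(t-s)+m.Δt := by
    have := (Nat.ceil_lt_add_one (div_nonneg (sub_nonneg.2 hst) ht.le)).le
    have := mul_mono_r this ht.le
    rwa [add_mul,one_mul,div_mul_cancel₀ _ ht.ne'] at this
  have h3 : (m.level t : ℝ) ≤ m.level s+(⌈(t-s)/m.Δt⌉₊ : ℝ) := by exact_mod_cast h1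
  linarith [mul_mono_r h3 ht.le]

theorem Mesh.level_eq (hfit : m.Fits M T) {n : ℕ} (hn : n < m.NT) {t : ℝ}
    (ht : t ∈ Ioc (n*m.Δt) ((n+1 : ℕ)*m.Δt)) : m.level t = n+1 := by
  have hdt := hfit.dt_pos
  have : ⌈t/m.Δt⌉₊ = n+1 := by
    rw [Nat.ceil_eq_iff (by omega),Nat.add_sub_cancel,lt_div_iff₀ hdt,div_le_iff₀ hdt]
    exact ht
  rw [Mesh.level,this]
  omega

theorem Mesh.level_bounds (hfit : m.Fits M T) {t : ℝ} (ht : t ∈ Icc 0 T) :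
    t ≤ m.level t*m.Δt ∧ m.level t*m.Δt ≤ t+m.Δt ∧ m.level t*m.Δt ≤ T := by
  have hdt := hfit.dt_pos
  have hle : ⌈t/m.Δt⌉₊ ≤ m.NT := by rw [Nat.ceil_le,div_le_iff₀ hdt,← hfit.T_eq]; exact ht.2
  have e : m.level t = ⌈t/m.Δt⌉₊ := min_eq_left hle
  rw [e]
  refine ⟨?_,?_,?_⟩
  · rw [← div_le_iff₀ hdt]; exact Nat.le_ceil _
  · have := mul_mono_r (Nat.ceil_lt_add_one (div_nonneg ht.1 hdt.le)).le hdt.le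
    rwa [add_mul,one_mul,div_mul_cancel₀ _ hdt.ne'] at this
  · rw [hfit.T_eq]
    gcongr

theorem _root_.MultiLane.Mesh.measurable_level (m : Mesh) : Measurable m.level :=
  (Nat.measurable_ceil.comp (measurable_id.div_const _)).min measurable_const

theorem measurable_schemeCurve (m : Mesh) (β : ℝ) (u₀ : ℕ → ℝ → ℝ) (k : ℕ) :
    Measurable fun p : ℝ × ℝ => M.schemeCurve m β u₀ k p.1 p.2 := by
  have h2 := (m.measurable_level.comp measurable_fst).prodMk (m.measurable_cellIndex.comp measurable_snd)
  exact (measurable_of_countable fun q => M.approx m β u₀ q.1 k q.2).comp h2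

theorem Profile.mono {Θ' : ℝ} {z : ℕ → ℝ → ℝ} (h : Profile M Θ z) (hΘ : Θ ≤ Θ') : Profile M Θ' z :=
  ⟨h.meas,h.mem,h.integrable,fun k hk => (h.mass k hk).trans hΘ,
    fun k hk => (h.translate k hk).mono hΘ⟩

theorem schemeCurve_move (hfit : m.Fits M T)
    (hp : ∀ n ≤ m.NT,Profile M Θ st[m,M.approx m β u₀ n] ∧
      M.gap st[m,M.approx m β u₀ n] st[m,M.approx m β u₀ (n+1)] ≤ Θ*m.Δt) (hΘ : 0 ≤ Θ) (s t : ℝ) :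
    M.gap (M.schemeCurve m β u₀ · s) (M.schemeCurve m β u₀ · t)
      ≤ Θ*|s-t| + Θ*m.Δt := by
  have chain : ∀ j n : ℕ,n+j ≤ m.NT → M.gap st[m,M.approx m β u₀ n]
      st[m,M.approx m β u₀ (n+j)] ≤ j*(Θ*m.Δt) := fun j n => by
    induction j with
    | zero => intro _; simp [gap]
    | succ j ih =>
      intro hj
      have h3 := (hp n (by omega)).1.gap_triangle (hp (n+j) (by omega)).1 (hp (n+(j+1)) hj).1
      grind
  have main : ∀ s t : ℝ,s ≤ t → M.gap (M.schemeCurve m β u₀ · s)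
      (M.schemeCurve m β u₀ · t) ≤ Θ*|s-t| + Θ*m.Δt := fun s t hst => by
    obtain ⟨h1,h2⟩ := Mesh.level_sub_le hfit.dt_pos hst
    have h3 := chain (m.level t-m.level s) (m.level s) (by
      rw [Nat.add_sub_cancel' h1]; exact min_le_right _ _)
    rw [Nat.add_sub_cancel' h1,Nat.cast_sub h1] at h3
    rw [abs_of_nonpos (by linarith)]
    have := mul_mono_l h2 hΘ
    have h3' : M.gap (M.schemeCurve m β u₀ · s) (M.schemeCurve m β u₀ · t) ≤ _ := h3
    linarith
  rcases le_total s t with h | h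
  · exact main s t h
  · rw [gap_comm,abs_sub_comm]; exact main t s h

/-- A common Lipschitz constant of the fluxes on `[-r, r]`. -/
theorem Standing.exists_lip (H : M.Standing) (r : ℝ) : ∃ L : ℝ,1 ≤ L ∧ ∀ k ∈ M.lanes,
    ∀ a ∈ Icc (-r) r,∀ b ∈ Icc (-r) r,|M.f k a-M.f k b| ≤ L*|a-b| := by
  choose! C hC0 hC using fun k (hk : k ∈ M.lanes) => H.exists_f_lip hk r
  refine ⟨1+∑ k ∈ M.lanes,C k,by
    linarith [Finset.sum_nonneg fun k hk => hC0 k hk],fun k hk a ha b hb => (hC k hk a ha b hb).trans ?_⟩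
  have := Finset.single_le_sum (fun k hk => hC0 k hk) hk
  exact mul_mono_r (by linarith) (abs_nonneg _)

/-- Summation of one-step inequalities. -/
theorem Mesh.chain (hfit : m.Fits M T) {a p : ℕ → ℝ} {A X Θ : ℝ} (hp : ∀ n ≤ m.NT,|p n| ≤ A)
    (hX : 0 ≤ X) (hΘ : 0 ≤ Θ) (hstep : ∀ n < m.NT,a (n+1)-a n
      ≤ m.Δt*p (n+1)+m.Δt*(X*(m.Δx+Θ*m.Δt))) {t₁ t₂ : ℝ}
    (h0 : 0 ≤ t₁) (h12 : t₁ ≤ t₂) (h2T : t₂ ≤ T) :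
    a (m.level t₂)-a (m.level t₁)
      ≤ (∫ t in t₁..t₂,p (m.level t))+(2*A+T*(X*(1+Θ)))*(m.Δx+m.Δt) := by
  have hdt := hfit.dt_pos
  have hdx := hfit.dx_pos
  obtain ⟨κ,hκ⟩ : ∃ κ,κ = X*(m.Δx+Θ*m.Δt) := ⟨_,rfl⟩
  rw [← hκ] at hstep
  have hPb : ∀ t,|p (m.level t)| ≤ A := fun t => hp _ (min_le_right _ _)
  have hPm : Measurable fun t => p (m.level t) :=
    (measurable_of_countable p).comp m.measurable_level
  have iP := intervalIntegrable_of_bound hPm hPb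
  have chain : ∀ j n : ℕ,n+j ≤ m.NT → a (n+j)-a n ≤
      (∫ t in (n*m.Δt)..((n+j : ℕ)*m.Δt),p (m.level t))+j*(m.Δt*κ) := by
    intro j n
    induction j with
    | zero => intro _; simp
    | succ j ih =>
      intro hj
      have e : ∫ t in ((n+j : ℕ)*m.Δt)..((n+j+1 : ℕ)*m.Δt),p (m.level t)
          = m.Δt*p (n+j+1) := by
        have hle : ((n+j : ℕ) : ℝ)*m.Δt≤(n+j+1 : ℕ)*m.Δt := by push_cast; linarith
        rw [intervalIntegral.integral_of_le hle,setIntegral_congr_fun (g := fun _ =>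
          p (n+j+1)) measurableSet_Ioc fun t ht => by
            simp [Mesh.level_eq hfit (show n+j < m.NT by omega) ht],
          setIntegral_const,Measure.real,Real.volume_Ioc,
          ENNReal.toReal_ofReal (by linarith),smul_eq_mul]
        push_cast
        ring
      have e2 := intervalIntegral.integral_add_adjacent_intervals (iP (n*m.Δt) ((n+j : ℕ)*m.Δt))
        (iP ((n+j : ℕ)*m.Δt) ((n+j+1 : ℕ)*m.Δt))
      grind
  obtain ⟨l1,l2⟩ := Mesh.level_sub_le hdt h12
  obtain ⟨a1,a2,a3⟩ := Mesh.level_bounds hfit ⟨h0,h12.trans h2T⟩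
  obtain ⟨b1,b2,b3⟩ := Mesh.level_bounds hfit ⟨h0.trans h12,h2T⟩
  have hc := chain (m.level t₂-m.level t₁) (m.level t₁) (by
      rw [Nat.add_sub_cancel' l1]; exact min_le_right _ _)
  rw [Nat.add_sub_cancel' l1,Nat.cast_sub l1] at hc
  have e3 := intervalIntegral.integral_interval_sub_interval_comm
    (iP (m.level t₁*m.Δt) (m.level t₂*m.Δt)) (iP t₁ t₂) (iP _ _)
  have g1 := (abs_le.1 (abs_intervalIntegral_le hPb (m.level t₁*m.Δt) t₁)).2
  have g2 := (abs_le.1 (abs_intervalIntegral_le hPb (m.level t₂*m.Δt) t₂)).1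
  rw [abs_of_nonpos (by linarith)] at g1 g2
  have hA := (abs_nonneg _).trans (hPb 0)
  have hT : 0 ≤ T := by linarith
  have hκ0 : 0 ≤ κ := by rw [hκ]; positivity
  have h2 : T*κ ≤ T*(X*((1+Θ)*(m.Δx+m.Δt))) := by
    rw [hκ]
    gcongr
    nlinarith
  nlinarith

theorem exists_schemeCurve (H : M.Standing) (hu : M.InitialData u₀) (hT : 0 ≤ T) (hℓ : 0 ≤ ℓ) :
    ∃ Θ₀,1 ≤ Θ₀ ∧ ∀ Θ,Θ₀ ≤ Θ → ∀ ε B ρ,Mollifier ε B ρ → ∃ C,0 ≤ C ∧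
      ∀ m β,Admissible M m β → m.Fits M T → 1 ≤ ℓ*m.lam → m.Δx≤1 → m.Δx ≤ ε →
        Curve M T Θ ρ (C*(m.Δx+m.Δt)) (M.schemeCurve m β u₀) := by
  obtain ⟨Λ,hB⟩ := H.exists_bounds
  obtain ⟨Θ₀,hΘ₀,hprof⟩ := exists_uniform_profile H hu hT hℓ
  refine ⟨Θ₀,hΘ₀,fun Θ hΘ ε B ρ hρ => ?_⟩
  have hΛ := hB.one_le
  have hΘ0 : 0 ≤ Θ := by linarith
  have hε := hρ.pos
  have hB0 := hρ.B_nonneg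
  obtain ⟨Cρ,hCρ,hψ⟩ := hρ.exists_testBound
  obtain ⟨L,hL,hf⟩ := H.exists_lip 1
  obtain ⟨X,hX⟩ : ∃ X,X=4*ε*Cρ*((15*L*Λ^2*(1+ℓ)*(1+Θ+M.lanes.card*Θ)
        + L*1*(4*Λ^2*(Θ+1)))+11*L*Λ^3*Θ) := ⟨_,rfl⟩
  have hX0 : 0 ≤ X := by rw [hX]; positivity
  obtain ⟨A,hA⟩ : ∃ A,A=2*Λ^3*(B/ε^2+B/ε)
        * (2*ε*(M.lanes.card*Θ)+2*ε*(M.lanes.card*Θ)) := ⟨_,rfl⟩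
  have hA0 : 0 ≤ A := by rw [hA]; positivity
  refine ⟨2*A+Θ+T*(X*(1+Θ)),by positivity,fun m β h hfit hl hdx hdxε => ?_⟩
  have hdt := h.dt_pos
  have hdx0 := h.dx_pos
  have hp : ∀ n ≤ m.NT,Profile M Θ st[m,M.approx m β u₀ n] ∧
      M.gap st[m,M.approx m β u₀ n] st[m,M.approx m β u₀ (n+1)] ≤ Θ*m.Δt := fun n hn =>
    ⟨(hprof m β h hfit hl n hn).1.mono hΘ,(hprof m β h hfit hl n hn).2.1.trans
      (mul_mono_r hΘ hdt.le)⟩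
  have hprofile : ∀ t,Profile M Θ fun k => M.schemeCurve m β u₀ k t := fun t =>
    (hp _ (min_le_right _ _)).1
  have hTX : 0 ≤ T*(X*(1+Θ)) := by positivity
  refine ⟨fun k _ => measurable_schemeCurve m β u₀ k,hprofile,fun s t => ?_,?_⟩
  · refine (schemeCurve_move hfit hp hΘ0 s t).trans (add_le_add le_rfl ?_)
    nlinarith
  intro z hz k hk t₁ t₂ h0 h12 h2T
  have hc := Mesh.chain hfit (a := fun n => laneGap ρ (stepFn m (M.approx m β u₀ n k)) (z k))
    (A := A)
    (fun n hn => by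
      rw [hA]; exact ((hp n hn).1.pairing_integrable hB hz hρ hk).2) hX0 hΘ0 (fun n hn => by
      rw [hX]
      exact h.laneGap_step hB (h.budget hu n).1 (hp n hn.le).1 (hp (n+1) hn).1 hk hdx hl hL
        (hf k hk) (add_le_add le_rfl (hp n hn.le).2) hΘ0 hρ hCρ (hψ m.Δx hdx0.le hdxε) hz)
    h0 h12 h2T
  refine hc.trans (add_le_add le_rfl ?_)
  nlinarith

end Model

theorem ae_tendsto_of_rate {g : ℕ → ℝ → ℝ} (hg : ∀ j,Integrable (g j)) {C : ℝ}
    (h : ∀ j,∫ x,|g j x| ≤ C*(1/4)^j) :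
    ∀ᵐ x,Tendsto (fun j => 2^j*g j x) atTop (𝓝 0) := by
  have hs : ∑' j,∫⁻ x,‖2^j*g j x‖ₑ ≠ ⊤ := by
    have hsum : Summable fun j => C*(1/2 : ℝ)^j :=
      (summable_geometric_of_lt_one (by norm_num) (by norm_num)).mul_left C
    refine ne_top_of_le_ne_top hsum.tsum_ofReal_ne_top (ENNReal.tsum_le_tsum fun j => ?_)
    rw [← ofReal_integral_norm_eq_lintegral_enorm ((hg j).const_mul _)]
    refine ENNReal.ofReal_le_ofReal ?_
    simp only [Real.norm_eq_abs,abs_mul,abs_pow]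
    rw [integral_const_mul]
    refine (mul_mono_l (h j) (by positivity)).trans (le_of_eq ?_)
    rw [mul_left_comm,← mul_pow]
    norm_num
  rw [← lintegral_tsum fun j => ((hg j).const_mul _).aestronglyMeasurable.enorm] at hs
  filter_upwards [ae_lt_top' (AEMeasurable.ennreal_tsum fun j =>
    ((hg j).const_mul _).aestronglyMeasurable.enorm) hs] with x hx
  rw [tendsto_zero_iff_enorm_tendsto_zero]
  exact ENNReal.tendsto_atTop_zero_of_tsum_ne_top hx.ne

theorem eLpNorm_one_eq {f : ℝ → ℝ} (hf : Integrable f) :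
    eLpNorm f 1 volume = ENNReal.ofReal (∫ x,|f x|) := by
  rw [eLpNorm_one_eq_lintegral_enorm,← ofReal_integral_norm_eq_lintegral_enorm hf]
  rfl

/-- Limit of a sequence of time-dependent functions which is Cauchy in `L¹` at every time. -/
theorem exists_limit {U : ℕ → ℝ → ℝ → ℝ} (hm : ∀ j,Measurable fun p : ℝ × ℝ => U j p.1 p.2)
    (h01 : ∀ j t x,U j t x ∈ 𝕀) (hi : ∀ j t,Integrable (U j t))
    (hc : ∀ n i j,n ≤ i → n ≤ j → ∀ t,∫ x,|U i t x-U j t x|≤(1/4)^n) :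
    ∃ u : ℝ → ℝ → ℝ,(Measurable fun p : ℝ × ℝ => u p.1 p.2) ∧ (∀ t x,u t x ∈ 𝕀) ∧
      ∀ t,Integrable (u t) ∧ (∀ᵐ x,Tendsto (fun j => U j t x) atTop (𝓝 (u t x))) ∧
        ∀ n,∫ x,|U n t x-u t x|≤(1/4)^n := by
  obtain ⟨u,hu⟩ : ∃ u : ℝ → ℝ → ℝ,∀ t x,u t x = max 0 (min 1 (limsup (fun j => U j t x) atTop)) :=
    ⟨_,fun _ _ => rfl⟩
  have hum : Measurable fun p : ℝ × ℝ => u p.1 p.2 := by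
    simp [hu]
    exact measurable_const.max (measurable_const.min (Measurable.limsup hm))
  refine ⟨u,hum,fun t x => ?_,fun t => ?_⟩
  · rw [hu]; exact ⟨le_max_left _ _,max_le zero_le_one (min_le_left _ _)⟩
  have hd := fun i j => (hi i t).sub (hi j t)
  have hlim : ∀ᵐ x,Tendsto (fun j => U j t x) atTop (𝓝 (u t x)) := by
    have hsum : Summable fun j => 2*(1/4 : ℝ)^j :=
      (summable_geometric_of_lt_one (by norm_num) (by norm_num)).mul_left 2
    filter_upwards [Lp.ae_tendsto_of_cauchy_eLpNorm (fun j => (hi j t).aestronglyMeasurable)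
      le_rfl hsum.tsum_ofReal_ne_top fun N n m' hn hm' => by
        have e : eLpNorm (U n t-U m' t) 1 volume = _ := eLpNorm_one_eq (hd n m')
        rw [e]
        have : (0 : ℝ)<(1/4)^N := by positivity
        exact (ENNReal.ofReal_lt_ofReal_iff (by positivity)).2
          ((hc N n m' hn hm' t).trans_lt (by linarith))] with x ⟨l,hl⟩
    have hl01 := isClosed_Icc.mem_of_tendsto hl (Eventually.of_forall fun j => h01 j t x)
    rwa [hu,hl.limsup_eq,min_eq_right hl01.2,max_eq_right hl01.1]
  have hle : ∀ n,eLpNorm (fun x => U n t x-u t x) 1 volume ≤ ENNReal.ofReal ((1/4)^n) :=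
    fun n => by
      have h1 : ∀ᵐ x,Tendsto (fun j => U n t x-U j t x) atTop (𝓝 (U n t x-u t x)) := by
        filter_upwards [hlim] with x hx using hx.const_sub _
      refine (Lp.eLpNorm_lim_le_liminf_eLpNorm (fun j => (hd n j).aestronglyMeasurable) _ h1).trans ?_
      · refine liminf_le_of_frequently_le' (Eventually.frequently ?_)
        filter_upwards [eventually_ge_atTop n] with j hj
        rw [eLpNorm_one_eq (hd n j)]
        exact ENNReal.ofReal_le_ofReal (hc n n j le_rfl hj t)
  have hdi : ∀ n,Integrable fun x => U n t x-u t x := fun n =>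
    memLp_one_iff_integrable.1 ⟨((hi n t).aestronglyMeasurable.sub (hum.comp (measurable_const.prodMk measurable_id)).aestronglyMeasurable),
      (hle n).trans_lt ENNReal.ofReal_lt_top⟩
  refine ⟨?_,hlim,fun n => ?_⟩
  · convert (hi 0 t).sub (hdi 0) using 1
    funext x; simp
  · have := hle n
    rwa [eLpNorm_one_eq (hdi n),ENNReal.ofReal_le_ofReal_iff (by positivity)] at this

namespace Model

variable {M : Model} {m : Mesh} {β Θ Λ T r α : ℝ} {k : ℕ} {L ℓ : ℝ} {u₀ : ℕ → ℝ → ℝ}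

/-- `∫ |v - α| ψ`. -/
noncomputable def deviation (v : ℝ → ℝ) (α : ℝ) (ψ : ℝ → ℝ) : ℝ := ∫ x,|v x-α| * ψ x

/-- `∫ productionDensity`. -/
noncomputable def production (M : Model) (w : ℕ → ℝ → ℝ) (k : ℕ) (α : ℝ) (ψ : ℝ → ℝ) : ℝ :=
  ∫ x,productionDensity M w k α ψ x

theorem abs_production_le (hB : Bounds M Λ) {z : ℕ → ℝ → ℝ} (hz : Profile M Θ z)
    (hk : k ∈ M.lanes) (hL : 0 ≤ L) (hr : 1 ≤ r)
    (hf : ∀ a ∈ Icc (-r) r,∀ b ∈ Icc (-r) r,|M.f k a-M.f k b| ≤ L*|a-b|)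
    (hα : |α| ≤ r) {ψ Γ : ℝ → ℝ} (hΓ : Integrable Γ) (h0 : ∀ x,|ψ x| ≤ Γ x)
    (h1 : ∀ x,|deriv ψ x| ≤ Γ x) :
    |production M z k α ψ| ≤ productionBound M Λ L r*∫ x,Γ x := by
  rw [← integral_const_mul]
  refine norm_integral_le_of_norm_le (f := productionDensity M z k α ψ) (hΓ.const_mul _)
    (.of_forall fun x => ?_)
  exact (hz.abs_productionDensity_le hB hk hL hr hf hα (h0 x) (h1 x))

theorem stepError_nonneg (h1 : 0 ≤ Λ) (hL : 0 ≤ L) (hℓ : 0 ≤ ℓ) (hr : 0 ≤ r) {μ : ℝ} (hμ : 0 ≤ μ)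
    (hx : 0 < m.Δx) {w z : ℕ → ℝ → ℝ} (hz : Profile M Θ z) (x : ℝ) :
    0 ≤ stepError M m Λ L ℓ r μ w z k x := by
  have := hz.sum_nonneg x
  rw [stepError,gradError,halfTaylor,halfTaylor]
  positivity

/-- The scheme satisfies the entropy inequalities between two times up to a small error. -/
theorem exists_scheme_entropy (H : M.Standing) (hu : M.InitialData u₀) (hT : 0 ≤ T) (hℓ : 0 ≤ ℓ)
    (hr : 1 ≤ r) {ψ Γ : ℝ → ℝ} (hψ : ∀ d,0 ≤ d → d≤1 → TestBound ψ Γ d) :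
    ∃ C,0 ≤ C ∧ ∀ m β,Admissible M m β → m.Fits M T → 1 ≤ ℓ*m.lam → m.Δx≤1 →
      ∀ k ∈ M.lanes,∀ α,|α| ≤ r → ∀ t₁ t₂,0 ≤ t₁ → t₁ ≤ t₂ → t₂ ≤ T →
        deviation (M.schemeCurve m β u₀ k t₂) α ψ-deviation (M.schemeCurve m β u₀ k t₁) α ψ
          ≤ (∫ t in t₁..t₂,production M (M.schemeCurve m β u₀ · t) k α ψ)
            + C*(m.Δx+m.Δt) := by
  obtain ⟨Λ,hB⟩ := H.exists_bounds
  obtain ⟨Θ,hΘ,hprof⟩ := exists_uniform_profile H hu hT hℓ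
  obtain ⟨L,hL,hf⟩ := H.exists_lip r
  have hψ0 := hψ 0 le_rfl zero_le_one
  obtain ⟨c,hc⟩ := hψ0.bounded
  have h1 := hB.one_le
  have hΓ0 := integral_nonneg (μ := volume) (f := Γ) hψ0.gamma_nonneg
  have hc0 := (hψ0.gamma_nonneg 0).trans (hc 0)
  obtain ⟨Y,hY⟩ : ∃ Y,Y=15*L*Λ^2*(1+ℓ)*(1+Θ+M.lanes.card*Θ)
        + L*r*(4*Λ^2*(Θ+1)) := ⟨_,rfl⟩
  have hY0 : 0 ≤ Y := by rw [hY]; positivity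
  obtain ⟨X,hX⟩ : ∃ X,X = c*Y+11*L*Λ^3*r*∫ x,Γ x := ⟨_,rfl⟩
  have hX0 : 0 ≤ X := by rw [hX]; positivity
  obtain ⟨A,hA⟩ : ∃ A,A = productionBound M Λ L r*∫ x,Γ x := ⟨_,rfl⟩
  have hA0 : 0 ≤ A := by rw [hA,productionBound]; positivity
  refine ⟨2*A+T*(X*(1+Θ)),by positivity,fun m β h hfit hl hdx k hk α hα t₁ t₂ h0 h12 h2 => ?_⟩
  have hdt := h.dt_pos
  have hdx0 := h.dx_pos
  have hchain := Mesh.chain hfit (a := fun n => deviation (stepFn m (M.approx m β u₀ n k)) α ψ)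
    (p := fun n => production M (fun j => stepFn m (M.approx m β u₀ n j)) k α ψ) (A := A)
    (Θ := Θ) (fun n hn => by
      rw [hA]
      exact abs_production_le hB (hprof m β h hfit hl n hn).1 hk (by linarith) hr (hf k hk) hα
        hψ0.integrable hψ0.abs_le hψ0.deriv_le) hX0 (by linarith) (fun n hn => by
      obtain ⟨p1,p2,-⟩ := hprof m β h hfit hl n hn.le
      obtain ⟨p3,-⟩ := hprof m β h hfit hl (n+1) hn
      have hμ := add_le_add (le_refl m.Δx) p2
      have hμ0 : 0 ≤ m.Δx+Θ*m.Δt := by positivity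
      have hw := (h.budget hu n).1
      obtain ⟨ie,ee⟩ := h.stepError_integrable hB hw p1 p3 hk hdx hl hL hr (hf k hk) hμ
        (by linarith)
      refine (h.entropy_step hB hw p1 p3 hk hdx hl hL hr (hf k hk) hμ (by linarith) hα
        (hψ m.Δx hdx0.le hdx)).trans (add_le_add le_rfl (mul_mono_l ?_ hdt.le))
      have iE := ie.const_mul c
      have iG := hψ0.integrable.const_mul (11*L*Λ^3*(m.Δx+Θ*m.Δt)*r)
      have hs := stepError_nonneg (k := k) (zero_le_one.trans h1) (zero_le_one.trans hL) hℓ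
        (zero_le_one.trans hr) hμ0 hdx0 (w := fun j => stepFn m (M.approx m β u₀ n j)) p3
      have hΓ := hψ0.gamma_nonneg
      refine (integral_mono_of_nonneg (.of_forall fun x => mul_nonneg (add_nonneg
        (hs x) (by positivity)) (hΓ x)) (iE.add iG) (.of_forall fun x => ?_)).trans ?_
      · simp only [Pi.add_apply]
        rw [add_mul,mul_comm c]
        refine add_le_add (mul_mono_l (hc x) (hs x))
          (mul_mono_r ?_ (hΓ x))
        gcongr
      · rw [integral_add' iE iG,integral_const_mul,integral_const_mul,hX]
        have := mul_mono_l ee hc0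
        rw [← hY] at this
        have e : ∀ a : ℝ,(c*Y+11*L*Λ^3*r*∫ x,Γ x)*a
          = c*(Y*a)+11*L*Λ^3*a*r*∫ x,Γ x := fun a => by ring
        rw [e]
        exact add_le_add this le_rfl)
    h0 h12 h2
  exact hchain

variable {M : Model} {β Θ Λ T r α : ℝ} {k : ℕ} {L : ℝ} {u : ℕ → ℝ → ℝ → ℝ}

/-- Measurable curves of profiles, Lipschitz continuous in `L¹`. -/
structure Path (M : Model) (Θ : ℝ) (u : ℕ → ℝ → ℝ → ℝ) : Prop where
  meas : ∀ k ∈ M.lanes,Measurable fun p : ℝ × ℝ => u k p.1 p.2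
  profile : ∀ t,Profile M Θ fun k => u k t
  move : ∀ s t,M.gap (u · s) (u · t) ≤ Θ*|s-t|

/-- Entropy inequalities between two times, tested with functions of the space variable. -/
def SliceEntropy (M : Model) (T : ℝ) (u : ℕ → ℝ → ℝ → ℝ) : Prop :=
  ∀ k ∈ M.lanes,∀ α ψ,ContDiff ℝ (⊤ : ℕ∞) ψ → (∀ x,0 ≤ ψ x) → HasCompactSupport ψ →
    ∀ t₁ t₂,0 ≤ t₁ → t₁ ≤ t₂ → t₂ ≤ T → deviation (u k t₂) α ψ-deviation (u k t₁) α ψ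
      ≤ ∫ t in t₁..t₂,production M (u · t) k α ψ

theorem deviation_integrable {v ψ : ℝ → ℝ} (hm : Measurable v) (h01 : ∀ x,v x ∈ 𝕀)
    (α : ℝ) (hψ : Integrable ψ) : Integrable fun x => |v x-α| * ψ x :=
  hψ.bdd_mul (c := 1+|α|) (hm.sub_const α).abs.aestronglyMeasurable
    (.of_forall fun x => by
      rw [Real.norm_eq_abs,abs_abs]
      refine (abs_sub _ _).trans (add_le_add ?_ le_rfl)
      rw [abs_of_nonneg (h01 x).1]; exact (h01 x).2)

theorem abs_deviation_sub_le {w z : ℕ → ℝ → ℝ} (hw : Profile M Θ w) (hz : Profile M Θ z)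
    (hk : k ∈ M.lanes) {ψ Γ : ℝ → ℝ} {c : ℝ} (hm : Measurable ψ) (hψ : ∀ x,|ψ x| ≤ Γ x)
    (hΓ : Integrable Γ) (hc : ∀ x,Γ x ≤ c) (a b : ℝ) :
    |deviation (w k) a ψ-deviation (z k) b ψ| ≤ c*M.gap w z+|a-b| * ∫ x,Γ x := by
  have hψi := hΓ.mono' hm.aestronglyMeasurable (.of_forall hψ)
  have i1 := ((hw.integrable k hk).sub (hz.integrable k hk)).abs.const_mul c
  have hc0 := (abs_nonneg _).trans ((hψ 0).trans (hc 0))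
  rw [deviation,deviation,← integral_sub (deviation_integrable (hw.meas k hk) (hw.mem k hk) a hψi)
    (deviation_integrable (hz.meas k hk) (hz.mem k hk) b hψi)]
  refine (abs_integral_le_integral_abs.trans (integral_mono_of_nonneg
    (.of_forall fun x => abs_nonneg _) (i1.add (hΓ.const_mul |a-b|))
    (.of_forall fun x => ?_))).trans ?_
  · simp [Pi.add_apply]
    rw [← sub_mul,abs_mul]
    have h1 : |(|w k x-a| - |z k x-b|)| ≤ |w k x-z k x| + |a-b| := by
      refine (abs_abs_sub_abs_le _ _).trans ((le_of_eq ?_).trans (abs_sub _ _))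
      congr 1; ring
    refine (mul_le_mul h1 (hψ x) (abs_nonneg _) (by positivity)).trans ?_
    rw [add_mul,mul_comm c]
    gcongr
    exact hc x
  · rw [integral_add' i1 (hΓ.const_mul _),integral_const_mul,integral_const_mul]
    gcongr
    exact le_gap w z hk

theorem tendsto_of_abs_sub_le {a b : ℕ → ℝ} {l : ℝ} (h : ∀ j,|a j-l| ≤ b j)
    (hb : Tendsto b atTop (𝓝 0)) : Tendsto a atTop (𝓝 l) :=
  tendsto_iff_norm_sub_tendsto_zero.2 (squeeze_zero (fun _ => norm_nonneg _) h hb)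

theorem tendsto_sign_add {a s : ℕ → ℝ} {l α : ℝ} (hs : ∀ j,0 < s j) (hs0 : Tendsto s atTop (𝓝 0))
    (ha : Tendsto (fun j => (s j)⁻¹*(a j-l)) atTop (𝓝 0)) :
    Tendsto (fun j => Real.sign (a j-(α+s j))+Real.sign (a j-(α-s j))) atTop
      (𝓝 (2*Real.sign (l-α))) := by
  have ha' : Tendsto a atTop (𝓝 l) := by
    have := (hs0.mul ha).add_const l
    simp [← mul_assoc,mul_inv_cancel₀ (hs _).ne']
      at this
    exact this
  have t1 : Tendsto (fun j => a j-(α+s j)) atTop (𝓝 (l-α)) := by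
    simpa using ha'.sub (hs0.const_add α)
  have t2 : Tendsto (fun j => a j-(α-s j)) atTop (𝓝 (l-α)) := by
    simpa using ha'.sub (hs0.const_sub α)
  refine tendsto_const_nhds.congr' ?_
  rcases lt_trichotomy (l-α) 0 with h | h | h
  · filter_upwards [t1.eventually_lt_const h,t2.eventually_lt_const h] with j h1 h2
    rw [Real.sign_of_neg h,Real.sign_of_neg h1,Real.sign_of_neg h2]; norm_num
  · obtain rfl : l = α := by linarith
    filter_upwards [(tendsto_order.1 ha).2 1 one_pos,(tendsto_order.1 ha).1 (-1) (by norm_num)]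
      with j h1 h2
    rw [inv_mul_lt_iff₀ (hs j)] at h1
    rw [lt_inv_mul_iff₀ (hs j)] at h2
    rw [sub_self,Real.sign_zero,Real.sign_of_neg (by linarith),Real.sign_of_pos (by linarith)]
    norm_num
  · filter_upwards [t1.eventually_const_lt h,t2.eventually_const_lt h] with j h1 h2
    rw [Real.sign_of_pos h,Real.sign_of_pos h1,Real.sign_of_pos h2]; norm_num

theorem tendsto_geometric (C : ℝ) {r : ℝ} (h0 : 0 ≤ r) (h1 : r<1) :
    Tendsto (fun j : ℕ => C*r^j) atTop (𝓝 0) := by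
  simpa using (tendsto_pow_atTop_nhds_zero_of_lt_one h0 h1).const_mul C

theorem tendsto_half_pow (α : ℝ) : Tendsto (fun j : ℕ => (1/2 : ℝ)^j) atTop (𝓝 0) ∧
    (∀ j : ℕ,|α+(1/2)^j| ≤ |α| + 1) ∧ (∀ j : ℕ,|α-(1/2)^j| ≤ |α| + 1) ∧
    Tendsto (fun j : ℕ => |α+(1/2)^j-α|) atTop (𝓝 0) ∧
    Tendsto (fun j : ℕ => |α-(1/2)^j-α|) atTop (𝓝 0) := by
  have hs0 : Tendsto (fun j => (1/2 : ℝ)^j) atTop (𝓝 0) := by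
    simpa using tendsto_geometric 1 (r := 1/2) (by norm_num) (by norm_num)
  have h (j : ℕ) : |(1/2 : ℝ)^j|≤1 := by
    rw [abs_of_nonneg (by positivity)]; exact pow_le_one₀ (by norm_num) (by norm_num)
  exact ⟨hs0,fun j => (abs_add_le _ _).trans (by linarith [h j]),
    fun j => (abs_sub _ _).trans (by linarith [h j]),by simpa using hs0.abs,by simpa using hs0.abs⟩

/-- The signs at `α` are reached from the constants `α ± 2⁻ʲ`. -/
theorem tendsto_production (hB : Bounds M Λ) {Z : ℕ → ℕ → ℝ → ℝ} {z : ℕ → ℝ → ℝ} {C : ℝ}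
    (hZ : ∀ j,Profile M Θ (Z j)) (hz : Profile M Θ z) (hg : ∀ j,M.gap (Z j) z ≤ C*(1/4)^j)
    (hk : k ∈ M.lanes) (hL : 0 ≤ L)
    (hf : ∀ a ∈ Icc (-(|α| + 1)) (|α| + 1),∀ b ∈ Icc (-(|α| + 1)) (|α| + 1),
      |M.f k a-M.f k b| ≤ L*|a-b|) {ψ Γ : ℝ → ℝ} {d : ℝ} (hψ : TestBound ψ Γ d) :
    Tendsto (fun j => production M (Z j) k (α+(1/2)^j) ψ
      + production M (Z j) k (α-(1/2)^j) ψ) atTop (𝓝 (2*production M z k α ψ)) := by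
  have h1 := hB.one_le
  have hΛ : 0 ≤ Λ := by linarith
  have hα0 := abs_nonneg α
  have hr : 1 ≤ |α| + 1 := by linarith
  obtain ⟨hs0,hαp,hαm,ap,am⟩ := tendsto_half_pow α
  have hα : |α| ≤ |α| + 1 := by linarith
  have ip := fun j => (hZ j).integrable_productionDensity hB hk hL hr hf (hαp j) hψ
  have im := fun j => (hZ j).integrable_productionDensity hB hk hL hr hf (hαm j) hψ
  have hg0 := squeeze_zero (fun j => gap_nonneg _ _) hg
    (tendsto_geometric C (by norm_num) (by norm_num))
  have hz1 := (eventually_all_finset M.lanes).2 fun i hi => ae_tendsto_of_rate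
      (fun j => ((hZ j).integrable i hi).sub (hz.integrable i hi)) fun j =>
        (le_gap (Z j) z hi).trans (hg j)
  have hz2 := ae_tendsto_of_rate
      (fun j => ((hZ j).slope_integrable hB hk).sub (hz.slope_integrable hB hk)) fun j => by
        refine ((hZ j).integral_slope_sub_le hB hz hk).trans ?_
        rw [mul_assoc]
        exact mul_mono_l (hg j) hΛ
  have strip : ∀ {a : ℕ → ℝ},Tendsto (fun j => 2^j*a j) atTop (𝓝 0) →
      Tendsto (fun j => |a j|) atTop (𝓝 0) := fun {a} h => by
    have := (hs0.mul h).abs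
    simpa using this
  rw [production,← integral_const_mul]
  simp only [production,← integral_add (ip _) (im _)]
  refine tendsto_integral_of_dominated_convergence (fun x => 2*(productionBound M Λ L (|α| + 1)
    * Γ x)) (fun j => ((ip j).add (im j)).aestronglyMeasurable) ((hψ.integrable.const_mul _).const_mul 2)
    (fun j => Eventually.of_forall fun x => ?_) ?_
  · refine (norm_add_le _ _).trans ?_
    rw [two_mul]
    exact add_le_add
      ((hZ j).abs_productionDensity_le hB hk hL hr hf (hαp j) (hψ.abs_le x) (hψ.deriv_le x))
      ((hZ j).abs_productionDensity_le hB hk hL hr hf (hαm j) (hψ.abs_le x) (hψ.deriv_le x))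
  filter_upwards [hz1,hz2] with x e1 e2
  have tvel := tendsto_of_abs_sub_le (fun j => (hZ j).vel_sub_le hB hz hk x) (by simpa using hg0.const_mul (Λ^2))
  have tdvel : Tendsto (fun j => M.dvel (Z j) k x) atTop (𝓝 (M.dvel z k x)) := by
    refine tendsto_of_abs_sub_le (fun j => ((hZ j).dvel_sub_le hB hz hk x).trans (add_le_add
      (mul_mono_l ((hZ j).avg_sub_le hB hz hk x) (by positivity)) le_rfl)) ?_
    simpa using ((hg0.const_mul Λ).const_mul (2*Λ^2)).add ((strip e2).const_mul Λ)
  have tsrc : Tendsto (fun j => M.src (Z j) k x) atTop (𝓝 (M.src z k x)) := by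
    refine tendsto_of_abs_sub_le (fun j => (hZ j).src_sub_le hB hz hk x x) ?_
    have t2 := ((hg0.const_mul (2*Λ)).const_mul (2*Λ)).mul_const (∑ j ∈ M.lanes,z j x)
    simpa using ((tendsto_finsetSum M.lanes fun i hi => strip (e1 i hi)).const_mul (2*Λ)).add t2
  have mz : ∀ j,Z j k x ∈ Icc (-(|α| + 1)) (|α| + 1) := fun j =>
    ⟨by linarith [((hZ j).mem k hk x).1],by linarith [((hZ j).mem k hk x).2]⟩
  have mz' : z k x ∈ Icc (-(|α| + 1)) (|α| + 1) :=
    ⟨by linarith [(hz.mem k hk x).1],by linarith [(hz.mem k hk x).2]⟩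
  have tk : ∀ {a : ℕ → ℝ},(∀ j,|a j| ≤ |α| + 1) → Tendsto (fun j => |a j-α|) atTop (𝓝 0) →
      Tendsto (fun j => M.kruzkovFlux k (Z j k x) (a j)) atTop (𝓝 (M.kruzkovFlux k (z k x) α)) :=
    fun {a} ha t => by
      refine tendsto_of_abs_sub_le
        (fun j => ?_) (by simpa using (t.const_mul L).add ((strip (e1 k hk)).const_mul L))
      have a2 := abs_kruzkovFlux_sub_le hf (abs_le.1 hα) (mz j) mz'
      rw [M.kruzkovFlux_comm α,M.kruzkovFlux_comm α] at a2
      exact (abs_sub_le _ _ _).trans (add_le_add (abs_kruzkovFlux_sub_le hf (mz j) (abs_le.1 (ha j)) (abs_le.1 hα)) a2)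
  have te : ∀ {a : ℕ → ℝ},(∀ j,|a j| ≤ |α| + 1) → Tendsto (fun j => |a j-α|) atTop (𝓝 0) →
      Tendsto (fun j => Real.sign (Z j k x-a j)*(M.f k (a j)-M.f k α)) atTop (𝓝 0) :=
    fun {a} ha t => by
      refine tendsto_of_abs_sub_le (fun j => ?_)
        (by simpa using t.const_mul L)
      rw [sub_zero]
      exact (abs_sign_mul_le _ _).trans (hf _ (abs_le.1 (ha j)) _ (abs_le.1 hα))
  have tsgn := tendsto_sign_add (α := α) (fun j => by positivity) hs0 (by simpa using e1 k hk)
  have key := ((((tk hαp ap).add (tk hαm am)).mul tvel).mul_const (deriv ψ x)).add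
    (((tsgn.mul (tsrc.sub (tdvel.const_mul (M.f k α)))).sub
      (((te hαp ap).add (te hαm am)).mul tdvel)).mul_const (ψ x))
  convert key using 2
  · simp [productionDensity]; ring
  · simp [productionDensity]; ring

/-- Entropy inequalities pass to limits of approximate solutions. -/
theorem sliceEntropy_of_limit (hB : Bounds M Λ) {U : ℕ → ℕ → ℝ → ℝ → ℝ} {C : ℝ}
    (hUm : ∀ j,∀ k ∈ M.lanes,Measurable fun p : ℝ × ℝ => U j k p.1 p.2)
    (hU : ∀ j t,Profile M Θ fun k => U j k t) (hu : Path M Θ u)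
    (hg : ∀ j t,M.gap (fun k => U j k t) (u · t) ≤ C*(1/4)^j)
    (he : ∀ r ψ Γ,1 ≤ r → (∀ d,0 ≤ d → d≤1 → TestBound ψ Γ d) → ∃ κ : ℕ → ℝ,
      Tendsto κ atTop (𝓝 0) ∧ ∀ j,∀ k ∈ M.lanes,∀ α,|α| ≤ r → ∀ t₁ t₂,0 ≤ t₁ → t₁ ≤ t₂ →
        t₂ ≤ T → deviation (U j k t₂) α ψ-deviation (U j k t₁) α ψ
          ≤ (∫ t in t₁..t₂,production M (fun i => U j i t) k α ψ)+κ j) :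
    SliceEntropy M T u := by
  intro k hk α ψ hs h0 hcs t₁ t₂ ht0 ht ht2
  obtain ⟨R,hR⟩ := hcs.isCompact.isBounded.subset_closedBall 0
  obtain ⟨A,hA,hψ⟩ := exists_testBound hs h0 (R := R) (fun x hx => by
    by_contra h
    have := hR (subset_tsupport _ h)
    rw [mem_closedBall_zero_iff,Real.norm_eq_abs] at this
    linarith) 1
  obtain ⟨κ,hκ,hκe⟩ := he (|α| + 1) ψ _ (by linarith [abs_nonneg α]) hψ
  have hψ0 := hψ 0 le_rfl zero_le_one
  set Γ : ℝ → ℝ := fun x => A*box (R+1) x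
  obtain ⟨c,hc⟩ := hψ0.bounded
  obtain ⟨L,hL,hf⟩ := hB.std.exists_lip (|α| + 1)
  obtain ⟨-,hαp,hαm,ap,am⟩ := tendsto_half_pow α
  have tdev : ∀ t (a : ℕ → ℝ),Tendsto (fun j => |a j-α|) atTop (𝓝 0) →
      Tendsto (fun j => deviation (U j k t) (a j) ψ) atTop (𝓝 (deviation (u k t) α ψ)) :=
    fun t a ha => by
      refine tendsto_of_abs_sub_le (fun j => (abs_deviation_sub_le (hU j t) (hu.profile t) hk
        hψ0.cont.measurable hψ0.abs_le hψ0.integrable hc (a j) α).trans (add_le_add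
        (mul_mono_l (hg j t) ((hψ0.gamma_nonneg 0).trans (hc 0))) le_rfl)) ?_
      simpa using ((tendsto_geometric C (r := 1/4) (by norm_num) (by norm_num)).const_mul c).add (ha.mul_const (∫ x,Γ x))
  have hm : ∀ {v : ℕ → ℝ → ℝ → ℝ} a,(∀ k ∈ M.lanes,Measurable fun p : ℝ × ℝ => v k p.1 p.2) →
      Measurable fun t => production M (v · t) k a ψ := fun a hv =>
    (measurable_productionDensity (φ := fun _ => ψ) hB.std hv hk
      (hψ0.cont.measurable.comp measurable_snd) ((measurable_deriv ψ).comp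
      measurable_snd)).stronglyMeasurable.integral_prod_right.measurable
  have hb : ∀ j t a,|a| ≤ |α| + 1 → |production M (fun i => U j i t) k a ψ|
      ≤ productionBound M Λ L (|α| + 1)*∫ x,Γ x := fun j t a ha =>
    abs_production_le hB (hU j t) hk (by linarith) (by linarith [abs_nonneg α]) (hf k hk) ha
      hψ0.integrable hψ0.abs_le hψ0.deriv_le
  have tp : Tendsto (fun j => ∫ t in t₁..t₂,(production M (fun i => U j i t) k (α+(1/2)^j) ψ
      + production M (fun i => U j i t) k (α-(1/2)^j) ψ)) atTop
      (𝓝 (∫ t in t₁..t₂,2*production M (u · t) k α ψ)) := by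
    refine intervalIntegral.tendsto_integral_filter_of_dominated_convergence
      (fun _ => 2*(productionBound M Λ L (|α| + 1)*∫ x,Γ x))
      (Eventually.of_forall fun j => ((hm _ (hUm j)).add (hm _ (hUm j))).aestronglyMeasurable)
      (Eventually.of_forall fun j => Eventually.of_forall fun t _ => ?_)
      intervalIntegrable_const (Eventually.of_forall fun t _ => tendsto_production hB
        (hU · t) (hu.profile t) (hg · t) hk (by linarith) (hf k hk) hψ0)
    rw [two_mul]
    exact (norm_add_le _ _).trans (add_le_add (hb j t _ (hαp j)) (hb j t _ (hαm j)))
  have hfin := le_of_tendsto_of_tendsto'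
    (((tdev t₂ _ ap).sub (tdev t₁ _ ap)).add ((tdev t₂ _ am).sub (tdev t₁ _ am)))
    (tp.add (hκ.const_mul 2)) fun j => by
      have q1 := hκe j k hk _ (hαp j) t₁ t₂ ht0 ht ht2
      have q2 := hκe j k hk _ (hαm j) t₁ t₂ ht0 ht ht2
      rw [intervalIntegral.integral_add (intervalIntegrable_of_bound (hm _ (hUm j))
        (fun t => hb j t _ (hαp j)) _ _) (intervalIntegrable_of_bound (hm _ (hUm j))
        (fun t => hb j t _ (hαm j)) _ _)]
      linarith
  rw [intervalIntegral.integral_const_mul] at hfin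
  linarith

end Model

/-- Bounds for a smooth function of compact support on the plane, its derivatives and the
increments in the first variable. -/
theorem exists_plane_bound {φ : ℝ → ℝ → ℝ} (hs : ContDiff ℝ (⊤ : ℕ∞) fun p : ℝ × ℝ => φ p.1 p.2)
    (hc : HasCompactSupport fun p : ℝ × ℝ => φ p.1 p.2) :
    (Continuous fun p : ℝ × ℝ => deriv (fun s => φ s p.2) p.1) ∧
    (Continuous fun p : ℝ × ℝ => deriv (φ p.1) p.2) ∧ ∃ c R,∀ x t s,
      |φ t x| ≤ c*box R x ∧ |deriv (fun s => φ s x) t| ≤ c*box R x ∧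
      |deriv (φ t) x| ≤ c*box R x ∧ |φ s x-φ t x| ≤ c*box R x*|s-t| ∧
      |deriv (φ s) x-deriv (φ t) x| ≤ c*box R x*|s-t| ∧
      |φ s x-φ t x-deriv (fun s => φ s x) t*(s-t)| ≤ c*box R x*(s-t)^2 := by
  set F : ℝ × ℝ → ℝ := fun p => φ p.1 p.2 with hF
  obtain ⟨R,hR⟩ := hc.isCompact.isBounded.subset_closedBall 0
  have bound : ∀ G : ℝ × ℝ → ℝ,ContDiff ℝ (⊤ : ℕ∞) G → tsupport G ⊆ tsupport F →
      ∃ c,0 ≤ c ∧ ∀ p,|G p| ≤ c*box R p.2 := fun G hG ht => by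
    have hGc : HasCompactSupport G := IsCompact.of_isClosed_subset hc (isClosed_tsupport _) ht
    obtain ⟨c,h⟩ := hGc.exists_bound_of_continuous hG.continuous
    refine ⟨c,(norm_nonneg _).trans (h 0),fun p => le_mul_box (h p) fun hp => ?_⟩
    have hn : p ∉ tsupport G := fun hm => by
      have h1 := hR (ht hm)
      have h2 := norm_snd_le p
      rw [mem_closedBall_zero_iff] at h1
      rw [Real.norm_eq_abs] at h2
      linarith
    rw [image_eq_zero_of_notMem_tsupport hn,abs_zero]
  have der : ∀ (G : ℝ × ℝ → ℝ) (v : ℝ × ℝ),ContDiff ℝ (⊤ : ℕ∞) G → tsupport G ⊆ tsupport F →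
      ContDiff ℝ (⊤ : ℕ∞) (fun p => fderiv ℝ G p v) ∧
        tsupport (fun p => fderiv ℝ G p v) ⊆ tsupport F := fun G v hG ht =>
    ⟨(hG.fderiv_right (by simp)).clm_apply contDiff_const,(tsupport_fderiv_apply_subset ℝ v).trans ht⟩
  have d1 : ∀ G : ℝ × ℝ → ℝ,ContDiff ℝ (⊤ : ℕ∞) G → ∀ t x,
      HasDerivAt (fun s => G (s,x)) (fderiv ℝ G (t,x) (1,0)) t := fun G hG t x =>
    (hG.differentiable (by simp) (t,x)).hasFDerivAt.comp_hasDerivAt t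
      ((hasDerivAt_id t).prodMk (hasDerivAt_const t x))
  have d2 : ∀ G : ℝ × ℝ → ℝ,ContDiff ℝ (⊤ : ℕ∞) G → ∀ t x,
      HasDerivAt (fun y => G (t,y)) (fderiv ℝ G (t,x) (0,1)) x := fun G hG t x =>
    (hG.differentiable (by simp) (t,x)).hasFDerivAt.comp_hasDerivAt x
      ((hasDerivAt_const x t).prodMk (hasDerivAt_id x))
  obtain ⟨s1,t1⟩ := der F (1,0) hs le_rfl
  obtain ⟨s2,t2⟩ := der F (0,1) hs le_rfl
  obtain ⟨s3,t3⟩ := der _ (1,0) s1 t1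
  obtain ⟨s4,t4⟩ := der _ (1,0) s2 t2
  have e1 : ∀ t x,deriv (fun s => φ s x) t = fderiv ℝ F (t,x) (1,0) := fun t x =>
    (d1 F hs t x).deriv
  have e2 : ∀ t x,deriv (φ t) x = fderiv ℝ F (t,x) (0,1) := fun t x => (d2 F hs t x).deriv
  obtain ⟨c0,p0,b0⟩ := bound F hs le_rfl
  obtain ⟨c1,p1,b1⟩ := bound _ s1 t1
  obtain ⟨c2,p2,b2⟩ := bound _ s2 t2
  obtain ⟨c3,p3,b3⟩ := bound _ s3 t3
  obtain ⟨c4,p4,b4⟩ := bound _ s4 t4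
  refine ⟨by simp [e1]; exact s1.continuous,by simp [e2]; exact s2.continuous,
    c0+c1+c2+c3+c4,R,fun x t s => ?_⟩
  have hb := box_nonneg R x
  have w : ∀ c',c' ≤ c0+c1+c2+c3+c4 → c'*box R x≤(c0+c1+c2+c3+c4)*box R x :=
    fun c' h => mul_mono_r h hb
  have lip : ∀ {G : ℝ × ℝ → ℝ} {c : ℝ},ContDiff ℝ (⊤ : ℕ∞) G →
      (∀ p,|fderiv ℝ G p (1,0)| ≤ c*box R p.2) → ∀ s t,
        |G (s,x)-G (t,x)| ≤ c*box R x*|s-t| := fun hG hc s t =>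
    Convex.norm_image_sub_le_of_norm_hasDerivWithin_le (fun a _ => (d1 _ hG a x).hasDerivWithinAt)
      (fun a _ => hc (a,x)) convex_univ (mem_univ t) (mem_univ s)
  have l3 := lip s1 b3
  refine ⟨(b0 (t,x)).trans (w _ (by linarith)),?_,?_,((lip hs b1) s t).trans ?_,?_,?_⟩
  · rw [e1]; exact (b1 (t,x)).trans (w _ (by linarith))
  · rw [e2]; exact (b2 (t,x)).trans (w _ (by linarith))
  · exact mul_mono_r (w _ (by linarith)) (abs_nonneg _)
  · rw [e2,e2]
    exact ((lip s2 b4) s t).trans (mul_mono_r (w _ (by linarith)) (abs_nonneg _))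
  · refine (Model.abs_taylor_of_lipschitz_deriv
      (fun t => (d1 F hs t x).differentiableAt) (C := c3*box R x) (by positivity)
      (fun a b => ?_) t s).trans (mul_mono_r (w _ (by linarith)) (sq_nonneg _))
    rw [e1,e1]; exact l3 a b

namespace Model

variable {M : Model} {β Θ Λ T r α : ℝ} {k : ℕ} {L : ℝ} {u v : ℕ → ℝ → ℝ → ℝ} {φ : ℝ → ℝ → ℝ}

theorem src_congr {w z : ℕ → ℝ → ℝ} (hk : k ∈ M.lanes) {x : ℝ} (h : ∀ j ∈ M.lanes,w j x = z j x)
    (ha : ∀ j ∈ M.lanes,M.avg (w j) = M.avg (z j)) : M.src w k x = M.src z k x := by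
  have hS : ∀ l,M.S l x (w l x) (w (l+1) x) (M.avg (w l) x) (M.avg (w (l+1)) x)
      = M.S l x (z l x) (z (l+1) x) (M.avg (z l) x) (M.avg (z (l+1)) x) := fun l => by
    by_cases hl : 1 ≤ l ∧ l < M.N
    · obtain ⟨h1,h2⟩ := pair_mem_lanes hl
      rw [h l h1,h _ h2,ha l h1,ha _ h2]
    · simp only [S,if_neg hl]
  obtain ⟨h1,-⟩ := mem_lanes.1 hk
  obtain ⟨l,rfl⟩ : ∃ l,k = l+1 := ⟨k-1,by omega⟩
  simp [src,R,hS]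

theorem Path.continuous_vel (hB : Bounds M Λ) (hΘ : 0 ≤ Θ) (hv : Path M Θ v) (hk : k ∈ M.lanes) :
    Continuous (Function.uncurry fun t x => M.vel (v · t) k x) := by
  refine (LipschitzWith.of_dist_le_mul (K := (Λ^2*Θ+2*Λ^2).toNNReal) fun p q => ?_).continuous
  rw [Real.coe_toNNReal _ (by positivity),Real.dist_eq]
  have a1 := ((hv.profile p.1).vel_sub_le hB (hv.profile q.1) hk p.2).trans
    (mul_mono_l (hv.move p.1 q.1) (by positivity))
  have b1 : |p.1-q.1| ≤ dist p q := le_max_left _ _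
  have b2 : |p.2-q.2| ≤ dist p q := le_max_right _ _
  refine (abs_sub_le _ _ _).trans ((add_le_add a1 ((hv.profile q.1).vel_lip hB hk p.2 q.2)).trans ?_)
  rw [add_mul,← mul_assoc]
  gcongr

/-- The entropy inequality in terms of integrals over time slices. -/
theorem entropyIneq_iff (hB : Bounds M Λ) (hΘ : 0 ≤ Θ) (hT : 0 < T) (hv : Path M Θ v)
    (hm : ∀ j ∈ M.lanes,AEStronglyMeasurable (fun p : ℝ × ℝ => u j p.1 p.2)
      (volume.restrict (Ioo 0 T ×ˢ univ)))
    (hae : ∀ j ∈ M.lanes,∀ t ∈ Icc 0 T,u j t =ᵐ[volume] v j t) (hk : k ∈ M.lanes)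
    (hφ : IsTest T φ) : M.EntropyIneq T u k α φ ↔
      0≤(∫ t in (0)..T,(deviation (v k t) α (fun x => deriv (fun s => φ s x) t)
        + production M (v · t) k α (φ t)))+deviation (v k 0) α (φ 0) := by
  obtain ⟨cφt,cφx,c,R,hb⟩ := exists_plane_bound hφ.smooth hφ.compact
  obtain ⟨L,hL,hf⟩ := hB.std.exists_lip (|α| + 1)
  have h1 := hB.one_le
  set μ : Measure (ℝ × ℝ) := (volume.restrict (Ioo 0 T)).prod volume with hμ
  have hvol : (volume : Measure (ℝ × ℝ)).restrict (Ioo 0 T ×ˢ univ) = μ := by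
    rw [Measure.volume_eq_prod,← Measure.prod_restrict,Measure.restrict_univ]
  have mem : ∀ᵐ p ∂μ,p.1 ∈ Ioo 0 T := by
    rw [← hvol]
    exact (ae_restrict_mem (measurableSet_Ioo.prod MeasurableSet.univ)).mono fun p hp => hp.1
  have huv : ∀ᵐ p ∂μ,∀ j ∈ M.lanes,u j p.1 p.2 = v j p.1 p.2 := by
    refine (eventually_all_finset M.lanes).2 fun j hj => ?_
    obtain ⟨g,gm,hg⟩ := (hvol ▸ hm j hj)
    have h2 : ∀ᵐ p ∂μ,p ∈ {p : ℝ × ℝ | g p = v j p.1 p.2} := by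
      rw [Measure.ae_prod_mem_iff_ae_ae_mem (measurableSet_eq_fun gm.measurable (hv.meas j hj))]
      filter_upwards [Measure.ae_ae_of_ae_prod hg,ae_restrict_mem measurableSet_Ioo] with t ht htT
      filter_upwards [ht,hae j hj t ⟨htT.1.le,htT.2.le⟩] with x hx hx'
      exact hx.symm.trans hx'
    filter_upwards [hg,h2] with p hp hp'
    exact hp.trans hp'
  have hdv : ∀ᵐ p ∂μ,p ∈ {p : ℝ × ℝ | deriv (M.vel (v · p.1) k) p.2
      = M.dvel (v · p.1) k p.2} := by
    rw [Measure.ae_prod_mem_iff_ae_ae_mem (measurableSet_eq_fun (measurable_deriv_with_param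
      (hv.continuous_vel hB hΘ hk)) (measurable_dvel hv.meas hB.std hk))]
    exact .of_forall fun t => by
      filter_upwards [(hv.profile t).ae_hasDerivAt_vel hB hk] with x hx using hx.deriv
  have havg : ∀ t ∈ Ioo 0 T,∀ j ∈ M.lanes,M.avg (u j t) = M.avg (v j t) := fun t ht j hj =>
    hB.std.avg_congr (hae j hj t ⟨ht.1.le,ht.2.le⟩)
  have hvel : ∀ t ∈ Ioo 0 T,M.velocity u k t = M.vel (v · t) k := fun t ht => by
    funext x; rw [velocity,havg t ht k hk]; rfl
  set A : ℝ × ℝ → ℝ := fun p => |v k p.1 p.2-α| * deriv (fun s => φ s p.2) p.1 with hA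
  set B : ℝ × ℝ → ℝ := fun p => productionDensity M (v · p.1) k α (φ p.1) p.2 with hBd
  set S : ℝ × ℝ → ℝ := fun p => Real.sign (v k p.1 p.2-α)*M.src (v · p.1) k p.2
    * φ p.1 p.2 with hS
  set D : ℝ × ℝ → ℝ := fun p => Real.sign (v k p.1 p.2-α)*M.f k α
    * M.dvel (v · p.1) k p.2*φ p.1 p.2 with hD
  have sm := sign_measurable.comp ((hv.meas k hk).sub_const α)
  have φm := hφ.smooth.continuous.measurable
  have int : ∀ {G : ℝ × ℝ → ℝ} {b : ℝ},Measurable G → (∀ p,|G p| ≤ b*box R p.2) →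
      Integrable G μ := fun {G b} hG h =>
    (((box_integrable R).const_mul b).comp_snd _).mono' hG.aestronglyMeasurable
      (.of_forall h)
  have hsum : ∀ t x,|M.src (v · t) k x|≤2*Λ*M.lanes.card := fun t x => by
    refine ((hv.profile t).abs_src_le hB hk x).trans (mul_mono_l ?_ (by linarith))
    exact (Finset.sum_le_sum fun j hj => ((hv.profile t).mem j hj x).2).trans (by simp)
  have iA : Integrable A μ := int
    (((hv.meas k hk).sub_const α).abs.mul cφt.measurable) fun p => by
      rw [hA,abs_mul,abs_abs,mul_assoc]
      exact mul_le_mul ((abs_sub _ _).trans (add_le_add ((hv.profile p.1).abs_le_one hk p.2) le_rfl))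
        (hb _ _ 0).2.1 (abs_nonneg _) (by positivity)
  have iB := int
    (measurable_productionDensity hB.std hv.meas hk φm cφx.measurable) fun p => by
      rw [mul_assoc]
      exact (hv.profile p.1).abs_productionDensity_le hB hk (by linarith) (by linarith [abs_nonneg α])
        (hf k hk) (by linarith) (hb _ _ 0).1 (hb _ _ 0).2.2.1
  have iS : Integrable S μ := int
    ((sm.mul (measurable_src hv.meas hB.std hk)).mul φm) fun p => by
      rw [hS,abs_mul,mul_assoc (2*Λ*M.lanes.card)]
      exact mul_le_mul ((abs_sign_mul_le _ _).trans (hsum _ _)) (hb _ _ 0).1 (abs_nonneg _)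
        (by positivity)
  have iD : Integrable D μ := int (b := |M.f k α| * (2*Λ^2)*c)
    (((sm.mul_const _).mul (measurable_dvel hv.meas hB.std hk)).mul φm) fun p => by
      rw [hD,abs_mul,mul_assoc (Real.sign _),mul_assoc (|M.f k α| * _)]
      refine mul_le_mul ((abs_sign_mul_le _ _).trans ?_) (hb _ _ 0).1 (abs_nonneg _) (by positivity)
      rw [abs_mul]
      exact mul_mono_l ((hv.profile p.1).abs_dvel_le hB hk p.2) (abs_nonneg _)
  have eS : ∫ p in Ioo 0 T ×ˢ (univ : Set ℝ),Real.sign (u k p.1 p.2-α)*M.sourceOf u k p.1 p.2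
      * φ p.1 p.2=∫ p,S p ∂μ := by
    rw [hvol]
    refine integral_congr_ae ?_
    filter_upwards [mem,huv] with p hp h
    have e : M.sourceOf u k p.1 p.2 = M.src (v · p.1) k p.2 :=
      src_congr hk h (havg p.1 hp)
    rw [hS,h k hk,e]
  have eA : ∫ p in Ioo 0 T ×ˢ (univ : Set ℝ),|u k p.1 p.2-α| * deriv (fun s => φ s p.2) p.1
      = ∫ p,A p ∂μ := by
    rw [hvol]
    refine integral_congr_ae ?_
    filter_upwards [huv] with p h
    rw [hA,h k hk]
  have eB : ∫ p in Ioo 0 T ×ˢ (univ : Set ℝ),M.kruzkovFlux k (u k p.1 p.2) α*M.velocity u k p.1 p.2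
      * deriv (fun y => φ p.1 y) p.2=∫ p,(B p-S p+D p) ∂μ := by
    rw [hvol]
    refine integral_congr_ae ?_
    filter_upwards [mem,huv] with p hp h
    rw [hvel p.1 hp,h k hk,hBd,hS,hD]
    simp [productionDensity]
    ring
  have eD : ∫ p in Ioo 0 T ×ˢ (univ : Set ℝ),Real.sign (u k p.1 p.2-α)*M.f k α
      * deriv (fun y => M.velocity u k p.1 y) p.2*φ p.1 p.2=∫ p,D p ∂μ := by
    rw [hvol]
    refine integral_congr_ae ?_
    filter_upwards [mem,huv,hdv] with p hp h hd
    rw [hvel p.1 hp,h k hk,hD]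
    congr 2
  have e0 : ∫ x,|u k 0 x-α| * φ 0 x = deviation (v k 0) α (φ 0) := integral_congr_ae (by
    filter_upwards [hae k hk 0 ⟨le_rfl,hT.le⟩] with x hx
    rw [hx])
  have eI : ∫ t in (0)..T,(deviation (v k t) α (fun x => deriv (fun s => φ s x) t)
      + production M (v · t) k α (φ t))=∫ p,(A p+B p) ∂μ := by
    rw [intervalIntegral.integral_of_le hT.le,integral_Ioc_eq_integral_Ioo,integral_add iA iB,
      integral_prod _ iA,integral_prod _ iB,
      ← integral_add iA.integral_prod_left iB.integral_prod_left]
    rfl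
  rw [EntropyIneq,eS,eA,eB,eD,e0,eI,integral_add iA iB,integral_add (f := fun p => B p-S p) (iB.sub iS) iD,
    integral_sub iB iS]
  constructor <;> intro h <;> linarith

end Model

/-- An inequality in the sense of distributions, integrated over an interval. -/
theorem increment_le_of_weak {A P : ℝ → ℝ} {K b T t₁ t₂ : ℝ} (hA : ∀ s t,|A s-A t| ≤ K*|s-t|)
    (hP : Measurable P) (hb : ∀ t,|P t| ≤ b) (h1 : 0 ≤ t₁) (h2 : t₁ < t₂) (h3 : t₂ ≤ T)
    (h : ∀ χ : ℝ → ℝ,ContDiff ℝ (⊤ : ℕ∞) χ → (∀ t,0 ≤ χ t) → ∀ τ,t₁ ≤ τ → τ < T →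
      (∀ t,t ∉ Icc t₁ τ → χ t=0) → χ 0=0 → 0≤∫ t in (0)..T,(deriv χ t*A t+χ t*P t)) :
    A t₂-A t₁≤∫ t in t₁..t₂,P t := by
  have hL := lipschitzWith_of_abs hA
  have hac : ∀ a c,AbsolutelyContinuousOnInterval A a c := fun a c =>
    hL.lipschitzOnWith.absolutelyContinuousOnInterval
  have iP := intervalIntegrable_of_bound hP hb
  have iA := fun a c =>
    (hac a c).intervalIntegrable_deriv
  have iq := fun a c =>
    (iP a c).sub (iA a c)
  obtain ⟨χ,hχ⟩ : ∃ χ : ℕ → ℝ → ℝ,∀ n t,χ n t = Real.smoothTransition (n*(t-t₁))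
    * Real.smoothTransition (n*(t₂-t)-1) := ⟨_,fun _ _ => rfl⟩
  have χ0 : ∀ n t,0 ≤ χ n t := fun n t => by
    rw [hχ]; exact mul_nonneg (Real.smoothTransition.nonneg _) (Real.smoothTransition.nonneg _)
  have χ1 : ∀ n t,χ n t≤1 := fun n t => by
    rw [hχ]; exact mul_le_one₀ (Real.smoothTransition.le_one _) (Real.smoothTransition.nonneg _)
      (Real.smoothTransition.le_one _)
  have χs : ∀ n,ContDiff ℝ (⊤ : ℕ∞) (χ n) := fun n => by
    rw [funext (hχ n)]
    exact (Real.smoothTransition.contDiff.comp (by fun_prop)).mul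
      (Real.smoothTransition.contDiff.comp (by fun_prop))
  have χl : ∀ n t,t ≤ t₁ → χ n t=0 := fun n t ht => by
    rw [hχ,Real.smoothTransition.zero_of_nonpos (mul_nonpos_of_nonneg_of_nonpos n.cast_nonneg
      (by linarith)),zero_mul]
  have χr : ∀ n : ℕ,0 < n → ∀ t,t₂-1/n ≤ t → χ n t=0 := fun n hn t ht => by
    have : (0 : ℝ) < n := by exact_mod_cast hn
    rw [sub_le_comm,le_div_iff₀ this] at ht
    rw [hχ,Real.smoothTransition.zero_of_nonpos (x := n*(t₂-t)-1) (by linarith),mul_zero]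
  have key : ∀ᶠ n : ℕ in atTop,0≤∫ t in t₁..t₂,χ n t*(P t-deriv A t) := by
    obtain ⟨N,hN⟩ := exists_nat_gt (1/(t₂-t₁))
    filter_upwards [eventually_ge_atTop (max N 1)] with n hn
    have n0 := (le_max_right _ _).trans hn
    have n0' : (0 : ℝ) < n := by exact_mod_cast n0
    have n1 : 1/n ≤ t₂-t₁ := by
      have : (N : ℝ) ≤ n := by exact_mod_cast (le_max_left _ _).trans hn
      rw [div_lt_iff₀ (by linarith)] at hN
      rw [div_le_iff₀ n0']
      nlinarith
    have n2 : 0<1/(n : ℝ) := by positivity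
    have := h (χ n) (χs n) (χ0 n) (t₂-1/n) (by linarith) (by linarith) (fun t ht => by
      by_cases h' : t ≤ t₁
      · exact χl n t h'
      · exact χr n n0 t (by by_contra hc; exact ht ⟨by linarith,by linarith⟩)) (χl n 0 h1)
    have cac : AbsolutelyContinuousOnInterval (χ n) 0 T :=
      ((χs n).of_le (by simp)).contDiffOn.absolutelyContinuousOnInterval
    have parts := cac.integral_deriv_mul_eq_sub (hac 0 T)
    rw [χl n 0 h1,χr n n0 T (by linarith)] at parts
    have i1 : ∀ {q : ℝ → ℝ},(∀ a c,IntervalIntegrable q volume a c) → ∀ a c,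
        IntervalIntegrable (fun t => χ n t*q t) volume a c := fun hq a c =>
      (hq a c).continuousOn_mul (χs n).continuous.continuousOn
    have i2 : IntervalIntegrable (fun t => deriv (χ n) t*A t) volume 0 T :=
      (((χs n).continuous_deriv (by simp)).mul hL.continuous).intervalIntegrable _ _
    have e : ∫ t in (0)..T,χ n t*(P t-deriv A t)
        = ∫ t in (0)..T,(deriv (χ n) t*A t+χ n t*P t) := by
      simp [mul_sub]
      rw [intervalIntegral.integral_sub (i1 iP 0 T) (i1 iA 0 T),
        intervalIntegral.integral_add i2 (i1 iP 0 T)]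
      rw [intervalIntegral.integral_add i2 (i1 iA 0 T)] at parts
      linarith
    rw [← e,← intervalIntegral.integral_add_adjacent_intervals (i1 iq 0 t₁) (i1 iq t₁ T),
      ← intervalIntegral.integral_add_adjacent_intervals (i1 iq t₁ t₂) (i1 iq t₂ T)] at this
    have z : ∀ a c,a ≤ c → (∀ t,t ∈ Icc a c → χ n t=0) →
        ∫ t in a..c,χ n t*(P t-deriv A t)=0 := fun a c hac hz =>
      intervalIntegral.integral_zero_ae (.of_forall fun t ht => by
        rw [uIoc_of_le hac] at ht; rw [hz t ⟨ht.1.le,ht.2⟩,zero_mul])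
    rwa [z 0 t₁ h1 fun t ht => χl n t ht.2,z t₂ T h3 fun t ht => χr n n0 t (by linarith [ht.1]),
      zero_add,add_zero] at this
  have lim : Tendsto (fun n : ℕ => ∫ t in t₁..t₂,χ n t*(P t-deriv A t)) atTop
      (𝓝 (∫ t in t₁..t₂,(P t-deriv A t))) := by
    refine intervalIntegral.tendsto_integral_filter_of_dominated_convergence
      (fun t => |P t-deriv A t|) (.of_forall fun n =>
        ((χs n).continuous.measurable.mul (hP.sub (measurable_deriv A))).aestronglyMeasurable)
      (.of_forall fun n => .of_forall fun t _ => by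
        rw [Real.norm_eq_abs,abs_mul,abs_of_nonneg (χ0 n t)]
        exact mul_le_of_le_one_left (abs_nonneg _) (χ1 n t)) (iq _ _).abs
      ((Measure.ae_ne volume t₂).mono fun t ht2 ht => ?_)
    rw [uIoc_of_le h2.le] at ht
    have ht' := lt_of_le_of_ne ht.2 ht2
    refine tendsto_const_nhds.congr' ?_
    obtain ⟨N,hN⟩ := exists_nat_gt (1/(t-t₁)+2/(t₂-t))
    filter_upwards [eventually_ge_atTop N] with n hn
    have hn : (N : ℝ) ≤ n := by exact_mod_cast hn
    have p1 : 0<1/(t-t₁) := one_div_pos.2 (by linarith [ht.1])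
    have p2 : 0<2/(t₂-t) := div_pos two_pos (by linarith)
    have q1 : 1 ≤ n*(t-t₁) := (div_le_iff₀ (by linarith [ht.1])).1 (by linarith)
    have q2 : 2 ≤ n*(t₂-t) := (div_le_iff₀ (by linarith)).1 (by linarith)
    rw [hχ,Real.smoothTransition.one_of_one_le q1,Real.smoothTransition.one_of_one_le
      (by linarith),one_mul,one_mul]
  have := ge_of_tendsto lim key
  rw [intervalIntegral.integral_sub (iP _ _) (iA _ _),(hac _ _).integral_deriv_eq_sub] at this
  linarith

namespace Model

variable {M : Model} {β Θ Λ T r α : ℝ} {k : ℕ} {L : ℝ} {u v : ℕ → ℝ → ℝ → ℝ} {φ : ℝ → ℝ → ℝ}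

theorem deviation_const_mul (v : ℝ → ℝ) (α c : ℝ) (ψ : ℝ → ℝ) :
    deviation v α (fun x => c*ψ x) = c*deviation v α ψ := by
  rw [deviation,deviation,← integral_const_mul]
  simp [mul_left_comm]

theorem production_const_mul (w : ℕ → ℝ → ℝ) (α c : ℝ) (ψ : ℝ → ℝ) :
    production M w k α (fun x => c*ψ x) = c*production M w k α ψ := by
  rw [production,production,← integral_const_mul]
  refine integral_congr_ae (.of_forall fun x => ?_)
  simp [productionDensity]
  ring

theorem Path.measurable_production (hB : Bounds M Λ) (hv : Path M Θ v) (hk : k ∈ M.lanes)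
    (hφ : Measurable fun p : ℝ × ℝ => φ p.1 p.2)
    (hφ' : Measurable fun p : ℝ × ℝ => deriv (φ p.1) p.2) :
    Measurable fun t => production M (v · t) k α (φ t) :=
  (measurable_productionDensity hB.std hv.meas hk hφ
    hφ').stronglyMeasurable.integral_prod_right.measurable

theorem IsTest.eq_zero (h : IsTest T φ) (x : ℝ) : φ T x=0 :=
  image_eq_zero_of_notMem_tsupport (x := (T,x))
    fun hm => lt_irrefl T (h.support hm).1

theorem sliceEntropy_of_entropyIneq (hB : Bounds M Λ) (hΘ : 0 ≤ Θ) (hT : 0 < T) (hv : Path M Θ v)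
    (hm : ∀ j ∈ M.lanes,AEStronglyMeasurable (fun p : ℝ × ℝ => u j p.1 p.2)
      (volume.restrict (Ioo 0 T ×ˢ univ)))
    (hae : ∀ j ∈ M.lanes,∀ t ∈ Icc 0 T,u j t =ᵐ[volume] v j t)
    (he : ∀ k ∈ M.lanes,∀ α φ,IsTest T φ → M.EntropyIneq T u k α φ) : SliceEntropy M T v := by
  intro k hk α ψ hs h0 hcs t₁ t₂ ht1 ht12 ht2
  rcases ht12.eq_or_lt with rfl | h12
  · simp
  obtain ⟨L,hL,hf⟩ := hB.std.exists_lip (|α| + 1)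
  obtain ⟨c,hc⟩ := hcs.exists_bound_of_continuous hs.continuous
  have hi : Integrable ψ := hs.continuous.integrable_of_hasCompactSupport hcs
  have hi' : Integrable (deriv ψ) := (hs.continuous_deriv (by simp)).integrable_of_hasCompactSupport hcs.deriv
  refine increment_le_of_weak (K := c*Θ) (b := productionBound M Λ L (|α| + 1)
    * ∫ x,(|ψ x| + |deriv ψ x|)) (T := T) (A := fun t => deviation (v k t) α ψ) (fun s t => ?_)
    (hv.measurable_production (φ := fun _ => ψ) hB hk
      (hs.continuous.measurable.comp measurable_snd) ((measurable_deriv ψ).comp measurable_snd))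
    (fun t => abs_production_le hB (hv.profile t) hk (by linarith) (by linarith [abs_nonneg α])
      (hf k hk) (by linarith) (hi.abs.add hi'.abs) (fun x => by simp) fun x => by simp)
    ht1 h12 ht2 fun χ χs χ0 τ hτ hτT χz χi => ?_
  · have := abs_deviation_sub_le (hv.profile s) (hv.profile t) hk hs.continuous.measurable
      (fun x => le_rfl) hi.abs hc α α
    rw [sub_self,abs_zero,zero_mul,add_zero] at this
    rw [mul_assoc]
    exact this.trans (mul_mono_l (hv.move s t) ((norm_nonneg _).trans (hc 0)))
  · have hsub : Function.support (fun p : ℝ × ℝ => χ p.1*ψ p.2) ⊆ Icc t₁ τ ×ˢ tsupport ψ :=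
      fun p hp => by
        refine ⟨?_,subset_tsupport _ (right_ne_zero_of_mul hp)⟩
        by_contra h
        exact left_ne_zero_of_mul hp (χz _ h)
    have hφ : IsTest T fun t x => χ t*ψ x := by
      refine ⟨(χs.comp contDiff_fst).mul (hs.comp contDiff_snd),
        HasCompactSupport.of_support_subset_isCompact (isCompact_Icc.prod hcs) hsub,?_,
        fun t _ x => mul_nonneg (χ0 t) (h0 x)⟩
      refine (closure_minimal hsub (isClosed_Icc.prod (isClosed_tsupport ψ))).trans fun p hp =>
        ⟨hp.1.2.trans_lt hτT,mem_univ _⟩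
    have := (entropyIneq_iff hB hΘ hT hv hm hae hk hφ).1 (he k hk α _ hφ)
    simp only [χi,zero_mul] at this
    have e0 : deviation (v k 0) α (fun _ => 0)=0 := by simp [deviation]
    rw [e0,add_zero] at this
    refine this.trans (le_of_eq (intervalIntegral.integral_congr fun t _ => ?_))
    simp only [deriv_mul_const_field]
    rw [deviation_const_mul,production_const_mul]

theorem entropyIneq_of_sliceEntropy (hB : Bounds M Λ) (hΘ : 0 ≤ Θ) (hT : 0 < T) (hv : Path M Θ v)
    (he : SliceEntropy M T v) (hk : k ∈ M.lanes) (hφ : IsTest T φ) : M.EntropyIneq T v k α φ := by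
  rw [entropyIneq_iff hB hΘ hT hv (fun j hj => (hv.meas j hj).aestronglyMeasurable)
    (fun _ _ _ _ => EventuallyEq.rfl) hk hφ]
  obtain ⟨cφt,cφx,c,R,hb⟩ := exists_plane_bound hφ.smooth hφ.compact
  obtain ⟨L,hL,hf⟩ := hB.std.exists_lip (|α| + 1)
  have h1 := hB.one_le
  set Γ : ℝ → ℝ := fun x => c*box R x with hΓd
  have hΓ := (box_integrable R).const_mul c
  have hΓ0 := fun x => (abs_nonneg _).trans (hb x 0 0).1
  have hI : 0≤∫ x,Γ x := integral_nonneg hΓ0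
  have hΓc := fun x => (mul_mono_r (le_abs_self c)
    (box_nonneg R x)).trans (mul_le_of_le_one_right (abs_nonneg c) (box_le_one R x))
  have smx : ∀ t,ContDiff ℝ (⊤ : ℕ∞) (φ t) := fun t =>
    hφ.smooth.comp (contDiff_const.prodMk contDiff_id : ContDiff ℝ (⊤ : ℕ∞) fun x => (t,x))
  have slc : ∀ {G : ℝ × ℝ → ℝ},Continuous G → ∀ t,Measurable fun x => G (t,x) := fun hG t =>
    (hG.comp (by fun_prop)).measurable
  set q : ℝ → ℝ := fun t => deviation (v k t) α (fun x => deriv (fun s => φ s x) t) with hq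
  set P : ℝ → ℝ := fun t => production M (v · t) k α (φ t) with hP
  set b := productionBound M Λ L (|α| + 1)*∫ x,Γ x with hbd
  have Pm : Measurable P := hv.measurable_production hB hk hφ.smooth.continuous.measurable cφx.measurable
  have Pb := fun t => abs_production_le hB (hv.profile t) hk (by linarith)
    (by linarith [abs_nonneg α]) (hf k hk) (by linarith) hΓ (fun x => (hb x t 0).1)
    fun x => (hb x t 0).2.2.1
  have dev : ∀ t {ψ : ℝ → ℝ} {κ : ℝ},(∀ x,|ψ x| ≤ Γ x*κ) →
      |deviation (v k t) α ψ|≤(1+|α|)*(κ*∫ x,Γ x) := fun t ψ κ hψ => by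
    rw [deviation,← Real.norm_eq_abs,← integral_const_mul,← integral_const_mul]
    refine norm_integral_le_of_norm_le ((hΓ.const_mul κ).const_mul _)
      (.of_forall fun x => ?_)
    rw [Real.norm_eq_abs,abs_mul,abs_abs,mul_comm κ]
    exact mul_le_mul ((abs_sub _ _).trans (add_le_add ((hv.profile t).abs_le_one hk x) le_rfl))
      (hψ x) (abs_nonneg _) (by positivity)
  have qm : Measurable q := (((hv.meas k hk).sub_const α).abs.mul
    cφt.measurable).stronglyMeasurable.integral_prod_right.measurable
  have qb := fun t => dev t fun x => by rw [mul_one]; exact (hb x t 0).2.1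
  have iq := intervalIntegrable_of_bound qm qb
  have iP := intervalIntegrable_of_bound Pm Pb
  set Q : ℝ → ℝ := fun t => q t+P t
  have iQ := fun a c => (iq a c).add (iP a c)
  obtain ⟨X,hX⟩ : ∃ X,X=(1+|α|)*(2*∫ x,Γ x)+|c| * Θ := ⟨_,rfl⟩
  have key := le_of_increment_le_sq (F := fun t => deviation (v k t) α (φ t)-∫ s in (0)..t,Q s)
    (C := X+b) hT.le fun a d ha had hdT => by
    have e1 := intervalIntegral.integral_interval_sub_left (iQ 0 d) (iQ 0 a)
    rcases had.eq_or_lt with rfl | had'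
    · simp
    have di := fun t s =>
      deviation_integrable ((hv.profile t).meas k hk) ((hv.profile t).mem k hk) α
        (hΓ.mono' (slc hφ.smooth.continuous s).aestronglyMeasurable
          (.of_forall fun x => (hb x s 0).1))
    have hsl := he k hk α (φ a) (smx a) (hφ.nonneg a ha) (HasCompactSupport.of_support_subset_isCompact
      (hφ.compact.image continuous_snd) fun x hx =>
        ⟨(a,x),subset_tsupport (fun p : ℝ × ℝ => φ p.1 p.2) hx,rfl⟩) a d ha had hdT
    have hdev : ∀ s ∈ Icc a d,(deviation (v k d) α (φ d)-deviation (v k d) α (φ a))/(d-a)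
        ≤ q s+X*(d-a) := fun s hs => by
      have hda : 0 < d-a := by linarith
      have e2 : deviation (v k d) α (φ d)-deviation (v k d) α (φ a)
          - (d-a)*deviation (v k d) α (fun x => deriv (fun s => φ s x) s)
          = deviation (v k d) α (fun x => φ d x-φ a x-(d-a)*deriv (fun s => φ s x) s) := by
        have i3 := deviation_integrable ((hv.profile d).meas k hk) ((hv.profile d).mem k hk) α
          ((hΓ.mono' (slc cφt s).aestronglyMeasurable
          (.of_forall fun x => (hb x s 0).2.1)).const_mul (d-a))
        rw [← deviation_const_mul]
        simp [deviation]
        rw [← integral_sub (di d d) (di d a),← integral_sub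
          (f := fun x => |v k d x-α| * φ d x-|v k d x-α| * φ a x) ((di d d).sub (di d a)) i3]
        simp [mul_sub]
      have e3 := (abs_le.1 (dev d (κ := 2*(d-a)^2) (ψ := fun x => φ d x-φ a x
          - (d-a)*deriv (fun s => φ s x) s) fun x => by
        have t2 := (hb x s a).2.2.2.2.2
        have q1 : (d-s)^2≤(d-a)^2 := by have := hs.1; have := hs.2; nlinarith
        have q2 : (a-s)^2≤(d-a)^2 := by have := hs.1; have := hs.2; nlinarith
        have q3 := mul_mono_l q1 (hΓ0 x)
        have q4 := mul_mono_l q2 (hΓ0 x)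
        have e : φ d x-φ a x-(d-a)*deriv (fun s => φ s x) s
          = (φ d x-φ s x-deriv (fun s => φ s x) s*(d-s))
            - (φ a x-φ s x-deriv (fun s => φ s x) s*(a-s)) := by ring
        rw [e]
        refine (abs_sub _ _).trans ((add_le_add ((hb x s d).2.2.2.2.2) t2).trans ?_)
        linarith)).2
      have e4 := (abs_le.1 (abs_deviation_sub_le (hv.profile d) (hv.profile s) hk (slc cφt s)
        (fun x => (hb x s 0).2.1) hΓ hΓc α α)).2
      rw [sub_self,abs_zero,zero_mul,add_zero] at e4
      have e5 : |c| * M.gap (v · d) (v · s) ≤ |c| * Θ*(d-a) := by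
        rw [mul_assoc]
        refine mul_mono_l ((hv.move d s).trans (mul_mono_l ?_ hΘ))
          (abs_nonneg _)
        rw [abs_of_nonneg (by linarith [hs.2])]; linarith [hs.1]
      rw [div_le_iff₀ hda,hX]
      nlinarith
    have hprod : ∀ s ∈ Icc a d,production M (v · s) k α (φ a) ≤ P s+b*(d-a) :=
      fun s hs => by
        have ip : ∀ a,Integrable (productionDensity M (v · s) k α (φ a)) := fun a =>
          integrable_of_dominated hΓ ((measurable_productionDensity (φ := fun _ => φ a) hB.std hv.meas
            hk ((smx a).continuous.measurable.comp measurable_snd)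
            ((measurable_deriv _).comp measurable_snd)).comp
            (measurable_const.prodMk measurable_id : Measurable fun x => (s,x)))
            fun x => (hv.profile s).abs_productionDensity_le hB hk (by linarith)
              (by linarith [abs_nonneg α]) (hf k hk) (by linarith) (hb x a 0).1 (hb x a 0).2.2.1
        have e : production M (v · s) k α (φ a)-P s
            = production M (v · s) k α (fun x => φ a x-φ s x) := by
          simp [hP,production]
          rw [← integral_sub (ip a) (ip s)]
          refine integral_congr_ae (.of_forall fun x => ?_)
          simp [productionDensity]
          rw [deriv_fun_sub ((smx a).differentiable (by simp) x) ((smx s).differentiable (by simp) x)]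
          ring
        have e' := (abs_le.1 (abs_production_le (α := α) hB (hv.profile s) hk
          (by linarith) (by linarith [abs_nonneg α]) (hf k hk) (by linarith)
          (hΓ.mul_const |a-s|) (fun x => (hb x s a).2.2.2.1) fun x => by
            rw [deriv_fun_sub ((smx a).differentiable (by simp) x)
              ((smx s).differentiable (by simp) x)]
            exact (hb x s a).2.2.2.2.1)).2
        rw [← e,integral_mul_const,← mul_assoc,← hbd,abs_of_nonpos (by linarith [hs.1])] at e'
        have : b*-(a-s) ≤ b*(d-a) := mul_mono_l (by linarith [hs.2]) (by grind)
        linarith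
    have i1 := intervalIntegral.integral_mono_on had intervalIntegrable_const
      ((iq a d).add intervalIntegrable_const) hdev
    have i2 := intervalIntegral.integral_mono_on had (intervalIntegrable_of_bound
      (hv.measurable_production hB hk ((smx a).continuous.measurable.comp
      measurable_snd) ((measurable_deriv _).comp measurable_snd)) (fun t => abs_production_le hB
      (hv.profile t) hk (by linarith) (by linarith [abs_nonneg α]) (hf k hk) (by linarith) hΓ
      (fun x => (hb x a 0).1) fun x => (hb x a 0).2.2.1) _ _)
      ((iP a d).add intervalIntegrable_const) hprod
    rw [intervalIntegral.integral_add (iq _ _) intervalIntegrable_const] at i1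
    rw [intervalIntegral.integral_add (iP _ _) intervalIntegrable_const] at i2
    simp only [intervalIntegral.integral_const,smul_eq_mul] at i1 i2
    rw [mul_div_cancel₀ _ (by linarith)] at i1
    have e7 : ∫ s in a..d,Q s=(∫ s in a..d,q s)+∫ s in a..d,P s :=
      intervalIntegral.integral_add (iq _ _) (iP _ _)
    nlinarith
  have eT : deviation (v k T) α (φ T)=0 := by simp [deviation,hφ.eq_zero]
  simp [intervalIntegral.integral_same] at key
  linarith

variable {M : Model} {β Θ Λ T r ε B δ : ℝ} {k : ℕ} {u v : ℕ → ℝ → ℝ → ℝ} {u₀ : ℕ → ℝ → ℝ} {ρ : ℝ → ℝ}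

theorem Path.curve (hB : Bounds M Λ) (hΘ : 0 ≤ Θ) (hu : Path M Θ u) (he : SliceEntropy M T u)
    (hρ : Mollifier ε B ρ) (hδ : 0 ≤ δ) : Curve M T Θ ρ δ u := by
  refine ⟨hu.meas,hu.profile,fun s t => (hu.move s t).trans (le_add_of_nonneg_right hδ),
    fun z hz k hk t₁ t₂ h0 h12 hT => (?_ : _ ≤ _).trans (le_add_of_nonneg_right hδ)⟩
  have h1 := hB.one_le
  have hε := hρ.pos
  have hB0 := hρ.B_nonneg
  have il := fun t =>
    hρ.laneGap_integrable ((hu.profile t).integrable k hk) (hz.integrable k hk)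
      ((hu.profile t).meas k hk) (hz.meas k hk)
  have ip := fun t =>
    ((hu.profile t).pairing_integrable hB hz hρ hk).1
  obtain ⟨b,hb⟩ : ∃ b,∀ t,∫ p,|M.pairing ρ (u · t) z k p| ≤ b := by
    refine ⟨2*Λ^3*(B/ε^2+B/ε)*(2*ε*(M.lanes.card*Θ)
      + 2*ε*(M.lanes.card*Θ)),fun t => ?_⟩
    have hb := (((hu.profile t).boxLe_sum_fst hε.le).add (hz.boxLe_sum_snd hε.le)).const_mul
      (c := 2*Λ^3*(B/ε^2+B/ε)) (by positivity)
    exact (integral_mono (ip t).abs hb.1 fun p =>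
      (hu.profile t).abs_pairing_le hB hz hρ hk p).trans hb.2
  have Hm : Measurable fun q : ℝ × ℝ => ∫ x,M.pairing ρ (u · q.1) z k (x,q.2) := by
    have m1 : Measurable fun q : (ℝ × ℝ) × ℝ => ((q.1.1,()),(q.2,q.1.2)) := by fun_prop
    have m2 := (measurable_pairing (v := fun j (_ : Unit) x => z j x) hB.std hu.meas hz.unit_meas hk
        hρ.smooth.continuous).comp m1
    exact (m2.stronglyMeasurable.integral_prod_right').measurable
  have Hi : Integrable (fun q => ∫ x,M.pairing ρ (u · q.1) z k (x,q.2))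
      ((volume.restrict (Ioc t₁ t₂)).prod volume) := by
    have hi := fun t => (ip t).integral_prod_right
    refine (integrable_prod_iff Hm.aestronglyMeasurable).2 ⟨Eventually.of_forall hi,
      Integrable.of_bound Hm.norm.stronglyMeasurable.integral_prod_right.aestronglyMeasurable b
        (Eventually.of_forall fun t => ?_)⟩
    rw [Real.norm_of_nonneg (integral_nonneg fun _ => norm_nonneg _)]
    refine (integral_mono (hi t).norm (ip t).abs.integral_prod_right fun y =>
      norm_integral_le_integral_norm _).trans (le_of_eq_of_le ?_ (hb t))
    exact (integral_prod_symm _ (ip t).abs).symm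
  have step := fun y => by
    have := he k hk (z k y) (fun x => ρ (x-y)) (hρ.smooth.comp (contDiff_id.sub contDiff_const))
      (fun _ => hρ.nonneg _) (HasCompactSupport.intro (isCompact_Icc (a := y-ε) (b := y+ε))
        fun x hx => hρ.eq_zero (by
          contrapose! hx; rw [abs_le] at hx; exact ⟨by linarith,by linarith⟩)) t₁ t₂ h0 h12 hT
    simp only [production,productionDensity_eq] at this
    rwa [intervalIntegral.integral_of_le h12] at this
  rw [laneGap,laneGap,intervalIntegral.integral_of_le h12]
  have ep : ∀ t,∫ p,M.pairing ρ (u · t) z k p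
      = ∫ y,∫ x,M.pairing ρ (u · t) z k (x,y) := fun t => integral_prod_symm _ (ip t)
  simp only [ep]
  rw [integral_integral_swap Hi,
    Measure.volume_eq_prod,integral_prod_symm _ (il t₂),integral_prod_symm _ (il t₁),
    ← integral_sub (il t₂).integral_prod_right (il t₁).integral_prod_right]
  exact integral_mono ((il t₂).integral_prod_right.sub (il t₁).integral_prod_right)
    Hi.swap.integral_prod_left step

end Model

theorem ae_eq_of_integral_abs_le {a b : ℝ → ℝ} (ha : Integrable a) (hb : Integrable b)
    (h : ∫ x,|a x-b x|≤0) : a =ᵐ[volume] b := by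
  have := (integral_eq_zero_iff_of_nonneg (fun x => abs_nonneg (a x-b x)) (ha.sub hb).abs).1
    (le_antisymm h (integral_nonneg fun _ => abs_nonneg _))
  filter_upwards [this] with x hx
  exact sub_eq_zero.1 (abs_eq_zero.1 hx)

theorem exists_unit_measurable {a : ℝ → ℝ} (hi : Integrable a)
    (hr : ∀ᵐ x,a x ∈ 𝕀) : ∃ b : ℝ → ℝ,Measurable b ∧ (∀ x,b x ∈ 𝕀) ∧
      b =ᵐ[volume] a := by
  refine ⟨fun x => max 0 (min 1 (hi.1.mk a x)),measurable_const.max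
    (measurable_const.min hi.1.stronglyMeasurable_mk.measurable),fun x =>
    ⟨le_max_left _ _,max_le zero_le_one (min_le_left _ _)⟩,?_⟩
  filter_upwards [hr,hi.1.ae_eq_mk] with x h1 h2
  rw [← h2,min_eq_right h1.2,max_eq_right h1.1]

/-- A Lipschitz curve in `L¹(ℝ; [0,1])` has a jointly measurable representative. -/
theorem exists_measurable_path {w : ℝ → ℝ → ℝ} {K : ℝ} (hi : ∀ t,Integrable (w t))
    (hr : ∀ t,∀ᵐ x,w t x ∈ 𝕀) (hl : ∀ s t,∫ x,|w s x-w t x| ≤ K*|s-t|) :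
    ∃ v : ℝ → ℝ → ℝ,(Measurable fun p : ℝ × ℝ => v p.1 p.2) ∧ (∀ t x,v t x ∈ 𝕀) ∧
      ∀ t,v t =ᵐ[volume] w t := by
  choose W hWm hW01 hWw using fun t => exists_unit_measurable (hi t) (hr t)
  have hWi : ∀ t,Integrable (W t) := fun t => (hi t).congr (hWw t).symm
  have hK : 0 ≤ K := by
    have := (integral_nonneg fun x => abs_nonneg (w 1 x-w 0 x)).trans (hl 1 0)
    simpa using this
  have hs : ∀ j : ℕ,0<(2*K+1)*4^j := fun j => by positivity
  obtain ⟨τ,hτ⟩ : ∃ τ : ℕ → ℝ → ℝ,∀ j t,τ j t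
    = (⌊t*((2*K+1)*4^j)⌋ : ℝ)/((2*K+1)*4^j) := ⟨_,fun _ _ => rfl⟩
  have hd : ∀ n j,n ≤ j → ∀ t,K*|τ j t-t|≤(1/4)^n/2 := fun n j hnj t => by
    have h1 : |τ j t-t|≤1/((2*K+1)*4^j) := by
      rw [hτ,div_sub' (hs j).ne',abs_div,abs_of_pos (hs j),abs_sub_comm,mul_comm _ t]
      gcongr
      rw [Int.self_sub_floor,Int.abs_fract]
      exact (Int.fract_lt_one _).le
    refine (mul_mono_l h1 hK).trans ?_
    have h2 : (4 : ℝ)^n≤4^j := pow_le_pow_right₀ (by norm_num) hnj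
    have h3 : (0 : ℝ)<4^n := by positivity
    rw [one_div_pow,mul_one_div,div_div,div_le_div_iff₀ (hs j) (by positivity)]
    nlinarith
  have hdist : ∀ s t,∫ x,|W s x-w t x| ≤ K*|s-t| := fun s t => by
    refine le_of_eq_of_le (integral_congr_ae ?_) (hl s t)
    filter_upwards [hWw s] with x hx
    rw [hx]
  obtain ⟨v,hm,h01,hv⟩ := exists_limit (U := fun j t => W (τ j t)) (fun j => by
      have m1 : Measurable fun p : ℝ × ℝ => (⌊p.1*((2*K+1)*4^j)⌋,p.2) :=
        (Int.measurable_floor.comp (measurable_fst.mul_const _)).prodMk measurable_snd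
      have m2 : Measurable fun q : ℤ × ℝ => W (q.1/((2*K+1)*4^j)) q.2 :=
        measurable_from_prod_countable_right fun n =>
          hWm (n/((2*K+1)*4^j))
      simp only [hτ]
      exact m2.comp m1)
    (fun j t x => hW01 _ x) (fun j t => hWi _) (fun n i j hi' hj t => by
      refine (integral_abs_sub_le_add (hWi _) (hi t) (hWi _)).trans ?_
      have e1 := (hdist (τ i t) t).trans (hd n i hi' t)
      have e2 := (hdist (τ j t) t).trans (hd n j hj t)
      simp only [abs_sub_comm (w t _)]
      linarith)
  refine ⟨v,hm,h01,fun t => ?_⟩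
  have h0 : ∫ x,|v t x-w t x|≤0 := by
    refine ge_of_tendsto' (f := fun n => (1/4 : ℝ)^n+(1/4)^n/2) (x := atTop) ?_ fun n => ?_
    · have := Model.tendsto_geometric 1 (r := 1/4) (by norm_num) (by norm_num)
      simpa using this.add (this.div_const 2)
    · refine (integral_abs_sub_le_add (hv t).1 (hWi (τ n t)) (hi t)).trans (add_le_add ?_
        ((hdist (τ n t) t).trans (hd n n le_rfl t)))
      simp only [abs_sub_comm (v t _)]
      exact (hv t).2.2 n
  exact ae_eq_of_integral_abs_le (hv t).1 (hi t) h0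

namespace Model

variable {M : Model} {T : ℝ} {u : ℕ → ℝ → ℝ → ℝ} {u₀ : ℕ → ℝ → ℝ}

theorem IsEntropySolution.exists_path (hT : 0 ≤ T) (hu : M.IsEntropySolution T u₀ u) :
    ∃ Θ,1 ≤ Θ ∧ ∃ v,Path M Θ v ∧ ∀ k ∈ M.lanes,∀ t ∈ Icc 0 T,u k t =ᵐ[volume] v k t := by
  have hc : ∀ t,max 0 (min T t) ∈ Icc 0 T := fun t =>
    ⟨le_max_left _ _,max_le hT (min_le_left _ _)⟩
  have hcc : ∀ s t,|max 0 (min T s)-max 0 (min T t)| ≤ |s-t| := fun s t =>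
    (abs_max_sub_max_le_max _ _ _ _).trans ((max_le (by simp) (abs_min_sub_min_le_max _ _ _ _)).trans
      (by simp))
  have key : ∀ k,∃ v : ℝ → ℝ → ℝ,∃ K L : ℝ,0 ≤ K ∧ 0 ≤ L ∧ (k ∈ M.lanes →
      (Measurable fun p : ℝ × ℝ => v p.1 p.2) ∧ (∀ t x,v t x ∈ Icc 0 1) ∧
      (∀ t,v t =ᵐ[volume] u k (max 0 (min T t))) ∧
      (∀ s ∈ Icc 0 T,∀ t ∈ Icc 0 T,∫ x,|u k s x-u k t x| ≤ K*|s-t|) ∧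
      ∀ t,TranslateLe (v t) L) := fun k => by
    by_cases hk : k ∈ M.lanes
    · obtain ⟨K,hK⟩ := hu.lip k hk
      obtain ⟨L,hL⟩ := hu.bv k hk
      have hK' := fun s hs t ht => (hK s hs t ht).trans
          (mul_mono_r (le_abs_self K) (abs_nonneg _))
      obtain ⟨v,h1,h2,h3⟩ := exists_measurable_path (w := fun t => u k (max 0 (min T t)))
        (fun t => hu.integrable k hk _ (hc t)) (fun t => hu.range k hk _ (hc t))
        fun s t => (hK' _ (hc s) _ (hc t)).trans
          (mul_mono_l (hcc s t) (abs_nonneg K))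
      refine ⟨v,|K|,L+1,abs_nonneg _,by positivity,fun _ => ⟨h1,h2,h3,hK',fun t => ?_⟩⟩
      have : essVariation (u k (max 0 (min T t))) < ENNReal.ofReal (L+1) :=
        (hL _ (hc t)).trans_lt (by
          rw [ENNReal.ofReal_add L.coe_nonneg zero_le_one,ENNReal.ofReal_coe_nnreal,ENNReal.ofReal_one]
          exact ENNReal.lt_add_right ENNReal.coe_ne_top one_ne_zero)
      obtain ⟨⟨w,hw⟩,hlt⟩ := iInf_lt_iff.1 this
      exact translateLe_of_eVariationOn (h1.comp measurable_prodMk_left).aemeasurable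
        (hw.trans (h3 t).symm) (by positivity) hlt.le
    · exact ⟨0,0,0,le_rfl,le_rfl,fun h => absurd h hk⟩
  choose v K L hK hL hv using key
  have hsum : ∀ {q : ℕ → ℝ},(∀ k,0 ≤ q k) → ∀ {k},k ∈ M.lanes → q k≤∑ k ∈ M.lanes,q k :=
    fun hq _ hk => Finset.single_le_sum (fun j _ => hq j) hk
  set Θ := 1+∑ k ∈ M.lanes,(K k+L k+(K k*T+|∫ x,u k 0 x|)) with hΘ
  have hb : ∀ k ∈ M.lanes,K k+L k+(K k*T+|∫ x,u k 0 x|) ≤ Θ := fun k hk =>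
    (hsum (q := fun k => K k+L k+(K k*T+|∫ x,u k 0 x|)) (fun j => by
      have := hK j; have := hL j; positivity) hk).trans (by linarith)
  have h1Θ : 1 ≤ Θ := le_add_of_nonneg_right (Finset.sum_nonneg fun j _ => by
    have := hK j; have := hL j; positivity)
  have hi := fun k hk t =>
    (hu.integrable k hk _ (hc t)).congr ((hv k hk).2.2.1 t).symm
  refine ⟨Θ,h1Θ,v,⟨fun k hk => (hv k hk).1,fun t => ⟨fun k hk =>
    (hv k hk).1.comp measurable_prodMk_left,fun k hk => (hv k hk).2.1 t,fun k hk => hi k hk t,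
    fun k hk => ?_,fun k hk => ((hv k hk).2.2.2.2 t).mono ?_⟩,fun s t => ?_⟩,fun k hk t ht => ?_⟩
  · obtain ⟨-,-,h3,h4,-⟩ := hv k hk
    have i0 := hu.integrable k hk 0 ⟨le_rfl,hT⟩
    have := (le_abs_self _).trans (abs_integral_le_integral_abs (f := fun x =>
      u k (max 0 (min T t)) x-u k 0 x) (μ := volume))
    rw [integral_sub (hu.integrable k hk _ (hc t)) i0] at this
    have h5 := h4 _ (hc t) 0 ⟨le_rfl,hT⟩
    rw [sub_zero,abs_of_nonneg (hc t).1] at h5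
    have h6 := mul_mono_l (hc t).2 (hK k)
    have := hb k hk
    rw [integral_congr_ae (h3 t)]
    linarith [le_abs_self (∫ x,u k 0 x),hK k,hL k]
  · have := hb k hk
    nlinarith [abs_nonneg (∫ x,u k 0 x),hK k]
  · have hS : ∑ k ∈ M.lanes,K k ≤ Θ := by
      refine (Finset.sum_le_sum fun k _ => ?_).trans (le_add_of_nonneg_left zero_le_one)
      have := hL k; have := hK k
      have : 0 ≤ K k*T+|∫ x,u k 0 x| := by positivity
      linarith
    refine le_trans ?_ (mul_mono_r hS (abs_nonneg _))
    rw [Finset.sum_mul]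
    refine Finset.sum_le_sum fun k hk => ?_
    obtain ⟨-,-,h3,h4,-⟩ := hv k hk
    refine le_trans (le_of_eq (integral_congr_ae ?_)) ((h4 _ (hc s) _ (hc t)).trans
      (mul_mono_l (hcc s t) (hK k)))
    filter_upwards [h3 s,h3 t] with x e1 e2
    rw [e1,e2]
  · have := (hv k hk).2.2.1 t
    rw [min_eq_right ht.2,max_eq_right ht.1] at this
    exact this.symm

end Model

theorem Mesh.integral_abs_average_sub_le {m : Mesh} (hx : 0 < m.Δx) {v : ℝ → ℝ} {K : ℝ}
    (hm : Measurable v) (hi : Integrable v) (hK : TranslateLe v K) :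
    ∫ x,|stepFn m (fun i => 1/m.Δx*∫ y in m.cell i,v y) x-v x|≤2*K*m.Δx := by
  have hb := BoxLe.translate hx.le hm hi hK
  have hb1 := hb.1
  have hb2 := hb.2
  rw [Measure.volume_eq_prod] at hb1 hb2
  rw [integral_prod _ hb1] at hb2
  have hmono : ∫ x,|stepFn m (fun i => 1/m.Δx*∫ y in m.cell i,v y) x-v x|
      ≤ ∫ x,1/m.Δx*∫ y,|v x-v y| * box m.Δx (x-y) := by
    refine integral_mono_of_nonneg (Eventually.of_forall fun x => abs_nonneg _)
      (hb1.integral_prod_left.const_mul _) ?_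
    filter_upwards [hb1.prod_right_ae] with x hbx
    have hxi := (Mesh.mem_cell_iff hx).2 (rfl : m.cellIndex x = _)
    set i := m.cellIndex x with hid
    have e0 : ∫ _ in m.cell i,v x = m.Δx*v x := by
      rw [setIntegral_const,Measure.real,Mesh.volume_cell hx,ENNReal.toReal_ofReal hx.le,
        smul_eq_mul]
    have e1 : stepFn m (fun i => 1/m.Δx*∫ y in m.cell i,v y) x-v x
        = 1/m.Δx*∫ y in m.cell i,(v y-v x) := by
      rw [integral_sub hi.integrableOn (integrableOn_const (by rw [Mesh.volume_cell hx]; exact ENNReal.ofReal_ne_top)),e0,mul_sub,← mul_assoc,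
        one_div_mul_cancel hx.ne',one_mul]
      rfl
    rw [e1,abs_mul,abs_of_pos (by positivity)]
    refine mul_mono_l (abs_integral_le_integral_abs.trans ?_) (one_div_pos.2 hx).le
    refine le_trans (le_of_eq (setIntegral_congr_fun (m.measurableSet_cell i) fun y hy => ?_))
      (setIntegral_le_integral hbx (Eventually.of_forall fun y =>
        mul_nonneg (abs_nonneg _) (box_nonneg _ _)))
    have hxy : |x-y| ≤ m.Δx := by
      rw [Mesh.cell,mem_Ico,Mesh.half_eq,Mesh.half_eq] at hxi hy
      push_cast at hxi hy
      rw [abs_le]; constructor <;> linarith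
    rw [box_of_le hxy,mul_one,abs_sub_comm]
  refine hmono.trans ?_
  rw [integral_const_mul,one_div,inv_mul_le_iff₀ hx]
  exact hb2.trans (le_of_eq (by ring))

namespace Model

variable {M : Model} {m : Mesh} {β Θ Λ T r ε B δ ℓ : ℝ} {k : ℕ} {u v : ℕ → ℝ → ℝ → ℝ}
  {u₀ : ℕ → ℝ → ℝ} {ρ : ℝ → ℝ}

theorem InitialData.exists_rate (hu : M.InitialData u₀) : ∃ K,0 ≤ K ∧ ∀ m β,0 < m.Δx →
    ∀ k ∈ M.lanes,∫ x,|stepFn m (M.approx m β u₀ 0 k) x-u₀ k x| ≤ K*m.Δx := by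
  obtain ⟨K,hK0,hK⟩ := hu.translate
  refine ⟨2*K,by positivity,fun m β hx k hk => ?_⟩
  obtain ⟨hi,-,hr⟩ := hu k hk
  obtain ⟨v,hm,h01,hv⟩ := exists_unit_measurable hi hr
  have htr : TranslateLe v K := fun h => by
    refine le_of_eq_of_le (integral_congr_ae ?_) (hK k hk h)
    have := (measurePreserving_add_right (volume : Measure ℝ) h).quasiMeasurePreserving.ae_eq_comp hv
    filter_upwards [hv,this] with x h1 h2
    simp [Function.comp_apply] at h2
    rw [h1,h2]
  refine le_of_eq_of_le (integral_congr_ae ?_)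
    (Mesh.integral_abs_average_sub_le hx hm (hi.congr hv.symm) htr)
  have e : M.approx m β u₀ 0 k = fun i => 1/m.Δx*∫ y in m.cell i,v y := by
    funext i
    rw [approx]
    dsimp only
    rw [setIntegral_congr_ae (m.measurableSet_cell i) (hv.mono fun x h _ => h.symm)]
  filter_upwards [hv] with x h1
  rw [e,h1]

theorem Curve.mono {δ' : ℝ} (h : Curve M T Θ ρ δ u) (hδ : δ ≤ δ') : Curve M T Θ ρ δ' u :=
  ⟨h.meas,h.profile,fun s t => (h.move s t).trans (by gcongr),fun z hz k hk t₁ t₂ h0 h1 h2 =>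
    (h.entropy z hz k hk t₁ t₂ h0 h1 h2).trans (by gcongr)⟩

/-- Curves that start close to each other remain close. -/
theorem exists_close (hB : Bounds M Λ) (hΘ : 0 ≤ Θ) (hT : 0 < T) {κ : ℝ} (hκ : 0 < κ) :
    ∃ ε B ρ,Mollifier ε B ρ ∧ ∃ δ,0 < δ ∧ ∀ u v,Curve M T Θ ρ δ u → Curve M T Θ ρ δ v →
      M.gap (u · 0) (v · 0) ≤ δ →
      ∀ t ∈ Icc 0 T,M.gap (u · t) (v · t) ≤ κ := by
  obtain ⟨B,hρ⟩ := exists_mollifier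
  obtain ⟨ρ₁,h1⟩ := hρ 1 one_pos
  obtain ⟨K,hK,hc⟩ := Curve.exists_comparison hB hΘ h1.B_nonneg T
  obtain ⟨a,ha,hKa⟩ : ∃ a,0 < a ∧ K*(5*a) ≤ κ := by
    refine ⟨κ/(5*(K+1)),by positivity,?_⟩
    rw [mul_div_mul_left _ _ (by norm_num : (5 : ℝ) ≠ 0) |>.symm,← mul_div_assoc,← mul_div_assoc,
      div_le_iff₀ (by positivity)]
    nlinarith
  obtain ⟨ρ,hρ⟩ := hρ a ha
  set h := min a T with hh
  have hh0 := lt_min ha hT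
  refine ⟨a,B,ρ,hρ,min a (a*h),by positivity,fun u v hu hv h0 t ht => ?_⟩
  refine (hc a ρ hρ _ (by positivity) u v hu hv h hh0 (min_le_right _ _) t ht).trans
    (le_trans (mul_mono_l ?_ hK) hKa)
  have e1 : min a (a*h)/h ≤ a := (div_le_iff₀ hh0).2 (min_le_right _ _)
  have e2 : h ≤ a := min_le_left _ _
  have e3 : min a (a*h) ≤ a := min_le_left _ _
  linarith

/-- Meshes with parameter `β` that resolve `[0,T]`, satisfy the restrictions on the time step, and
whose time step is not too small. -/
structure Regular (M : Model) (T ℓ : ℝ) (m : Mesh) (β : ℝ) : Prop where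
  adm : Admissible M m β
  fits : m.Fits M T
  ratio : 1 ≤ ℓ*m.lam

theorem schemeCurve_clamp (hm : m.Fits M T) (k : ℕ) (t : ℝ) :
    M.schemeCurve m β u₀ k (max 0 (min T t)) = M.schemeCurve m β u₀ k t := by
  have hdt := hm.dt_pos
  have hT : 0 ≤ T := by rw [hm.T_eq]; positivity
  have : m.level (max 0 (min T t)) = m.level t := by
    rcases le_total t 0 with h | h
    · rw [min_eq_right (h.trans hT),max_eq_left h]
      simp [Mesh.level,Nat.ceil_eq_zero.2 (div_nonpos_of_nonpos_of_nonneg h hdt.le)]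
    rcases le_total t T with h' | h'
    · rw [min_eq_right h',max_eq_right h]
    · rw [min_eq_left h',max_eq_right hT]
      have e : m.level T = m.NT := by
        rw [Mesh.level,hm.T_eq,mul_div_assoc,div_self hdt.ne',mul_one,Nat.ceil_natCast,min_self]
      exact le_antisymm (Mesh.level_sub_le hdt h').1 (by rw [e]; exact min_le_right _ _)
  funext x
  rw [schemeCurve,schemeCurve,this]

theorem schemeCurve_zero (m : Mesh) (β : ℝ) (u₀ : ℕ → ℝ → ℝ) (k : ℕ) :
    M.schemeCurve m β u₀ k 0 = stepFn m (M.approx m β u₀ 0 k) := by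
  funext x
  simp [schemeCurve,Mesh.level]

/-- Schemes on fine meshes are close to each other and to entropy solutions. -/
theorem exists_scheme_close (H : M.Standing) (hu : M.InitialData u₀) (hT : 0 < T) (hℓ : 0 ≤ ℓ) :
    ∃ Θ₀,1 ≤ Θ₀ ∧ ∀ Θ,Θ₀ ≤ Θ → ∀ κ,0 < κ → ∃ δ,0 < δ ∧
      ∀ m β,Regular M T ℓ m β → m.Δx < δ → m.Δt < δ →
        (∀ v,Path M Θ v → SliceEntropy M T v → (∀ k ∈ M.lanes,v k 0 =ᵐ[volume] u₀ k) →
          ∀ t ∈ Icc 0 T,M.gap (M.schemeCurve m β u₀ · t) (v · t) ≤ κ) ∧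
        ∀ m' β',Regular M T ℓ m' β' → m'.Δx < δ → m'.Δt < δ → ∀ t,
          M.gap (M.schemeCurve m β u₀ · t) (M.schemeCurve m' β' u₀ · t) ≤ κ := by
  obtain ⟨Λ,hB⟩ := H.exists_bounds
  obtain ⟨Θ₀,h1,hcurve⟩ := exists_schemeCurve H hu hT.le hℓ
  obtain ⟨K,hK,hini⟩ := hu.exists_rate
  refine ⟨Θ₀,h1,fun Θ hΘ κ hκ => ?_⟩
  have hΘ0 : 0 ≤ Θ := by linarith
  obtain ⟨ε,B,ρ,hρ,δ,hδ,hclose⟩ := exists_close hB hΘ0 hT hκ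
  obtain ⟨C,hC,hcur⟩ := hcurve Θ hΘ ε B ρ hρ
  have hε := hρ.pos
  set n : ℝ := (M.lanes.card : ℝ) with hn
  set d := min (min 1 ε) (δ/(2*C+2*n*K+1)) with hd
  have hdδ : (2*C+2*n*K+1)*d ≤ δ := by
    rw [mul_comm,← le_div_iff₀ (by positivity)]; exact min_le_right _ _
  have hcd : ∀ m β,Regular M T ℓ m β → m.Δx < d → m.Δt < d →
      Curve M T Θ ρ δ (M.schemeCurve m β u₀) := fun m β hm hx ht => by
    have hd1 : d ≤ min 1 ε := min_le_left _ _
    refine (hcur m β hm.adm hm.fits hm.ratio (hx.le.trans (hd1.trans (min_le_left _ _)))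
      (hx.le.trans (hd1.trans (min_le_right _ _)))).mono (le_trans ?_ hdδ)
    have : C*(m.Δx+m.Δt) ≤ C*(2*d) := by gcongr; linarith
    have : 0≤(2*n*K+1)*d := by positivity
    linarith
  have hid : ∀ m β,Regular M T ℓ m β → m.Δx < d →
      M.gap (M.schemeCurve m β u₀ · 0) u₀ ≤ n*(K*d) := fun m β hm hx => by
    rw [gap,hn,← nsmul_eq_mul]
    refine Finset.sum_le_card_nsmul _ _ _ fun k hk => ?_
    simp [schemeCurve_zero]
    exact (hini m β hm.fits.dx_pos k hk).trans (by gcongr)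
  have hnK : 2*(n*(K*d)) ≤ δ := by
    have : 0≤(2*C+1)*d := by positivity
    linarith
  refine ⟨d,(by positivity),fun m β hm hx ht => ⟨fun v hv he hv0 => hclose _ _ (hcd m β hm hx ht)
    (hv.curve hB hΘ0 he hρ hδ.le) ?_,fun m' β' hm' hx' ht' t => ?_⟩⟩
  · refine le_trans (le_of_eq (Finset.sum_congr rfl fun k hk => integral_congr_ae ?_))
      ((hid m β hm hx).trans (by linarith))
    filter_upwards [hv0 k hk] with x hx
    rw [hx]
  · have hg : M.gap (M.schemeCurve m β u₀ · 0) (M.schemeCurve m' β' u₀ · 0) ≤ δ := by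
      refine le_trans ?_ ((add_le_add (hid m β hm hx) (hid m' β' hm' hx')).trans (by linarith))
      rw [gap,gap,gap,← Finset.sum_add_distrib]
      refine Finset.sum_le_sum fun k hk => ?_
      have i2 := ((hcd m' β' hm' hx' ht').profile 0).integrable k hk
      simp only [abs_sub_comm (M.schemeCurve m' β' u₀ k 0 _) (u₀ k _)]
      exact integral_abs_sub_le_add (((hcd m β hm hx ht).profile 0).integrable k hk) (hu k hk).1 i2
    have := hclose _ _ (hcd m β hm hx ht) (hcd m' β' hm' hx' ht') hg (max 0 (min T t))
      ⟨le_max_left _ _,max_le hT.le (min_le_left _ _)⟩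
    simpa only [schemeCurve_clamp hm.fits,schemeCurve_clamp hm'.fits] using this

end Model

theorem essVariation_le_of_tendsto {U : ℕ → ℝ → ℝ} {u : ℝ → ℝ} {K : ENNReal}
    (h01 : ∀ j x,U j x ∈ 𝕀) (hU : ∀ᵐ x,Tendsto (U · x) atTop (𝓝 (u x)))
    (hK : ∀ j,eVariationOn (U j) univ ≤ K) : essVariation u ≤ K := by
  have : ∀ x,∃ l,Tendsto (U · x) (hyperfilter ℕ) (𝓝 l) := fun x => by
    obtain ⟨l,-,hl⟩ := (isCompact_Icc).ultrafilter_le_nhds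
      ((hyperfilter ℕ).map fun j => U j x) (le_principal_iff.2 (Ultrafilter.mem_map.2 (univ_mem' fun j => h01 j x)))
    exact ⟨l,hl⟩
  choose w hw using this
  have hwu : w =ᵐ[volume] u := by
    filter_upwards [hU] with x hx
    exact tendsto_nhds_unique (hw x) (hx.mono_left Nat.hyperfilter_le_atTop)
  refine iInf_le_of_le ⟨w,hwu⟩ (not_lt.1 fun h => ?_)
  obtain ⟨j,hj⟩ := (eVariationOn.lowerSemicontinuous_aux (fun x _ => hw x) h).exists
  exact (hK j).not_gt hj

theorem le_of_forall_le_add_pow {a b C : ℝ} (h : ∀ n : ℕ,a ≤ b+C*(1/4)^n) : a ≤ b :=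
  ge_of_tendsto' (by simpa using (Model.tendsto_geometric C (r := 1/4) (by norm_num)
    (by norm_num)).const_add b) h

namespace Model

variable {M : Model} {m : Mesh} {β Θ Λ T r ε B δ ℓ : ℝ} {k : ℕ} {u v : ℕ → ℝ → ℝ → ℝ}
  {u₀ : ℕ → ℝ → ℝ} {ρ : ℝ → ℝ}

theorem CFL.diagonal (hc : M.CFL m β) (hx : 0 < m.Δx) (ht : 0 < m.Δt)
    (hS : 6*m.Δt*M.SLip≤1) : M.DiagonalCFL m β := fun k hk => by
  have hF : 0 ≤ M.fLip k*stripNorm (M.ν k) := mul_nonneg (fLip_nonneg k) (stripNorm_nonneg _)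
  have hl : 0 < m.lam := div_pos ht hx
  have h2 := ((le_div_iff₀ (by linarith)).1 (hc k hk)).trans ((min_le_right _ _).trans (min_le_left _ _))
  linarith

theorem exists_regular_mesh (H : M.Standing) (hT : 0 < T) (h0 : 0 < β) (h1 : β<2/3) :
    ∃ ℓ,0 ≤ ℓ ∧ ∀ δ,0 < δ → ∃ m,Regular M T ℓ m β ∧ m.Δx < δ ∧ m.Δt < δ := by
  have hη := H.eta_pos
  have hS := SLip_nonneg (M := M)
  have hF : ∀ k,0≤6*M.fLip k*stripNorm (M.ν k) := fun k =>
    mul_nonneg (mul_nonneg (by norm_num) (fLip_nonneg k)) (stripNorm_nonneg _)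
  have hD := Finset.sum_nonneg fun k (_ : k ∈ M.lanes) => hF k
  set D := 1+∑ k ∈ M.lanes,6*M.fLip k*stripNorm (M.ν k)
  set a := min 1 (min (4-6*β) (min (6*β) (2/3)))
  have ha : 0 < a := lt_min one_pos (lt_min (by linarith) (lt_min (by linarith) (by norm_num)))
  obtain ⟨c,hc⟩ : ∃ c,c = a/D := ⟨_,rfl⟩
  have hc0 : 0 < c := by rw [hc]; positivity
  refine ⟨2/c,by positivity,fun δ hδ => ?_⟩
  obtain ⟨n,hn⟩ := exists_nat_gt (M.η/min (min δ (δ/c)) (min (T/c) (1/((6*M.SLip+1)*c))))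
  have hn0 : (0 : ℝ) < n := lt_trans (by positivity) hn
  have he : M.η/n < min (min δ (δ/c)) (min (T/c) (1/((6*M.SLip+1)*c))) := by
    rw [div_lt_iff₀ (by positivity)] at hn
    rw [div_lt_iff₀ hn0,mul_comm]; exact hn
  simp only [lt_min_iff,lt_div_iff₀ hc0,lt_div_iff₀ (show 0<(6*M.SLip+1)*c by positivity)]
    at he
  obtain ⟨x,hx⟩ : ∃ x,x = M.η/n := ⟨_,rfl⟩
  rw [← hx] at he
  obtain ⟨⟨e1,e2⟩,e3,e4⟩ := he
  have hx0 : 0 < x := by rw [hx]; positivity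
  have hxc : 0 < x*c := by positivity
  obtain ⟨p,hp⟩ : ∃ p,p = ⌈T/(x*c)⌉₊ := ⟨_,rfl⟩
  have p1 : T ≤ p*(x*c) := (div_le_iff₀ hxc).1 (hp ▸ Nat.le_ceil _)
  have p2 : p*(x*c)≤2*T := by
    have := (Nat.ceil_lt_add_one (by positivity : 0 ≤ T/(x*c))).le
    rw [← hp,div_add_one hxc.ne',le_div_iff₀ hxc] at this
    linarith
  have hp0 : (0 : ℝ) < p := by
    rcases (Nat.cast_nonneg p : (0 : ℝ) ≤ p).eq_or_lt with h | h
    · rw [← h,zero_mul] at p1; linarith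
    · exact h
  have t1 : T/p ≤ x*c := (div_le_iff₀ hp0).2 (by linarith)
  have t2 : x*c≤2*(T/p) := by rw [← mul_div_assoc,le_div_iff₀ hp0]; linarith
  have t0 : 0 < T/p := by positivity
  have t3 : 6*(T/p)*M.SLip≤1 := by nlinarith [mul_mono_r t1 hS]
  have fits : Mesh.Fits ⟨x,T/p,n,p⟩ M T := ⟨hx0,t0,by rw [hx]; field_simp,by field_simp⟩
  have cfl : M.CFL ⟨x,T/p,n,p⟩ β := fun k hk => by
    have hlam : T/p/x ≤ c := (div_le_iff₀ hx0).2 (by linarith)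
    rw [hc] at hlam
    refine hlam.trans (div_le_div₀ (le_min zero_le_one (le_min (by linarith) (le_min (by linarith)
      (by dsimp only; linarith)))) (min_le_min_left _ (min_le_min_left _ (min_le_min_left _
      (by dsimp only; linarith)))) (by linarith [hF k]) ?_)
    exact add_le_add le_rfl (Finset.single_le_sum (f := fun k => 6*M.fLip k*stripNorm (M.ν k))
      (fun k _ => hF k) hk)
  refine ⟨⟨x,T/p,n,p⟩,⟨.of_diagonal H h0 h1 fits cfl (cfl.diagonal hx0 t0 t3),fits,?_⟩,e1,
    t1.trans_lt e2⟩
  have : c/2 ≤ T/p/x := (le_div_iff₀ hx0).2 (by linarith)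
  rw [div_mul_eq_mul_div,le_div_iff₀ hc0,Mesh.lam]
  linarith

theorem exists_entropySolution (H : M.Standing) (hu : M.InitialData u₀) (hT : 0 < T) (h0 : 0 < β)
    (h1 : β<2/3) : ∃ u,M.IsEntropySolution T u₀ u := by
  obtain ⟨Λ,hB⟩ := H.exists_bounds
  obtain ⟨ℓ,hℓ,hmesh⟩ := exists_regular_mesh H hT h0 h1
  obtain ⟨Θ₀,-,hclose⟩ := exists_scheme_close H hu hT hℓ
  obtain ⟨Θ₁,hΘ₁,hprof⟩ := exists_uniform_profile H hu hT.le hℓ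
  obtain ⟨K,hK,hini⟩ := hu.exists_rate
  have hΘ : 0 ≤ Θ₁ := by linarith
  choose d hd hclose using fun n => hclose Θ₀ le_rfl ((1/4)^n) (by positivity)
  have hmin : ∀ n : ℕ,∃ e,0 < e ∧ e≤(1/4)^n ∧ ∀ i ≤ n,e ≤ d i := fun n =>
    ⟨min ((1/4)^n) ((Finset.range (n+1)).inf' ⟨0,by simp⟩ d),
      lt_min (by positivity) ((Finset.lt_inf'_iff _).2 fun i _ => hd i),min_le_left _ _,
      fun i hi => (min_le_right _ _).trans (Finset.inf'_le d (by grind))⟩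
  choose e he he4 hed using hmin
  choose m hm hmx hmt using fun n => hmesh (e n) (he n)
  have hx4 : ∀ n,(m n).Δx≤(1/4)^n := fun n => (hmx n).le.trans (he4 n)
  have ht4 : ∀ n,(m n).Δt≤(1/4)^n := fun n => (hmt n).le.trans (he4 n)
  set U : ℕ → ℕ → ℝ → ℝ → ℝ := fun n => M.schemeCurve (m n) β u₀ with hU
  have hp : ∀ n t,Profile M Θ₁ fun k => U n k t := fun n t =>
    (hprof _ _ (hm n).adm (hm n).fits (hm n).ratio _ (min_le_right _ _)).1
  have hUm : ∀ n,∀ k ∈ M.lanes,Measurable fun p : ℝ × ℝ => U n k p.1 p.2 := fun n k _ =>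
    measurable_schemeCurve (m n) β u₀ k
  have hlim : ∀ k,∃ w : ℝ → ℝ → ℝ,k ∈ M.lanes → (Measurable fun p : ℝ × ℝ => w p.1 p.2) ∧
      (∀ t x,w t x ∈ Icc 0 1) ∧ ∀ t,Integrable (w t) ∧
        (∀ᵐ x,Tendsto (fun j => U j k t x) atTop (𝓝 (w t x))) ∧
          ∀ n,∫ x,|U n k t x-w t x|≤(1/4)^n := fun k => by
    by_cases hk : k ∈ M.lanes
    · obtain ⟨w,hw⟩ := exists_limit (U := fun n => U n k) (fun n => hUm n k hk)
        (fun n t x => (hp n t).mem k hk x) (fun n t => (hp n t).integrable k hk)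
        (fun n i j hi hj t => (le_gap _ _ hk).trans
          ((hclose n _ _ (hm i) ((hmx i).trans_le (hed i n hi)) ((hmt i).trans_le (hed i n hi))).2 _ _
            (hm j) ((hmx j).trans_le (hed j n hj)) ((hmt j).trans_le (hed j n hj)) t))
      exact ⟨w,fun _ => hw⟩
    · exact ⟨0,fun h => absurd h hk⟩
  choose u hlim using hlim
  have hi : ∀ k ∈ M.lanes,∀ t,Integrable (u k t) := fun k hk t => ((hlim k hk).2.2 t).1
  have hdist : ∀ k ∈ M.lanes,∀ t n,∫ x,|U n k t x-u k t x|≤(1/4)^n := fun k hk t =>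
    ((hlim k hk).2.2 t).2.2
  have hdist' : ∀ k ∈ M.lanes,∀ t n,∫ x,|u k t x-U n k t x|≤(1/4)^n := fun k hk t n => by
    simp only [abs_sub_comm (u k t _)]; exact hdist k hk t n
  have hgap : ∀ n t,M.gap (fun k => U n k t) (u · t) ≤ M.lanes.card*(1/4)^n :=
    fun n t => by
      rw [gap,← nsmul_eq_mul]
      exact Finset.sum_le_card_nsmul _ _ _ fun k hk => hdist k hk t n
  have huprof : ∀ t,Profile M Θ₁ fun k => u k t := fun t => by
    refine ⟨fun k hk => (hlim k hk).1.comp measurable_prodMk_left,fun k hk => (hlim k hk).2.1 t,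
      fun k hk => hi k hk t,fun k hk => le_of_forall_le_add_pow (C := 1) fun n => ?_,
      fun k hk h => le_of_forall_le_add_pow (C := 2) fun n => ?_⟩
    · have := (le_abs_self _).trans (abs_integral_le_integral_abs (μ := volume)
        (f := fun x => u k t x-U n k t x))
      rw [integral_sub (hi k hk t) ((hp n t).integrable k hk)] at this
      linarith [hdist' k hk t n,(hp n t).mass k hk]
    · have i1 := hi k hk t
      have i2 := (hp n t).integrable k hk
      have h1 := integral_abs_sub_le_add (i1.comp_add_right h) (i2.comp_add_right h) i1
      have h2 := integral_abs_sub_le_add (i2.comp_add_right h) i2 i1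
      have h3 := integral_add_right_eq_self (μ := volume) (fun x => |u k t x-U n k t x|) h
      linarith [hdist k hk t n,hdist' k hk t n,(hp n t).translate k hk h]
  have hpath : Path M Θ₁ u := by
    refine ⟨fun k hk => (hlim k hk).1,huprof,fun s t =>
      le_of_forall_le_add_pow (C := 2*M.lanes.card+Θ₁) fun n => ?_⟩
    have h2 := schemeCurve_move (hm n).fits (fun j hj =>
      let h := hprof _ _ (hm n).adm (hm n).fits (hm n).ratio j hj; ⟨h.1,h.2.1⟩) hΘ s t
    have h3 := (huprof s).gap_triangle (hp n s) (huprof t)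
    have h4 := (hp n s).gap_triangle (hp n t) (huprof t)
    have h5 := hgap n s
    rw [gap_comm] at h5
    linarith [mul_mono_l (ht4 n) hΘ,hgap n t]
  have hslice : SliceEntropy M T u := by
    refine sliceEntropy_of_limit hB hUm hp hpath hgap fun r ψ Γ hr hψ => ?_
    obtain ⟨C,hC,hs⟩ := exists_scheme_entropy H hu hT.le hℓ hr hψ
    refine ⟨fun j => C*(2*(1/4)^j),?_,fun j k hk α hα t₁ t₂ ht0 ht htT => ?_⟩
    · simpa using (tendsto_geometric 2 (r := 1/4) (by norm_num) (by norm_num)).const_mul C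
    · have hj : (m j).Δx≤1 := (hx4 j).trans (pow_le_one₀ (by norm_num) (by norm_num))
      refine (hs _ _ (hm j).adm (hm j).fits (hm j).ratio hj k hk α hα t₁ t₂ ht0 ht htT).trans ?_
      exact add_le_add le_rfl (mul_mono_l (by linarith [hx4 j,ht4 j]) hC)
  refine ⟨u,fun k hk => (hlim k hk).1.aestronglyMeasurable,fun k hk t _ => hi k hk t,
    fun k hk t _ => Eventually.of_forall ((hlim k hk).2.1 t),fun k hk => ⟨Θ₁,fun s _ t _ =>
    (le_gap (u · s) (u · t) hk).trans (hpath.move s t)⟩,fun k hk =>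
    ⟨Θ₁.toNNReal,fun t _ => essVariation_le_of_tendsto (fun j x => (hp j t).mem k hk x)
      ((hlim k hk).2.2 t).2.1 fun j =>
        (hprof _ _ (hm j).adm (hm j).fits (hm j).ratio _ (min_le_right _ _)).2.2 k hk⟩,
    fun k hk => ?_,fun k hk α φ hφ => entropyIneq_of_sliceEntropy hB hΘ hT hpath hslice hk hφ⟩
  have h0 : ∫ x,|u k 0 x-u₀ k x|≤0 := le_of_forall_le_add_pow (C := 1+K) fun n => by
    have h1 := integral_abs_sub_le_add (hi k hk 0) ((hp n 0).integrable k hk) (hu k hk).1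
    have h2 := hini (m n) β (hm n).fits.dx_pos k hk
    rw [← schemeCurve_zero] at h2
    linarith [hdist' k hk 0 n,mul_mono_l (hx4 n) hK]
  exact ae_eq_of_integral_abs_le (hi k hk 0) (hu k hk).1 h0

variable {M : Model} {m : Mesh} {β Θ T ℓ : ℝ} {k : ℕ} {u v : ℕ → ℝ → ℝ → ℝ} {u₀ : ℕ → ℝ → ℝ}

theorem Path.mono {Θ' : ℝ} (h : Path M Θ u) (hΘ : Θ ≤ Θ') : Path M Θ' u :=
  ⟨h.meas,fun t => (h.profile t).mono hΘ,fun s t => (h.move s t).trans (by gcongr)⟩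

theorem exists_scheme_convergence (H : M.Standing) (hu₀ : M.InitialData u₀) (hT : 0 < T)
    (h0 : 0 < β) (h1 : β<2/3) (hu : M.IsEntropySolution T u₀ u) {lam₀ : ℝ} (hl : 0 < lam₀)
    {ε : ℝ} (hε : 0 < ε) : ∃ δ,0 < δ ∧ ∀ m : Mesh,m.Fits M T → M.CFL m β → lam₀ ≤ m.lam →
      m.Δx < δ → m.Δt < δ → ∀ k ∈ M.lanes,∀ t ∈ Icc 0 T,
        eLpNorm (fun x => M.approxSol m β u₀ k t x-u k t x) 1 volume ≤ ENNReal.ofReal ε := by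
  obtain ⟨Λ,hB⟩ := H.exists_bounds
  have hℓ : 0≤1/lam₀ := by positivity
  obtain ⟨Θ₀,-,hclose⟩ := exists_scheme_close H hu₀ hT hℓ
  obtain ⟨Θ₁,hΘ₁,v,hv,huv⟩ := hu.exists_path hT.le
  obtain ⟨Θ₂,hΘ₂,hprof⟩ := exists_uniform_profile H hu₀ hT.le hℓ
  obtain ⟨d,hd,hclose⟩ := hclose (max Θ₀ Θ₁) (le_max_left _ _) (ε/2) (by positivity)
  have hS := SLip_nonneg (M := M)
  have hs : SliceEntropy M T v :=
    sliceEntropy_of_entropyIneq hB (by linarith) hT hv hu.meas huv hu.entropy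
  refine ⟨min d (min (1/(6*M.SLip+1)) (ε/(2*Θ₂))),by positivity,
    fun m hfit hcfl hlam hx ht k hk t htT => ?_⟩
  simp only [lt_min_iff] at hx ht
  have hdt := hfit.dt_pos
  have hdiag : 6*m.Δt*M.SLip≤1 := by
    have := ht.2.1.le
    rw [le_div_iff₀ (by positivity)] at this
    linarith
  have hm : Regular M T (1/lam₀) m β :=
    ⟨.of_diagonal H h0 h1 hfit hcfl (hcfl.diagonal hfit.dx_pos hdt hdiag),hfit,by
      rwa [one_div,← div_eq_inv_mul,one_le_div hl]⟩
  have hc := (le_gap _ _ hk).trans ((hclose m β hm hx.1 ht.1).1 v (hv.mono (le_max_right _ _)) hs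
    (fun k hk => (huv k hk 0 ⟨le_rfl,hT.le⟩).symm.trans (hu.initial k hk)) t htT)
  have hp := hprof m β hm.adm hfit hm.ratio
  obtain ⟨n,hn⟩ : ∃ n,n = m.timeIndex t := ⟨_,rfl⟩
  have hnT : t/m.Δt ≤ m.NT := by rw [div_le_iff₀ hdt,← hfit.T_eq]; exact htT.2
  have hlev : m.level t = ⌈t/m.Δt⌉₊ := min_eq_left (Nat.ceil_le.2 hnT)
  have hn1 : m.level t = n ∨ m.level t = n+1 := by
    have a1 := Nat.floor_le_ceil (t/m.Δt)
    have a2 := Nat.ceil_le_floor_add_one (t/m.Δt)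
    rw [hn,hlev,Mesh.timeIndex]
    omega
  have hnN : n ≤ m.NT := by
    have : m.level t ≤ m.NT := min_le_right _ _
    omega
  have hstep : ∫ x,|M.approxSol m β u₀ k t x-M.schemeCurve m β u₀ k t x| ≤ ε/2 := by
    have e : ∀ x,M.approxSol m β u₀ k t x = stepFn m (M.approx m β u₀ n k) x := fun x => by
      rw [approxSol,← hn,stepFn]
    have h2 : Θ₂*m.Δt ≤ ε/2 := by
      have := ht.2.2.le
      rw [le_div_iff₀ (by positivity)] at this
      linarith
    simp only [e,schemeCurve]
    rcases hn1 with h | h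
    · simp only [h,sub_self,abs_zero,integral_zero]; positivity
    · rw [h]; exact (le_gap (fun k => stepFn m (M.approx m β u₀ n k))
        (fun k => stepFn m (M.approx m β u₀ (n+1) k)) hk).trans ((hp n hnN).2.1.trans h2)
  have i1 : Integrable (M.approxSol m β u₀ k t) := by
    have := (hp n hnN).1.integrable k hk
    rwa [hn] at this
  have i2 : Integrable (M.schemeCurve m β u₀ k t) :=
    (hp _ (min_le_right _ _)).1.integrable k hk
  have i3 := hu.integrable k hk t htT
  rw [eLpNorm_one_eq (f := fun x => M.approxSol m β u₀ k t x-u k t x) (i1.sub i3)]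
  refine ENNReal.ofReal_le_ofReal ((integral_abs_sub_le_add i1 i2 i3).trans ?_)
  have : ∫ x,|M.schemeCurve m β u₀ k t x-u k t x|=∫ x,|M.schemeCurve m β u₀ k t x-v k t x| :=
    integral_congr_ae ((huv k hk t htT).mono fun x hx => by simp only [hx])
  linarith

end Model

end MultiLane

theorem lemma4p3 :
    -- the constants are functions of the listed quantities only
    (∃ (CTV : (N : ℕ) → (S ω u₀ f D1 D2 D11 D12 D21 D22 : ℝ) → ℝ)
       (CL : (S ω u₀ f ν D1 D2 lam β tv : ℝ) → ℝ),
      ∀ M : Model, M.Standing →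
      ∀ u₀ : ℕ → ℝ → ℝ, M.InitialData u₀ →
      ∀ T : ℝ, 0 < T → ∀ β : ℝ, 0 < β → β < 2 / 3 →
      ∀ m : Mesh, m.Fits M T → M.CFL m β → M.DiagonalCFL m β →
        -- (a) invariant region
        (∀ k ∈ M.lanes, ∀ t ∈ Set.Icc 0 T, ∀ x : ℝ,
          0 ≤ M.approxSol m β u₀ k t x ∧ M.approxSol m β u₀ k t x ≤ 1) ∧
        -- (b) conservation of total mass
        ((∀ n ≤ m.NT, ∀ k ∈ M.lanes, Summable (M.approx m β u₀ n k)) ∧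
          ∀ n ≤ m.NT, ∑ k ∈ M.lanes, ∑' i : ℤ, M.approx m β u₀ n k i
            = ∑ k ∈ M.lanes, ∑' i : ℤ, M.approx m β u₀ 0 k i) ∧
        -- (c) total variation bound
        ((∀ n ≤ m.NT + 1, ∀ k ∈ M.lanes,
            Summable (fun i : ℤ => |M.approx m β u₀ n k (i + 1) - M.approx m β u₀ n k i|)) ∧
          ∀ n ≤ m.NT + 1,
            ∑ k ∈ M.lanes, Model.discreteTV (M.approx m β u₀ n k) ≤
              Real.exp (CTV M.N M.SLip M.kernelTV (M.dataL1 u₀) (M.maxLane M.fLip)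
                  (M.nuNorm D1) (M.nuNorm D2) (M.nuNorm fun q => D1 (D1 q))
                  (M.nuNorm fun q => D1 (D2 q)) (M.nuNorm fun q => D2 (D1 q))
                  (M.nuNorm fun q => D2 (D2 q)) * m.time n)
                * ∑ k ∈ M.lanes, Model.discreteTV (M.approx m β u₀ 0 k)
              + Real.exp (CTV M.N M.SLip M.kernelTV (M.dataL1 u₀) (M.maxLane M.fLip)
                  (M.nuNorm D1) (M.nuNorm D2) (M.nuNorm fun q => D1 (D1 q))
                  (M.nuNorm fun q => D1 (D2 q)) (M.nuNorm fun q => D2 (D1 q))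
                  (M.nuNorm fun q => D2 (D2 q)) * m.time n)
              - 1) ∧
        -- (d) Lipschitz continuity in time
        (∀ k ∈ M.lanes, ∀ n r : ℕ, n < r → r ≤ m.NT →
          Summable (fun i : ℤ => |M.approx m β u₀ r k i - M.approx m β u₀ n k i|) ∧
          m.Δx * ∑' i : ℤ, |M.approx m β u₀ r k i - M.approx m β u₀ n k i| ≤
            CL M.SLip M.kernelTV (M.dataL1 u₀) (M.maxLane M.fLip) (M.nuNorm fun q => q)
                (M.nuNorm D1) (M.nuNorm D2) m.lam β (M.maxTV m β u₀)
              * m.Δt * ((r : ℝ) - (n : ℝ))) ∧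
        -- (e) cell entropy inequalities
        (∀ α : ℝ, ∀ i : ℤ, ∀ k ∈ M.lanes, ∀ n ≤ m.NT,
          |M.approx m β u₀ (n + 1) k i - α| - |M.approx m β u₀ n k i - α|
            + m.lam * (M.entropyFlux m β k (M.approx m β u₀ n k) i
                  (M.approx m β u₀ n k i) (M.approx m β u₀ n k (i + 1)) α
                - M.entropyFlux m β k (M.approx m β u₀ n k) (i - 1)
                  (M.approx m β u₀ n k (i - 1)) (M.approx m β u₀ n k i) α)
            + m.lam * Real.sign (M.approx m β u₀ (n + 1) k i - α) * M.f k α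
                * (M.ν k (m.half i) (M.cHalf m (M.approx m β u₀ n k) i)
                  - M.ν k (m.half (i - 1)) (M.cHalf m (M.approx m β u₀ n k) (i - 1)))
          ≤ m.Δt * Real.sign (M.approx m β u₀ (n + 1) k i - α)
              * M.discreteSource m (M.approx m β u₀ n) k i)) ∧
    -- (f) existence of the entropy solution and convergence to it
    (∀ M : Model, M.Standing →
      ∀ u₀ : ℕ → ℝ → ℝ, M.InitialData u₀ →
      ∀ T : ℝ, 0 < T → ∀ β : ℝ, 0 < β → β < 2 / 3 →
        (∃ u : ℕ → ℝ → ℝ → ℝ, M.IsEntropySolution T u₀ u) ∧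
        ∀ u : ℕ → ℝ → ℝ → ℝ, M.IsEntropySolution T u₀ u →
          ∀ lam₀ : ℝ, 0 < lam₀ → ∀ ε : ℝ, 0 < ε → ∃ δ : ℝ, 0 < δ ∧
            ∀ m : Mesh, m.Fits M T → M.CFL m β → lam₀ ≤ m.lam → m.Δx < δ → m.Δt < δ →
              ∀ k ∈ M.lanes, ∀ t ∈ Set.Icc 0 T,
                MeasureTheory.eLpNorm (fun x => M.approxSol m β u₀ k t x - u k t x) 1
                  MeasureTheory.volume ≤ ENNReal.ofReal ε) := by
  refine ⟨⟨Model.tvRate, Model.moveRate, fun M H u₀ hu T hT β hβ0 hβ1 m hf hc hd => ?_⟩,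
    fun M H u₀ hu T hT β hβ0 hβ1 =>
    ⟨Model.exists_entropySolution H hu hT hβ0 hβ1, fun u hu' lam₀ hl ε hε =>
      Model.exists_scheme_convergence H hu hT hβ0 hβ1 hu' hl hε⟩⟩
  have h := Model.Admissible.of_diagonal H hβ0 hβ1 hf hc hd
  refine ⟨fun k hk t _ x => (h.budget hu _).1 k hk _,
    ⟨fun n _ k hk => ((h.budget hu n).2.mass_le k hk).1, fun n _ => h.approx_mass hu n⟩,
    ⟨fun n _ k hk => ((h.budget hu n).2.tv k hk).1, fun n _ => ?_⟩,
    fun k hk n r hnr hr => ?_, fun α i k hk n _ => h.cell_entropy (h.budget hu n).1 α i hk⟩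
  · have := h.tv_le hu n
    rw [Model.growthRate, mul_add, mul_one] at this
    linarith
  · obtain ⟨j, rfl⟩ : ∃ j, r = n + j := ⟨r - n, by omega⟩
    have h1 := h.move_le hu hk (n := n) j fun l hl =>
      Model.tv_le_maxTV (m := m) (β := β) (u₀ := u₀) (by omega : l ≤ m.NT) hk
    refine ⟨h1.1, (mul_le_mul_of_nonneg_left h1.2 h.dx_pos.le).trans (le_of_eq ?_)⟩
    have := h.dx_pos.ne'
    push_cast
    field_simp
    ring
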